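/- **Setting.** Let $G=(V,A,g)$ be a directed graph (loops allowed) with $V=\{1,\dots,n\}$, $n\ge1$, with gains $g:A\to[-B,B]$ and battery capacity $B>0$. Traversing an arc $uv$ with charge $b$ is possible iff $b+g(uv)\ge0$, and then leads to charge $\min\{b+g(uv),B\}$. For a path $P$ (not necessarily simple; a single vertex is a path), $\alpha_B(P)$ is the final charge when $P$ is started with charge $B$, and $-\infty$ if $P$ cannot be traversed; $\alpha_B(s,t)$ is the maximum of $\alpha_B(P)$ over all paths $P$ from $s$ to $t$ ($-\infty$ if there is none). **The table $M$.** $M\in(\mathbb R\cup\{-\infty\})^{V\times V}$ is the output of the randomized procedure *Compute-Shortcuts*$(G)$ below. In it $\log$ is the binary logarithm; non-integral numbers of iterations are rounded up; probabilities are truncated to $[0,1]$; a maximum over the empty set is $-\infty$, and $|-\infty|=+\infty$; all maxima and existence queries over $a$ range over $a\in V$; loops over vertices run in increasing order and change tables in place; "$T\!\uparrow k$" means $T\gets\max\{T,k\}$; tables with superscript $\circ$ are the tables at the start of the current procedure; $C_1,\dots,C_5>0$ are the hidden constants. Besides entries $D[x][y]$, a data structure $D$ has entries $D[xy][z]$ and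 $D[x][yz]$. * *Compute-Shortcuts*$(G)$: $M[x][y]\gets g(xy)$ if $xy\in A$ and $-\infty$ otherwise, then $M[x][x]\!\uparrow 0$ for all $x$. Then $C_1\log^2 n$ times $M\gets$ *Update*$(M)$. Return $M$. * *Update*$(M)$: $r\gets\lceil C_2 n^{1/2}\rceil$, $M'\gets M$. Repeat $r$ times: with probability $\log(n)/r$ (independently) $M'\gets\max\{M',\textit{Long}(M)\}$; then $M\gets\textit{Short}(M)$. Return $\max\{M,M'\}$. * *Short*$(M)$: for tables $M,N$ let $J_{M,N}(x,y,z)=M[x][y]+N[y][z]$ if both summands are $\ge0$; otherwise $\min\{M[x][y],0\}+\min\{N[y][z],0\}$ if this is $\ge-B$, and $-\infty$ if not. Put $M_2[x][z]=\max_y J_{M,M}(x,y,z)$, $M_3[x][z]=\max_y J_{M,M_2}(x,y,z)$ and $D=\max\{M,M_2,M_3\}$. For all $x,y,z$, with $m=M[x][y]$: if $m\ge0$, let $k_2=\max\{M[y][a]+M[a][z]:-m\le M[y][a]\le0\}$, and if $m+k_2\ge m$ then $D[x][z]\!\uparrow m+k_2$; if $m\le0$, let $k_2=\max\{M[y][a]+M[a][z]:0\le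 M[y][a]\le|m|\}$; if $m\ge m+k_2\ge-B$ then $D[x][z]\!\uparrow m+k_2$; if $m+k_2\ge m$ then $D[x][z]\!\uparrow m$; and $D[x][z]\!\uparrow\min\{m,\max\{M[a][z]:M[y][a]\ge|m|\}\}$. Return the table $D[\cdot][\cdot]$. * *BFS*$(M,D)$: for all $x,y,z$: let $k=\max D^\circ[ya][z]$ over $a$ with $-M[x][y]\le M[y][a]\le0$ if $M[x][y]\ge0$, and over $a$ with $0\le M[y][a]\le|M[x][y]|$ otherwise; $D[xy][z]\!\uparrow M[x][y]+k$. Let $l=\max D^\circ[z][ay]$ over $a$ with $-M[y][x]\le M[a][y]\le0$ if $M[y][x]\ge0$, and over $a$ with $0\le M[a][y]\le|M[y][x]|$ otherwise; $D[z][yx]\!\uparrow l+M[y][x]$. * *Concat*$(M,D,U,W,X)$: for all $(u,v,w,x)\in U\times V\times W\times X$: if $M[u][v]<0$, then $D[uv][x]\!\uparrow D[uv][w]+\max\{D^\circ[wa][x]:-(D[uv][w]-M[u][v])\le M[w][a]\le0\}$; if $M[v][u]<0$, then $D[x][vu]\!\uparrow D[w][vu]+\max\{D^\circ[x][aw]:-(D[w][vu]-M[v][u])\le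 M[a][w]\le0\}$. * *ConcatOpp*$(M,D,U,W,X)$: for all $(u,v,w,x)\in U\times V\times W\times X$: if $M[u][v]<0$, then first $D[uv][x]\!\uparrow D[uv][w]+\max\{D^\circ[w][ax]:M[a][x]\ge0,\ M[a][x]-D^\circ[w][ax]\le D[uv][w]-M[u][v],\ D^\circ[w][ax]\le|D[uv][w]|\}$, and then, if some $a$ has $M[a][x]\ge0$, $D^\circ[w][ax]\ge|D[uv][w]|$ and $M[a][x]\le|M[u][v]|$, $D[uv][x]\gets0$; if $M[v][u]<0$, then first $D[x][vu]\!\uparrow D[w][vu]+\max\{D^\circ[xa][w]:M[x][a]\ge0,\ M[x][a]-D^\circ[xa][w]\le D[w][vu]-M[v][u],\ D^\circ[xa][w]\le|D[w][vu]|\}$, and then, if some $a$ has $M[x][a]\ge0$, $D^\circ[xa][w]\ge|D[w][vu]|$ and $M[x][a]\le|M[v][u]|$, $D[x][vu]\gets0$. * *Funnels*$(M)$: $D[x][y]=M[x][y]$, $D[xy][y]=D[x][xy]=M[x][y]$, all other entries $-\infty$; $s\gets C_3n^{2/3}$. Run *BFS*$(M,D)$ $n/s$ times. Let $S$ contain each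 vertex independently with probability $C_4\log(n)\,s/n$. Run *Concat*$(M,D,S,S,S)$ $\log n$ times, *Concat*$(M,D,S,S,V)$ once, and *BFS*$(M,D)$ $n/s$ times. Return $D$. * *Long*$(M)$: $D\gets\textit{Funnels}(M)$, $T\gets\emptyset$. For $i=1,\dots,\lceil\log(n^{1/2}\log^2n)\rceil$: let $T_i$ contain each vertex independently with probability $C_5\log^2(n)/(2^in^{1/2})$; $2^i$ times run *ConcatOpp*$(M,D,T_i,V,V)$ and then *Concat*$(M,D,T_i,V,V)$; $T\gets T\cup T_i$. Finally, for all $(u,v,x,y)\in T\times V^3$: if $M[u][v]\le0$, with $\sigma=D[uv][x]+M[x][y]$: if $-B\le\sigma\le M[u][v]$ then $D[u][y]\!\uparrow\sigma$; if $\sigma\ge M[u][v]$ then $D[u][y]\!\uparrow M[u][v]$; if $\sigma\ge0$ then $D[v][y]\!\uparrow\sigma-M[u][v]$; if $M[v][u]\le0$, with $\tau=M[y][x]+D[x][vu]$: if $-B\le\tau\le M[v][u]$ then $D[y][u]\!\uparrow\tau$; if $\tau\ge M[v][u]$ then $D[y][u]\!\uparrow M[v][u]$; if $\tau\ge0$ then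 $D[y][v]\!\uparrow\tau-M[v][u]$. Return the table $D[\cdot][\cdot]$. All random choices are independent. **The graph $H$.** $H$ has vertex set $V^0\cup V^B$ (two copies $x^0,x^B$ of every $x\in V$) and the arcs (0-0) $x^0z^0$ if $M[x][y]+M[y][z]\ge0$ and $M[x][y]\ge0$ for some $y\in V$; (0-$B$) $x^0y^B$ if $M[x][y]\ge B$, or $M[x][y]+M[y][x]>0$ and $M[x][y]>0$; ($B$-0) $x^By^0$ if $M[x][y]\ne-\infty$; ($B$-$B$) $x^Bz^B$ if $M[x][y]+M[y][z]\ge0$ and $M[y][z]\ge0$ for some $y\in V$. $H^\star$ is its transitive closure ($pq$ is an arc of $H^\star$ iff there is a walk with at least one arc from $p$ to $q$ in $H$). **Theorem.** With high probability, for every $s,t\in V$ we have $\alpha_B(s,t)=B$ if and only if $s^Bt^B$ is an arc of $H^\star$. That is: for every $c>0$ there is $K>0$ such that for all hidden constants $C_1,\dots,C_5\ge K$, all $n\ge1$, all $B>0$ and all $G$ as above, with probability at least $1-n^{-c}$ over the random choices of Compute-Shortcuts$(G)$, $$\forall s,t\in V:\qquad \alpha_B(s,t)=B\iff s^Bt^B\in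 E(H^\star).$$ -/

import Mathlib

open scoped ENNReal NNReal

/-- A road network: a directed graph with a real gain on every arc (the value of `gain` at a pair
that is not an arc is irrelevant). Loops are allowed. -/
structure RoadNetwork (V : Type) extends Digraph V where
  gain : V → V → ℝ

namespace RoadNetwork

variable {V : Type}

/-- `P` is a (not necessarily simple) directed path from `s` to `t`, given by its list of
vertices. A single vertex is a path from itself to itself. -/
def IsPath (G : RoadNetwork V) (s t : V) (P : List V) : Prop :=
  P.IsChain G.Adj ∧ P.head? = some s ∧ P.getLast? = some t

/-- The charge after an arc of gain `g` is traversed with charge `b` and battery capacity `B`: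
the arc cannot be traversed (`⊥`) if the charge would become negative, and charge above `B`
is lost. -/
noncomputable def arcCharge (B : ℝ) (b : EReal) (g : ℝ) : EReal :=
  open Classical in if 0 ≤ b + (g : EReal) then min (b + (g : EReal)) (B : EReal) else ⊥

/-- The charge at the end of a path that is started with charge `b`; `⊥` if the path cannot be
traversed. -/
noncomputable def pathCharge (G : RoadNetwork V) (B : ℝ) (b : EReal) : List V → EReal
  | [] => b
  | [_] => b
  | u :: v :: P => pathCharge G B (arcCharge B b (G.gain u v)) (v :: P)

/-- The maximum final charge: the largest charge with which one can reach `t` when leaving `s`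
with charge `b`, and `⊥` if `t` cannot be reached. -/
noncomputable def alpha (G : RoadNetwork V) (B b : ℝ) (s t : V) : EReal :=
  ⨆ P : {P : List V // G.IsPath s t P}, G.pathCharge B (b : EReal) P.1

end RoadNetwork

/-- A shortcuts table; the entry `⊥` means that no shortcut is known. -/
abbrev Table (n : ℕ) := Fin n → Fin n → EReal

namespace Table

variable {n : ℕ}

/-- `raise M x y k` is the assignment `M[x][y] ← max {M[x][y], k}`. -/
noncomputable def raise (M : Table n) (x y : Fin n) (k : EReal) : Table n :=
  Function.update M x (Function.update (M x) y (max (M x y) k))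

/-- The table of the arcs of `G` and of the trivial paths. -/
noncomputable def ofNetwork (G : RoadNetwork (Fin n)) : Table n := fun x y =>
  open Classical in
  max (if x = y then 0 else ⊥) (if G.Adj x y then (G.gain x y : EReal) else ⊥)

end Table

/-- The absolute value of an extended real. -/
noncomputable def eabs (x : EReal) : EReal := max x (-x)

/-- The largest `value a` over the `a` with property `cond`; `⊥` if there is none. -/
noncomputable def maxOver {n : ℕ} (cond : Fin n → Prop) (value : Fin n → EReal) : EReal :=
  open Classical in (Finset.univ.filter cond).sup value

/-- The loop that runs `body v` on the elements `v` of `S` in increasing order. -/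
noncomputable def forEach {n : ℕ} {σ : Type} (S : Finset (Fin n)) (body : Fin n → σ → σ) (st : σ) :
    σ :=
  (S.sort (· ≤ ·)).foldl (fun st v => body v st) st

/-- The loop over all triples of vertices. -/
noncomputable def forTriples {n : ℕ} {σ : Type} (body : Fin n → Fin n → Fin n → σ → σ) (st : σ) :
    σ :=
  forEach Finset.univ (fun x => forEach Finset.univ fun y => forEach Finset.univ fun z =>
    body x y z) st

/-- The loop over all quadruples in `U × V × W × X`. -/
noncomputable def forQuadruples {n : ℕ} {σ : Type} (U V W X : Finset (Fin n))
    (body : Fin n → Fin n → Fin n → Fin n → σ → σ) (st : σ) : σ :=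
  forEach U (fun u => forEach V fun v => forEach W fun w => forEach X fun x => body u v w x) st

/-! ### Short shortcuts -/

/-- The `2`-shortcuts along `x y z`, with gains from `M` on `x y` and from `N` on `y z`. -/
noncomputable def joinShortcut {n : ℕ} (B : ℝ) (M N : Table n) (x y z : Fin n) : EReal :=
  open Classical in
  if 0 ≤ M x y ∧ 0 ≤ N y z then M x y + N y z
  else if (-B : ℝ) ≤ min (M x y) 0 + min (N y z) 0 then min (M x y) 0 + min (N y z) 0
  else ⊥

/-- Trivial shortcuts: all `2`-shortcuts and the easy `3`-shortcuts of `M`, added to `D`. -/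
noncomputable def trivialShortcuts {n : ℕ} (B : ℝ) (M D : Table n) : Table n :=
  let M₂ : Table n := forTriples (fun x y z T => T.raise x z (joinShortcut B M M x y z))
    (fun _ _ => ⊥)
  let M₃ : Table n := forTriples (fun x y z T => T.raise x z (joinShortcut B M M₂ x y z))
    (fun _ _ => ⊥)
  fun x z => max (D x z) (max (M₂ x z) (M₃ x z))

/-- The update of the hard `3`-shortcuts for the triple `x, y, z`. -/
noncomputable def hardShortcutStep {n : ℕ} (B : ℝ) (M : Table n) (x y z : Fin n) (D : Table n) :
    Table n :=
  open Classical in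
  let D₁ : Table n :=
    if 0 ≤ M x y then
      let k₂ := maxOver (fun a => -M x y ≤ M y a ∧ M y a ≤ 0) (fun a => M y a + M a z)
      if M x y ≤ M x y + k₂ then D.raise x z (M x y + k₂) else D
    else D
  if M x y ≤ 0 then
    let k₂ := maxOver (fun a => 0 ≤ M y a ∧ M y a ≤ eabs (M x y)) (fun a => M y a + M a z)
    let D₂ : Table n :=
      if M x y + k₂ ≤ M x y ∧ (-B : ℝ) ≤ M x y + k₂ then D₁.raise x z (M x y + k₂) else D₁
    let D₃ : Table n := if M x y ≤ M x y + k₂ then D₂.raise x z (M x y) else D₂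
    let k := maxOver (fun a => eabs (M x y) ≤ M y a) (fun a => M a z)
    D₃.raise x z (min (M x y) k)
  else D₁

/-- Short shortcuts: the shortcuts along paths of length at most `3`. -/
noncomputable def shortShortcuts {n : ℕ} (B : ℝ) (M : Table n) : Table n :=
  forTriples (hardShortcutStep B M) (trivialShortcuts B M M)

/-! ### Arc-bounded paths -/

/-- The data structure of the long-shortcuts procedure: `mono x y` is `D[x][y]`,
`first x y z` is `D[xy][z]` and `last x y z` is `D[x][yz]`. -/
structure PathData (n : ℕ) where
  mono : Table n
  first : Fin n → Fin n → Fin n → EReal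
  last : Fin n → Fin n → Fin n → EReal

namespace PathData

variable {n : ℕ}

/-- The data structure that knows exactly the single arcs. -/
noncomputable def init (M : Table n) : PathData n where
  mono := M
  first := fun x y z => if z = y then M x y else ⊥
  last := fun x y z => if x = y then M y z else ⊥

/-- `D[x][y] ← max {D[x][y], k}`. -/
noncomputable def raiseMono (D : PathData n) (x y : Fin n) (k : EReal) : PathData n :=
  { D with mono := D.mono.raise x y k }

/-- `D[xy][z] ← k`. -/
noncomputable def setFirst (D : PathData n) (x y z : Fin n) (k : EReal) : PathData n :=
  { D with
    first := Function.update D.first x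
      (Function.update (D.first x) y (Function.update (D.first x y) z k)) }

/-- `D[x][yz] ← k`. -/
noncomputable def setLast (D : PathData n) (x y z : Fin n) (k : EReal) : PathData n :=
  { D with
    last := Function.update D.last x
      (Function.update (D.last x) y (Function.update (D.last x y) z k)) }

/-- `D[xy][z] ← max {D[xy][z], k}`. -/
noncomputable def raiseFirst (D : PathData n) (x y z : Fin n) (k : EReal) : PathData n :=
  D.setFirst x y z (max (D.first x y z) k)

/-- `D[x][yz] ← max {D[x][yz], k}`. -/
noncomputable def raiseLast (D : PathData n) (x y z : Fin n) (k : EReal) : PathData n :=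
  D.setLast x y z (max (D.last x y z) k)

end PathData

/-- Breadth search. The queries are answered by `D₀`, the data structure at the start of the
procedure, for which the range trees are built. -/
noncomputable def breadthSearch {n : ℕ} (M : Table n) (D₀ : PathData n) : PathData n :=
  open Classical in
  forTriples (fun x y z D =>
    let k := if 0 ≤ M x y
      then maxOver (fun a => -M x y ≤ M y a ∧ M y a ≤ 0) (fun a => D₀.first y a z)
      else maxOver (fun a => 0 ≤ M y a ∧ M y a ≤ eabs (M x y)) (fun a => D₀.first y a z)
    let l := if 0 ≤ M y x
      then maxOver (fun a => -M y x ≤ M a y ∧ M a y ≤ 0) (fun a => D₀.last z a y)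
      else maxOver (fun a => 0 ≤ M a y ∧ M a y ≤ eabs (M y x)) (fun a => D₀.last z a y)
    (D.raiseFirst x y z (M x y + k)).raiseLast z y x (l + M y x)) D₀

/-- Concatenation of arc-bounded paths of the same direction. The range trees are built for `D₀`,
the data structure at the start of the procedure. -/
noncomputable def concatenate {n : ℕ} (M : Table n) (U W X : Finset (Fin n)) (D₀ : PathData n) :
    PathData n :=
  open Classical in
  forQuadruples U Finset.univ W X (fun u v w x D =>
    let D₁ :=
      if M u v < 0 then
        let k := maxOver (fun a => -(D.first u v w - M u v) ≤ M w a ∧ M w a ≤ 0)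
          (fun a => D₀.first w a x)
        D.raiseFirst u v x (D.first u v w + k)
      else D
    if M v u < 0 then
      let k := maxOver (fun a => -(D₁.last w v u - M v u) ≤ M a w ∧ M a w ≤ 0)
        (fun a => D₀.last x a w)
      D₁.raiseLast x v u (k + D₁.last w v u)
    else D₁) D₀

/-- Concatenation of arc-bounded paths of opposite directions. The range trees are built for `D₀`,
the data structure at the start of the procedure. -/
noncomputable def concatenateOpposite {n : ℕ} (M : Table n) (U W X : Finset (Fin n))
    (D₀ : PathData n) : PathData n :=
  open Classical in
  forQuadruples U Finset.univ W X (fun u v w x D =>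
    let D₂ :=
      if M u v < 0 then
        let k := maxOver (fun a => 0 ≤ M a x ∧
            M a x - D₀.last w a x ≤ D.first u v w - M u v ∧
            D₀.last w a x ≤ eabs (D.first u v w))
          (fun a => D₀.last w a x)
        let D₁ := D.raiseFirst u v x (D.first u v w + k)
        if ∃ a, 0 ≤ M a x ∧ eabs (D₁.first u v w) ≤ D₀.last w a x ∧ M a x ≤ eabs (M u v)
        then D₁.setFirst u v x 0 else D₁
      else D
    if M v u < 0 then
      let k := maxOver (fun a => 0 ≤ M x a ∧
          M x a - D₀.first x a w ≤ D₂.last w v u - M v u ∧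
          D₀.first x a w ≤ eabs (D₂.last w v u))
        (fun a => D₀.first x a w)
      let D₃ := D₂.raiseLast x v u (k + D₂.last w v u)
      if ∃ a, 0 ≤ M x a ∧ eabs (D₃.last w v u) ≤ D₀.first x a w ∧ M x a ≤ eabs (M v u)
      then D₃.setLast x v u 0 else D₃
    else D₂) D₀

/-- Monotone paths out of arc-bounded paths that start or end in `T`. -/
noncomputable def arcBoundedToMonotone {n : ℕ} (B : ℝ) (M : Table n) (T : Finset (Fin n))
    (D₀ : PathData n) : PathData n :=
  open Classical in
  forQuadruples T Finset.univ Finset.univ Finset.univ (fun u v x y D =>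
    let g := D.first u v x + M x y
    let D₃ :=
      if M u v ≤ 0 then
        let D₁ := if (-B : ℝ) ≤ g ∧ g ≤ M u v then D.raiseMono u y g else D
        let D₂ := if M u v ≤ g then D₁.raiseMono u y (M u v) else D₁
        if 0 ≤ g then D₂.raiseMono v y (-M u v + g) else D₂
      else D
    let h := M y x + D.last x v u
    if M v u ≤ 0 then
      let D₄ := if (-B : ℝ) ≤ h ∧ h ≤ M v u then D₃.raiseMono y u h else D₃
      let D₅ := if M v u ≤ h then D₄.raiseMono y u (M v u) else D₄
      if 0 ≤ h then D₅.raiseMono y v (h - M v u) else D₅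
    else D₃) D₀

/-! ### The randomized algorithm -/

/-- The hidden constants of the algorithm. -/
structure HiddenConstants where
  /-- of the number of outer iterations, `Θ(log² n)` -/
  outer : ℝ
  /-- of the number of inner iterations, `Θ(n^(1/2))` -/
  rounds : ℝ
  /-- of the parameter `s = Θ(n^(2/3))` of the computation of funnels -/
  funnel : ℝ
  /-- of the expected size `Θ(s log n)` of the sample in the computation of funnels -/
  sample : ℝ
  /-- of the sampling probabilities `Θ(log² n / (2^i n^(1/2)))` in the long shortcuts -/
  long : ℝ

/-- All the hidden constants are at least `K`. -/
def HiddenConstants.AtLeast (κ : HiddenConstants) (K : ℝ) : Prop :=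
  K ≤ κ.outer ∧ K ≤ κ.rounds ∧ K ≤ κ.funnel ∧ K ≤ κ.sample ∧ K ≤ κ.long

/-- The binary logarithm. -/
noncomputable def lg (x : ℝ) : ℝ := Real.logb 2 x

/-- A real number, clamped to `[0, 1]`. -/
noncomputable def clamp (p : ℝ) : ℝ≥0∞ := min (ENNReal.ofReal p) 1

/-- A coin that shows `true` with probability `p` (clamped to `[0, 1]`). -/
noncomputable def coin (p : ℝ) : PMF Bool :=
  PMF.ofFintype (fun b => if b then clamp p else 1 - clamp p) (by
    simp [clamp])

/-- The random set that contains every vertex independently with probability `p` (clamped to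
`[0, 1]`). -/
noncomputable def sampleSet (n : ℕ) (p : ℝ) : PMF (Finset (Fin n)) :=
  PMF.ofFintype (fun S => clamp p ^ S.card * (1 - clamp p) ^ (n - S.card)) (by
    have h := Fintype.sum_pow_mul_eq_add_pow (Fin n) (clamp p) (1 - clamp p)
    rw [Fintype.card_fin, add_tsub_cancel_of_le (show clamp p ≤ 1 from min_le_right _ _),
      one_pow] at h
    exact h)

/-- A randomized step `f`, run for the indices `0, …, m - 1` in this order. -/
noncomputable def repeatRandom {σ : Type} (f : ℕ → σ → PMF σ) : ℕ → σ → PMF σ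
  | 0, st => PMF.pure st
  | m + 1, st => (repeatRandom f m st).bind (f m)

/-- Compute funnels. -/
noncomputable def computeFunnels {n : ℕ} (κ : HiddenConstants) (M : Table n) :
    PMF (PathData n) :=
  let s : ℝ := κ.funnel * (n : ℝ) ^ (2 / 3 : ℝ)
  let D₁ := (breadthSearch M)^[⌈(n : ℝ) / s⌉₊] (PathData.init M)
  (sampleSet n (κ.sample * lg n * s / n)).map fun S =>
    let D₂ := (concatenate M S S S)^[⌈lg n⌉₊] D₁
    let D₃ := concatenate M S S Finset.univ D₂
    (breadthSearch M)^[⌈(n : ℝ) / s⌉₊] D₃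

/-- One iteration of the main loop of the long shortcuts, on the data structure and the set of
all the vertices sampled so far. -/
noncomputable def longStep {n : ℕ} (κ : HiddenConstants) (M : Table n) (i : ℕ)
    (st : PathData n × Finset (Fin n)) : PMF (PathData n × Finset (Fin n)) :=
  (sampleSet n (κ.long * lg n ^ 2 / (2 ^ i * (n : ℝ) ^ (1 / 2 : ℝ)))).map fun Tᵢ =>
    ((fun D => concatenate M Tᵢ Finset.univ Finset.univ
        (concatenateOpposite M Tᵢ Finset.univ Finset.univ D))^[2 ^ i] st.1,
      st.2 ∪ Tᵢ)

/-- Long shortcuts. -/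
noncomputable def longShortcuts {n : ℕ} (κ : HiddenConstants) (B : ℝ) (M : Table n) :
    PMF (Table n) :=
  (computeFunnels κ M).bind fun D =>
    (repeatRandom (fun i => longStep κ M (i + 1)) ⌈lg ((n : ℝ) ^ (1 / 2 : ℝ) * lg n ^ 2)⌉₊
      (D, ∅)).map fun st => (arcBoundedToMonotone B M st.2 st.1).mono

/-- One inner iteration, on the pair `(M, M')`; `r` is the number of inner iterations. -/
noncomputable def updateStep {n : ℕ} (κ : HiddenConstants) (B : ℝ) (r : ℕ)
    (st : Table n × Table n) : PMF (Table n × Table n) :=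
  (coin (lg n / r)).bind fun b =>
    (if b then (longShortcuts κ B st.1).map fun L x y => max (st.2 x y) (L x y)
      else PMF.pure st.2).map fun M' => (shortShortcuts B st.1, M')

/-- Update shortcuts: one outer iteration. -/
noncomputable def updateShortcuts {n : ℕ} (κ : HiddenConstants) (B : ℝ) (M : Table n) :
    PMF (Table n) :=
  let r : ℕ := ⌈κ.rounds * (n : ℝ) ^ (1 / 2 : ℝ)⌉₊
  (repeatRandom (fun _ => updateStep κ B r) r (M, M)).map fun st x y =>
    max (st.1 x y) (st.2 x y)

/-- Compute shortcuts: the law of the shortcuts table `M` that the algorithm returns. -/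
noncomputable def computeShortcuts {n : ℕ} (κ : HiddenConstants) (B : ℝ)
    (G : RoadNetwork (Fin n)) : PMF (Table n) :=
  repeatRandom (fun _ => updateShortcuts κ B) ⌈κ.outer * lg n ^ 2⌉₊ (Table.ofNetwork G)

/-! ### The auxiliary graph -/

/-- The two copies of a vertex: with empty and with full battery. -/
inductive Level
  | zero
  | full

/-- The auxiliary graph `H` on the two copies of the vertex set, built from the table `M`. -/
def auxGraph {n : ℕ} (B : ℝ) (M : Table n) : Digraph (Fin n × Level) where
  Adj
    | (x, .zero), (z, .zero) => ∃ y, 0 ≤ M x y + M y z ∧ 0 ≤ M x y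
    | (x, .zero), (y, .full) => (B : EReal) ≤ M x y ∨ (0 < M x y + M y x ∧ 0 < M x y)
    | (x, .full), (y, .zero) => M x y ≠ ⊥
    | (x, .full), (z, .full) => ∃ y, 0 ≤ M x y + M y z ∧ 0 ≤ M y z

/-- The transitive closure of a digraph. -/
def transitiveClosure {W : Type} (H : Digraph W) : Digraph W where
  Adj := Relation.TransGen H.Adj

/-! ### Loops, maxima and tables -/

section Loops

variable {n : ℕ} {σ : Type}

/-! The equivalence holds for every table with two properties: each finite entry can be driven
(`SoundTable`), and each entry is at least as good as what the simple paths of the network offer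
(`CompleteTable`). The first property holds for every outcome of the random choices, the second one
with probability at least 1 - n^(-c).

Soundness is an invariant of all loops. An entry m for (x, y) promises the charge min(c + m, B) at y
for every initial charge c with c + m ≥ 0. An entry with a first or a last arc makes a similar
promise about a path whose heights stay in the band spanned by that arc.

Completeness concerns two kinds of simple paths (`Route`): climbing ones, which begin at their
lowest and end at their highest point and never lose more than B, with their total gain; and
arbitrary ones of which no part loses more than d ≤ B, which have to yield an entry of at least -d.
The potential is the length of a shortest route with given ends and bounds in the current table;
once it is at most 1, the entry is good enough. An outer iteration removes a fraction of order 1/log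
n of this length with constant probability (`updateShortcuts_fail`). Hence the expected excess
length decays geometrically (`updateShortcuts_expect_le`), and Markov's inequality with a union
bound over the best routes of all pairs gives `computeShortcuts_fail_complete`.

The progress has two sources. A round of short shortcuts removes disjoint triples of arcs in which
two neighbours have the same sign or the middle arc is the smallest. If the rounds of an outer
iteration do not halve the length ℓ, then at least half of them start from a shortest route with
only O(ℓ/√n) such triples. Away from these few breaks the gains alternate in sign and are unimodal
in absolute value. Each descending arc that is not a break bounds a part of the path: follow the
path in the direction in which the gains fall until it leaves the height band of the arc. The breaks
cut this part into unimodal pieces, and one iteration of the long shortcuts gets over one piece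
(`FirstKnown.arcSearch_step`), with the help of the precomputed funnels. As breaks are rare, most of
the parts are long compared with their number of breaks. A sample whose density fits a class of
parts with similar numbers of breaks therefore hits parts that cover half of a large class, and a
disjoint subfamily of them gives shortcuts (`Route.long_fail`).

For the graph H, soundness is a matter of driving its arcs; an arc from level 0 to level B may
require many round trips. Conversely, let a path have a final charge close to B. Its prefixes are
replaced by simple paths that start fully charged at some u with s^B u^B in H* and reach at least
the same charge (`ChargeFrom.extend`). When the path returns to a visited vertex with more charge,
it closes a cycle of positive gain. Cut at its largest drop, this cycle gives an arc from level 0 to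
level B (`exists_full_of_cycle`), so the simple path can be restarted with a full battery on the
cycle. Finally, a simple path that is full at both ends splits at its lowest point into a drop and a
climb, which form an arc from level B to level B. -/

theorem List.foldl_reach {α : Type} {P Q : σ → Prop} {body : α → σ → σ} (l : List α)
    (hP : ∀ v ∈ l, ∀ st, P st → P (body v st))
    (hQ : ∀ v ∈ l, ∀ st, P st → Q st → Q (body v st)) {v₀ : α} (hv : v₀ ∈ l)
    (h₀ : ∀ st, P st → Q (body v₀ st)) (st : σ) (h : P st) :
    Q (l.foldl (fun st v => body v st) st) := by
  have keep : ∀ (l' : List α), (∀ v ∈ l', v ∈ l) → ∀ st, P st → Q st →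
      Q (l'.foldl (fun st v => body v st) st) := by
    intro l'
    induction l' with
    | nil => intro _ st _ hq; exact hq
    | cons a l' ih =>
      intro hl st hp hq
      exact ih (fun v hv => hl v (by simp [hv])) _ (hP a (hl a (by simp)) st hp)
        (hQ a (hl a (by simp)) st hp hq)
  have main : ∀ (l' : List α), (∀ v ∈ l', v ∈ l) → v₀ ∈ l' → ∀ st, P st →
      Q (l'.foldl (fun st v => body v st) st) := by
    intro l'
    induction l' with
    | nil => intro _ h; simp at h
    | cons a l' ih =>
      intro hl hv st hp
      rcases List.mem_cons.1 hv with rfl | hv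
      · exact keep l' (fun v hv => hl v (by simp [hv])) _ (hP v₀ (hl v₀ (by simp)) st hp) (h₀ st hp)
      · exact ih (fun v hv => hl v (by simp [hv])) hv _ (hP a (hl a (by simp)) st hp)
  exact main l (fun _ h => h) hv st h

theorem forEach_reach {P Q : σ → Prop} {S : Finset (Fin n)} {body : Fin n → σ → σ}
    (hP : ∀ v ∈ S, ∀ st, P st → P (body v st))
    (hQ : ∀ v ∈ S, ∀ st, P st → Q st → Q (body v st)) {v₀ : Fin n} (hv : v₀ ∈ S)
    (h₀ : ∀ st, P st → Q (body v₀ st)) (st : σ) (h : P st) : Q (forEach S body st) := by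
  unfold forEach
  exact List.foldl_reach _ (fun v hv => hP v (by simpa using hv))
    (fun v hv => hQ v (by simpa using hv)) (by simpa using hv) h₀ st h

theorem forEach_preserve {P : σ → Prop} {S : Finset (Fin n)} {body : Fin n → σ → σ}
    (hP : ∀ v ∈ S, ∀ st, P st → P (body v st)) (st : σ) (h : P st) : P (forEach S body st) := by
  unfold forEach
  have : ∀ v ∈ S.sort (· ≤ ·), ∀ st, P st → P (body v st) :=
    fun v hv => hP v (by simpa using hv)
  revert this st
  induction S.sort (· ≤ ·) with
  | nil => intro st h _; exact h
  | cons a l ih =>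
    intro st h hl
    exact ih _ (hl a (by simp) st h) (fun v hv => hl v (by simp [hv]))

theorem forTriples_preserve {P : σ → Prop} {body : Fin n → Fin n → Fin n → σ → σ}
    (hP : ∀ x y z st, P st → P (body x y z st)) (st : σ) (h : P st) : P (forTriples body st) :=
  forEach_preserve (fun x _ => forEach_preserve fun y _ => forEach_preserve fun z _ => hP x y z)
    st h

/-- The pattern of all lower bounds on tables that are changed in place: `P` is an invariant, `Q` a
bound for one entry. A single iteration establishes `Q` from any state with the invariant, and the
others preserve it. -/
theorem forTriples_reach {P Q : σ → Prop} {body : Fin n → Fin n → Fin n → σ → σ}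
    (hP : ∀ x y z st, P st → P (body x y z st))
    (hQ : ∀ x y z st, P st → Q st → Q (body x y z st)) (x y z : Fin n)
    (h₀ : ∀ st, P st → Q (body x y z st)) (st : σ) (h : P st) : Q (forTriples body st) := by
  have hQ' : ∀ x y z st, P st ∧ Q st → P (body x y z st) ∧ Q (body x y z st) :=
    fun x y z st h => ⟨hP x y z st h.1, hQ x y z st h.1 h.2⟩
  refine forEach_reach (P := P) ?_ ?_ (Finset.mem_univ x) ?_ st h
  · exact fun x _ => forEach_preserve fun y _ => forEach_preserve fun z _ => hP x y z
  · exact fun x _ st hp hq => (forEach_preserve (P := fun st => P st ∧ Q st) (fun y _ =>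
      forEach_preserve fun z _ => hQ' x y z) st ⟨hp, hq⟩).2
  · intro st hp
    refine forEach_reach (P := P) ?_ ?_ (Finset.mem_univ y) ?_ st hp
    · exact fun y _ => forEach_preserve fun z _ => hP x y z
    · exact fun y _ st hp hq => (forEach_preserve (P := fun st => P st ∧ Q st) (fun z _ =>
        hQ' x y z) st ⟨hp, hq⟩).2
    · intro st hp
      exact forEach_reach (P := P) (fun z _ => hP x y z) (fun z _ => hQ x y z)
        (Finset.mem_univ z) h₀ st hp

theorem forQuadruples_preserve {P : σ → Prop} {U V W X : Finset (Fin n)}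
    {body : Fin n → Fin n → Fin n → Fin n → σ → σ}
    (hP : ∀ u ∈ U, ∀ v w x st, P st → P (body u v w x st)) (st : σ) (h : P st) :
    P (forQuadruples U V W X body st) :=
  forEach_preserve (fun u hu => forEach_preserve fun v _ => forEach_preserve fun w _ =>
    forEach_preserve fun x _ => hP u hu v w x) st h

theorem forQuadruples_reach {P Q : σ → Prop} {U V W X : Finset (Fin n)}
    {body : Fin n → Fin n → Fin n → Fin n → σ → σ}
    (hP : ∀ u v w x st, P st → P (body u v w x st))
    (hQ : ∀ u v w x st, P st → Q st → Q (body u v w x st)) {u v w x : Fin n}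
    (hu : u ∈ U) (hv : v ∈ V) (hw : w ∈ W) (hx : x ∈ X)
    (h₀ : ∀ st, P st → Q (body u v w x st)) (st : σ) (h : P st) :
    Q (forQuadruples U V W X body st) := by
  have hQ' : ∀ u v w x st, P st ∧ Q st → P (body u v w x st) ∧ Q (body u v w x st) :=
    fun u v w x st h => ⟨hP u v w x st h.1, hQ u v w x st h.1 h.2⟩
  refine forEach_reach (P := P) ?_ ?_ hu ?_ st h
  · exact fun u _ => forEach_preserve fun v _ => forEach_preserve fun w _ =>
      forEach_preserve fun x _ => hP u v w x
  · exact fun u _ st hp hq => (forEach_preserve (P := fun st => P st ∧ Q st) (fun v _ =>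
      forEach_preserve fun w _ => forEach_preserve fun x _ => hQ' u v w x) st ⟨hp, hq⟩).2
  · intro st hp
    refine forEach_reach (P := P) ?_ ?_ hv ?_ st hp
    · exact fun v _ => forEach_preserve fun w _ => forEach_preserve fun x _ => hP u v w x
    · exact fun v _ st hp hq => (forEach_preserve (P := fun st => P st ∧ Q st) (fun w _ =>
        forEach_preserve fun x _ => hQ' u v w x) st ⟨hp, hq⟩).2
    · intro st hp
      refine forEach_reach (P := P) ?_ ?_ hw ?_ st hp
      · exact fun w _ => forEach_preserve fun x _ => hP u v w x
      · exact fun w _ st hp hq => (forEach_preserve (P := fun st => P st ∧ Q st) (fun x _ =>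
          hQ' u v w x) st ⟨hp, hq⟩).2
      · intro st hp
        exact forEach_reach (P := P) (fun x _ => hP u v w x) (fun x _ => hQ u v w x) hx h₀ st hp

/-- A map that intertwines the bodies of two loops intertwines the loops. -/
theorem forEach_map {τ : Type} (F : σ → τ) {S : Finset (Fin n)} {body : Fin n → σ → σ}
    {body' : Fin n → τ → τ} (h : ∀ v st, F (body v st) = body' v (F st)) (st : σ) :
    F (forEach S body st) = forEach S body' (F st) := by
  unfold forEach
  induction S.sort (· ≤ ·) generalizing st with
  | nil => rfl
  | cons a l ih => simp only [List.foldl_cons]; rw [ih, h]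

theorem le_maxOver {cond : Fin n → Prop} {value : Fin n → EReal} {a : Fin n} (h : cond a) :
    value a ≤ maxOver cond value := by
  classical
  unfold maxOver
  exact Finset.le_sup (f := value) (by simpa using h)

end Loops

/-- `e` is `⊥` or a real number with property `P`. -/
def Holds (P : ℝ → Prop) (e : EReal) : Prop := e = ⊥ ∨ ∃ r : ℝ, e = r ∧ P r

namespace Holds

variable {P Q S : ℝ → Prop} {a b : EReal}

theorem bot : Holds P ⊥ := Or.inl rfl

theorem coe {r : ℝ} (h : P r) : Holds P (r : EReal) := Or.inr ⟨r, rfl, h⟩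

theorem of_coe {r : ℝ} (h : Holds P (r : EReal)) : P r := by
  rcases h with h | ⟨s, hs, hp⟩
  · exact absurd h (EReal.coe_ne_bot r)
  · rw [EReal.coe_eq_coe_iff] at hs; rwa [hs]

theorem mono (h : Holds P a) (hPQ : ∀ r, P r → Q r) : Holds Q a := by
  rcases h with h | ⟨r, hr, hp⟩
  · exact Or.inl h
  · exact Or.inr ⟨r, hr, hPQ r hp⟩

theorem max (ha : Holds P a) (hb : Holds P b) : Holds P (max a b) := by
  rcases max_choice a b with h | h <;> rwa [h]

theorem add (ha : Holds P a) (hb : Holds Q b) (h : ∀ r s, P r → Q s → S (r + s)) :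
    Holds S (a + b) := by
  rcases ha with rfl | ⟨r, rfl, hr⟩
  · rw [EReal.bot_add]; exact bot
  · rcases hb with rfl | ⟨s, rfl, hs⟩
    · rw [EReal.add_bot]; exact bot
    · rw [← EReal.coe_add]; exact coe (h r s hr hs)

theorem maxOver {n : ℕ} {cond : Fin n → Prop} {value : Fin n → EReal}
    (h : ∀ a, cond a → Holds P (value a)) : Holds P (maxOver cond value) := by
  classical
  unfold _root_.maxOver
  refine Finset.sup_induction bot (fun a ha b hb => ?_) (fun a ha => h a (by simpa using ha))
  exact Holds.max ha hb

theorem ne_top (h : Holds P a) : a ≠ ⊤ := by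
  rcases h with rfl | ⟨r, rfl, _⟩
  · exact bot_ne_top
  · exact EReal.coe_ne_top r

end Holds

theorem eabs_coe (r : ℝ) : eabs (r : EReal) = ((|r| : ℝ) : EReal) := by
  unfold eabs
  rw [← EReal.coe_neg]
  exact (EReal.coe_strictMono.monotone.map_max (a := r) (b := -r)).symm

theorem eabs_bot : eabs ⊥ = ⊤ := by simp [eabs]

namespace Table

variable {n : ℕ}

theorem raise_apply (M : Table n) (x y : Fin n) (k : EReal) (a b : Fin n) :
    M.raise x y k a b = if a = x ∧ b = y then max (M x y) k else M a b := by
  unfold raise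
  by_cases ha : a = x
  · subst ha
    by_cases hb : b = y
    · subst hb; simp
    · simp [hb]
  · simp [ha]

theorem le_raise (M : Table n) (x y : Fin n) (k : EReal) : M ≤ M.raise x y k := by
  intro a b
  rw [raise_apply]
  split_ifs with h
  · rw [h.1, h.2]; exact le_max_left _ _
  · exact le_rfl

theorem le_raise_self (M : Table n) (x y : Fin n) (k : EReal) : k ≤ M.raise x y k x y := by
  rw [raise_apply]; simp

theorem raise_holds {P : Fin n → Fin n → ℝ → Prop} {M : Table n}
    (hM : ∀ a b, Holds (P a b) (M a b)) {x y : Fin n} {k : EReal} (hk : Holds (P x y) k)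
    (a b : Fin n) : Holds (P a b) (M.raise x y k a b) := by
  rw [raise_apply]
  split_ifs with h
  · rw [h.1, h.2]; exact (hM x y).max hk
  · exact hM a b

end Table

namespace PathData

variable {n : ℕ} (D : PathData n) (x y z : Fin n) (k : EReal)

@[simp] theorem raiseFirst_last : (D.raiseFirst x y z k).last = D.last := rfl
@[simp] theorem raiseLast_first : (D.raiseLast x y z k).first = D.first := rfl

theorem setFirst_apply (a b c : Fin n) :
    (D.setFirst x y z k).first a b c = if a = x ∧ b = y ∧ c = z then k else D.first a b c := by
  unfold setFirst
  by_cases ha : a = x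
  · subst ha
    by_cases hb : b = y
    · subst hb
      by_cases hc : c = z
      · subst hc; simp
      · simp [hc]
    · simp [hb]
  · simp [ha]

theorem setLast_apply (a b c : Fin n) :
    (D.setLast x y z k).last a b c = if a = x ∧ b = y ∧ c = z then k else D.last a b c := by
  unfold setLast
  by_cases ha : a = x
  · subst ha
    by_cases hb : b = y
    · subst hb
      by_cases hc : c = z
      · subst hc; simp
      · simp [hc]
    · simp [hb]
  · simp [ha]

theorem raiseFirst_apply (a b c : Fin n) : (D.raiseFirst x y z k).first a b c =
    if a = x ∧ b = y ∧ c = z then max (D.first x y z) k else D.first a b c :=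
  setFirst_apply _ _ _ _ _ _ _ _

theorem le_raiseFirst (a b c : Fin n) : D.first a b c ≤ (D.raiseFirst x y z k).first a b c := by
  rw [raiseFirst_apply]
  split_ifs with h
  · rw [h.1, h.2.1, h.2.2]; exact le_max_left _ _
  · exact le_rfl

theorem le_raiseFirst_self : k ≤ (D.raiseFirst x y z k).first x y z := by
  rw [raiseFirst_apply]; simp

end PathData

/-! ### Drives -/

namespace RoadNetwork

variable {V : Type} {G : RoadNetwork V} {B : ℝ}

theorem arcCharge_mono {b b' : EReal} (h : b ≤ b') (g : ℝ) :
    arcCharge B b g ≤ arcCharge B b' g := by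
  classical
  have hg : b + (g : EReal) ≤ b' + g := by gcongr
  unfold arcCharge
  split_ifs with h1 h2
  · exact min_le_min_right _ hg
  · exact absurd (h1.trans hg) h2
  · exact bot_le
  · exact le_rfl

theorem pathCharge_mono (P : List V) {b b' : EReal} (h : b ≤ b') :
    G.pathCharge B b P ≤ G.pathCharge B b' P := by
  induction P generalizing b b' with
  | nil => exact h
  | cons u P ih =>
    cases P with
    | nil => exact h
    | cons v P => exact ih (arcCharge_mono h _)

theorem pathCharge_append (P Q : List V) (y : V) (hP : P.getLast? = some y) (b : EReal) :
    G.pathCharge B b (P ++ Q) = G.pathCharge B (G.pathCharge B b P) (y :: Q) := by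
  induction P generalizing b with
  | nil => simp at hP
  | cons u P ih =>
    cases P with
    | nil =>
      simp only [List.getLast?_singleton, Option.some.injEq] at hP
      subst hP; rfl
    | cons v P => exact ih (by simpa [List.getLast?_cons_cons] using hP) _

theorem arcCharge_bot (g : ℝ) : arcCharge B ⊥ g = ⊥ := by
  simp [arcCharge]

theorem arcCharge_coe {c g : ℝ} (h : 0 ≤ c + g) :
    arcCharge B (c : EReal) g = ((min (c + g) B : ℝ) : EReal) := by
  unfold arcCharge
  rw [← EReal.coe_add, if_pos (by exact_mod_cast h)]
  exact (EReal.coe_strictMono.monotone.map_min (a := c + g) (b := B)).symm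

theorem arcCharge_coe_of_neg {c g : ℝ} (h : c + g < 0) : arcCharge B (c : EReal) g = ⊥ := by
  unfold arcCharge
  rw [← EReal.coe_add, if_neg]
  rw [not_le]; exact_mod_cast h

theorem pathCharge_le (P : List V) {b : EReal} (h : b ≤ B) : G.pathCharge B b P ≤ B := by
  induction P generalizing b with
  | nil => exact h
  | cons u P ih =>
    cases P with
    | nil => exact h
    | cons v P =>
      refine ih ?_
      unfold arcCharge
      split_ifs
      · exact min_le_right _ _
      · exact bot_le

variable (G B) in
/-- Some path from `x` to `y`, started with charge `c`, leads to a charge of at least `c'`. -/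
def Reaches (x : V) (c : ℝ) (y : V) (c' : ℝ) : Prop :=
  ∃ P, G.IsPath x y P ∧ (c' : EReal) ≤ G.pathCharge B c P

namespace Reaches

variable {x y z : V} {c c' c'' d d' : ℝ}

theorem refl (h : c' ≤ c) : G.Reaches B x c x c' :=
  ⟨[x], ⟨by simp, by simp, by simp⟩, by
    change (c' : EReal) ≤ c
    exact_mod_cast h⟩

theorem mono (h : G.Reaches B x c y c') (hd : c ≤ d) (hd' : d' ≤ c') : G.Reaches B x d y d' := by
  obtain ⟨P, hP, h⟩ := h
  refine ⟨P, hP, le_trans (by exact_mod_cast hd') (h.trans (pathCharge_mono P ?_))⟩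
  exact_mod_cast hd

theorem weaken (h : G.Reaches B x c y c') (hd' : d' ≤ c') : G.Reaches B x c y d' :=
  h.mono le_rfl hd'

/-- Charges are monotone: the second path, started with at least the promised charge, ends with at
least the promised charge. -/
theorem trans (h : G.Reaches B x c y c') (h' : G.Reaches B y c' z c'') :
    G.Reaches B x c z c'' := by
  obtain ⟨P, ⟨hP, hPx, hPy⟩, hc⟩ := h
  obtain ⟨Q, ⟨hQ, hQy, hQz⟩, hc'⟩ := h'
  cases Q with
  | nil => simp at hQy
  | cons a Q =>
    simp only [List.head?_cons, Option.some.injEq] at hQy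
    subst hQy
    refine ⟨P ++ Q, ⟨?_, ?_, ?_⟩, ?_⟩
    · rw [List.isChain_append]
      refine ⟨hP, hQ.tail, ?_⟩
      intro u hu v hv
      rw [hPy] at hu
      simp only [Option.mem_def, Option.some.injEq] at hu
      subst hu
      cases Q with
      | nil => simp at hv
      | cons b Q =>
        simp only [List.head?_cons, Option.mem_def, Option.some.injEq] at hv
        subst hv
        exact (List.isChain_cons_cons.1 hQ).1
    · cases P with
      | nil => simp at hPy
      | cons b P => simpa using hPx
    · cases Q with
      | nil =>
        simp only [List.getLast?_singleton, Option.some.injEq] at hQz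
        subst hQz; simpa using hPy
      | cons b Q =>
        rw [List.getLast?_append]
        rw [List.getLast?_cons_cons] at hQz
        rw [hQz]; rfl
    · rw [pathCharge_append P Q a hPy]
      exact hc'.trans (pathCharge_mono _ hc)

theorem arc (h : G.Adj x y) (hc : 0 ≤ c + G.gain x y) :
    G.Reaches B x c y (min (c + G.gain x y) B) := by
  refine ⟨[x, y], ⟨by simp [h], by simp, by simp⟩, ?_⟩
  change _ ≤ arcCharge B (c : EReal) (G.gain x y)
  rw [arcCharge_coe hc]

theorem le_alpha (h : G.Reaches B x c y c') : (c' : EReal) ≤ G.alpha B c x y := by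
  obtain ⟨P, hP, h⟩ := h
  exact h.trans (le_iSup (fun P : {P : List V // G.IsPath x y P} => G.pathCharge B (c : EReal) P.1)
    ⟨P, hP⟩)

end Reaches

theorem alpha_le (x y : V) {b : ℝ} (h : b ≤ B) : G.alpha B b x y ≤ B :=
  iSup_le fun P => pathCharge_le P.1 (by exact_mod_cast h)

end RoadNetwork

/-! ### Soundness of the shortcuts -/

open RoadNetwork

variable {n : ℕ} {G : RoadNetwork (Fin n)} {B : ℝ}

variable (G B) in
/-- A shortcut of gain `m` from `x` to `y` can be driven. -/
def SoundEntry (x y : Fin n) (m : ℝ) : Prop :=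
  -B ≤ m ∧ ∀ c, 0 ≤ c → c ≤ B → 0 ≤ c + m → G.Reaches B x c y (min (c + m) B)

variable (G B) in
/-- All the shortcuts of the table can be driven. -/
def SoundTable (M : Table n) : Prop := ∀ x y, Holds (SoundEntry G B x y) (M x y)

variable (G B) in
/-- A gain `d` of a path from `u` to `x` that is bounded by its first arc `u v` of gain `m`. -/
def SoundFirst (u v x : Fin n) (m d : ℝ) : Prop :=
  (m ≤ 0 → m ≤ d ∧ d ≤ 0 ∧ ∀ e, 0 ≤ e → e ≤ B → G.Reaches B v e x (min (e + d - m) (B + d))) ∧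
  (0 ≤ m → 0 ≤ d ∧ d ≤ m ∧
    ∀ c, 0 ≤ c → c ≤ B → G.Reaches B u c x (min (c + m) B - (m - d)))

variable (G B) in
/-- A gain `d` of a path from `x` to `u` that is bounded by its last arc `v u` of gain `m`. -/
def SoundLast (x v u : Fin n) (m d : ℝ) : Prop :=
  (m ≤ 0 → m ≤ d ∧ d ≤ 0 ∧
    ∀ c, 0 ≤ c → c ≤ B → 0 ≤ c + d → G.Reaches B x c v (min (c + d - m) B)) ∧
  (0 ≤ m → 0 ≤ d ∧ d ≤ m ∧
    ∀ c, 0 ≤ c → c ≤ B → 0 ≤ c + d - m → G.Reaches B x c u (min (c + d) B))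

variable (G B) in
/-- All the arc-bounded paths and all the shortcuts of the data structure can be driven. -/
structure SoundData (M : Table n) (D : PathData n) : Prop where
  mono : SoundTable G B D.mono
  first : ∀ u v x, Holds (fun d => ∃ m : ℝ, M u v = m ∧ SoundFirst G B u v x m d) (D.first u v x)
  last : ∀ x v u, Holds (fun d => ∃ m : ℝ, M v u = m ∧ SoundLast G B x v u m d) (D.last x v u)

/-! ### Driving rules for real gains -/

section RealLevel

variable {x y z u v w a : Fin n} {m m' m'' d e : ℝ}

theorem SoundEntry.reaches (h : SoundEntry G B x y m) {c t : ℝ} (h0 : 0 ≤ c) (hB : c ≤ B)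
    (hc : 0 ≤ c + m) (ht : t ≤ c + m) (htB : t ≤ B) : G.Reaches B x c y t :=
  (h.2 c h0 hB hc).weaken (le_min ht htB)

theorem soundEntry_of_arc (h : G.Adj x y) (hg : G.gain x y ∈ Set.Icc (-B) B) :
    SoundEntry G B x y (G.gain x y) :=
  ⟨hg.1, fun _ _ _ hc => Reaches.arc h hc⟩

theorem soundEntry_self (hB : 0 ≤ B) : SoundEntry G B x x 0 :=
  ⟨by linarith, fun c _ hc _ => Reaches.refl (by rw [add_zero]; exact min_le_left _ _)⟩

theorem SoundEntry.join_nonneg (h1 : SoundEntry G B x y m) (h2 : SoundEntry G B y z m')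
    (hm : 0 ≤ m) (hm' : 0 ≤ m') : SoundEntry G B x z (m + m') := by
  refine ⟨by linarith [h1.1], fun c h0 hB hc => ?_⟩
  refine (h1.2 c h0 hB (by linarith)).trans
    (h2.reaches (le_min (by linarith) (by linarith)) (min_le_right _ _)
      (by have := le_min (show (0 : ℝ) ≤ c + m by linarith) (h0.trans hB); linarith) ?_
      (min_le_right _ _))
  simp only [min_def]; split_ifs <;> linarith

/-- A positive gain counts as zero, because it is lost if the battery is already full. -/
theorem SoundEntry.join_nonpos (h1 : SoundEntry G B x y m)
    (h2 : SoundEntry G B y z m') (h : -B ≤ min m 0 + min m' 0) :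
    SoundEntry G B x z (min m 0 + min m' 0) := by
  refine ⟨h, fun c h0 hcB hc => ?_⟩
  have e1 := min_le_left m 0
  have e2 := min_le_right m 0
  have e3 := min_le_left m' 0
  have e4 := min_le_right m' 0
  refine (h1.reaches (t := c + min m 0) h0 hcB (by linarith) (by linarith) (by linarith)).trans
    (h2.reaches (by linarith) (by linarith) (by linarith) ?_ (min_le_right _ _))
  have := min_le_left (c + (min m 0 + min m' 0)) B
  linarith

/-- The middle arc consumes at most what the first one gains, and the last arc regains it. An
overflow at `y` costs nothing in the end, since `z` is at least as high as `y`. -/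
theorem SoundEntry.hard_nonneg (h1 : SoundEntry G B x y m) (h2 : SoundEntry G B y a m')
    (h3 : SoundEntry G B a z m'') (hm : 0 ≤ m) (hm1 : -m ≤ m') (hm2 : m' ≤ 0)
    (hk : m ≤ m + (m' + m'')) : SoundEntry G B x z (m + (m' + m'')) := by
  refine ⟨by linarith [h1.1], fun c h0 hB hc => ?_⟩
  have k1 : 0 ≤ min (c + m) B + m' := by
    simp only [min_def]; split_ifs <;> linarith [h2.1]
  refine (h1.2 c h0 hB (by linarith)).trans ((h2.reaches (t := min (c + m) B + m')
    (by linarith) (min_le_right _ _) k1 le_rfl (by linarith [min_le_right (c + m) B])).trans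
    (h3.reaches k1 (by linarith [min_le_right (c + m) B]) (by linarith) ?_ (min_le_right _ _)))
  simp only [min_def]; split_ifs <;> linarith

theorem SoundEntry.hard_sum (h1 : SoundEntry G B x y m) (h2 : SoundEntry G B y a m')
    (h3 : SoundEntry G B a z m'') (hm1 : 0 ≤ m') (hm2 : m' ≤ -m)
    (hk : m + (m' + m'') ≤ m) (hB : -B ≤ m + (m' + m'')) :
    SoundEntry G B x z (m + (m' + m'')) := by
  refine ⟨hB, fun c h0 hcB hc => ?_⟩
  refine (h1.reaches (t := c + m) h0 hcB (by linarith) le_rfl (by linarith)).trans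
    ((h2.reaches (t := c + m + m') (by linarith) (by linarith) (by linarith) le_rfl
      (by linarith)).trans
    (h3.reaches (by linarith) (by linarith) (by linarith) ?_ (min_le_right _ _)))
  linarith [min_le_left (c + (m + (m' + m''))) B]

theorem SoundEntry.hard_first (h1 : SoundEntry G B x y m) (h2 : SoundEntry G B y a m')
    (h3 : SoundEntry G B a z m'') (hm1 : 0 ≤ m') (hm2 : m' ≤ -m)
    (hk : m ≤ m + (m' + m'')) : SoundEntry G B x z m := by
  refine ⟨h1.1, fun c h0 hcB hc => ?_⟩
  refine (h1.reaches (t := c + m) h0 hcB (by linarith) le_rfl (by linarith)).trans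
    ((h2.reaches (t := c + m + m') (by linarith) (by linarith) (by linarith) le_rfl
      (by linarith)).trans
    (h3.reaches (by linarith) (by linarith) (by linarith) ?_ (min_le_right _ _)))
  linarith [min_le_left (c + m) B]

/-- The second arc makes up for the whole loss on the first one, so `a` is reached with the initial
charge. -/
theorem SoundEntry.hard_min (h1 : SoundEntry G B x y m) (h2 : SoundEntry G B y a m')
    (h3 : SoundEntry G B a z m'') (hm : m ≤ 0) (hm2 : -m ≤ m') :
    SoundEntry G B x z (min m m'') := by
  refine ⟨le_min h1.1 h3.1, fun c h0 hcB hc => ?_⟩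
  have e1 := min_le_left m m''
  have e2 := min_le_right m m''
  refine (h1.reaches (t := c + m) h0 hcB (by linarith) le_rfl (by linarith)).trans
    ((h2.reaches (t := c) (by linarith) (by linarith) (by linarith) (by linarith) hcB).trans
    (h3.reaches h0 hcB (by linarith) ?_ (min_le_right _ _)))
  linarith [min_le_left (c + min m m'') B]

/-- The shape of `SoundFirst` comes from the band of the first arc. If the arc descends, the path
behind it starts at its lowest point `v`, so it can be driven with any charge `e`; it never rises
above `u`, so an overflow still leaves the charge `B + d`. If the arc ascends, then `u` is the
lowest and `v` the highest point, and overflow happens at worst on the first arc. -/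
theorem soundFirst_self (h : SoundEntry G B u v m) : SoundFirst G B u v v m m := by
  refine ⟨fun hm => ⟨le_rfl, hm, fun e _ _ => Reaches.refl ?_⟩,
    fun hm => ⟨hm, le_rfl, fun c h0 hB => ?_⟩⟩
  · exact (min_le_left _ _).trans (by linarith)
  · exact (h.2 c h0 hB (by linarith)).weaken (by linarith)

/-- Dually, in `SoundLast` the lowest point of the band decides whether the path can be driven, and
the highest point is where the overflow is accounted for. For a descending last arc `v u` these are
`u` and `v`, for an ascending one `v` and `u`. The promise is about the arrival at the highest
point. -/
theorem soundLast_self (h : SoundEntry G B v u m) : SoundLast G B v v u m m := by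
  refine ⟨fun hm => ⟨le_rfl, hm, fun c _ _ _ => Reaches.refl ?_⟩,
    fun hm => ⟨hm, le_rfl, fun c h0 hB _ => h.2 c h0 hB (by linarith)⟩⟩
  exact (min_le_left _ _).trans (by linarith)

/-- The band of the arc `y a` is contained in the band of `x y`, so a path confined to the former is
confined to the latter. The other `cons` rules have the same reason. -/
theorem SoundFirst.cons_nonneg (h1 : SoundEntry G B x y m) (h2 : SoundEntry G B y a m')
    (hd : SoundFirst G B y a z m' d) (hm : 0 ≤ m) (hm1 : -m ≤ m') (hm2 : m' ≤ 0) :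
    SoundFirst G B x y z m (m + d) := by
  obtain ⟨d1, d2, hR⟩ := hd.1 hm2
  -- From `y`, the highest point of the rest of the path, nothing is lost by overflow.
  have key : ∀ c', 0 ≤ c' → c' ≤ B → 0 ≤ c' + m' → G.Reaches B y c' z (c' + d) := by
    intro c' h0 hB hc
    refine (h2.reaches (t := c' + m') h0 hB hc le_rfl (by linarith)).trans
      ((hR (c' + m') hc (by linarith)).weaken ?_)
    exact le_min (by linarith) (by linarith)
  -- A first arc of gain zero has to satisfy the promises for both signs.
  refine ⟨fun hm0 => ⟨by linarith, by linarith, fun e h0 hB => ?_⟩,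
    fun _ => ⟨by linarith, by linarith, fun c h0 hB => ?_⟩⟩
  · exact (key e h0 hB (by linarith)).weaken ((min_le_left _ _).trans (by linarith))
  · have k1 : 0 ≤ min (c + m) B + m' := by
      simp only [min_def]; split_ifs <;> linarith [h2.1]
    exact (h1.2 c h0 hB (by linarith)).trans
      ((key _ (by linarith) (min_le_right _ _) k1).weaken (by linarith))

theorem SoundFirst.cons_neg (hd : SoundFirst G B y a z m' d) (hm : m < 0) (hm1 : 0 ≤ m')
    (hm2 : m' ≤ -m) : SoundFirst G B x y z m (m + d) := by
  obtain ⟨d1, d2, hR⟩ := hd.2 hm1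
  refine ⟨fun _ => ⟨by linarith, by linarith, fun e h0 hB => ?_⟩, fun h => by linarith⟩
  refine (hR e h0 hB).weaken ?_
  simp only [min_def]; split_ifs <;> linarith

theorem SoundLast.cons_nonneg (h1 : SoundEntry G B y x m) (h2 : SoundEntry G B a y m')
    (hd : SoundLast G B z a y m' d) (hm : 0 ≤ m) (hm1 : -m ≤ m') (hm2 : m' ≤ 0) :
    SoundLast G B z y x m (d + m) := by
  obtain ⟨d1, d2, hR⟩ := hd.1 hm2
  have key : ∀ c, 0 ≤ c → c ≤ B → 0 ≤ c + d → G.Reaches B z c y (min (c + d) (B + m')) := by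
    intro c h0 hB hc
    have k : 0 ≤ min (c + d - m') B + m' := by
      simp only [min_def]; split_ifs <;> linarith [h2.1]
    refine (hR c h0 hB hc).trans (h2.reaches (by linarith) (min_le_right _ _) k ?_
      ((min_le_right _ _).trans (by linarith)))
    simp only [min_def]; split_ifs <;> linarith
  refine ⟨fun hm0 => ⟨by linarith, by linarith, fun c h0 hB hc => ?_⟩,
    fun _ => ⟨by linarith, by linarith, fun c h0 hB hc => ?_⟩⟩
  · refine (key c h0 hB (by linarith)).weaken ?_
    simp only [min_def]; split_ifs <;> linarith
  · have k : 0 ≤ min (c + d) (B + m') := le_min (by linarith) (by linarith [h2.1])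
    refine (key c h0 hB (by linarith)).trans (h1.reaches k
      ((min_le_right _ _).trans (by linarith)) (by linarith) ?_ (min_le_right _ _))
    simp only [min_def]; split_ifs <;> linarith

theorem SoundLast.cons_neg (hd : SoundLast G B z a y m' d) (hm : m < 0) (hm1 : 0 ≤ m')
    (hm2 : m' ≤ -m) : SoundLast G B z y x m (d + m) := by
  obtain ⟨d1, d2, hR⟩ := hd.2 hm1
  refine ⟨fun _ => ⟨by linarith, by linarith, fun c h0 hB hc => ?_⟩, fun h => by linarith⟩
  refine (hR c h0 hB (by linarith)).weaken ?_
  simp only [min_def]; split_ifs <;> linarith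

/-- Relative to `u`, the arc `w a` leads from height `d` to `d + m'`, and the range condition says
that this is not below the height `m` of `v`. So the second path stays inside the band of the first.
-/
theorem SoundFirst.concat (hmB : -B ≤ m) (hd : SoundFirst G B u v w m d)
    (h2 : SoundEntry G B w a m') (he : SoundFirst G B w a x m' e) (hm : m < 0)
    (h1 : -(d - m) ≤ m') (hm' : m' ≤ 0) : SoundFirst G B u v x m (d + e) := by
  obtain ⟨d1, d2, hR⟩ := hd.1 hm.le
  obtain ⟨e1, e2, hR'⟩ := he.1 hm'
  refine ⟨fun _ => ⟨by linarith, by linarith, fun c h0 hB => ?_⟩, fun h => by linarith⟩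
  have k : 0 ≤ min (c + d - m) (B + d) + m' := by
    simp only [min_def]; split_ifs <;> linarith
  have k' : min (c + d - m) (B + d) ≤ B := (min_le_right _ _).trans (by linarith)
  refine (hR c h0 hB).trans ((h2.reaches (t := min (c + d - m) (B + d) + m') (by linarith) k' k
    le_rfl (by linarith)).trans ((hR' _ k (by linarith)).weaken ?_))
  simp only [min_def]; split_ifs <;> linarith

theorem SoundLast.concat (hmB : -B ≤ m) (hd : SoundLast G B w v u m d)
    (h2 : SoundEntry G B a w m') (he : SoundLast G B x a w m' e) (hm : m < 0)
    (h1 : -(d - m) ≤ m') (hm' : m' ≤ 0) : SoundLast G B x v u m (e + d) := by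
  obtain ⟨d1, d2, hR⟩ := hd.1 hm.le
  obtain ⟨e1, e2, hR'⟩ := he.1 hm'
  refine ⟨fun _ => ⟨by linarith, by linarith, fun c h0 hB hc => ?_⟩, fun h => by linarith⟩
  have k0 : 0 ≤ min (c + e - m') B := le_min (by linarith) (by linarith)
  have k : 0 ≤ min (c + e - m') B + m' := by
    simp only [min_def]; split_ifs <;> linarith
  have k1 : 0 ≤ min (c + e - m') B + m' + d := by
    simp only [min_def]; split_ifs <;> linarith
  have k2 := min_le_right (c + e - m') B
  refine (hR' c h0 hB (by linarith)).trans ((h2.reaches (t := min (c + e - m') B + m') k0 k2 k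
    le_rfl (by linarith)).trans ((hR _ k (by linarith) k1).weaken ?_))
  simp only [min_def]; split_ifs <;> linarith

/-- The band of the second path has its top `x` at height `d + e` and its bottom `a` at height `d +
e - m'`. The two inequalities place both between `m` and 0. -/
theorem SoundFirst.concatOpposite (hmB : -B ≤ m) (hd : SoundFirst G B u v w m d)
    (he : SoundLast G B w a x m' e) (hm : m < 0) (hm' : 0 ≤ m') (h1 : m' - e ≤ d - m)
    (h2 : e ≤ -d) : SoundFirst G B u v x m (d + e) := by
  obtain ⟨d1, d2, hR⟩ := hd.1 hm.le
  obtain ⟨e1, e2, hR'⟩ := he.2 hm'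
  refine ⟨fun _ => ⟨by linarith, by linarith, fun c h0 hB => ?_⟩, fun h => by linarith⟩
  refine (hR c h0 hB).trans ((hR' _ (le_min (by linarith) (by linarith))
    ((min_le_right _ _).trans (by linarith)) ?_).weaken ?_)
  all_goals simp only [min_def]; split_ifs <;> linarith

/-- The second path ends at or above the top of the band, so any gain up to 0 may be claimed. Its
lowest point has height `d + e - m' ≥ -m' ≥ m`, so no charge beyond that needed at `v` is required.
-/
theorem SoundFirst.concatOpposite_zero (hmB : -B ≤ m) (hd : SoundFirst G B u v w m d)
    (he : SoundLast G B w a x m' e) (hm : m < 0) (hm' : 0 ≤ m') (h1 : -d ≤ e)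
    (h2 : m' ≤ -m) : SoundFirst G B u v x m 0 := by
  obtain ⟨d1, d2, hR⟩ := hd.1 hm.le
  obtain ⟨e1, e2, hR'⟩ := he.2 hm'
  refine ⟨fun _ => ⟨by linarith, by linarith, fun c h0 hB => ?_⟩, fun h => by linarith⟩
  refine (hR c h0 hB).trans ((hR' _ (le_min (by linarith) (by linarith))
    ((min_le_right _ _).trans (by linarith)) ?_).weaken ?_)
  all_goals simp only [min_def]; split_ifs <;> linarith

theorem SoundLast.concatOpposite (hmB : -B ≤ m) (hd : SoundLast G B w v u m d)
    (he : SoundFirst G B x a w m' e) (hm : m < 0) (hm' : 0 ≤ m') (h1 : m' - e ≤ d - m)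
    (h2 : e ≤ -d) : SoundLast G B x v u m (e + d) := by
  obtain ⟨d1, d2, hR⟩ := hd.1 hm.le
  obtain ⟨e1, e2, hR'⟩ := he.2 hm'
  refine ⟨fun _ => ⟨by linarith, by linarith, fun c h0 hB hc => ?_⟩, fun h => by linarith⟩
  have k1 : 0 ≤ min (c + m') B - (m' - e) + d := by
    simp only [min_def]; split_ifs <;> linarith
  refine (hR' c h0 hB).trans ((hR _ (by linarith) ?_ k1).weaken ?_)
  all_goals simp only [min_def]; split_ifs <;> linarith

theorem SoundLast.concatOpposite_zero (hmB : -B ≤ m) (hd : SoundLast G B w v u m d)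
    (he : SoundFirst G B x a w m' e) (hm : m < 0) (hm' : 0 ≤ m') (h1 : -d ≤ e)
    (h2 : m' ≤ -m) : SoundLast G B x v u m 0 := by
  obtain ⟨d1, d2, hR⟩ := hd.1 hm.le
  obtain ⟨e1, e2, hR'⟩ := he.2 hm'
  refine ⟨fun _ => ⟨by linarith, by linarith, fun c h0 hB hc => ?_⟩, fun h => by linarith⟩
  have k1 : 0 ≤ min (c + m') B - (m' - e) + d := by
    simp only [min_def]; split_ifs <;> linarith
  refine (hR' c h0 hB).trans ((hR _ (by linarith) ?_ k1).weaken ?_)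
  all_goals simp only [min_def]; split_ifs <;> linarith

/-- An arc behind a path that is bounded by a descending arc `u v` ends below, inside or above the
band. Below, `y` is the lowest point and the total gain is safe; inside, only the depth `m` of the
band is; above, the part from the bottom `v` to `y` climbs monotonically from its lowest to its
highest point. -/
theorem SoundFirst.exit_below (h1 : SoundEntry G B u v m) (hd : SoundFirst G B u v x m d)
    (h2 : SoundEntry G B x y m') (hm : m ≤ 0) (hB : -B ≤ d + m') (hg : d + m' ≤ m) :
    SoundEntry G B u y (d + m') := by
  obtain ⟨d1, d2, hR⟩ := hd.1 hm
  refine ⟨hB, fun c h0 hcB hc => ?_⟩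
  refine (h1.reaches (t := c + m) h0 hcB (by linarith) le_rfl (by linarith)).trans
    (((hR _ (by linarith) (by linarith)).weaken (d' := c + d) ?_).trans
    (h2.reaches (by linarith) (by linarith) (by linarith) ?_ (min_le_right _ _)))
  · exact le_min (by linarith) (by linarith)
  · exact (min_le_left _ _).trans (by linarith)

theorem SoundFirst.exit_inside (h1 : SoundEntry G B u v m) (hd : SoundFirst G B u v x m d)
    (h2 : SoundEntry G B x y m') (hm : m ≤ 0) (hg : m ≤ d + m') : SoundEntry G B u y m := by
  obtain ⟨d1, d2, hR⟩ := hd.1 hm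
  refine ⟨h1.1, fun c h0 hcB hc => ?_⟩
  refine (h1.reaches (t := c + m) h0 hcB (by linarith) le_rfl (by linarith)).trans
    (((hR _ (by linarith) (by linarith)).weaken (d' := c + d) ?_).trans
    (h2.reaches (by linarith) (by linarith) (by linarith) ?_ (min_le_right _ _)))
  · exact le_min (by linarith) (by linarith)
  · exact (min_le_left _ _).trans (by linarith)

theorem SoundFirst.exit_above (h1 : SoundEntry G B u v m) (hd : SoundFirst G B u v x m d)
    (h2 : SoundEntry G B x y m') (hm : m ≤ 0) (hg : 0 ≤ d + m') :
    SoundEntry G B v y (-m + (d + m')) := by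
  obtain ⟨d1, d2, hR⟩ := hd.1 hm
  have hmB := h1.1
  refine ⟨by linarith, fun c h0 hcB hc => ?_⟩
  refine (hR _ h0 hcB).trans (h2.reaches (le_min (by linarith) (by linarith))
    ((min_le_right _ _).trans (by linarith)) ?_ ?_ (min_le_right _ _))
  all_goals simp only [min_def]; split_ifs <;> linarith

theorem SoundLast.exit_below (h1 : SoundEntry G B v u m) (hd : SoundLast G B x v u m d)
    (h2 : SoundEntry G B y x m') (hm : m ≤ 0) (hB : -B ≤ m' + d) (hg : m' + d ≤ m) :
    SoundEntry G B y u (m' + d) := by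
  obtain ⟨d1, d2, hR⟩ := hd.1 hm
  have hmB := h1.1
  refine ⟨hB, fun c h0 hcB hc => ?_⟩
  have k0 : 0 ≤ min (c + m') B := le_min (by linarith) (by linarith)
  have k1 : 0 ≤ min (c + m') B + d := by simp only [min_def]; split_ifs <;> linarith
  refine (h2.2 c h0 hcB (by linarith)).trans ((hR _ k0 (min_le_right _ _) k1).trans
    (h1.reaches (le_min (by linarith) (by linarith)) (min_le_right _ _) ?_ ?_
      (min_le_right _ _)))
  all_goals simp only [min_def]; split_ifs <;> linarith

theorem SoundLast.exit_inside (h1 : SoundEntry G B v u m) (hd : SoundLast G B x v u m d)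
    (h2 : SoundEntry G B y x m') (hm : m ≤ 0) (hg : m ≤ m' + d) : SoundEntry G B y u m := by
  obtain ⟨d1, d2, hR⟩ := hd.1 hm
  have hmB := h1.1
  refine ⟨hmB, fun c h0 hcB hc => ?_⟩
  have k0 : 0 ≤ min (c + m') B := le_min (by linarith) (by linarith)
  have k1 : 0 ≤ min (c + m') B + d := by simp only [min_def]; split_ifs <;> linarith
  refine (h2.2 c h0 hcB (by linarith)).trans ((hR _ k0 (min_le_right _ _) k1).trans
    (h1.reaches (le_min (by linarith) (by linarith)) (min_le_right _ _) ?_ ?_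
      (min_le_right _ _)))
  all_goals simp only [min_def]; split_ifs <;> linarith

theorem SoundLast.exit_above (h1 : SoundEntry G B v u m) (hd : SoundLast G B x v u m d)
    (h2 : SoundEntry G B y x m') (hm : m ≤ 0) (hg : 0 ≤ m' + d) :
    SoundEntry G B y v (m' + d - m) := by
  obtain ⟨d1, d2, hR⟩ := hd.1 hm
  have hmB := h1.1
  refine ⟨by linarith, fun c h0 hcB hc => ?_⟩
  have k0 : 0 ≤ min (c + m') B := le_min (by linarith) (by linarith)
  have k1 : 0 ≤ min (c + m') B + d := by simp only [min_def]; split_ifs <;> linarith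
  refine (h2.2 c h0 hcB (by linarith)).trans ((hR _ k0 (min_le_right _ _) k1).weaken ?_)
  simp only [min_def]; split_ifs <;> linarith

end RealLevel

open RoadNetwork

/-! ### Soundness of the short shortcuts -/

section TableLevel

variable {n : ℕ} {G : RoadNetwork (Fin n)} {B : ℝ}

theorem EReal.min_coe_zero (m : ℝ) : min (m : EReal) 0 = ((min m 0 : ℝ) : EReal) :=
  (EReal.coe_strictMono.monotone.map_min (a := m) (b := 0)).symm

theorem EReal.min_coe_coe (m m' : ℝ) : min (m : EReal) m' = ((min m m' : ℝ) : EReal) :=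
  (EReal.coe_strictMono.monotone.map_min (a := m) (b := m')).symm

theorem SoundTable.joinShortcut {M N : Table n} (hM : SoundTable G B M)
    (hN : SoundTable G B N) (x y z : Fin n) :
    Holds (SoundEntry G B x z) (joinShortcut B M N x y z) := by
  unfold _root_.joinShortcut
  rcases hM x y with h | ⟨m, h, sm⟩
  · simp [h, Holds.bot]
  rcases hN y z with h' | ⟨m', h', sm'⟩
  · simp [h', Holds.bot]
  rw [h, h', EReal.min_coe_zero, EReal.min_coe_zero]
  split_ifs with h1 h2
  · rw [← EReal.coe_add]
    exact .coe (sm.join_nonneg sm' (by exact_mod_cast h1.1) (by exact_mod_cast h1.2))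
  · rw [← EReal.coe_add] at h2 ⊢
    exact .coe (sm.join_nonpos sm' (by exact_mod_cast h2))
  · exact .bot

theorem SoundTable.bot : SoundTable G B (fun _ _ => ⊥) := fun _ _ => .bot

theorem SoundTable.max {M N : Table n} (hM : SoundTable G B M) (hN : SoundTable G B N) :
    SoundTable G B (fun x y => max (M x y) (N x y)) := fun x y => (hM x y).max (hN x y)

theorem SoundTable.trivialShortcuts {M D : Table n} (hM : SoundTable G B M)
    (hD : SoundTable G B D) : SoundTable G B (trivialShortcuts B M D) := by
  have h2 : SoundTable G B (forTriples (fun x y z T =>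
      T.raise x z (_root_.joinShortcut B M M x y z)) (fun _ _ => ⊥)) :=
    forTriples_preserve (P := SoundTable G B)
      (fun x y z T hT => Table.raise_holds hT (hM.joinShortcut hM x y z)) _ .bot
  have h3 := forTriples_preserve (P := SoundTable G B)
    (fun x y z T hT => Table.raise_holds hT (hM.joinShortcut h2 x y z)) _ .bot
  exact hD.max (h2.max h3)

theorem SoundTable.ite_raise {T : Table n} {c : Prop} [Decidable c] {x z : Fin n} {k : EReal}
    (hT : SoundTable G B T) (hk : c → Holds (SoundEntry G B x z) k) :
    SoundTable G B (if c then T.raise x z k else T) := by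
  split_ifs with h
  · exact Table.raise_holds hT (hk h)
  · exact hT

theorem SoundTable.hardShortcutStep {M D : Table n} (hM : SoundTable G B M)
    (hD : SoundTable G B D) (x y z : Fin n) :
    SoundTable G B (hardShortcutStep B M x y z D) := by
  classical
  rcases hM x y with h | ⟨m, h, sm⟩
  -- Since `⊥ ≤ 0`, the second branch does run for a missing entry, but everything that it writes is
  -- `⊥`.
  · have hr : ∀ T : Table n, T.raise x z ⊥ = T := by
      intro T; funext a b; rw [Table.raise_apply]
      split_ifs with hab
      · rw [hab.1, hab.2]; simp
      · rfl
    simp [_root_.hardShortcutStep, h, hr, hD]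
  have k1 : SoundTable G B (if 0 ≤ M x y then
      let k₂ := maxOver (fun a => -M x y ≤ M y a ∧ M y a ≤ 0) (fun a => M y a + M a z)
      if M x y ≤ M x y + k₂ then D.raise x z (M x y + k₂) else D
    else D) := by
    rw [h]
    dsimp only
    split_ifs with h1 h2
    · refine Table.raise_holds hD ?_
      have := Holds.maxOver (P := fun k => m ≤ m + k → SoundEntry G B x z (m + k))
        (cond := fun a => -(m : EReal) ≤ M y a ∧ M y a ≤ 0)
        (value := fun a => M y a + M a z) ?_
      · rcases this with hk | ⟨k, hk, hk'⟩
        · rw [hk, EReal.add_bot]; exact .bot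
        · rw [hk, ← EReal.coe_add] at h2 ⊢
          exact .coe (hk' (by exact_mod_cast h2))
      · rintro a ⟨ha, ha'⟩
        rcases hM y a with hya | ⟨m', hya, sm'⟩
        · rw [hya]; simp [Holds.bot]
        rw [hya] at ha ha' ⊢
        refine (Holds.coe (P := (· = m')) rfl).add (hM a z) ?_
        rintro _ m'' rfl sm'' hk
        exact sm.hard_nonneg sm' sm'' (by exact_mod_cast h1) (by exact_mod_cast ha)
          (by exact_mod_cast ha') hk
    · exact hD
    · exact hD
  unfold _root_.hardShortcutStep
  dsimp only
  generalize (if 0 ≤ M x y then _ else D : Table n) = D₁ at k1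
  by_cases h0 : M x y ≤ 0
  swap
  · rw [if_neg h0]; exact k1
  rw [if_pos h0, h, eabs_coe]
  rw [h] at h0
  have hm : m ≤ 0 := by exact_mod_cast h0
  have habs : |m| = -m := abs_of_nonpos hm
  have K := Holds.maxOver (P := fun k => (m + k ≤ m → -B ≤ m + k → SoundEntry G B x z (m + k)) ∧
      (m ≤ m + k → SoundEntry G B x z m))
      (cond := fun a => 0 ≤ M y a ∧ M y a ≤ ((|m| : ℝ) : EReal))
      (value := fun a => M y a + M a z) (by
    rintro a ⟨ha, ha'⟩
    rcases hM y a with hya | ⟨m', hya, sm'⟩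
    · rw [hya]; simp [Holds.bot]
    rw [hya] at ha ha' ⊢
    rw [habs] at ha'
    refine (Holds.coe (P := (· = m')) rfl).add (hM a z) ?_
    rintro _ m'' rfl sm''
    exact ⟨sm.hard_sum sm' sm'' (by exact_mod_cast ha) (by exact_mod_cast ha'),
      sm.hard_first sm' sm'' (by exact_mod_cast ha) (by exact_mod_cast ha')⟩)
  have K' := Holds.maxOver (P := fun k => SoundEntry G B x z (min m k))
      (cond := fun a => ((|m| : ℝ) : EReal) ≤ M y a) (value := fun a => M a z) (by
    intro a ha
    rcases hM y a with hya | ⟨m', hya, sm'⟩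
    · simp [hya] at ha
    rw [hya, habs] at ha
    exact (hM a z).mono fun m'' sm'' => sm.hard_min sm' sm'' hm (by exact_mod_cast ha))
  refine Table.raise_holds 
    (SoundTable.ite_raise (SoundTable.ite_raise k1 fun h1 => ?_) fun h1 => ?_) ?_
  · rcases K with K | ⟨k, K, hk⟩
    · rw [K, EReal.add_bot]; exact .bot
    · rw [K, ← EReal.coe_add] at h1 ⊢
      exact .coe (hk.1 (by exact_mod_cast h1.1) (by exact_mod_cast h1.2))
  · rcases K with K | ⟨k, K, hk⟩
    · simp [K] at h1
    · rw [K, ← EReal.coe_add] at h1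
      exact .coe (hk.2 (by exact_mod_cast h1))
  · rcases K' with K' | ⟨k, K', hk⟩
    · rw [K']; simp [Holds.bot]
    · rw [K', EReal.min_coe_coe]; exact .coe hk

theorem SoundTable.shortShortcuts {M : Table n} (hM : SoundTable G B M) :
    SoundTable G B (shortShortcuts B M) :=
  forTriples_preserve (P := SoundTable G B)
    (fun x y z _ hT => hM.hardShortcutStep hT x y z) _ (hM.trivialShortcuts hM)

end TableLevel

open RoadNetwork

/-! ### Soundness of the arc-bounded paths -/

section DataLevel

variable {n : ℕ} {G : RoadNetwork (Fin n)} {B : ℝ} {M : Table n} {D D₀ : PathData n}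

variable (G B M) in
/-- `SoundFirst`, for the gain of the first arc that is given by the table. -/
def FirstSound (u v x : Fin n) (d : ℝ) : Prop := ∃ m : ℝ, M u v = m ∧ SoundFirst G B u v x m d

variable (G B M) in
/-- `SoundLast`, for the gain of the last arc that is given by the table. -/
def LastSound (x v u : Fin n) (d : ℝ) : Prop := ∃ m : ℝ, M v u = m ∧ SoundLast G B x v u m d

theorem SoundData.setFirst (hD : SoundData G B M D) {x y z : Fin n} {k : EReal}
    (hk : Holds (FirstSound G B M x y z) k) : SoundData G B M (D.setFirst x y z k) := by
  refine ⟨hD.mono, fun a b c => ?_, hD.last⟩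
  rw [PathData.setFirst_apply]
  split_ifs with h
  · rw [h.1, h.2.1, h.2.2]; exact hk
  · exact hD.first a b c

theorem SoundData.setLast (hD : SoundData G B M D) {x y z : Fin n} {k : EReal}
    (hk : Holds (LastSound G B M x y z) k) : SoundData G B M (D.setLast x y z k) := by
  refine ⟨hD.mono, hD.first, fun a b c => ?_⟩
  rw [PathData.setLast_apply]
  split_ifs with h
  · rw [h.1, h.2.1, h.2.2]; exact hk
  · exact hD.last a b c

theorem SoundData.raiseFirst (hD : SoundData G B M D) {x y z : Fin n} {k : EReal}
    (hk : Holds (FirstSound G B M x y z) k) : SoundData G B M (D.raiseFirst x y z k) :=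
  hD.setFirst ((hD.first x y z).max hk)

theorem SoundData.raiseLast (hD : SoundData G B M D) {x y z : Fin n} {k : EReal}
    (hk : Holds (LastSound G B M x y z) k) : SoundData G B M (D.raiseLast x y z k) :=
  hD.setLast ((hD.last x y z).max hk)

theorem SoundData.ite_raiseMono (hD : SoundData G B M D) {c : Prop} [Decidable c] {x z : Fin n}
    {k : EReal} (hk : c → Holds (SoundEntry G B x z) k) :
    SoundData G B M (if c then D.raiseMono x z k else D) := by
  split_ifs with h
  · exact ⟨Table.raise_holds hD.mono (hk h), hD.first, hD.last⟩
  · exact hD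

theorem SoundTable.init (hM : SoundTable G B M) : SoundData G B M (PathData.init M) := by
  refine ⟨hM, fun u v x => ?_, fun x v u => ?_⟩
  · simp only [PathData.init]
    split_ifs with h
    · subst h
      rcases hM u x with h | ⟨m, h, sm⟩
      · rw [h]; exact .bot
      · rw [h]; exact .coe ⟨m, rfl, soundFirst_self sm⟩
    · exact .bot
  · simp only [PathData.init]
    split_ifs with h
    · subst h
      rcases hM x u with h | ⟨m, h, sm⟩
      · rw [h]; exact .bot
      · rw [h]; exact .coe ⟨m, rfl, soundLast_self sm⟩
    · exact .bot

theorem SoundData.breadthSearch (hM : SoundTable G B M) (hD : SoundData G B M D₀) :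
    SoundData G B M (breadthSearch M D₀) := by
  classical
  refine forTriples_preserve (P := SoundData G B M) (fun x y z D h => ?_) _ hD
  refine SoundData.raiseLast (SoundData.raiseFirst h ?_) ?_
  · rcases hM x y with h | ⟨m, h, sm⟩
    · rw [h, EReal.bot_add]; exact .bot
    rw [h, eabs_coe]
    refine (Holds.coe (P := (· = m)) rfl).add (P := (· = m))
      (Q := fun d => FirstSound G B M x y z (m + d)) ?_ (by rintro _ d rfl hd; exact hd)
    split_ifs with h0
    · have h0' : 0 ≤ m := by exact_mod_cast h0
      refine Holds.maxOver fun a ha => (hD.first y a z).mono ?_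
      rintro d ⟨m', hm', hd⟩
      have sm' := hM y a
      rw [hm'] at ha sm'
      exact ⟨m, h, hd.cons_nonneg sm sm'.of_coe h0' (by exact_mod_cast ha.1)
        (by exact_mod_cast ha.2)⟩
    · have h0' : m < 0 := by rw [not_le] at h0; exact_mod_cast h0
      refine Holds.maxOver fun a ha => (hD.first y a z).mono ?_
      rintro d ⟨m', hm', hd⟩
      rw [hm', abs_of_neg h0'] at ha
      exact ⟨m, h, hd.cons_neg h0' (by exact_mod_cast ha.1) (by exact_mod_cast ha.2)⟩
  · rcases hM y x with h | ⟨m, h, sm⟩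
    · rw [h, EReal.add_bot]; exact .bot
    rw [h, eabs_coe]
    refine Holds.add (P := fun d => LastSound G B M z y x (d + m)) (Q := (· = m)) ?_
      (Holds.coe rfl) (by rintro d _ hd rfl; exact hd)
    split_ifs with h0
    · have h0' : 0 ≤ m := by exact_mod_cast h0
      refine Holds.maxOver fun a ha => (hD.last z a y).mono ?_
      rintro d ⟨m', hm', hd⟩
      have sm' := hM a y
      rw [hm'] at ha sm'
      exact ⟨m, h, hd.cons_nonneg sm sm'.of_coe h0' (by exact_mod_cast ha.1)
        (by exact_mod_cast ha.2)⟩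
    · have h0' : m < 0 := by rw [not_le] at h0; exact_mod_cast h0
      refine Holds.maxOver fun a ha => (hD.last z a y).mono ?_
      rintro d ⟨m', hm', hd⟩
      rw [hm', abs_of_neg h0'] at ha
      exact ⟨m, h, hd.cons_neg h0' (by exact_mod_cast ha.1) (by exact_mod_cast ha.2)⟩

theorem SoundData.concatenate (hM : SoundTable G B M) (hD : SoundData G B M D₀)
    (U W X : Finset (Fin n)) : SoundData G B M (concatenate M U W X D₀) := by
  classical
  refine forQuadruples_preserve (P := SoundData G B M) (fun u _ v w x D h => ?_) _ hD
  dsimp only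
  have k1 : SoundData G B M (if M u v < 0 then
        let k := maxOver (fun a => -(D.first u v w - M u v) ≤ M w a ∧ M w a ≤ 0)
          (fun a => D₀.first w a x)
        D.raiseFirst u v x (D.first u v w + k)
      else D) := by
    split_ifs with h0
    · refine h.raiseFirst ?_
      rcases h.first u v w with hd | ⟨d, hd, m, hm, sd⟩
      · rw [hd, EReal.bot_add]; exact .bot
      have sm := hM u v
      rw [hm] at h0 sm
      rw [hd, hm]
      refine (Holds.coe (P := (· = d)) rfl).add (P := (· = d))
        (Q := fun e => FirstSound G B M u v x (d + e)) ?_ (by rintro _ e rfl he; exact he)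
      refine Holds.maxOver fun a ha => (hD.first w a x).mono ?_
      rintro e ⟨m', hm', se⟩
      have sm' := hM w a
      rw [hm'] at ha sm'
      exact ⟨m, hm, sd.concat sm.of_coe.1 sm'.of_coe se (by exact_mod_cast h0)
        (by exact_mod_cast ha.1) (by exact_mod_cast ha.2)⟩
    · exact h
  dsimp only at k1
  generalize (if M u v < 0 then _ else D : PathData n) = D₁ at k1
  split_ifs with h0
  · refine k1.raiseLast ?_
    rcases k1.last w v u with hd | ⟨d, hd, m, hm, sd⟩
    · rw [hd, EReal.add_bot]; exact .bot
    have sm := hM v u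
    rw [hm] at h0 sm
    rw [hd, hm]
    refine Holds.add (P := fun e => LastSound G B M x v u (e + d)) (Q := (· = d)) ?_
      (Holds.coe rfl) (by rintro e _ he rfl; exact he)
    refine Holds.maxOver fun a ha => (hD.last x a w).mono ?_
    rintro e ⟨m', hm', se⟩
    have sm' := hM a w
    rw [hm'] at ha sm'
    exact ⟨m, hm, sd.concat sm.of_coe.1 sm'.of_coe se (by exact_mod_cast h0)
      (by exact_mod_cast ha.1) (by exact_mod_cast ha.2)⟩
  · exact k1

/-- Absolute values are nonnegative. So the existence queries that lead to an assignment of 0 never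
succeed because of an unknown path. -/
theorem not_eabs_le_bot (x : EReal) : ¬ eabs x ≤ ⊥ := by
  unfold eabs
  rw [le_bot_iff, max_eq_bot, not_and]
  rintro rfl
  simp

theorem SoundFirst.nonpos {u v x : Fin n} {m d : ℝ} (h : SoundFirst G B u v x m d)
    (hm : m < 0) : d ≤ 0 := (h.1 hm.le).2.1

theorem SoundLast.nonpos {u v x : Fin n} {m d : ℝ} (h : SoundLast G B x v u m d)
    (hm : m < 0) : d ≤ 0 := (h.1 hm.le).2.1

theorem SoundData.concatenateOpposite (hM : SoundTable G B M) (hD : SoundData G B M D₀)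
    (U W X : Finset (Fin n)) : SoundData G B M (concatenateOpposite M U W X D₀) := by
  classical
  refine forQuadruples_preserve (P := SoundData G B M) (fun u _ v w x D h => ?_) _ hD
  dsimp only
  have k1 : SoundData G B M (if M u v < 0 then
        let k := maxOver (fun a => 0 ≤ M a x ∧
            M a x - D₀.last w a x ≤ D.first u v w - M u v ∧
            D₀.last w a x ≤ eabs (D.first u v w))
          (fun a => D₀.last w a x)
        let D₁ := D.raiseFirst u v x (D.first u v w + k)
        if ∃ a, 0 ≤ M a x ∧ eabs (D₁.first u v w) ≤ D₀.last w a x ∧ M a x ≤ eabs (M u v)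
        then D₁.setFirst u v x 0 else D₁
      else D) := by
    split_ifs with h0
    · dsimp only
      generalize hk : D.first u v w + maxOver _ _ = k
      have s1 : SoundData G B M (D.raiseFirst u v x k) := by
        refine h.raiseFirst ?_
        rw [← hk]
        rcases h.first u v w with hd | ⟨d, hd, m, hm, sd⟩
        · rw [hd, EReal.bot_add]; exact .bot
        have sm := hM u v
        rw [hm] at h0 sm
        have hm0 : m < 0 := by exact_mod_cast h0
        rw [hd, hm, eabs_coe, abs_of_nonpos (sd.nonpos hm0)]
        refine (Holds.coe (P := (· = d)) rfl).add (P := (· = d))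
          (Q := fun e => FirstSound G B M u v x (d + e)) ?_ (by rintro _ e rfl he; exact he)
        refine Holds.maxOver fun a ha => ?_
        rcases hD.last w a x with he | ⟨e, he, m', hm', se⟩
        · rw [he]; exact .bot
        rw [he]
        rw [hm', he] at ha
        exact .coe ⟨m, hm, sd.concatOpposite sm.of_coe.1 se hm0 (by exact_mod_cast ha.1)
          (by exact_mod_cast ha.2.1) (by exact_mod_cast ha.2.2)⟩
      generalize D.raiseFirst u v x k = D₁ at s1
      split_ifs with h1
      · refine s1.setFirst ?_
        obtain ⟨a, h1, h2, h3⟩ := h1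
        rcases hD.last w a x with he | ⟨e, he, m', hm', se⟩
        · rw [he] at h2
          exact absurd h2 (not_eabs_le_bot _)
        -- An unknown prefix has absolute value `⊤`, which no known gain reaches.
        rcases s1.first u v w with hd | ⟨d, hd, m, hm, sd⟩
        · rw [hd, eabs_bot, he] at h2
          exact absurd (top_le_iff.1 h2) (EReal.coe_ne_top _)
        have sm := hM u v
        rw [hm] at h0 sm h3
        have hm0 : m < 0 := by exact_mod_cast h0
        rw [hd, he, eabs_coe, abs_of_nonpos (sd.nonpos hm0)] at h2
        rw [hm'] at h1 h3
        rw [eabs_coe, abs_of_neg hm0] at h3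
        rw [← EReal.coe_zero]
        exact .coe ⟨m, hm, sd.concatOpposite_zero sm.of_coe.1 se hm0 (by exact_mod_cast h1)
          (by exact_mod_cast h2) (by exact_mod_cast h3)⟩
      · exact s1
    · exact h
  dsimp only at k1
  generalize (if M u v < 0 then _ else D : PathData n) = D₂ at k1
  by_cases h0 : M v u < 0
  swap
  · rw [if_neg h0]; exact k1
  rw [if_pos h0]
  generalize hk : maxOver _ _ + D₂.last w v u = k
  have s1 : SoundData G B M (D₂.raiseLast x v u k) := by
    refine k1.raiseLast ?_
    rw [← hk]
    rcases k1.last w v u with hd | ⟨d, hd, m, hm, sd⟩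
    · rw [hd, EReal.add_bot]; exact .bot
    have sm := hM v u
    rw [hm] at h0 sm
    have hm0 : m < 0 := by exact_mod_cast h0
    rw [hd, hm, eabs_coe, abs_of_nonpos (sd.nonpos hm0)]
    refine Holds.add (P := fun e => LastSound G B M x v u (e + d)) (Q := (· = d)) ?_
      (Holds.coe rfl) (by rintro e _ he rfl; exact he)
    refine Holds.maxOver fun a ha => ?_
    rcases hD.first x a w with he | ⟨e, he, m', hm', se⟩
    · rw [he]; exact .bot
    rw [he]
    rw [hm', he] at ha
    exact .coe ⟨m, hm, sd.concatOpposite sm.of_coe.1 se hm0 (by exact_mod_cast ha.1)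
      (by exact_mod_cast ha.2.1) (by exact_mod_cast ha.2.2)⟩
  generalize D₂.raiseLast x v u k = D₃ at s1
  split_ifs with h1
  · refine s1.setLast ?_
    obtain ⟨a, h1, h2, h3⟩ := h1
    rcases hD.first x a w with he | ⟨e, he, m', hm', se⟩
    · rw [he] at h2
      exact absurd h2 (not_eabs_le_bot _)
    rcases s1.last w v u with hd | ⟨d, hd, m, hm, sd⟩
    · rw [hd, eabs_bot, he] at h2
      exact absurd (top_le_iff.1 h2) (EReal.coe_ne_top _)
    have sm := hM v u
    rw [hm] at h0 sm h3
    have hm0 : m < 0 := by exact_mod_cast h0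
    rw [hd, he, eabs_coe, abs_of_nonpos (sd.nonpos hm0)] at h2
    rw [hm'] at h1 h3
    rw [eabs_coe, abs_of_neg hm0] at h3
    rw [← EReal.coe_zero]
    exact .coe ⟨m, hm, sd.concatOpposite_zero sm.of_coe.1 se hm0 (by exact_mod_cast h1)
      (by exact_mod_cast h2) (by exact_mod_cast h3)⟩
  · exact s1

theorem SoundData.arcBoundedToMonotone (hM : SoundTable G B M) (hD : SoundData G B M D₀)
    (T : Finset (Fin n)) : SoundData G B M (arcBoundedToMonotone B M T D₀) := by
  classical
  refine forQuadruples_preserve (P := SoundData G B M) (fun u _ v x y D h => ?_) _ hD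
  dsimp only
  have k1 : SoundData G B M (if M u v ≤ 0 then
        let g := D.first u v x + M x y
        let D₁ := if (-B : ℝ) ≤ g ∧ g ≤ M u v then D.raiseMono u y g else D
        let D₂ := if M u v ≤ g then D₁.raiseMono u y (M u v) else D₁
        if 0 ≤ g then D₂.raiseMono v y (-M u v + g) else D₂
      else D) := by
    by_cases h0 : M u v ≤ 0
    swap
    · rw [if_neg h0]; exact h
    rw [if_pos h0]
    have hg : Holds (fun g => ∃ m d m' : ℝ, M u v = m ∧ SoundEntry G B u v m ∧
        SoundFirst G B u v x m d ∧ SoundEntry G B x y m' ∧ g = d + m' ∧ m ≤ 0)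
        (D.first u v x + M x y) := by
      refine (h.first u v x).add (hM x y) ?_
      rintro d m' ⟨m, hm, sd⟩ sm'
      have sm := hM u v
      rw [hm] at h0 sm
      exact ⟨m, d, m', hm, sm.of_coe, sd, sm', rfl, by exact_mod_cast h0⟩
    dsimp only
    generalize D.first u v x + M x y = g at hg
    rcases hg with rfl | ⟨_, rfl, m, d, m', hm, sm, sd, sm', rfl, hm0⟩
    -- A missing sum `⊥` is at least `M u v` only if that is missing as well, and then the update
    -- writes `⊥`.
    · simp
      split_ifs with h1
      · rw [h1]
        exact ⟨Table.raise_holds h.mono .bot, h.first, h.last⟩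
      · exact h
    rw [hm]
    refine .ite_raiseMono (.ite_raiseMono (.ite_raiseMono h ?_) ?_) ?_
    · intro h1
      exact .coe (sd.exit_below sm sm' hm0 (by exact_mod_cast h1.1) (by exact_mod_cast h1.2))
    · intro h1
      exact .coe (sd.exit_inside sm sm' hm0 (by exact_mod_cast h1))
    · intro h1
      rw [← EReal.coe_neg, ← EReal.coe_add]
      exact .coe (sd.exit_above sm sm' hm0 (by exact_mod_cast h1))
  dsimp only at k1
  generalize (if M u v ≤ 0 then _ else D : PathData n) = D₃ at k1
  by_cases h0 : M v u ≤ 0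
  swap
  · rw [if_neg h0]; exact k1
  rw [if_pos h0]
  have hg : Holds (fun g => ∃ m d m' : ℝ, M v u = m ∧ SoundEntry G B v u m ∧
      SoundLast G B x v u m d ∧ SoundEntry G B y x m' ∧ g = m' + d ∧ m ≤ 0)
      (M y x + D.last x v u) := by
    refine (hM y x).add (h.last x v u) ?_
    rintro m' d sm' ⟨m, hm, sd⟩
    have sm := hM v u
    rw [hm] at h0 sm
    exact ⟨m, d, m', hm, sm.of_coe, sd, sm', rfl, by exact_mod_cast h0⟩
  generalize M y x + D.last x v u = g at hg
  rcases hg with rfl | ⟨_, rfl, m, d, m', hm, sm, sd, sm', rfl, hm0⟩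
  · simp
    split_ifs with h1
    · rw [h1]
      exact ⟨Table.raise_holds k1.mono .bot, k1.first, k1.last⟩
    · exact k1
  rw [hm]
  refine .ite_raiseMono (.ite_raiseMono (.ite_raiseMono k1 ?_) ?_) ?_
  · intro h1
    exact .coe (sd.exit_below sm sm' hm0 (by exact_mod_cast h1.1) (by exact_mod_cast h1.2))
  · intro h1
    exact .coe (sd.exit_inside sm sm' hm0 (by exact_mod_cast h1))
  · intro h1
    rw [← EReal.coe_sub]
    exact .coe (sd.exit_above sm sm' hm0 (by exact_mod_cast h1))

end DataLevel

/-! ### Completeness of the short shortcuts -/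

section ShortComplete

variable {n : ℕ} {B : ℝ} {M : Table n}

theorem Table.le_ite_raise {T T' : Table n} {c : Prop} [Decidable c] {x y : Fin n} {k : EReal}
    (h : T ≤ T') : T ≤ if c then T'.raise x y k else T' := by
  split_ifs
  · exact h.trans (T'.le_raise _ _ _)
  · exact h

theorem le_hardShortcutStep (x y z : Fin n) (D : Table n) : D ≤ hardShortcutStep B M x y z D := by
  classical
  unfold hardShortcutStep
  have k1 : D ≤ (if 0 ≤ M x y then
      let k₂ := maxOver (fun a => -M x y ≤ M y a ∧ M y a ≤ 0) (fun a => M y a + M a z)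
      if M x y ≤ M x y + k₂ then D.raise x z (M x y + k₂) else D
    else D) := by
    by_cases h : 0 ≤ M x y
    · rw [if_pos h]; exact Table.le_ite_raise le_rfl
    · rw [if_neg h]
  dsimp only at k1 ⊢
  generalize (if 0 ≤ M x y then _ else D : Table n) = D₁ at k1
  by_cases h : M x y ≤ 0
  · rw [if_pos h]
    exact (Table.le_ite_raise (Table.le_ite_raise k1)).trans (Table.le_raise _ _ _ _)
  · rw [if_neg h]; exact k1

theorem le_shortShortcuts_of_step {x y z : Fin n} {k : EReal}
    (h : ∀ D, k ≤ hardShortcutStep B M x y z D x z) : k ≤ shortShortcuts B M x z :=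
  forTriples_reach (P := fun _ => True) (Q := fun T : Table n => k ≤ T x z)
    (fun _ _ _ _ _ => trivial)
    (fun a b c T _ hT => hT.trans (le_hardShortcutStep a b c T x z)) x y z (fun D _ => h D) _
    trivial

theorem trivialShortcuts_le : trivialShortcuts B M M ≤ shortShortcuts B M := fun x z =>
  forTriples_preserve (P := fun T : Table n => trivialShortcuts B M M x z ≤ T x z)
    (fun a b c T hT => hT.trans (le_hardShortcutStep a b c T x z)) _ le_rfl

theorem le_shortShortcuts : M ≤ shortShortcuts B M := fun x z =>
  (le_max_left _ _ : M x z ≤ trivialShortcuts B M M x z).trans (trivialShortcuts_le x z)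

theorem joinShortcut_le_shortShortcuts (x y z : Fin n) :
    joinShortcut B M M x y z ≤ shortShortcuts B M x z := by
  refine le_trans ?_ (trivialShortcuts_le x z)
  refine le_trans ?_ (le_max_right _ _)
  refine le_trans ?_ (le_max_left _ _)
  exact forTriples_reach (P := fun _ => True)
    (body := fun x y z T => Table.raise T x z (joinShortcut B M M x y z))
    (Q := fun T : Table n => joinShortcut B M M x y z ≤ T x z) (fun _ _ _ _ _ => trivial)
    (fun a b c T _ hT => hT.trans (Table.le_raise T _ _ _ x z)) x y z
    (fun T _ => Table.le_raise_self T _ _ _) _ trivial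

variable {x y z a : Fin n} {m m' m'' : ℝ}

theorem short_pair (h1 : M x y = m) (h2 : M y z = m') (h : 0 ≤ m * m') (hB : -B ≤ m + m') :
    ((m + m' : ℝ) : EReal) ≤ shortShortcuts B M x z := by
  refine le_trans ?_ (joinShortcut_le_shortShortcuts x y z)
  unfold joinShortcut
  rw [h1, h2, EReal.min_coe_zero, EReal.min_coe_zero, ← EReal.coe_add, ← EReal.coe_add]
  split_ifs with k1 k2
  · exact le_rfl
  · rw [EReal.coe_le_coe_iff]
    rcases le_or_gt 0 m with hm | hm
    · rcases le_or_gt 0 m' with hm' | hm'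
      · exact absurd ⟨by exact_mod_cast hm, by exact_mod_cast hm'⟩ k1
      · have : m = 0 := by nlinarith
        rw [min_eq_right hm, min_eq_left hm'.le]; linarith
    · have hm' : m' ≤ 0 := by nlinarith
      rw [min_eq_left hm.le, min_eq_left hm']
  · exfalso
    rcases le_or_gt 0 m with hm | hm
    · rcases le_or_gt 0 m' with hm' | hm'
      · exact absurd ⟨by exact_mod_cast hm, by exact_mod_cast hm'⟩ k1
      · have : m = 0 := by nlinarith
        rw [min_eq_right hm, min_eq_left hm'.le] at k2
        exact k2 (by exact_mod_cast (by linarith))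
    · have hm' : m' ≤ 0 := by nlinarith
      rw [min_eq_left hm.le, min_eq_left hm'] at k2
      exact k2 (by exact_mod_cast hB)

theorem short_pair_min (h1 : M x y = m) (h2 : M y z = m') (hn : m < 0 ∨ m' < 0)
    (hB : -B ≤ min m 0 + min m' 0) :
    ((min m 0 + min m' 0 : ℝ) : EReal) ≤ shortShortcuts B M x z := by
  refine le_trans ?_ (joinShortcut_le_shortShortcuts x y z)
  unfold joinShortcut
  rw [h1, h2, EReal.min_coe_zero, EReal.min_coe_zero, ← EReal.coe_add, ← EReal.coe_add]
  split_ifs with k1 k2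
  · exfalso
    have e1 : 0 ≤ m := by exact_mod_cast k1.1
    have e2 : 0 ≤ m' := by exact_mod_cast k1.2
    rcases hn with hn | hn <;> linarith
  · exact le_rfl
  · exact absurd (by exact_mod_cast hB) k2

theorem short_hard_nonneg (h1 : M x y = m) (h2 : M y a = m') (h3 : M a z = m'') (hm : 0 ≤ m)
    (hm1 : -m ≤ m') (hm2 : m' ≤ 0) (hk : 0 ≤ m' + m'') :
    ((m + (m' + m'') : ℝ) : EReal) ≤ shortShortcuts B M x z := by
  classical
  refine le_shortShortcuts_of_step (y := y) fun D => ?_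
  unfold hardShortcutStep
  have hle : ((m' + m'' : ℝ) : EReal) ≤
      maxOver (fun a => -(m : EReal) ≤ M y a ∧ M y a ≤ 0) (fun a => M y a + M a z) := by
    have := le_maxOver (cond := fun a => -(m : EReal) ≤ M y a ∧ M y a ≤ 0)
      (value := fun a => M y a + M a z) (a := a)
      ⟨by rw [h2]; exact_mod_cast hm1, by rw [h2]; exact_mod_cast hm2⟩
    rwa [h2, h3, ← EReal.coe_add] at this
  have hm0 : (0 : EReal) ≤ M x y := by rw [h1]; exact_mod_cast hm
  have k1 : ((m + (m' + m'') : ℝ) : EReal) ≤ (if 0 ≤ M x y then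
      let k₂ := maxOver (fun a => -M x y ≤ M y a ∧ M y a ≤ 0) (fun a => M y a + M a z)
      if M x y ≤ M x y + k₂ then D.raise x z (M x y + k₂) else D
    else D) x z := by
    rw [if_pos hm0, h1, if_pos]
    · refine le_trans ?_ (Table.le_raise_self _ _ _ _)
      rw [EReal.coe_add]
      gcongr
    · calc (m : EReal) ≤ ((m + (m' + m'') : ℝ) : EReal) := by exact_mod_cast (by linarith)
        _ ≤ _ := by rw [EReal.coe_add]; gcongr
  dsimp only at k1 ⊢
  generalize (if 0 ≤ M x y then _ else D : Table n) = D₁ at k1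
  by_cases h : M x y ≤ 0
  · rw [if_pos h]
    exact k1.trans (((Table.le_ite_raise (Table.le_ite_raise le_rfl)).trans
      (Table.le_raise _ _ _ _)) x z)
  · rw [if_neg h]; exact k1

/-- The maximum in the query may be attained at another vertex than `a` and may exceed 0. Then `m`
is written, otherwise a value of at least `m + (m' + m'')`; the minimum covers both cases. -/
theorem short_hard_nonpos (h1 : M x y = m) (h2 : M y a = m') (h3 : M a z = m'') (hm : m ≤ 0)
    (hm1 : 0 ≤ m') (hm2 : m' ≤ -m) (hB : -B ≤ m + (m' + m'')) :
    ((min m (m + (m' + m'')) : ℝ) : EReal) ≤ shortShortcuts B M x z := by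
  classical
  refine le_shortShortcuts_of_step (y := y) fun D => ?_
  unfold hardShortcutStep
  have hle : ((m' + m'' : ℝ) : EReal) ≤
      maxOver (fun a => 0 ≤ M y a ∧ M y a ≤ ((|m| : ℝ) : EReal)) (fun a => M y a + M a z) := by
    have := le_maxOver (cond := fun a => 0 ≤ M y a ∧ M y a ≤ ((|m| : ℝ) : EReal))
      (value := fun a => M y a + M a z) (a := a)
      ⟨by rw [h2]; exact_mod_cast hm1, by rw [h2, abs_of_nonpos hm]; exact_mod_cast hm2⟩
    rwa [h2, h3, ← EReal.coe_add] at this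
  dsimp only
  generalize (if 0 ≤ M x y then _ else D : Table n) = D₁
  have hm0 : M x y ≤ 0 := by rw [h1]; exact_mod_cast hm
  rw [if_pos hm0, h1, eabs_coe]
  generalize maxOver (fun a => 0 ≤ M y a ∧ M y a ≤ ((|m| : ℝ) : EReal))
    (fun a => M y a + M a z) = k at hle
  refine le_trans ?_ (Table.le_raise _ _ _ _ x z)
  have hle' : ((m + (m' + m'') : ℝ) : EReal) ≤ m + k := by rw [EReal.coe_add]; gcongr
  by_cases hk : (m : EReal) ≤ m + k
  · rw [if_pos hk]
    exact le_trans (by exact_mod_cast min_le_left _ _) (Table.le_raise_self _ _ _ _)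
  · rw [if_neg hk, if_pos]
    · exact le_trans (le_trans (by exact_mod_cast min_le_right _ _) hle')
        (Table.le_raise_self _ _ _ _)
    · exact ⟨(not_le.1 hk).le, le_trans (by exact_mod_cast hB) hle'⟩

theorem short_hard_min (h1 : M x y = m) (h2 : M y a = m') (h3 : M a z = m'') (hm : m ≤ 0)
    (hm2 : -m ≤ m') : ((min m m'' : ℝ) : EReal) ≤ shortShortcuts B M x z := by
  classical
  refine le_shortShortcuts_of_step (y := y) fun D => ?_
  unfold hardShortcutStep
  have hm0 : M x y ≤ 0 := by rw [h1]; exact_mod_cast hm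
  dsimp only
  rw [if_pos hm0]
  refine le_trans ?_ (Table.le_raise_self _ _ _ _)
  rw [← EReal.min_coe_coe, h1, eabs_coe, abs_of_nonpos hm]
  refine min_le_min le_rfl ?_
  have := le_maxOver (cond := fun a => ((-m : ℝ) : EReal) ≤ M y a) (value := fun a => M a z)
    (a := a) (by rw [h2]; exact_mod_cast hm2)
  rwa [h3] at this

end ShortComplete

/-! ### Routes -/

/-- A path from `x` to `y` along `ℓ` shortcuts of the table `M`, with distinct vertices `v i`, and
heights `h i` whose increments are at most the gains. No part of the path loses more than `d`, and
the whole path gains `w`; with `up`, it starts at its lowest and stops at its highest point. -/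
structure Route {n : ℕ} (M : Table n) (up : Prop) (d w : ℝ) (x y : Fin n) (ℓ : ℕ)
    (v : ℕ → Fin n) (h : ℕ → ℝ) : Prop where
  start : v 0 = x
  finish : v ℓ = y
  inj : ∀ i ≤ ℓ, ∀ j ≤ ℓ, v i = v j → i = j
  gain : ∀ i < ℓ, ((h (i + 1) - h i : ℝ) : EReal) ≤ M (v i) (v (i + 1))
  drop : ∀ i j, i ≤ j → j ≤ ℓ → h i - h j ≤ d
  total : w ≤ h ℓ - h 0
  climb : up → ∀ i ≤ ℓ, h 0 ≤ h i ∧ h i ≤ h ℓ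

/-- There is a route of length at most `L`. -/
def HasRoute {n : ℕ} (M : Table n) (up : Prop) (d w : ℝ) (x y : Fin n) (L : ℕ) : Prop :=
  ∃ ℓ ≤ L, ∃ v h, Route M up d w x y ℓ v h

section Routes

variable {n : ℕ} {M M' : Table n} {up : Prop} {d w : ℝ} {x y : Fin n} {ℓ : ℕ} {v : ℕ → Fin n}
  {h : ℕ → ℝ}

theorem Route.length_lt (R : Route M up d w x y ℓ v h) : ℓ < n := by
  have : Function.Injective (fun i : Fin (ℓ + 1) => v i) := fun i j hij =>
    Fin.ext (R.inj i (by omega) j (by omega) hij)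
  simpa using Fintype.card_le_of_injective _ this

theorem Route.mono (R : Route M up d w x y ℓ v h) (hM : M ≤ M') : Route M' up d w x y ℓ v h :=
  { R with gain := fun i hi => (R.gain i hi).trans (hM _ _) }

theorem HasRoute.mono {L L' : ℕ} (R : HasRoute M up d w x y L) (hM : M ≤ M') (hL : L ≤ L') :
    HasRoute M' up d w x y L' := by
  obtain ⟨ℓ, hℓ, v, h, R⟩ := R
  exact ⟨ℓ, hℓ.trans hL, v, h, R.mono hM⟩

/-- The heights can be chosen such that the increments are the gains. -/
theorem Route.exact (R : Route M up d w x y ℓ v h) (hM : ∀ a b, M a b ≠ ⊤) :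
    ∃ h', Route M up d w x y ℓ v h' ∧
      ∀ i < ℓ, M (v i) (v (i + 1)) = ((h' (i + 1) - h' i : ℝ) : EReal) := by
  let g : ℕ → ℝ := fun i => (M (v i) (v (i + 1))).toReal
  let h' : ℕ → ℝ := fun i => ∑ k ∈ Finset.range i, g k
  have hg : ∀ i < ℓ, M (v i) (v (i + 1)) = (g i : EReal) := fun i hi => by
    refine (EReal.coe_toReal (hM _ _) ?_).symm
    intro hb
    have := R.gain i hi
    rw [hb, le_bot_iff] at this
    exact EReal.coe_ne_bot _ this
  have hs : ∀ i, h' (i + 1) - h' i = g i := fun i => by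
    simp [h', Finset.sum_range_succ]
  have hle : ∀ i < ℓ, h (i + 1) - h i ≤ g i := fun i hi => by
    have := R.gain i hi
    rw [hg i hi] at this
    exact_mod_cast this
  have key : ∀ i j, i ≤ j → j ≤ ℓ → h j - h i ≤ h' j - h' i := by
    intro i j hij
    induction j, hij using Nat.le_induction with
    | base => intro _; simp
    | succ j hij ih =>
      intro hj
      have := ih (by omega)
      have := hle j (by omega)
      have := hs j
      linarith
  refine ⟨h', ⟨R.start, R.finish, R.inj, fun i hi => ?_, fun i j hij hj => ?_, ?_, fun hu i hi => ?_⟩,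
    fun i hi => ?_⟩
  · rw [hs, hg i hi]
  · linarith [key i j hij hj, R.drop i j hij hj]
  · linarith [key 0 ℓ (Nat.zero_le _) le_rfl, R.total]
  · have := R.climb hu i hi
    constructor <;> linarith [key 0 i (Nat.zero_le _) hi, key i ℓ hi le_rfl]
  · rw [hs, hg i hi]

/-- A shortcut from `v a` to `v b` replaces the part of the route between them. -/
theorem Route.skip (R : Route M up d w x y ℓ v h) {a b : ℕ} (hab : a < b) (hb : b ≤ ℓ)
    (hs : ((h b - h a : ℝ) : EReal) ≤ M (v a) (v b)) :
    Route M up d w x y (ℓ - (b - a - 1)) (fun i => v (if i ≤ a then i else i + (b - a - 1)))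
      (fun i => h (if i ≤ a then i else i + (b - a - 1))) := by
  refine ⟨by simp [R.start], ?_, ?_, ?_, ?_, ?_, ?_⟩
  · rw [if_neg (by omega), ← R.finish]; congr 1; omega
  · intro i hi j hj hij
    have := R.inj (if i ≤ a then i else i + (b - a - 1)) (by split_ifs <;> omega)
      (if j ≤ a then j else j + (b - a - 1)) (by split_ifs <;> omega) hij
    split_ifs at this <;> omega
  · intro i hi
    rcases lt_trichotomy i a with h1 | h1 | h1
    · rw [if_pos (by omega), if_pos (by omega)]; exact R.gain i (by omega)
    · rw [if_neg (by omega), if_pos (by omega), h1, show a + 1 + (b - a - 1) = b by omega]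
      exact hs
    · rw [if_neg (by omega), if_neg (by omega),
        show i + 1 + (b - a - 1) = i + (b - a - 1) + 1 by omega]
      exact R.gain _ (by omega)
  · intro i j hij hj
    exact R.drop _ _ (by split_ifs <;> omega) (by split_ifs <;> omega)
  · rw [if_neg (by omega), if_pos (Nat.zero_le _),
      show ℓ - (b - a - 1) + (b - a - 1) = ℓ by omega]
    exact R.total
  · intro hu i hi
    rw [if_neg (show ¬ ℓ - (b - a - 1) ≤ a by omega), if_pos (Nat.zero_le _),
      show ℓ - (b - a - 1) + (b - a - 1) = ℓ by omega]
    exact R.climb hu _ (by split_ifs <;> omega)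

/-- Disjoint parts of a route are replaced by shortcuts. -/
theorem Route.skip_all {ι : Type*} (J : Finset ι) (a b : ι → ℕ)
    (hdis : ∀ i ∈ J, ∀ j ∈ J, i ≠ j → b i ≤ a j ∨ b j ≤ a i)
    (hab : ∀ j ∈ J, a j < b j) :
    ∀ {ℓ : ℕ} {v : ℕ → Fin n} {h : ℕ → ℝ}, Route M up d w x y ℓ v h → (∀ j ∈ J, b j ≤ ℓ) →
      (∀ j ∈ J, ((h (b j) - h (a j) : ℝ) : EReal) ≤ M (v (a j)) (v (b j))) →
      HasRoute M up d w x y (ℓ - ∑ j ∈ J, (b j - a j - 1)) := by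
  classical
  -- The rightmost interval is cut first, so that the indices of the other intervals do not change.
  induction J using Finset.induction_on_max_value a with
  | empty => intro ℓ v h R _ _; exact ⟨ℓ, by simp, v, h, R⟩
  | insert j J hj hmax ih =>
    intro ℓ v h R hbl hs
    have hJ : ∀ i ∈ J, b i ≤ a j := by
      intro i hi
      have hij : i ≠ j := fun e => hj (e ▸ hi)
      rcases hdis i (by simp [hi]) j (by simp) hij with h1 | h1
      · exact h1
      · have := hmax i hi
        have := hab j (by simp)
        omega
    have hj1 := hab j (by simp)
    have hj2 := hbl j (by simp)
    have R' := R.skip hj1 hj2 (hs j (by simp))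
    have := ih (fun i hi k hk => hdis i (by simp [hi]) k (by simp [hk]))
      (fun i hi => hab i (by simp [hi])) R' (fun i hi => by have := hJ i hi; omega)
      (fun i hi => by
        have h1 := hJ i hi
        have h2 := hab i (by simp [hi])
        simp only [if_pos h1, if_pos (show a i ≤ a j by omega)]
        exact hs i (by simp [hi]))
    rw [Finset.sum_insert hj]
    rwa [Nat.sub_sub] at this

/-- The heights of a route that need not climb may be changed at the ends. -/
theorem Route.modify (R : Route M up d w x y ℓ v h) (hup : ¬ up) (hw : w ≤ -d) {k : ℕ → ℝ}
    (hgain : ∀ i < ℓ, k (i + 1) - k i ≤ h (i + 1) - h i)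
    (hdrop : ∀ i j, i ≤ j → j ≤ ℓ → k i - k j ≤ d) : Route M up d w x y ℓ v k :=
  { R with
    gain := fun i hi => le_trans (by exact_mod_cast hgain i hi) (R.gain i hi)
    drop := hdrop
    total := by linarith [hdrop 0 ℓ (Nat.zero_le _) le_rfl]
    climb := fun hu => absurd hu hup }

end Routes

/-! ### Shortening of routes by one round of short shortcuts -/

section Reduce

variable {n : ℕ} {M M' : Table n} {up : Prop} {B d w : ℝ} {x y : Fin n} {ℓ : ℕ} {v : ℕ → Fin n}
  {h : ℕ → ℝ}

/-- The gain of the `i`-th arc of a path with heights `h`. -/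
def arcGain (h : ℕ → ℝ) (i : ℕ) : ℝ := h (i + 1) - h i

/-- The gains of the arcs of the route are the entries of the table. -/
def ExactGains (M : Table n) (ℓ : ℕ) (v : ℕ → Fin n) (h : ℕ → ℝ) : Prop :=
  ∀ i < ℓ, M (v i) (v (i + 1)) = ((arcGain h i : ℝ) : EReal)

/-- The arcs `t`, `t + 1`, `t + 2` are not alternating, or the middle arc is the smallest one. -/
def Reducible (h : ℕ → ℝ) (t : ℕ) : Prop :=
  0 ≤ arcGain h t * arcGain h (t + 1) ∨ 0 ≤ arcGain h (t + 1) * arcGain h (t + 2) ∨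
    (|arcGain h (t + 1)| ≤ |arcGain h t| ∧ |arcGain h (t + 1)| ≤ |arcGain h (t + 2)|)

theorem Route.pair_shortcut (R : Route M up d w x y ℓ v h) (E : ExactGains M ℓ v h) (hd : d ≤ B)
    {t : ℕ} (ht : t + 2 ≤ ℓ) (h0 : 0 ≤ arcGain h t * arcGain h (t + 1)) :
    ((h (t + 2) - h t : ℝ) : EReal) ≤ shortShortcuts B M (v t) (v (t + 2)) := by
  have := R.drop t (t + 2) (by omega) ht
  have e : arcGain h t + arcGain h (t + 1) = h (t + 2) - h t := by
    unfold arcGain; ring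
  rw [← e]
  exact short_pair (E t (by omega)) (E (t + 1) (by omega)) h0 (by rw [e]; linarith)

/-- Neighbouring arcs of the same sign add up, and an alternating triple with a smallest middle arc
is a hard shortcut with the exact total gain. Thus the heights of the remaining vertices need no
change. -/
theorem Route.exists_shortcut (R : Route M up d w x y ℓ v h) (E : ExactGains M ℓ v h)
    (hd : d ≤ B) {t : ℕ} (ht : t + 3 ≤ ℓ) (hr : Reducible h t) :
    ∃ a b, t ≤ a ∧ a + 2 ≤ b ∧ b ≤ t + 3 ∧
      ((h b - h a : ℝ) : EReal) ≤ shortShortcuts B M (v a) (v b) := by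
  by_cases h1 : 0 ≤ arcGain h t * arcGain h (t + 1)
  · exact ⟨t, t + 2, le_rfl, le_rfl, by omega, R.pair_shortcut E hd (by omega) h1⟩
  by_cases h2 : 0 ≤ arcGain h (t + 1) * arcGain h (t + 2)
  · exact ⟨t + 1, t + 3, by omega, le_rfl, le_rfl, R.pair_shortcut E hd (by omega) h2⟩
  obtain ⟨h3, h4⟩ : _ ∧ _ := (hr.resolve_left h1).resolve_left h2
  refine ⟨t, t + 3, le_rfl, by omega, le_rfl, ?_⟩
  have e : arcGain h t + (arcGain h (t + 1) + arcGain h (t + 2)) = h (t + 3) - h t := by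
    unfold arcGain; ring
  have hdr := R.drop t (t + 3) (by omega) ht
  have E1 := E t (by omega)
  have E2 := E (t + 1) (by omega)
  have E3 := E (t + 2) (by omega)
  rw [← e]
  rw [not_le] at h1 h2
  rcases lt_or_ge (arcGain h t) 0 with hm | hm
  · have hm1 : 0 < arcGain h (t + 1) := by nlinarith
    have hm2 : arcGain h (t + 2) < 0 := by nlinarith
    rw [abs_of_neg hm, abs_of_pos hm1] at h3
    rw [abs_of_neg hm2, abs_of_pos hm1] at h4
    have := short_hard_nonpos (B := B) E1 E2 E3 hm.le hm1.le h3 (by rw [e]; linarith)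
    rwa [min_eq_right (by linarith)] at this
  · have hm1 : arcGain h (t + 1) < 0 := by nlinarith
    have hm2 : 0 < arcGain h (t + 2) := by nlinarith
    rw [abs_of_nonneg hm, abs_of_neg hm1] at h3
    rw [abs_of_pos hm2, abs_of_neg hm1] at h4
    exact short_hard_nonneg (B := B) E1 E2 E3 hm (by linarith) hm1.le (by linarith)

/-- Windows of three arcs with starts at distance at least 3 are disjoint, so their shortcuts can be
used simultaneously, and each of them saves at least one arc. -/
theorem Route.short_of_separated (R : Route M up d w x y ℓ v h) (E : ExactGains M ℓ v h)
    (hd : d ≤ B) (T : Finset ℕ) (hT : ∀ t ∈ T, t + 3 ≤ ℓ ∧ Reducible h t)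
    (hsep : ∀ s ∈ T, ∀ t ∈ T, s < t → s + 3 ≤ t) :
    HasRoute (shortShortcuts B M) up d w x y (ℓ - T.card) := by
  classical
  have key : ∀ t, ∃ ab : ℕ × ℕ, t ∈ T → t ≤ ab.1 ∧ ab.1 + 2 ≤ ab.2 ∧ ab.2 ≤ t + 3 ∧
      ((h ab.2 - h ab.1 : ℝ) : EReal) ≤ shortShortcuts B M (v ab.1) (v ab.2) := by
    intro t
    by_cases ht : t ∈ T
    · obtain ⟨a, b, hab⟩ := R.exists_shortcut E hd (hT t ht).1 (hT t ht).2
      exact ⟨(a, b), fun _ => hab⟩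
    · exact ⟨(0, 0), fun h => absurd h ht⟩
  choose ab hab using key
  have R' : Route (shortShortcuts B M) up d w x y ℓ v h := R.mono le_shortShortcuts
  refine (R'.skip_all T (fun t => (ab t).1) (fun t => (ab t).2) ?_ ?_ ?_ ?_).mono le_rfl ?_
  · intro i hi j hj hij
    have h1 := hab i hi
    have h2 := hab j hj
    rcases lt_or_gt_of_ne hij with h3 | h3
    · have := hsep i hi j hj h3; left; omega
    · have := hsep j hj i hi h3; right; omega
  · intro j hj
    have := hab j hj
    omega
  · intro j hj
    have := hab j hj
    have := (hT j hj).1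
    omega
  · exact fun j hj => (hab j hj).2.2.2
  · have : T.card ≤ ∑ j ∈ T, ((ab j).2 - (ab j).1 - 1) := by
      rw [Finset.card_eq_sum_ones]
      refine Finset.sum_le_sum fun j hj => ?_
      have := hab j hj
      omega
    omega

/-- The largest residue class modulo 3. -/
theorem exists_separated_subset (T : Finset ℕ) :
    ∃ T' ⊆ T, (∀ s ∈ T', ∀ t ∈ T', s < t → s + 3 ≤ t) ∧ T.card ≤ 3 * T'.card := by
  classical
  have hcard : T.card = ∑ c ∈ Finset.range 3, (T.filter (· % 3 = c)).card :=
    Finset.card_eq_sum_card_fiberwise fun t _ => by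
      simp only [Finset.coe_range, Set.mem_Iio]; exact Nat.mod_lt _ (by norm_num)
  have : ∃ c ∈ Finset.range 3, T.card ≤ 3 * (T.filter (· % 3 = c)).card := by
    by_contra! hc
    have h0 := hc 0 (by simp)
    have h1 := hc 1 (by simp)
    have h2 := hc 2 (by simp)
    simp only [Finset.sum_range_succ, Finset.sum_range_zero] at hcard
    omega
  obtain ⟨c, _, hc⟩ := this
  refine ⟨_, Finset.filter_subset _ _, fun s hs t ht hst => ?_, hc⟩
  rw [Finset.mem_filter] at hs ht
  omega

/-- One round of short shortcuts shortens a route by a third of the reducible triples. -/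
theorem Route.short_many (R : Route M up d w x y ℓ v h) (E : ExactGains M ℓ v h)
    (hd : d ≤ B) (T : Finset ℕ) (hT : ∀ t ∈ T, t + 3 ≤ ℓ ∧ Reducible h t) (k : ℕ)
    (hk : 3 * k ≤ T.card) : HasRoute (shortShortcuts B M) up d w x y (ℓ - k) := by
  obtain ⟨T', hT', hsep, hcard⟩ := exists_separated_subset T
  exact (R.short_of_separated E hd T' (fun t ht => hT t (hT' ht)) hsep).mono le_rfl (by omega)

/-- For shortcuts at the ends of the path that do not have the exact gain. If a route need not
climb, its total gain is only bounded by its drop, so the heights at the ends may be adapted to such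
a shortcut. -/
theorem Route.short_jump (R : Route M up d w x y ℓ v h) (hup : ¬ up) (hw : w ≤ -d) {k : ℕ → ℝ}
    (hgain : ∀ i < ℓ, k (i + 1) - k i ≤ h (i + 1) - h i)
    (hdrop : ∀ i j, i ≤ j → j ≤ ℓ → k i - k j ≤ d) {a b : ℕ} (hab : a + 2 ≤ b) (hb : b ≤ ℓ)
    (hs : ((k b - k a : ℝ) : EReal) ≤ shortShortcuts B M (v a) (v b)) :
    HasRoute (shortShortcuts B M) up d w x y (ℓ - 1) :=
  ⟨_, by omega, _, _, (((R.modify hup hw hgain hdrop).mono le_shortShortcuts).skip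
    (by omega) hb hs)⟩

/-- No middle arc of a triple is smallest. So as soon as the gains do not increase in absolute
value, they decrease strictly from then on. -/
theorem unimodal_tail {h : ℕ → ℝ} {p q : ℕ}
    (hr : ∀ t, p ≤ t → t + 3 ≤ q → ¬ Reducible h t)
    (hp : |arcGain h (p + 1)| ≤ |arcGain h p|) :
    ∀ i, p + 1 ≤ i → i + 1 < q → |arcGain h (i + 1)| < |arcGain h i| := by
  intro i hi
  induction i, hi using Nat.le_induction with
  | base =>
    intro hq
    by_contra hc
    exact hr p le_rfl (by omega) (Or.inr (Or.inr ⟨hp, not_lt.1 hc⟩))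
  | succ i hi ih =>
    intro hq
    by_contra hc
    exact hr i (by omega) (by omega) (Or.inr (Or.inr ⟨(ih (by omega)).le, not_lt.1 hc⟩))

/-- One round of short shortcuts shortens every route of length at least `2`. -/
theorem Route.short_one (R : Route M up d w x y ℓ v h) (E : ExactGains M ℓ v h)
    (hd : d ≤ B) (hw : ¬ up → w ≤ -d) (hℓ : 2 ≤ ℓ) :
    HasRoute (shortShortcuts B M) up d w x y (ℓ - 1) := by
  by_cases hr : ∃ t, t + 3 ≤ ℓ ∧ Reducible h t
  · obtain ⟨t, ht, hr⟩ := hr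
    exact R.short_of_separated E hd {t} (by simp [ht, hr]) (by simp) |>.mono le_rfl (by simp)
  push Not at hr
  obtain ⟨k, rfl⟩ : ∃ k, ℓ = k + 2 := ⟨ℓ - 2, by omega⟩
  have hD := R.drop
  have halt : ∀ t, t + 2 ≤ k + 2 → ¬ 0 ≤ arcGain h t * arcGain h (t + 1) ∨
      HasRoute (shortShortcuts B M) up d w x y (k + 2 - 1) := by
    intro t ht
    by_cases h0 : 0 ≤ arcGain h t * arcGain h (t + 1)
    · right
      exact ⟨_, by omega, _, _, (R.mono le_shortShortcuts).skip (by omega) ht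
        (R.pair_shortcut E hd ht h0)⟩
    · exact Or.inl h0
  by_cases hdone : HasRoute (shortShortcuts B M) up d w x y (k + 2 - 1)
  · exact hdone
  replace halt : ∀ t, t + 2 ≤ k + 2 → arcGain h t * arcGain h (t + 1) < 0 :=
    fun t ht => not_le.1 ((halt t ht).resolve_right hdone)
  have a0 := halt 0 (by omega)
  have ak := halt k (by omega)
  have g0 : arcGain h 0 = h 1 - h 0 := rfl
  have g1 : arcGain h 1 = h 2 - h 1 := rfl
  have gk : arcGain h k = h (k + 1) - h k := rfl
  have gk1 : arcGain h (k + 1) = h (k + 2) - h (k + 1) := rfl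
  -- A climbing route without reducible triples cannot exist. It starts at its lowest point, so the
  -- second gain is not larger than the first in absolute value and the gains decrease up to the
  -- end; but it stops at its highest point, so the last gain is not smaller than the one before it.
  by_cases hup : up
  · exfalso
    have c1 := (R.climb hup 1 (by omega)).1
    have c2 := (R.climb hup 2 (by omega)).1
    have c3 := (R.climb hup (k + 1) (by omega)).2
    have c4 := (R.climb hup k (by omega)).2
    have p0 : 0 < arcGain h 0 := by
      rcases (show (0 : ℝ) ≤ arcGain h 0 by linarith).lt_or_eq with h1 | h1
      · exact h1
      · rw [← h1] at a0; simp at a0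
    have p1 : arcGain h (0 + 1) < 0 := by nlinarith
    have q0 : 0 < arcGain h (k + 1) := by
      rcases (show (0 : ℝ) ≤ arcGain h (k + 1) by linarith).lt_or_eq with h1 | h1
      · exact h1
      · rw [← h1] at ak; simp at ak
    have q1 : arcGain h k < 0 := by nlinarith
    rcases Nat.eq_zero_or_pos k with rfl | hk
    · linarith
    have := unimodal_tail (p := 0) (q := k + 2) (fun t _ ht => hr t ht)
      (by rw [abs_of_neg p1, abs_of_pos p0]; rw [zero_add]; linarith) k (by omega) (by omega)
    rw [abs_of_pos q0, abs_of_neg q1] at this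
    linarith
  have hw' := hw hup
  -- An initial ascent can be given away: the start is lifted to the height of the next vertex, and
  -- the shortcut over two arcs keeps the gain of the descent. A final ascent is treated in the same
  -- way below.
  rcases lt_or_ge 0 (arcGain h 0) with p0 | p0
  · have p1 : arcGain h (0 + 1) < 0 := by nlinarith
    refine R.short_jump hup hw' (k := fun i => if i = 0 then h 1 else h i) (a := 0) (b := 2)
      ?_ ?_ le_rfl (by omega) ?_
    · intro i hi
      rcases Nat.eq_zero_or_pos i with rfl | hi
      · simp; linarith
      · rw [if_neg (by omega), if_neg (by omega)]
    · intro i j hij hj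
      rcases Nat.eq_zero_or_pos j with rfl | hj0
      · obtain rfl : i = 0 := by omega
        simp; linarith [hD 0 0 le_rfl (by omega)]
      rw [if_neg (show j ≠ 0 by omega)]
      split_ifs
      · exact hD 1 j (by omega) hj
      · exact hD i j hij hj
    · have := short_pair_min (B := B) (E 0 (by omega)) (E 1 (by omega)) (Or.inr p1) (by
        rw [min_eq_right p0.le, min_eq_left p1.le]; linarith [hD 1 2 (by omega) (by omega)])
      rw [min_eq_right p0.le, min_eq_left p1.le, zero_add] at this
      simpa [g1] using this
  have p0 : arcGain h 0 < 0 := by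
    rcases p0.lt_or_eq with h1 | h1
    · exact h1
    · rw [h1] at a0; simp at a0
  have p1 : 0 < arcGain h (0 + 1) := by nlinarith
  rcases lt_or_ge 0 (arcGain h (k + 1)) with q0 | q0
  · have q1 : arcGain h k < 0 := by nlinarith
    refine R.short_jump hup hw' (k := fun i => if i = k + 2 then h (k + 1) else h i) (a := k)
      (b := k + 2) ?_ ?_ le_rfl le_rfl ?_
    · intro i hi
      rw [if_neg (show i ≠ k + 2 by omega)]
      split_ifs with h1
      · obtain rfl : i = k + 1 := by omega
        linarith
      · exact le_rfl
    · intro i j hij hj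
      split_ifs with h1 h2 h2
      · linarith [hD 0 0 le_rfl (by omega)]
      · omega
      · exact hD i (k + 1) (by omega) (by omega)
      · exact hD i j hij hj
    · have := short_pair_min (B := B) (E k (by omega)) (E (k + 1) (by omega)) (Or.inl q1) (by
        rw [min_eq_right q0.le, min_eq_left q1.le]; linarith [hD k (k + 1) (by omega) (by omega)])
      rw [min_eq_right q0.le, min_eq_left q1.le, add_zero] at this
      simpa [gk] using this
  have q0 : arcGain h (k + 1) < 0 := by
    rcases q0.lt_or_eq with h1 | h1
    · exact h1
    · rw [h1] at ak; simp at ak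
  have q1 : 0 < arcGain h k := by nlinarith
  rcases Nat.eq_zero_or_pos k with rfl | hk
  · linarith
  obtain ⟨l, rfl⟩ : ∃ l, k = l + 1 := ⟨k - 1, by omega⟩
  have gl : arcGain h l = h (l + 1) - h l := rfl
  have al := halt l (by omega)
  have q2 : arcGain h l < 0 := by nlinarith
  -- If the last three gains fall in absolute value, the path ends inside the band of the descent
  -- `l`. The shortcut over these arcs has the gain of that descent, and the end is lowered to its
  -- foot.
  have tail : |arcGain h (l + 1)| ≤ |arcGain h l| → |arcGain h (l + 2)| ≤ |arcGain h (l + 1)| →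
      HasRoute (shortShortcuts B M) up d w x y (l + 1 + 2 - 1) := by
    intro t1 t2
    rw [abs_of_pos q1, abs_of_neg q2] at t1
    rw [abs_of_pos q1, abs_of_neg q0] at t2
    have dl := hD l (l + 1) (by omega) (by omega)
    refine R.short_jump hup hw' (k := fun i => if i = l + 3 then h (l + 1) else h i) (a := l)
      (b := l + 3) ?_ ?_ (by omega) le_rfl ?_
    · intro i hi
      rw [if_neg (show i ≠ l + 3 by omega)]
      split_ifs with h1
      · obtain rfl : i = l + 2 := by omega
        linarith
      · exact le_rfl
    · intro i j hij hj
      split_ifs with h1 h2 h2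
      · linarith [hD 0 0 le_rfl (by omega)]
      · omega
      · rcases Nat.lt_or_ge i (l + 2) with h3 | h3
        · exact hD i (l + 1) (by omega) (by omega)
        · obtain rfl : i = l + 2 := by omega
          linarith
      · exact hD i j hij hj
    · have := short_hard_nonpos (B := B) (E l (by omega)) (E (l + 1) (by omega))
        (E (l + 2) (by omega)) q2.le q1.le t1 (by
          have := hD l (l + 3) (by omega) (by omega)
          unfold arcGain; linarith)
      rw [min_eq_left (by linarith)] at this
      simpa [gl] using this
  rcases le_or_gt |arcGain h (0 + 1)| |arcGain h 0| with t0 | t0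
  · have um := unimodal_tail (p := 0) (q := l + 1 + 2) (fun t _ ht => hr t ht) t0
    refine tail ?_ (um (l + 1) (by omega) (by omega)).le
    rcases Nat.eq_zero_or_pos l with rfl | hl
    · exact t0
    · exact (um l (by omega) (by omega)).le
  have a1 := halt 1 (by omega)
  rw [zero_add] at p1 t0
  have p2 : arcGain h 2 < 0 := by nlinarith
  have g2 : arcGain h 2 = h 3 - h 2 := rfl
  -- Here the second arc regains more than the first one loses, so the first three arcs give a
  -- shortcut with the smaller of the two descending gains.
  have hmin := short_hard_min (B := B) (E 0 (by omega)) (E 1 (by omega)) (E 2 (by omega)) p0.le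
    (by rw [abs_of_neg p0, abs_of_pos p1] at t0; exact t0.le)
  rcases le_or_gt |arcGain h 1| |arcGain h 2| with t1 | t1
  · rw [abs_of_neg p0, abs_of_pos p1] at t0
    rw [abs_of_neg p2, abs_of_pos p1] at t1
    have dl := hD 2 3 (by omega) (by omega)
    refine R.short_jump hup hw' (k := fun i => if i = 0 then h 2 else h i) (a := 0) (b := 3)
      ?_ ?_ (by omega) (by omega) ?_
    · intro i hi
      rcases Nat.eq_zero_or_pos i with rfl | hi
      · simp; linarith
      · rw [if_neg (by omega), if_neg (by omega)]
    · intro i j hij hj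
      rcases Nat.eq_zero_or_pos j with rfl | hj0
      · obtain rfl : i = 0 := by omega
        simp; linarith [hD 0 0 le_rfl (by omega)]
      rw [if_neg (show j ≠ 0 by omega)]
      split_ifs
      · rcases Nat.lt_or_ge 1 j with h3 | h3
        · exact hD 2 j (by omega) hj
        · obtain rfl : j = 1 := by omega
          linarith
      · exact hD i j hij hj
    · rw [min_eq_right (by linarith)] at hmin
      simpa [g2] using hmin
  · rcases Nat.eq_zero_or_pos l with rfl | hl
    -- The whole path has three arcs, and the middle one is the largest. Heights that alternate
    -- between `h 0` and `h 0 + μ` respect all gains and drop by `-μ ≤ d`.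
    · set μ := min (arcGain h 0) (arcGain h 2) with hμ
      have μ0 : μ ≤ arcGain h 0 := min_le_left _ _
      have μ2 : μ ≤ arcGain h 2 := min_le_right _ _
      have μ1 : -μ ≤ arcGain h 1 := by
        rw [abs_of_neg p0, abs_of_pos p1] at t0
        rw [abs_of_neg p2, abs_of_pos p1] at t1
        rcases min_choice (arcGain h 0) (arcGain h 2) with e | e <;> rw [hμ, e] <;> linarith
      have μd : -μ ≤ d := by
        have := hD 0 1 (by omega) (by omega)
        have := hD 2 3 (by omega) (by omega)
        rcases min_choice (arcGain h 0) (arcGain h 2) with e | e <;> rw [hμ, e] <;> linarith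
      have d0 : 0 ≤ d := by linarith [hD 0 0 le_rfl (by omega)]
      refine R.short_jump hup hw' (k := fun i => if i % 2 = 0 then h 0 else h 0 + μ) (a := 0)
        (b := 3) ?_ ?_ (by omega) le_rfl ?_
      · intro i hi
        have : i = 0 ∨ i = 1 ∨ i = 2 := by omega
        rcases this with rfl | rfl | rfl <;> norm_num <;> linarith
      · intro i j _ _
        split_ifs <;> linarith
      · simpa using hmin
    · have um := unimodal_tail (p := 1) (q := l + 1 + 2) (fun t _ ht => hr t ht) t1.le
      refine tail ?_ (um (l + 1) (by omega) (by omega)).le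
      rcases Nat.lt_or_ge 1 l with hl1 | hl1
      · exact (um l (by omega) (by omega)).le
      · obtain rfl : l = 1 := by omega
        exact t1.le

/-- A finite family of intervals has a disjoint subfamily that is not much shorter than the union
of the family. -/
theorem exists_disjoint_intervals {ι : Type*} [DecidableEq ι] (J : Finset ι) (a b : ι → ℕ) :
    ∃ J' ⊆ J, (∀ i ∈ J', ∀ j ∈ J', i ≠ j → b i ≤ a j ∨ b j ≤ a i) ∧
      (J.biUnion fun j => Finset.Ico (a j) (b j)).card ≤ 3 * ∑ j ∈ J', (b j - a j) := by
  induction J using Finset.strongInduction with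
  | H J ih =>
    rcases J.eq_empty_or_nonempty with rfl | hne
    · exact ⟨∅, by simp⟩
    -- Greedy choice: all intervals that meet a longest interval lie in its enlargement by its own
    -- length on both sides, which is three times as long.
    obtain ⟨m, hm, hmax⟩ := J.exists_max_image (fun j => b j - a j) hne
    by_cases hpos : b m ≤ a m
    · refine ⟨∅, by simp, by simp, ?_⟩
      refine (Finset.card_eq_zero.2 (Finset.eq_empty_of_forall_notMem fun e he => ?_)).le.trans
        (Nat.zero_le _)
      simp only [Finset.mem_biUnion, Finset.mem_Ico] at he
      obtain ⟨j, hj, h1, h2⟩ := he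
      have := hmax j hj
      omega
    set K := J.filter (fun j => b j ≤ a m ∨ b m ≤ a j) with hK
    have hKJ : K ⊂ J := by
      refine Finset.filter_ssubset.2 ⟨m, hm, ?_⟩
      omega
    obtain ⟨K', hK', hdis, hcard⟩ := ih K hKJ
    have hmK : m ∉ K' := fun hmem => by
      have := (Finset.mem_filter.1 (hK' hmem)).2
      omega
    refine ⟨insert m K', ?_, ?_, ?_⟩
    · exact Finset.insert_subset hm (hK'.trans (Finset.filter_subset _ _))
    · intro i hi j hj hij
      rw [Finset.mem_insert] at hi hj
      rcases hi with rfl | hi <;> rcases hj with rfl | hj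
      · exact absurd rfl hij
      · have := (Finset.mem_filter.1 (hK' hj)).2; tauto
      · have := (Finset.mem_filter.1 (hK' hi)).2; tauto
      · exact hdis i hi j hj hij
    · have hsub : (J.biUnion fun j => Finset.Ico (a j) (b j)) ⊆
          Finset.Ico (a m - (b m - a m)) (b m + (b m - a m)) ∪
            K.biUnion fun j => Finset.Ico (a j) (b j) := by
        intro e he
        simp only [Finset.mem_biUnion, Finset.mem_union, Finset.mem_Ico] at he ⊢
        obtain ⟨j, hj, h1, h2⟩ := he
        by_cases hjK : j ∈ K
        · exact Or.inr ⟨j, hjK, h1, h2⟩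
        · have h3 : ¬ (b j ≤ a m ∨ b m ≤ a j) := fun hh => hjK (Finset.mem_filter.2 ⟨hj, hh⟩)
          have := hmax j hj
          left; omega
      have := Finset.card_le_card hsub
      have h2 := Finset.card_union_le (Finset.Ico (a m - (b m - a m)) (b m + (b m - a m)))
        (K.biUnion fun j => Finset.Ico (a j) (b j))
      rw [Nat.card_Ico] at h2
      rw [Finset.sum_insert hmK]
      omega

end Reduce

/-! ### Completeness of the arc-bounded paths -/

/-- The body of the loop of `breadthSearch`. -/
noncomputable def breadthBody {n : ℕ} (M : Table n) (D₀ : PathData n) (x y z : Fin n)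
    (D : PathData n) : PathData n :=
  open Classical in
    let k := if 0 ≤ M x y
      then maxOver (fun a => -M x y ≤ M y a ∧ M y a ≤ 0) (fun a => D₀.first y a z)
      else maxOver (fun a => 0 ≤ M y a ∧ M y a ≤ eabs (M x y)) (fun a => D₀.first y a z)
    let l := if 0 ≤ M y x
      then maxOver (fun a => -M y x ≤ M a y ∧ M a y ≤ 0) (fun a => D₀.last z a y)
      else maxOver (fun a => 0 ≤ M a y ∧ M a y ≤ eabs (M y x)) (fun a => D₀.last z a y)
    (D.raiseFirst x y z (M x y + k)).raiseLast z y x (l + M y x)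

/-- The body of the loop of `concatenate`. -/
noncomputable def concatBody {n : ℕ} (M : Table n) (D₀ : PathData n) (u v w x : Fin n)
    (D : PathData n) : PathData n :=
  open Classical in
    let D₁ :=
      if M u v < 0 then
        let k := maxOver (fun a => -(D.first u v w - M u v) ≤ M w a ∧ M w a ≤ 0)
          (fun a => D₀.first w a x)
        D.raiseFirst u v x (D.first u v w + k)
      else D
    if M v u < 0 then
      let k := maxOver (fun a => -(D₁.last w v u - M v u) ≤ M a w ∧ M a w ≤ 0)
        (fun a => D₀.last x a w)
      D₁.raiseLast x v u (k + D₁.last w v u)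
    else D₁

/-- The body of the loop of `concatenateOpposite`. -/
noncomputable def concatOppositeBody {n : ℕ} (M : Table n) (D₀ : PathData n) (u v w x : Fin n)
    (D : PathData n) : PathData n :=
  open Classical in
    let D₂ :=
      if M u v < 0 then
        let k := maxOver (fun a => 0 ≤ M a x ∧
            M a x - D₀.last w a x ≤ D.first u v w - M u v ∧
            D₀.last w a x ≤ eabs (D.first u v w))
          (fun a => D₀.last w a x)
        let D₁ := D.raiseFirst u v x (D.first u v w + k)
        if ∃ a, 0 ≤ M a x ∧ eabs (D₁.first u v w) ≤ D₀.last w a x ∧ M a x ≤ eabs (M u v)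
        then D₁.setFirst u v x 0 else D₁
      else D
    if M v u < 0 then
      let k := maxOver (fun a => 0 ≤ M x a ∧
          M x a - D₀.first x a w ≤ D₂.last w v u - M v u ∧
          D₀.first x a w ≤ eabs (D₂.last w v u))
        (fun a => D₀.first x a w)
      let D₃ := D₂.raiseLast x v u (k + D₂.last w v u)
      if ∃ a, 0 ≤ M x a ∧ eabs (D₃.last w v u) ≤ D₀.first x a w ∧ M x a ≤ eabs (M v u)
      then D₃.setLast x v u 0 else D₃
    else D₂

section FirstLower

variable {n : ℕ} {M : Table n} {D₀ : PathData n} {u v w x y z a : Fin n} {m m' e e' : ℝ}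

theorem le_breadthSearch_first (a b c : Fin n) :
    D₀.first a b c ≤ (breadthSearch M D₀).first a b c :=
  forTriples_preserve (P := fun D : PathData n => D₀.first a b c ≤ D.first a b c)
    (body := breadthBody M D₀)
    (fun _ _ _ _ hD => hD.trans (PathData.le_raiseFirst _ _ _ _ _ _ _ _)) _ le_rfl

theorem breadthSearch_step (h1 : M x y = m) (h2 : M y a = m')
    (hm : (0 ≤ m ∧ -m ≤ m' ∧ m' ≤ 0) ∨ (m < 0 ∧ 0 ≤ m' ∧ m' ≤ -m))
    (he : (e : EReal) ≤ D₀.first y a z) :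
    ((m + e : ℝ) : EReal) ≤ (breadthSearch M D₀).first x y z := by
  classical
  refine forTriples_reach (P := fun _ => True) (body := breadthBody M D₀)
    (Q := fun D : PathData n => ((m + e : ℝ) : EReal) ≤ D.first x y z) (fun _ _ _ _ _ => trivial)
    (fun _ _ _ _ _ hD => hD.trans (PathData.le_raiseFirst _ _ _ _ _ _ _ _)) x y z
    (fun D _ => ?_) D₀ trivial
  unfold breadthBody
  dsimp only
  rw [PathData.raiseLast_first]
  refine le_trans ?_ (PathData.le_raiseFirst_self _ _ _ _ _)
  rw [h1, EReal.coe_add]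
  gcongr
  rw [eabs_coe]
  rcases hm with ⟨h0, h3, h4⟩ | ⟨h0, h3, h4⟩
  · rw [if_pos (by exact_mod_cast h0)]
    exact he.trans (le_maxOver (cond := fun a => -(m : EReal) ≤ M y a ∧ M y a ≤ 0)
      (value := fun a => D₀.first y a z) (by rw [h2]; exact ⟨by exact_mod_cast h3, by exact_mod_cast h4⟩))
  · rw [if_neg (by rw [not_le]; exact_mod_cast h0)]
    exact he.trans (le_maxOver (cond := fun a => 0 ≤ M y a ∧ M y a ≤ ((|m| : ℝ) : EReal))
      (value := fun a => D₀.first y a z)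
      (by rw [h2, abs_of_neg h0]; exact ⟨by exact_mod_cast h3, by exact_mod_cast h4⟩))

theorem concatBody_keep (a b c : Fin n) (k : EReal) (D : PathData n) (hD : k ≤ D.first a b c)
    (u v w x : Fin n) : k ≤ (concatBody M D₀ u v w x D).first a b c := by
  classical
  unfold concatBody
  dsimp only
  split_ifs
  · rw [PathData.raiseLast_first]; exact hD.trans (PathData.le_raiseFirst _ _ _ _ _ _ _ _)
  · exact hD
  · exact hD.trans (PathData.le_raiseFirst _ _ _ _ _ _ _ _)
  · exact hD

theorem le_concatenate_first (U W X : Finset (Fin n)) (a b c : Fin n) :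
    D₀.first a b c ≤ (concatenate M U W X D₀).first a b c :=
  forQuadruples_preserve (P := fun D : PathData n => D₀.first a b c ≤ D.first a b c)
    (fun u _ v w x D hD => concatBody_keep a b c _ D hD u v w x) _ le_rfl

/-- When the iteration comes, the prefix `D[uv][w]` may already have been improved. A larger prefix
only widens the range of the query, so the arc `w a` remains admissible. -/
theorem concatenate_step {U W X : Finset (Fin n)} (hu : u ∈ U) (hw : w ∈ W) (hx : x ∈ X)
    (h1 : M u v = m) (hm : m < 0) (h2 : M w a = m') (h3 : -(e - m) ≤ m') (h4 : m' ≤ 0)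
    (he : (e : EReal) ≤ D₀.first u v w) (he' : (e' : EReal) ≤ D₀.first w a x) :
    ((e + e' : ℝ) : EReal) ≤ (concatenate M U W X D₀).first u v x := by
  classical
  refine forQuadruples_reach (body := concatBody M D₀)
    (P := fun D : PathData n => (e : EReal) ≤ D.first u v w)
    (Q := fun D : PathData n => ((e + e' : ℝ) : EReal) ≤ D.first u v x)
    (fun u' v' w' x' D hD => concatBody_keep u v w _ D hD u' v' w' x')
    (fun u' v' w' x' D _ hD => concatBody_keep u v x _ D hD u' v' w' x')
    hu (Finset.mem_univ v) hw hx (fun D hD => ?_) D₀ he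
  unfold concatBody
  dsimp only
  have key : ((e + e' : ℝ) : EReal) ≤ (D.raiseFirst u v x (D.first u v w +
      maxOver (fun a => -(D.first u v w - M u v) ≤ M w a ∧ M w a ≤ 0)
        (fun a => D₀.first w a x))).first u v x := by
    refine le_trans ?_ (PathData.le_raiseFirst_self _ _ _ _ _)
    rw [EReal.coe_add]
    refine add_le_add hD (he'.trans (le_maxOver
      (cond := fun a => -(D.first u v w - M u v) ≤ M w a ∧ M w a ≤ 0)
      (value := fun a => D₀.first w a x) ⟨?_, by rw [h2]; exact_mod_cast h4⟩))
    rw [h1, h2]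
    calc -(D.first u v w - m) ≤ -((e : EReal) - m) := by
          rw [EReal.neg_le_neg_iff]; exact EReal.sub_le_sub hD le_rfl
      _ ≤ m' := by exact_mod_cast h3
  rw [if_pos (show M u v < 0 by rw [h1]; exact_mod_cast hm)]
  split_ifs
  · rw [PathData.raiseLast_first]; exact key
  · exact key

theorem ite_setLast_first {c c' : Prop} [Decidable c] [Decidable c'] (D : PathData n)
    (k : EReal) : (if c then if c' then (D.raiseLast x v u k).setLast x v u 0
      else D.raiseLast x v u k else D).first = D.first := by
  split_ifs <;> rfl

/-- The assignment of 0 can lower an entry, but not below a nonpositive bound, and it happens only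
for descending first arcs. -/
theorem concatOppositeBody_keep (a b c : Fin n) {k : EReal} (hk : k ≤ 0 ∨ ¬ M a b < 0)
    (D : PathData n) (hD : k ≤ D.first a b c) (u v w x : Fin n) :
    k ≤ (concatOppositeBody M D₀ u v w x D).first a b c := by
  classical
  unfold concatOppositeBody
  dsimp only
  rw [ite_setLast_first]
  split_ifs with h2 h3
  · rw [PathData.setFirst_apply]
    split_ifs with h4
    · rw [h4.1, h4.2.1] at hk
      exact hk.resolve_right (not_not.2 h2)
    · exact hD.trans (PathData.le_raiseFirst _ _ _ _ _ _ _ _)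
  · exact hD.trans (PathData.le_raiseFirst _ _ _ _ _ _ _ _)
  · exact hD

theorem le_concatenateOpposite_first (U W X : Finset (Fin n)) (a b c : Fin n) {k : EReal}
    (hk : k ≤ 0 ∨ ¬ M a b < 0) (h : k ≤ D₀.first a b c) :
    k ≤ (concatenateOpposite M U W X D₀).first a b c :=
  forQuadruples_preserve (P := fun D : PathData n => k ≤ D.first a b c)
    (fun u _ v w x D hD => concatOppositeBody_keep a b c hk D hD u v w x) _ h

/-- If the second path fails the last condition of the query, then it rises above the band, and the
subsequent test assigns 0. This test reads the prefix after the first update, which has not changed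
it because `w ≠ x`. -/
theorem concatenateOpposite_step {U W X : Finset (Fin n)} (hu : u ∈ U) (hw : w ∈ W) (hx : x ∈ X)
    (hwx : w ≠ x) (h1 : M u v = m) (hm : m < 0) (h2 : M a x = m') (hm' : 0 ≤ m')
    (h3 : m' - e' ≤ e - m) (h4 : m' ≤ -m) (h5 : e ≤ 0) (h6 : e + e' ≤ 0)
    (he : (e : EReal) ≤ D₀.first u v w) (he' : (e' : EReal) ≤ D₀.last w a x) :
    ((e + e' : ℝ) : EReal) ≤ (concatenateOpposite M U W X D₀).first u v x := by
  classical
  refine forQuadruples_reach (body := concatOppositeBody M D₀)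
    (P := fun D : PathData n => (e : EReal) ≤ D.first u v w)
    (Q := fun D : PathData n => ((e + e' : ℝ) : EReal) ≤ D.first u v x)
    (fun u' v' w' x' D hD => concatOppositeBody_keep u v w
      (Or.inl (by exact_mod_cast h5)) D hD u' v' w' x')
    (fun u' v' w' x' D _ hD => concatOppositeBody_keep u v x
      (Or.inl (by exact_mod_cast h6)) D hD u' v' w' x')
    hu (Finset.mem_univ v) hw hx (fun D hD => ?_) D₀ he
  unfold concatOppositeBody
  dsimp only
  have hmuv : M u v < 0 := by rw [h1]; exact_mod_cast hm
  have key : ((e + e' : ℝ) : EReal) ≤ (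
      let k := maxOver (fun a => 0 ≤ M a x ∧
          M a x - D₀.last w a x ≤ D.first u v w - M u v ∧
          D₀.last w a x ≤ eabs (D.first u v w))
        (fun a => D₀.last w a x)
      let D₁ := D.raiseFirst u v x (D.first u v w + k)
      if ∃ a, 0 ≤ M a x ∧ eabs (D₁.first u v w) ≤ D₀.last w a x ∧ M a x ≤ eabs (M u v)
      then D₁.setFirst u v x 0 else D₁ : PathData n).first u v x := by
    dsimp only
    split_ifs with h7
    · rw [PathData.setFirst_apply, if_pos ⟨rfl, rfl, rfl⟩]
      exact_mod_cast h6
    · refine le_trans ?_ (PathData.le_raiseFirst_self _ _ _ _ _)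
      push Not at h7
      have h8 : D₀.last w a x ≤ eabs (D.first u v w) := by
        by_contra hc
        refine absurd (h7 a (by rw [h2]; exact_mod_cast hm') ?_) ?_
        · rw [PathData.raiseFirst_apply, if_neg (fun h => hwx h.2.2)]
          exact (not_le.1 hc).le
        · rw [not_lt, h1, h2, eabs_coe, abs_of_neg hm]
          exact_mod_cast h4
      rw [EReal.coe_add]
      refine add_le_add hD (he'.trans (le_maxOver (cond := fun a => 0 ≤ M a x ∧
          M a x - D₀.last w a x ≤ D.first u v w - M u v ∧
          D₀.last w a x ≤ eabs (D.first u v w)) (value := fun a => D₀.last w a x)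
          ⟨by rw [h2]; exact_mod_cast hm', ?_, h8⟩))
      rw [h1, h2]
      calc (m' : EReal) - D₀.last w a x ≤ (m' : EReal) - e' := EReal.sub_le_sub le_rfl he'
        _ ≤ (e : EReal) - m := by exact_mod_cast h3
        _ ≤ _ := EReal.sub_le_sub hD le_rfl
  rw [if_pos hmuv]
  rw [ite_setLast_first]
  exact key

end FirstLower

/-! ### Reversal -/

/-- The table of the reversed graph. -/
def Table.rev {n : ℕ} (M : Table n) : Table n := fun x y => M y x

/-- The data structure of the reversed graph. -/
def PathData.rev {n : ℕ} (D : PathData n) : PathData n where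
  mono := D.mono.rev
  first := fun x y z => D.last z y x
  last := fun x y z => D.first z y x

namespace PathData

variable {n : ℕ} (M : Table n) (D : PathData n)

theorem rev_setFirst (x y z : Fin n) (k : EReal) :
    (D.setFirst x y z k).rev = D.rev.setLast z y x k := by
  have : ∀ a b c, (D.setFirst x y z k).rev.last a b c = (D.rev.setLast z y x k).last a b c := by
    intro a b c
    rw [setLast_apply]
    change (D.setFirst x y z k).first c b a = _
    rw [setFirst_apply]
    simp only [PathData.rev]
    congr 1
    apply propext; tauto
  unfold PathData.rev at this ⊢
  unfold setLast at this ⊢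
  simp only [mk.injEq]
  exact ⟨rfl, rfl, funext fun a => funext fun b => funext fun c => this a b c⟩

theorem rev_setLast (x y z : Fin n) (k : EReal) :
    (D.setLast x y z k).rev = D.rev.setFirst z y x k := by
  have := rev_setFirst D.rev z y x k
  rw [show D.rev.rev = D from rfl] at this
  rw [← this]; rfl

theorem rev_raiseFirst (x y z : Fin n) (k : EReal) :
    (D.raiseFirst x y z k).rev = D.rev.raiseLast z y x k := rev_setFirst _ _ _ _ _

theorem rev_raiseLast (x y z : Fin n) (k : EReal) :
    (D.raiseLast x y z k).rev = D.rev.raiseFirst z y x k := rev_setLast _ _ _ _ _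

theorem rev_init : (init M).rev = init M.rev := by
  simp only [init, PathData.rev, Table.rev]

theorem raiseLast_raiseFirst (x y z a b c : Fin n) (k l : EReal) :
    (D.raiseLast x y z k).raiseFirst a b c l = (D.raiseFirst a b c l).raiseLast x y z k := rfl

/-- The two updates in the body are mirror images of each other, and they commute since they write
to different components. With such identities, every result on first arcs gives one on last arcs. -/
theorem rev_breadthSearch : (breadthSearch M D).rev = breadthSearch M.rev D.rev := by
  classical
  unfold breadthSearch forTriples
  refine forEach_map _ (fun x E => forEach_map _ (fun y E => forEach_map _ (fun z E => ?_) _) _) _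
  rw [rev_raiseLast, rev_raiseFirst, raiseLast_raiseFirst]
  simp only [PathData.rev, Table.rev]
  rw [add_comm (M y x), add_comm (M x y)]
  rfl

theorem rev_concatenate (U W X : Finset (Fin n)) :
    (concatenate M U W X D).rev = concatenate M.rev U W X D.rev := by
  classical
  unfold concatenate forQuadruples
  refine forEach_map _ (fun u E => forEach_map _ (fun v E => forEach_map _ (fun w E =>
    forEach_map _ (fun x E => ?_) _) _) _) _
  dsimp only
  by_cases h1 : M u v < 0 <;> by_cases h2 : M v u < 0
  · rw [if_pos h1, if_pos h2, if_pos (show M.rev u v < 0 from h2),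
      if_pos (show M.rev v u < 0 from h1), rev_raiseLast, rev_raiseFirst, raiseLast_raiseFirst]
    simp only [PathData.rev, Table.rev, raiseFirst_last]
    rw [add_comm (E.first u v w), add_comm (E.last w v u)]
  · rw [if_pos h1, if_neg h2, if_neg (show ¬ M.rev u v < 0 from h2),
      if_pos (show M.rev v u < 0 from h1), rev_raiseFirst]
    simp only [PathData.rev, Table.rev]
    rw [add_comm (E.first u v w)]
  · rw [if_neg h1, if_pos h2, if_pos (show M.rev u v < 0 from h2),
      if_neg (show ¬ M.rev v u < 0 from h1), rev_raiseLast]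
    simp only [PathData.rev, Table.rev]
    rw [add_comm (E.last w v u)]
  · rw [if_neg h1, if_neg h2, if_neg (show ¬ M.rev u v < 0 from h2),
      if_neg (show ¬ M.rev v u < 0 from h1)]

end PathData

namespace PathData

variable {n : ℕ} (M : Table n) (D : PathData n)

theorem rev_concatOppositeBody (D₀ : PathData n) (u v w x : Fin n) :
    (concatOppositeBody M D₀ u v w x D).rev = concatOppositeBody M.rev D₀.rev u v w x D.rev := by
  classical
  set kf := D.first u v w + maxOver (fun a => 0 ≤ M a x ∧
              M a x - D₀.last w a x ≤ D.first u v w - M u v ∧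
              D₀.last w a x ≤ eabs (D.first u v w)) (fun a => D₀.last w a x) with hkf
  set kl := maxOver (fun a => 0 ≤ M x a ∧
            M x a - D₀.first x a w ≤ D.last w v u - M v u ∧
            D₀.first x a w ≤ eabs (D.last w v u)) (fun a => D₀.first x a w) + D.last w v u with hkl
  let cf : Prop := ∃ a, 0 ≤ M a x ∧
    eabs ((D.raiseFirst u v x kf).first u v w) ≤ D₀.last w a x ∧ M a x ≤ eabs (M u v)
  let cl : Prop := ∃ a, 0 ≤ M x a ∧
    eabs ((D.raiseLast x v u kl).last w v u) ≤ D₀.first x a w ∧ M x a ≤ eabs (M v u)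
  -- The two halves of the body, with all parameters evaluated at `D`. As each half changes only its
  -- own component, the parameters of the second half are the same after the first one, and the
  -- halves commute.
  let F : PathData n → PathData n := fun E => if M u v < 0 then
    if cf then (E.raiseFirst u v x kf).setFirst u v x 0 else E.raiseFirst u v x kf else E
  let L : PathData n → PathData n := fun E => if M v u < 0 then
    if cl then (E.raiseLast x v u kl).setLast x v u 0 else E.raiseLast x v u kl else E
  have e1 : concatOppositeBody M D₀ u v w x D = L (F D) := by
    have hl : (F D).last = D.last := by
      simp only [F]; split_ifs <;> rfl
    have hl' : ((F D).raiseLast x v u kl).last = (D.raiseLast x v u kl).last := by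
      simp only [F]; split_ifs <;> rfl
    change (if M v u < 0 then if ∃ a, 0 ≤ M x a ∧
          eabs (((F D).raiseLast x v u (maxOver (fun a => 0 ≤ M x a ∧
            M x a - D₀.first x a w ≤ (F D).last w v u - M v u ∧
            D₀.first x a w ≤ eabs ((F D).last w v u)) (fun a => D₀.first x a w) +
              (F D).last w v u)).last w v u) ≤ D₀.first x a w ∧ M x a ≤ eabs (M v u)
        then ((F D).raiseLast x v u (maxOver (fun a => 0 ≤ M x a ∧
            M x a - D₀.first x a w ≤ (F D).last w v u - M v u ∧
            D₀.first x a w ≤ eabs ((F D).last w v u)) (fun a => D₀.first x a w) +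
              (F D).last w v u)).setLast x v u 0
        else (F D).raiseLast x v u (maxOver (fun a => 0 ≤ M x a ∧
            M x a - D₀.first x a w ≤ (F D).last w v u - M v u ∧
            D₀.first x a w ≤ eabs ((F D).last w v u)) (fun a => D₀.first x a w) +
              (F D).last w v u) else F D) = _
    rw [hl, ← hkl, hl']
  have e2 : concatOppositeBody M.rev D₀.rev u v w x D.rev = (F (L D)).rev := by
    let F' : PathData n → PathData n := fun E => if M u v < 0 then
      if cf then (E.raiseLast x v u kf).setLast x v u 0 else E.raiseLast x v u kf else E
    let L' : PathData n → PathData n := fun E => if M v u < 0 then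
      if cl then (E.raiseFirst u v x kl).setFirst u v x 0 else E.raiseFirst u v x kl else E
    have hL : ∀ E : PathData n, (L E).rev = L' E.rev := by
      intro E
      simp only [L, L']
      split_ifs
      · rw [rev_setLast, rev_raiseLast]
      · rw [rev_raiseLast]
      · rfl
    have hF : ∀ E : PathData n, (F E).rev = F' E.rev := by
      intro E
      simp only [F, F']
      split_ifs
      · rw [rev_setFirst, rev_raiseFirst]
      · rw [rev_raiseFirst]
      · rfl
    rw [hF, hL]
    have hcl : (D.rev.raiseFirst u v x kl).first u v w = (D.raiseLast x v u kl).last w v u := by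
      rw [← rev_raiseLast]; rfl
    have hkl2 : D.rev.first u v w + maxOver (fun a => 0 ≤ M.rev a x ∧
              M.rev a x - D₀.rev.last w a x ≤ D.rev.first u v w - M.rev u v ∧
              D₀.rev.last w a x ≤ eabs (D.rev.first u v w)) (fun a => D₀.rev.last w a x) = kl := by
      rw [add_comm]; rfl
    have hL1 : (if M.rev u v < 0 then if ∃ a, 0 ≤ M.rev a x ∧
        eabs ((D.rev.raiseFirst u v x kl).first u v w) ≤ D₀.rev.last w a x ∧
          M.rev a x ≤ eabs (M.rev u v)
        then (D.rev.raiseFirst u v x kl).setFirst u v x 0 else D.rev.raiseFirst u v x kl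
        else D.rev) = L' D.rev := by
      simp only [hcl]; rfl
    have hl : (L' D.rev).last = D.rev.last := by
      simp only [L']; split_ifs <;> rfl
    have hl' : ∀ k, ((L' D.rev).raiseLast x v u k).last = (D.rev.raiseLast x v u k).last := by
      intro k; simp only [L']; split_ifs <;> rfl
    have hcf : ∀ k, (D.rev.raiseLast x v u k).last w v u = (D.raiseFirst u v x k).first u v w := by
      intro k; rw [← rev_raiseFirst]; rfl
    unfold concatOppositeBody
    dsimp only
    rw [hkl2, hL1, hl]
    have hkf2 : maxOver (fun a => 0 ≤ M.rev x a ∧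
            M.rev x a - D₀.rev.first x a w ≤ D.rev.last w v u - M.rev v u ∧
            D₀.rev.first x a w ≤ eabs (D.rev.last w v u)) (fun a => D₀.rev.first x a w) +
            D.rev.last w v u = kf := by
      rw [add_comm]; rfl
    rw [hkf2, hl', hcf]
    rfl
  rw [e1, e2]
  congr 1
  simp only [F, L]
  split_ifs <;> rfl

theorem rev_concatenateOpposite (U W X : Finset (Fin n)) :
    (concatenateOpposite M U W X D).rev = concatenateOpposite M.rev U W X D.rev :=
  forEach_map _ (fun u _ => forEach_map _ (fun v _ => forEach_map _ (fun w _ =>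
    forEach_map _ (fun x E => rev_concatOppositeBody M E D u v w x) _) _) _) _

end PathData

/-! ### The table of the data structure -/

section Mono

variable {n : ℕ} {M : Table n} {D₀ : PathData n}

theorem breadthSearch_mono : (breadthSearch M D₀).mono = D₀.mono :=
  forTriples_preserve (P := fun D : PathData n => D.mono = D₀.mono) (body := breadthBody M D₀)
    (fun _ _ _ _ hD => hD) _ rfl

theorem concatenate_mono (U W X : Finset (Fin n)) : (concatenate M U W X D₀).mono = D₀.mono :=
  forQuadruples_preserve (P := fun D : PathData n => D.mono = D₀.mono) (body := concatBody M D₀)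
    (fun _ _ _ _ _ D hD => by
      unfold concatBody; dsimp only; split_ifs <;> exact hD) _ rfl

theorem concatenateOpposite_mono (U W X : Finset (Fin n)) :
    (concatenateOpposite M U W X D₀).mono = D₀.mono :=
  forQuadruples_preserve (P := fun D : PathData n => D.mono = D₀.mono)
    (body := concatOppositeBody M D₀)
    (fun _ _ _ _ _ D hD => by
      unfold concatOppositeBody; dsimp only; split_ifs <;> exact hD) _ rfl

variable {B : ℝ}

/-- The body of the loop of `arcBoundedToMonotone`. -/
noncomputable def arcMonotoneBody {n : ℕ} (B : ℝ) (M : Table n) (u v x y : Fin n)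
    (D : PathData n) : PathData n :=
  open Classical in
    let g := D.first u v x + M x y
    let D₃ :=
      if M u v ≤ 0 then
        let D₁ := if (-B : ℝ) ≤ g ∧ g ≤ M u v then D.raiseMono u y g else D
        let D₂ := if M u v ≤ g then D₁.raiseMono u y (M u v) else D₁
        if 0 ≤ g then D₂.raiseMono v y (-M u v + g) else D₂
      else D
    let h := M y x + D.last x v u
    if M v u ≤ 0 then
      let D₄ := if (-B : ℝ) ≤ h ∧ h ≤ M v u then D₃.raiseMono y u h else D₃
      let D₅ := if M v u ≤ h then D₄.raiseMono y u (M v u) else D₄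
      if 0 ≤ h then D₅.raiseMono y v (h - M v u) else D₅
    else D₃

theorem PathData.ite_raiseMono_first {c : Prop} [Decidable c] (D : PathData n) (x y : Fin n)
    (k : EReal) : (if c then D.raiseMono x y k else D).first = D.first := by split_ifs <;> rfl

theorem PathData.ite_raiseMono_last {c : Prop} [Decidable c] (D : PathData n) (x y : Fin n)
    (k : EReal) : (if c then D.raiseMono x y k else D).last = D.last := by split_ifs <;> rfl

theorem PathData.le_ite_raiseMono {c : Prop} [Decidable c] {T : Table n} {D : PathData n}
    (h : T ≤ D.mono) (x y : Fin n) (k : EReal) :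
    T ≤ (if c then D.raiseMono x y k else D).mono := by
  split_ifs
  · exact h.trans (Table.le_raise _ _ _ _)
  · exact h

theorem arcMonotoneBody_keep (u v x y : Fin n) (D : PathData n) :
    (arcMonotoneBody B M u v x y D).first = D.first ∧
    (arcMonotoneBody B M u v x y D).last = D.last ∧
    D.mono ≤ (arcMonotoneBody B M u v x y D).mono := by
  classical
  unfold arcMonotoneBody
  dsimp only
  by_cases h1 : M u v ≤ 0 <;> by_cases h2 : M v u ≤ 0
  · rw [if_pos h1, if_pos h2]
    simp only [PathData.ite_raiseMono_first, PathData.ite_raiseMono_last, true_and]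
    iterate 6 refine PathData.le_ite_raiseMono ?_ _ _ _
    exact le_rfl
  · rw [if_pos h1, if_neg h2]
    simp only [PathData.ite_raiseMono_first, PathData.ite_raiseMono_last, true_and]
    iterate 3 refine PathData.le_ite_raiseMono ?_ _ _ _
    exact le_rfl
  · rw [if_neg h1, if_pos h2]
    simp only [PathData.ite_raiseMono_first, PathData.ite_raiseMono_last, true_and]
    iterate 3 refine PathData.le_ite_raiseMono ?_ _ _ _
    exact le_rfl
  · rw [if_neg h1, if_neg h2]
    exact ⟨rfl, rfl, le_rfl⟩

theorem le_arcBoundedToMonotone (T : Finset (Fin n)) :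
    D₀.mono ≤ (arcBoundedToMonotone B M T D₀).mono :=
  forQuadruples_preserve (P := fun D : PathData n => D₀.mono ≤ D.mono)
    (body := arcMonotoneBody B M)
    (fun u _ v x y D hD => hD.trans (arcMonotoneBody_keep u v x y D).2.2) _ le_rfl

theorem arcBoundedToMonotone_reach {T : Finset (Fin n)} {u v x y a b : Fin n} {k : EReal}
    (hu : u ∈ T) (h : ∀ D : PathData n, D.first = D₀.first → D.last = D₀.last →
      k ≤ (arcMonotoneBody B M u v x y D).mono a b) :
    k ≤ (arcBoundedToMonotone B M T D₀).mono a b :=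
  forQuadruples_reach (body := arcMonotoneBody B M)
    (P := fun D : PathData n => D.first = D₀.first ∧ D.last = D₀.last)
    (Q := fun D : PathData n => k ≤ D.mono a b)
    (fun u v x y D hD => ⟨(arcMonotoneBody_keep u v x y D).1.trans hD.1,
      (arcMonotoneBody_keep u v x y D).2.1.trans hD.2⟩)
    (fun u v x y D _ hD => hD.trans ((arcMonotoneBody_keep u v x y D).2.2 a b))
    hu (Finset.mem_univ v) (Finset.mem_univ x) (Finset.mem_univ y) (fun D hD => h D hD.1 hD.2) D₀
    ⟨rfl, rfl⟩

variable {T : Finset (Fin n)} {u v x y : Fin n} {m m' e : ℝ}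

theorem PathData.le_ite_raiseMono_apply {c : Prop} [Decidable c] {D : PathData n} {a b x y : Fin n}
    {k k' : EReal} (h : (c → k ≤ k' ∧ a = x ∧ b = y) ∧ (¬ c → k ≤ D.mono a b)) :
    k ≤ (if c then D.raiseMono x y k' else D).mono a b := by
  split_ifs with hc
  · obtain ⟨h1, rfl, rfl⟩ := h.1 hc
    exact h1.trans (Table.le_raise_self _ _ _ _)
  · exact h.2 hc

/-- The minimum is due to `e` being only a lower bound: if the known entry is so good that the sum
exceeds `M u v`, then `M u v` is written instead. -/
theorem exit_first_below (hu : u ∈ T) (h1 : M u v = m) (hm : m ≤ 0) (h2 : M x y = m')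
    (he : (e : EReal) ≤ D₀.first u v x) (hB : -B ≤ e + m') :
    ((min m (e + m') : ℝ) : EReal) ≤ (arcBoundedToMonotone B M T D₀).mono u y := by
  classical
  refine arcBoundedToMonotone_reach (v := v) (x := x) (y := y) hu fun D hf hl => ?_
  have key : ((min m (e + m') : ℝ) : EReal) ≤ (
        let g := D.first u v x + M x y
        let D₁ := if (-B : ℝ) ≤ g ∧ g ≤ M u v then D.raiseMono u y g else D
        let D₂ := if M u v ≤ g then D₁.raiseMono u y (M u v) else D₁
        if 0 ≤ g then D₂.raiseMono v y (-M u v + g) else D₂).mono u y := by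
    dsimp only
    rw [hf]
    have hg : ((e + m' : ℝ) : EReal) ≤ D₀.first u v x + M x y := by
      rw [h2, EReal.coe_add]; gcongr
    generalize D₀.first u v x + M x y = g at hg
    refine le_trans ?_ (PathData.le_ite_raiseMono le_rfl _ _ _ _ _)
    refine PathData.le_ite_raiseMono_apply ⟨fun _ => ⟨?_, rfl, rfl⟩, fun hc => ?_⟩
    · rw [h1]; exact_mod_cast min_le_left _ _
    · refine PathData.le_ite_raiseMono_apply ⟨fun _ => ⟨?_, rfl, rfl⟩, fun hc' => ?_⟩
      · exact le_trans (by exact_mod_cast min_le_right _ _) hg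
      · exact absurd ⟨le_trans (by exact_mod_cast hB) hg, (not_le.1 hc).le⟩ hc'
  unfold arcMonotoneBody
  dsimp only at key ⊢
  rw [if_pos (show M u v ≤ 0 by rw [h1]; exact_mod_cast hm)]
  generalize (if 0 ≤ D.first u v x + M x y then _ else _ : PathData n) = D₃ at key ⊢
  by_cases h3 : M v u ≤ 0
  · rw [if_pos h3]
    iterate 3 refine le_trans ?_ (PathData.le_ite_raiseMono le_rfl _ _ _ _ _)
    exact key
  · rw [if_neg h3]; exact key

theorem exit_first_above (hu : u ∈ T) (h1 : M u v = m) (hm : m ≤ 0) (h2 : M x y = m')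
    (he : (e : EReal) ≤ D₀.first u v x) (h0 : 0 ≤ e + m') :
    ((e + m' - m : ℝ) : EReal) ≤ (arcBoundedToMonotone B M T D₀).mono v y := by
  classical
  refine arcBoundedToMonotone_reach (v := v) (x := x) (y := y) hu fun D hf hl => ?_
  have key : ((e + m' - m : ℝ) : EReal) ≤ (
        let g := D.first u v x + M x y
        let D₁ := if (-B : ℝ) ≤ g ∧ g ≤ M u v then D.raiseMono u y g else D
        let D₂ := if M u v ≤ g then D₁.raiseMono u y (M u v) else D₁
        if 0 ≤ g then D₂.raiseMono v y (-M u v + g) else D₂).mono v y := by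
    dsimp only
    rw [hf]
    have hg : ((e + m' : ℝ) : EReal) ≤ D₀.first u v x + M x y := by
      rw [h2, EReal.coe_add]; gcongr
    generalize D₀.first u v x + M x y = g at hg
    refine PathData.le_ite_raiseMono_apply ⟨fun _ => ⟨?_, rfl, rfl⟩, fun hc => ?_⟩
    · rw [h1, show e + m' - m = -m + (e + m') by ring, EReal.coe_add, EReal.coe_neg]
      gcongr
    · exact absurd (le_trans (by exact_mod_cast h0) hg) hc
  unfold arcMonotoneBody
  dsimp only at key ⊢
  rw [if_pos (show M u v ≤ 0 by rw [h1]; exact_mod_cast hm)]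
  generalize (if 0 ≤ D.first u v x + M x y then _ else _ : PathData n) = D₃ at key ⊢
  by_cases h3 : M v u ≤ 0
  · rw [if_pos h3]
    iterate 3 refine le_trans ?_ (PathData.le_ite_raiseMono le_rfl _ _ _ _ _)
    exact key
  · rw [if_neg h3]; exact key

theorem exit_last_below (hu : u ∈ T) (h1 : M v u = m) (hm : m ≤ 0) (h2 : M y x = m')
    (he : (e : EReal) ≤ D₀.last x v u) (hB : -B ≤ e + m') :
    ((min m (e + m') : ℝ) : EReal) ≤ (arcBoundedToMonotone B M T D₀).mono y u := by
  classical
  refine arcBoundedToMonotone_reach (v := v) (x := x) (y := y) hu fun D hf hl => ?_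
  unfold arcMonotoneBody
  dsimp only
  have hg : ((e + m' : ℝ) : EReal) ≤ M y x + D₀.last x v u := by
    rw [h2, add_comm e, EReal.coe_add]; gcongr
  rw [if_pos (show M v u ≤ 0 by rw [h1]; exact_mod_cast hm), hl]
  generalize (if M u v ≤ 0 then _ else D : PathData n) = D₃
  generalize M y x + D₀.last x v u = g at hg
  refine le_trans ?_ (PathData.le_ite_raiseMono le_rfl _ _ _ _ _)
  refine PathData.le_ite_raiseMono_apply ⟨fun _ => ⟨?_, rfl, rfl⟩, fun hc => ?_⟩
  · rw [h1]; exact_mod_cast min_le_left _ _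
  · refine PathData.le_ite_raiseMono_apply ⟨fun _ => ⟨?_, rfl, rfl⟩, fun hc' => ?_⟩
    · exact le_trans (by exact_mod_cast min_le_right _ _) hg
    · exact absurd ⟨le_trans (by exact_mod_cast hB) hg, (not_le.1 hc).le⟩ hc'

theorem exit_last_above (hu : u ∈ T) (h1 : M v u = m) (hm : m ≤ 0) (h2 : M y x = m')
    (he : (e : EReal) ≤ D₀.last x v u) (h0 : 0 ≤ e + m') :
    ((e + m' - m : ℝ) : EReal) ≤ (arcBoundedToMonotone B M T D₀).mono y v := by
  classical
  refine arcBoundedToMonotone_reach (v := v) (x := x) (y := y) hu fun D hf hl => ?_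
  unfold arcMonotoneBody
  dsimp only
  have hg : ((e + m' : ℝ) : EReal) ≤ M y x + D₀.last x v u := by
    rw [h2, add_comm e, EReal.coe_add]; gcongr
  rw [if_pos (show M v u ≤ 0 by rw [h1]; exact_mod_cast hm), hl]
  generalize (if M u v ≤ 0 then _ else D : PathData n) = D₃
  generalize M y x + D₀.last x v u = g at hg
  refine PathData.le_ite_raiseMono_apply ⟨fun _ => ⟨?_, rfl, rfl⟩, fun hc => ?_⟩
  · rw [h1, EReal.coe_sub]
    exact EReal.sub_le_sub hg le_rfl
  · exact absurd (le_trans (by exact_mod_cast h0) hg) hc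

end Mono

/-! ### Funnels -/

section Funnels

variable {n : ℕ} {M : Table n} {ℓ : ℕ} {v : ℕ → Fin n} {h : ℕ → ℝ} {D : PathData n}

/-- The part of the path between `p` and `q` is known, with its first arc. -/
def FirstKnown (v : ℕ → Fin n) (h : ℕ → ℝ) (D : PathData n) (p q : ℕ) : Prop :=
  ((h q - h p : ℝ) : EReal) ≤ D.first (v p) (v (p + 1)) (v q)

/-- The part of the path between `p` and `q + 1` is known, with its last arc. -/
def LastKnown (v : ℕ → Fin n) (h : ℕ → ℝ) (D : PathData n) (p q : ℕ) : Prop :=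
  ((h (q + 1) - h p : ℝ) : EReal) ≤ D.last (v p) (v q) (v (q + 1))

/-- The arcs in `[p, q)` are alternating, and their gains do not increase in absolute value. -/
def Falling (h : ℕ → ℝ) (p q : ℕ) : Prop :=
  ∀ i, p ≤ i → i + 1 < q →
    arcGain h i * arcGain h (i + 1) < 0 ∧ |arcGain h (i + 1)| ≤ |arcGain h i|

/-- The arcs in `[p, q)` are alternating, and their gains do not decrease in absolute value. -/
def Rising (h : ℕ → ℝ) (p q : ℕ) : Prop :=
  ∀ i, p ≤ i → i + 1 < q →
    arcGain h i * arcGain h (i + 1) < 0 ∧ |arcGain h i| ≤ |arcGain h (i + 1)|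

theorem Falling.mono {p q p' q' : ℕ} (F : Falling h p q) (hp : p ≤ p') (hq : q' ≤ q) :
    Falling h p' q' := fun i h1 h2 => F i (hp.trans h1) (h2.trans_le hq)

theorem Rising.mono {p q p' q' : ℕ} (F : Rising h p q) (hp : p ≤ p') (hq : q' ≤ q) :
    Rising h p' q' := fun i h1 h2 => F i (hp.trans h1) (h2.trans_le hq)

/-- Each arc turns back by at most the length of its predecessor, so the intervals between
consecutive heights are nested. -/
theorem Falling.mem_uIcc {p q : ℕ} (F : Falling h p q) (hpq : p < q) :
    ∀ i, p ≤ i → i ≤ q → h i ∈ Set.uIcc (h p) (h (p + 1)) := by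
  obtain ⟨k, rfl⟩ : ∃ k, q = p + 1 + k := ⟨q - (p + 1), by omega⟩
  induction k generalizing p with
  | zero =>
    intro i h1 h2
    obtain rfl | rfl : i = p ∨ i = p + 1 := by omega
    · exact Set.left_mem_uIcc
    · exact Set.right_mem_uIcc
  | succ k ih =>
    intro i h1 h2
    rcases h1.eq_or_lt with rfl | h1
    · exact Set.left_mem_uIcc
    have := ih (p := p + 1) (F.mono (by omega) (by omega)) (by omega) i h1 (by omega)
    obtain ⟨e1, e2⟩ := F p le_rfl (by omega)
    refine Set.uIcc_subset_uIcc_iff_mem.2 ⟨Set.right_mem_uIcc, ?_⟩ this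
    unfold arcGain at e1 e2
    rcases lt_or_ge (h (p + 1) - h p) 0 with h3 | h3
    · have h4 : 0 < h (p + 1 + 1) - h (p + 1) := by nlinarith
      rw [abs_of_neg h3, abs_of_pos h4] at e2
      exact Set.mem_uIcc.2 (Or.inr ⟨by linarith, by linarith⟩)
    · have h4 : h (p + 1 + 1) - h (p + 1) < 0 := by nlinarith
      rw [abs_of_nonneg h3, abs_of_neg h4] at e2
      exact Set.mem_uIcc.2 (Or.inl ⟨by linarith, by linarith⟩)

theorem Falling.band {p q : ℕ} (F : Falling h p q) (hpq : p < q) (hp : arcGain h p ≤ 0) (i : ℕ)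
    (h1 : p ≤ i) (h2 : i ≤ q) : h (p + 1) ≤ h i ∧ h i ≤ h p := by
  have := F.mem_uIcc hpq i h1 h2
  unfold arcGain at hp
  rwa [Set.uIcc_of_ge (by linarith), Set.mem_Icc] at this

theorem FirstKnown.breadthSearch_step (E : ExactGains M ℓ v h) {p q : ℕ} (hq : q ≤ ℓ)
    (hpq : p + 1 < q) (F : Falling h p q) (H : FirstKnown v h D (p + 1) q) :
    FirstKnown v h (breadthSearch M D) p q := by
  obtain ⟨e1, e2⟩ := F p le_rfl hpq
  have := _root_.breadthSearch_step (M := M) (E p (by omega)) (E (p + 1) (by omega)) ?_ H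
  · unfold FirstKnown
    refine le_trans ?_ this
    unfold arcGain
    exact_mod_cast (by linarith)
  · rcases lt_or_ge (arcGain h p) 0 with h3 | h3
    · have h4 : 0 < arcGain h (p + 1) := by nlinarith
      rw [abs_of_neg h3, abs_of_pos h4] at e2
      exact Or.inr ⟨h3, h4.le, e2⟩
    · have h4 : arcGain h (p + 1) < 0 := by nlinarith
      rw [abs_of_nonneg h3, abs_of_neg h4] at e2
      exact Or.inl ⟨h3, by linarith, h4.le⟩

theorem FirstKnown.mono {D' : PathData n} {p q : ℕ} (H : FirstKnown v h D p q)
    (hD : ∀ a b c, D.first a b c ≤ D'.first a b c) : FirstKnown v h D' p q := H.trans (hD _ _ _)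

theorem le_breadthSearch_iterate_first (k : ℕ) (a b c : Fin n) :
    D.first a b c ≤ ((breadthSearch M)^[k] D).first a b c := by
  induction k with
  | zero => exact le_rfl
  | succ k ih =>
    rw [Function.iterate_succ_apply']
    exact ih.trans (le_breadthSearch_first _ _ _)

theorem FirstKnown.breadthSearch_iterate (E : ExactGains M ℓ v h) {p p' q : ℕ} (hq : q ≤ ℓ)
    (hp : p ≤ p') (hpq : p' < q) (F : Falling h p q) (H : FirstKnown v h D p' q) (k : ℕ)
    (hk : p' - p ≤ k) : FirstKnown v h ((breadthSearch M)^[k] D) p q := by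
  induction k generalizing p with
  | zero =>
    obtain rfl : p = p' := by omega
    exact H
  | succ k ih =>
    rcases hp.eq_or_lt with rfl | hp
    · exact H.mono (le_breadthSearch_iterate_first _)
    · rw [Function.iterate_succ_apply']
      exact FirstKnown.breadthSearch_step E hq (by omega) F
        (ih (p := p + 1) (by omega) (F.mono (by omega) le_rfl) (by omega))

theorem firstKnown_init (E : ExactGains M ℓ v h) {p : ℕ} (hp : p < ℓ) :
    FirstKnown v h (PathData.init M) p (p + 1) := by
  unfold FirstKnown PathData.init
  dsimp only
  rw [if_pos rfl, E p hp]
  rfl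

theorem firstKnown_breadthSearch_init (E : ExactGains M ℓ v h) {p q k : ℕ} (hq : q ≤ ℓ)
    (hpq : p < q) (F : Falling h p q) (hk : q ≤ p + k + 1) :
    FirstKnown v h ((breadthSearch M)^[k] (PathData.init M)) p q := by
  obtain ⟨r, rfl⟩ : ∃ r, q = r + 1 := ⟨q - 1, by omega⟩
  exact (firstKnown_init E (by omega)).breadthSearch_iterate E hq (by omega) (by omega) F k
    (by omega)

theorem FirstKnown.concatenate_step {U W X : Finset (Fin n)} (E : ExactGains M ℓ v h)
    {p w q : ℕ} (hw : w < ℓ) (hp : p < ℓ) (hu : v p ∈ U) (hvw : v w ∈ W) (hx : v q ∈ X)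
    (hmp : arcGain h p < 0) (hmw : arcGain h w ≤ 0) (hb : h (p + 1) ≤ h (w + 1))
    (H₁ : FirstKnown v h D p w) (H₂ : FirstKnown v h D w q) :
    FirstKnown v h (concatenate M U W X D) p q := by
  have := _root_.concatenate_step hu hvw hx (E p hp) hmp (E w hw) (by unfold arcGain; linarith)
    hmw H₁ H₂
  unfold FirstKnown
  refine le_trans ?_ this
  exact_mod_cast (by linarith)

/-- The negative arcs with tail in `S`. -/
def Marked (v : ℕ → Fin n) (h : ℕ → ℝ) (S : Finset (Fin n)) (i : ℕ) : Prop :=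
  v i ∈ S ∧ arcGain h i < 0

/-- Every part of the path with `k + 1` falling arcs contains a marked arc. -/
def HitsFunnels (ℓ : ℕ) (v : ℕ → Fin n) (h : ℕ → ℝ) (S : Finset (Fin n)) (k : ℕ) : Prop :=
  ∀ p, p + k + 1 ≤ ℓ → Falling h p (p + k + 1) → ∃ i, p ≤ i ∧ i ≤ p + k ∧ Marked v h S i

/-- The data structure that is computed in the computation of funnels from the sample `S`. -/
noncomputable def funnelData (M : Table n) (k T : ℕ) (S : Finset (Fin n)) : PathData n :=
  (breadthSearch M)^[k] (concatenate M S S Finset.univ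
    ((concatenate M S S S)^[T] ((breadthSearch M)^[k] (PathData.init M))))

open Classical in
/-- The number of marked arcs in `[p, q)`. -/
noncomputable def markedCount (v : ℕ → Fin n) (h : ℕ → ℝ) (S : Finset (Fin n)) (p q : ℕ) : ℕ :=
  ((Finset.Ico p q).filter (Marked v h S)).card

theorem markedCount_add {S : Finset (Fin n)} {p q r : ℕ} (h1 : p ≤ q) (h2 : q ≤ r) :
    markedCount v h S p r = markedCount v h S p q + markedCount v h S q r := by
  classical
  unfold markedCount
  rw [← Finset.card_union_of_disjoint, ← Finset.filter_union, Finset.Ico_union_Ico_eq_Ico h1 h2]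
  exact Finset.disjoint_filter_filter (Finset.Ico_disjoint_Ico_consecutive p q r)

theorem markedCount_pos {S : Finset (Fin n)} {p q i : ℕ} (h1 : p ≤ i) (h2 : i < q)
    (hi : Marked v h S i) : 0 < markedCount v h S p q := by
  classical
  exact Finset.card_pos.2 ⟨i, by simp [h1, h2, hi]⟩

theorem markedCount_le {S : Finset (Fin n)} {p q : ℕ} : markedCount v h S p q ≤ q - p := by
  classical
  exact (Finset.card_filter_le _ _).trans (by simp)

/-- Doubling: round `t + 1` joins two parts between marked arcs, each with at most `2 ^ t` marked
arcs. -/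
theorem firstKnown_concatenate_iterate {S : Finset (Fin n)} (E : ExactGains M ℓ v h) {k : ℕ}
    (hS : HitsFunnels ℓ v h S k) (t : ℕ) :
    ∀ p w, p < w → w < ℓ → Falling h p (w + 1) → Marked v h S p → Marked v h S w →
      markedCount v h S p w ≤ 2 ^ t →
      FirstKnown v h ((concatenate M S S S)^[t] ((breadthSearch M)^[k] (PathData.init M))) p w := by
  induction t with
  | zero =>
    intro p w hpw hw F hp hmw hc
    -- The only marked arc counted is `p` itself. If `w` were beyond the reach of the breadth
    -- search, the sample would hit another one between them.
    refine firstKnown_breadthSearch_init E hw.le hpw (F.mono le_rfl (by omega)) ?_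
    by_contra hlt
    obtain ⟨i, h1, h2, hi⟩ := hS (p + 1) (by omega) (F.mono (by omega) (by omega))
    have e1 := markedCount_add (v := v) (h := h) (S := S) (p := p) (q := p + 1) (r := w)
      (by omega) (by omega)
    have e2 := markedCount_pos (q := p + 1) le_rfl (by omega) hp
    have e3 := markedCount_pos (q := w) h1 (by omega) hi
    simp only [Nat.pow_zero] at hc
    omega
  | succ t ih =>
    intro p w hpw hw F hp hmw hc
    rw [Function.iterate_succ_apply']
    by_cases hc' : markedCount v h S p w ≤ 2 ^ t
    · exact (ih p w hpw hw F hp hmw hc').mono (le_concatenate_first _ _ _)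
    -- The cut is at the marked arc that is preceded by exactly `2 ^ t` marked arcs.
    have hex : ∃ u, p ≤ u ∧ u < w ∧ markedCount v h S p u ≤ 2 ^ t ∧
        2 ^ t < markedCount v h S p (u + 1) := by
      by_contra hcon
      push Not at hcon
      have : ∀ u, p ≤ u → u ≤ w → markedCount v h S p u ≤ 2 ^ t := by
        intro u hu
        induction u, hu using Nat.le_induction with
        | base => intro _; exact markedCount_le.trans (by simp)
        | succ u hu ih => intro huw; exact hcon u hu huw (ih (by omega))
      exact hc' (this w hpw.le le_rfl)
    obtain ⟨u, h1, h2, h3, h4⟩ := hex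
    have e1 := markedCount_add (v := v) (h := h) (S := S) h1 (Nat.le_succ u)
    have e2 := markedCount_le (v := v) (h := h) (S := S) (p := u) (q := u + 1)
    have e3 := markedCount_add (v := v) (h := h) (S := S) h1 h2.le
    have hmu : Marked v h S u := by
      by_contra hn
      have : markedCount v h S u (u + 1) = 0 := by
        classical
        unfold markedCount
        rw [Finset.card_eq_zero, Finset.filter_eq_empty_iff]
        intro i hi
        obtain rfl : i = u := by rw [Finset.mem_Ico] at hi; omega
        exact hn
      simp only [Nat.succ_eq_add_one] at e1
      omega
    have hpu : p < u := by
      rcases h1.eq_or_lt with rfl | h1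
      · have : markedCount v h S p p = 0 := Nat.le_zero.1 (markedCount_le.trans (by simp))
        have : 0 < 2 ^ t := by positivity
        simp only [Nat.succ_eq_add_one] at e1
        have : markedCount v h S p (p + 1) ≤ 1 := e2.trans (by omega)
        omega
      · exact h1
    have h5 : markedCount v h S u w ≤ 2 ^ t := by
      simp only [Nat.succ_eq_add_one] at e1
      rw [pow_succ] at hc
      omega
    refine FirstKnown.concatenate_step E (by omega) (by omega) hp.1 hmu.1 hmw.1 hp.2 hmu.2.le ?_
      (ih p u hpu (by omega) (F.mono le_rfl (by omega)) hp hmu h3)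
      (ih u w h2 hw (F.mono h1 le_rfl) hmu hmw h5)
    exact (F.band (by omega) hp.2.le (u + 1) (by omega) (by omega)).1

theorem le_concatenate_iterate_first (S : Finset (Fin n)) (t : ℕ) (a b c : Fin n) :
    D.first a b c ≤ ((concatenate M S S S)^[t] D).first a b c := by
  induction t with
  | zero => exact le_rfl
  | succ k ih =>
    rw [Function.iterate_succ_apply']
    exact ih.trans (le_concatenate_first _ _ _ _ _ _)

/-- A sample that hits all long funnels makes all funnels known. -/
theorem firstKnown_funnelData {S : Finset (Fin n)} (E : ExactGains M ℓ v h) {k T : ℕ}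
    (hS : HitsFunnels ℓ v h S k) (hT : ℓ ≤ 2 ^ T) {p q : ℕ} (hpq : p < q) (hq : q ≤ ℓ)
    (F : Falling h p q) : FirstKnown v h (funnelData M k T S) p q := by
  classical
  have hshort : ∀ p q, p < q → q ≤ ℓ → Falling h p q → q ≤ p + k + 1 →
      FirstKnown v h ((concatenate M S S S)^[T] ((breadthSearch M)^[k] (PathData.init M))) p q :=
    fun p q hpq hq F hk => (firstKnown_breadthSearch_init E hq hpq F hk).mono
      (le_concatenate_iterate_first _ _)
  -- From a marked arc to an arbitrary end: the doubling leads to a marked arc `w` among the last `k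
  -- + 1` arcs, and the part behind it is short enough for the first breadth search.
  have hmarked : ∀ p, p < q → Falling h p q → Marked v h S p →
      FirstKnown v h (concatenate M S S Finset.univ
        ((concatenate M S S S)^[T] ((breadthSearch M)^[k] (PathData.init M)))) p q := by
    intro p hpq F hp
    by_cases hk : q ≤ p + k + 1
    · exact (hshort p q hpq hq F hk).mono (le_concatenate_first _ _ _)
    obtain ⟨w, h1, h2, hw⟩ := hS (q - (k + 1)) (by omega) (F.mono (by omega) (by omega))
    refine FirstKnown.concatenate_step E (by omega) (by omega) hp.1 hw.1 (Finset.mem_univ _) hp.2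
      hw.2.le (F.band hpq hp.2.le (w + 1) (by omega) (by omega)).1
      (firstKnown_concatenate_iterate E hS T p w (by omega) (by omega)
        (F.mono le_rfl (by omega)) hp hw (markedCount_le.trans (by omega)))
      (hshort w q (by omega) hq (F.mono (by omega) le_rfl) (by omega))
  unfold funnelData
  by_cases hk : q ≤ p + k + 1
  · exact ((hshort p q hpq hq F hk).mono (le_concatenate_first _ _ _)).mono
      (le_breadthSearch_iterate_first _)
  -- The final breadth search prepends the at most `k` arcs before the first marked one.
  obtain ⟨p', h1, h2, hp'⟩ := hS p (by omega) (F.mono le_rfl (by omega))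
  exact (hmarked p' (by omega) (F.mono h1 le_rfl) hp').breadthSearch_iterate E hq h1 (by omega) F k
    (by omega)

/-! ### Reversed paths -/

/-- The path backwards. -/
def revPath (ℓ : ℕ) (v : ℕ → Fin n) (i : ℕ) : Fin n := v (ℓ - i)

/-- The heights of the path backwards. -/
def revHeight (ℓ : ℕ) (h : ℕ → ℝ) (i : ℕ) : ℝ := -h (ℓ - i)

theorem arcGain_revHeight {i : ℕ} (hi : i < ℓ) :
    arcGain (revHeight ℓ h) i = arcGain h (ℓ - 1 - i) := by
  unfold arcGain revHeight
  rw [show ℓ - (i + 1) = ℓ - 1 - i by omega, show ℓ - i = ℓ - 1 - i + 1 by omega]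
  ring

theorem ExactGains.rev (E : ExactGains M ℓ v h) :
    ExactGains M.rev ℓ (revPath ℓ v) (revHeight ℓ h) := by
  intro i hi
  rw [arcGain_revHeight hi, ← E (ℓ - 1 - i) (by omega)]
  unfold Table.rev revPath
  rw [show ℓ - (i + 1) = ℓ - 1 - i by omega, show ℓ - i = ℓ - 1 - i + 1 by omega]

theorem firstKnown_rev {p q : ℕ} (hpq : p ≤ q) (hq : q < ℓ) :
    FirstKnown (revPath ℓ v) (revHeight ℓ h) D.rev (ℓ - 1 - q) (ℓ - p) ↔ LastKnown v h D p q := by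
  unfold FirstKnown LastKnown revPath revHeight
  rw [show ℓ - (ℓ - p) = p by omega, show ℓ - (ℓ - 1 - q) = q + 1 by omega,
    show ℓ - (ℓ - 1 - q + 1) = q by omega, show -h p - -h (q + 1) = h (q + 1) - h p by ring]
  rfl

theorem Rising.rev {p q : ℕ} (R : Rising h p (q + 1)) (hq : q < ℓ) :
    Falling (revHeight ℓ h) (ℓ - 1 - q) (ℓ - p) := by
  intro i h1 h2
  rw [arcGain_revHeight (by omega), arcGain_revHeight (by omega)]
  have := R (ℓ - 1 - (i + 1)) (by omega) (by omega)
  rw [show ℓ - 1 - (i + 1) + 1 = ℓ - 1 - i by omega] at this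
  exact ⟨by rw [mul_comm]; exact this.1, this.2⟩

theorem PathData.rev_breadthSearch_iterate (k : ℕ) :
    ((breadthSearch M)^[k] D).rev = (breadthSearch M.rev)^[k] D.rev := by
  induction k generalizing D with
  | zero => rfl
  | succ k ih => rw [Function.iterate_succ_apply, ih, rev_breadthSearch]; rfl

theorem PathData.rev_concatenate_iterate (U W X : Finset (Fin n)) (k : ℕ) :
    ((concatenate M U W X)^[k] D).rev = (concatenate M.rev U W X)^[k] D.rev := by
  induction k generalizing D with
  | zero => rfl
  | succ k ih => rw [Function.iterate_succ_apply, ih, rev_concatenate]; rfl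

theorem rev_funnelData (k T : ℕ) (S : Finset (Fin n)) :
    (funnelData M k T S).rev = funnelData M.rev k T S := by
  unfold funnelData
  rw [PathData.rev_breadthSearch_iterate, PathData.rev_concatenate,
    PathData.rev_concatenate_iterate, PathData.rev_breadthSearch_iterate, PathData.rev_init]

theorem lastKnown_funnelData {S : Finset (Fin n)} (E : ExactGains M ℓ v h) {k T : ℕ}
    (hS : HitsFunnels ℓ (revPath ℓ v) (revHeight ℓ h) S k) (hT : ℓ ≤ 2 ^ T) {p q : ℕ}
    (hpq : p ≤ q) (hq : q < ℓ) (F : Rising h p (q + 1)) :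
    LastKnown v h (funnelData M k T S) p q := by
  rw [← firstKnown_rev hpq hq, rev_funnelData]
  exact firstKnown_funnelData E.rev hS hT (by omega) (by omega) (F.rev hq)

end Funnels

/-! ### Arc-bounded paths with few breaks -/

section ArcSearch

variable {n : ℕ} {M : Table n} {ℓ : ℕ} {v : ℕ → Fin n} {h : ℕ → ℝ} {D : PathData n}

/-- Every interior arc outside of `Bk` alternates with its neighbours, and is not the smallest. -/
def Breaks (ℓ : ℕ) (h : ℕ → ℝ) (Bk : Finset ℕ) : Prop :=
  ∀ i < ℓ, i ∉ Bk → 1 ≤ i ∧ i + 2 ≤ ℓ ∧ ¬ Reducible h (i - 1)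

theorem Breaks.alternating {Bk : Finset ℕ} (hB : Breaks ℓ h Bk) {i : ℕ} (hi : i < ℓ)
    (hb : i ∉ Bk) : 1 ≤ i ∧ i + 2 ≤ ℓ ∧ arcGain h (i - 1) * arcGain h i < 0 ∧
      arcGain h i * arcGain h (i + 1) < 0 ∧
      (|arcGain h i| ≤ |arcGain h (i - 1)| → |arcGain h (i + 1)| < |arcGain h i|) := by
  obtain ⟨h1, h2, h3⟩ := hB i hi hb
  unfold Reducible at h3
  rw [show i - 1 + 1 = i by omega, show i - 1 + 2 = i + 1 by omega] at h3
  push Not at h3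
  exact ⟨h1, h2, h3.1, h3.2.1, h3.2.2⟩

theorem Breaks.falling {Bk : Finset ℕ} (hB : Breaks ℓ h Bk) {p q : ℕ} (hq : q ≤ ℓ)
    (hb : ∀ i, p < i → i < q → i ∉ Bk)
    (hp : p + 1 < q → |arcGain h (p + 1)| ≤ |arcGain h p|) : Falling h p q := by
  intro i hi
  induction i, hi using Nat.le_induction with
  | base =>
    intro hq'
    have := hB.alternating (i := p + 1) (by omega) (hb _ (by omega) hq')
    exact ⟨this.2.2.1, hp hq'⟩
  | succ i hi ih =>
    intro hq'
    have := hB.alternating (i := i + 1) (by omega) (hb _ (by omega) (by omega))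
    exact ⟨this.2.2.2.1, (this.2.2.2.2 (ih (by omega)).2).le⟩

/-- Between breaks, the gains rise and then fall in absolute value. -/
theorem Breaks.unimodal {Bk : Finset ℕ} (hB : Breaks ℓ h Bk) {b x : ℕ} (hbx : b < x) (hx : x ≤ ℓ)
    (hb : ∀ i, b < i → i < x → i ∉ Bk) :
    ∃ s, b ≤ s ∧ s < x ∧ Rising h b (s + 1) ∧ Falling h s x := by
  classical
  -- The peak is the first arc that is not smaller than its successor.
  have hex : ∃ s, b ≤ s ∧ s < x ∧ (s + 1 < x → |arcGain h (s + 1)| ≤ |arcGain h s|) :=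
    ⟨x - 1, by omega, by omega, by omega⟩
  obtain ⟨h1, h2, h3⟩ := Nat.find_spec hex
  refine ⟨Nat.find hex, h1, h2, fun i hi his => ?_,
    hB.falling hx (fun i hi hix => hb i (by omega) hix) h3⟩
  have h4 := Nat.find_min hex (m := i) (by omega)
  push Not at h4
  have h5 := h4 hi (by omega)
  have := hB.alternating (i := i + 1) (by omega) (hb (i + 1) (by omega) (by omega))
  exact ⟨this.2.2.1, h5.2.le⟩

/-- All falling parts are known with their first arcs, all rising parts with their last arcs. -/
def FunnelsKnown (ℓ : ℕ) (v : ℕ → Fin n) (h : ℕ → ℝ) (D : PathData n) : Prop :=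
  (∀ p q, p < q → q ≤ ℓ → Falling h p q → FirstKnown v h D p q) ∧
    ∀ p q, p ≤ q → q < ℓ → Rising h p (q + 1) → LastKnown v h D p q

theorem FunnelsKnown.rev (H : FunnelsKnown ℓ v h D) :
    FunnelsKnown ℓ (revPath ℓ v) (revHeight ℓ h) D.rev := by
  have hv : ∀ i ≤ ℓ, revPath ℓ (revPath ℓ v) i = v i := fun i hi => by
    unfold revPath; congr 1; omega
  have hh : ∀ i ≤ ℓ, revHeight ℓ (revHeight ℓ h) i = h i := fun i hi => by
    unfold revHeight; rw [neg_neg]; congr 1; omega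
  have hg : ∀ i < ℓ, arcGain (revHeight ℓ (revHeight ℓ h)) i = arcGain h i := fun i hi => by
    unfold arcGain; rw [hh _ hi, hh _ hi.le]
  constructor
  · intro p q hpq hq F
    have := (firstKnown_rev (v := v) (h := h) (D := D) (ℓ := ℓ) (p := ℓ - q) (q := ℓ - 1 - p)
      (by omega) (by omega)).2 (H.2 _ _ (by omega) (by omega) ?_)
    · rwa [show ℓ - 1 - (ℓ - 1 - p) = p by omega, show ℓ - (ℓ - q) = q by omega] at this
    · intro i h1 h2
      have := F (ℓ - 1 - (i + 1)) (by omega) (by omega)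
      rw [show ℓ - 1 - (i + 1) + 1 = ℓ - 1 - i by omega, arcGain_revHeight (by omega),
        arcGain_revHeight (by omega), show ℓ - 1 - (ℓ - 1 - i) = i by omega,
        show ℓ - 1 - (ℓ - 1 - (i + 1)) = i + 1 by omega] at this
      exact ⟨by rw [mul_comm]; exact this.1, this.2⟩
  · intro p q hpq hq F
    rw [← firstKnown_rev hpq hq]
    change FirstKnown _ _ D _ _
    have F' := F.rev hq
    have : FirstKnown v h D (ℓ - 1 - q) (ℓ - p) := H.1 _ _ (by omega) (by omega) (by
      intro i h1 h2
      have := F' i h1 h2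
      rwa [hg i (by omega), hg (i + 1) (by omega)] at this)
    unfold FirstKnown at this ⊢
    rwa [hv _ (by omega), hv _ (by omega), hv _ (by omega), hh _ (by omega), hh _ (by omega)]

/-- One iteration of the main loop of the long shortcuts. -/
noncomputable def arcSearch (M : Table n) (T : Finset (Fin n)) (D : PathData n) : PathData n :=
  concatenate M T Finset.univ Finset.univ (concatenateOpposite M T Finset.univ Finset.univ D)

theorem rev_arcSearch (T : Finset (Fin n)) : (arcSearch M T D).rev = arcSearch M.rev T D.rev := by
  unfold arcSearch
  rw [PathData.rev_concatenate, PathData.rev_concatenateOpposite]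

theorem rev_arcSearch_iterate (T : Finset (Fin n)) (k : ℕ) :
    ((arcSearch M T)^[k] D).rev = (arcSearch M.rev T)^[k] D.rev := by
  induction k generalizing D with
  | zero => rfl
  | succ k ih => rw [Function.iterate_succ_apply, ih, rev_arcSearch]; rfl

theorem le_arcSearch_first (T : Finset (Fin n)) (a b c : Fin n) {k : EReal}
    (hk : k ≤ 0 ∨ ¬ M a b < 0) (hD : k ≤ D.first a b c) : k ≤ (arcSearch M T D).first a b c :=
  (le_concatenateOpposite_first _ _ _ _ _ _ hk hD).trans (le_concatenate_first _ _ _ _ _ _)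

theorem le_arcSearch_last (T : Finset (Fin n)) (a b c : Fin n) {k : EReal}
    (hk : k ≤ 0 ∨ ¬ M b c < 0) (hD : k ≤ D.last a b c) : k ≤ (arcSearch M T D).last a b c := by
  have := le_arcSearch_first (M := M.rev) (D := D.rev) T c b a hk hD
  rwa [← rev_arcSearch] at this

/-- A part that is bounded by a descending first arc has a nonpositive gain, so the assignments of 0
cannot spoil it; entries with other first arcs are never reset. -/
theorem FirstKnown.bounded (E : ExactGains M ℓ v h) {p q : ℕ} (hp : p < ℓ)
    (hb : arcGain h p < 0 → h q ≤ h p) :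
    ((h q - h p : ℝ) : EReal) ≤ 0 ∨ ¬ M (v p) (v (p + 1)) < 0 := by
  rw [E p hp]
  by_cases h0 : arcGain h p < 0
  · left; have := hb h0; exact_mod_cast (by linarith)
  · right; exact_mod_cast h0

theorem FunnelsKnown.concatenateOpposite (E : ExactGains M ℓ v h) (H : FunnelsKnown ℓ v h D)
    (T : Finset (Fin n)) : FunnelsKnown ℓ v h (concatenateOpposite M T Finset.univ Finset.univ D) := by
  refine ⟨fun p q hpq hq F => le_concatenateOpposite_first _ _ _ _ _ _
    (FirstKnown.bounded E (by omega) fun h0 => (F.band hpq h0.le q hpq.le le_rfl).2)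
    (H.1 p q hpq hq F), fun p q hpq hq F => ?_⟩
  have h1 := le_concatenateOpposite_first (M := M.rev) (D₀ := D.rev) T Finset.univ Finset.univ
    (v (q + 1)) (v q) (v p) (k := ((h (q + 1) - h p : ℝ) : EReal)) ?_ (H.2 p q hpq hq F)
  · rwa [← PathData.rev_concatenateOpposite] at h1
  · have F' := F.rev hq
    have := FirstKnown.bounded (p := ℓ - 1 - q) (q := ℓ - p) E.rev (by omega)
      fun h0 => (F'.band (by omega) h0.le (ℓ - p) (by omega) le_rfl).2
    unfold revHeight revPath at this
    rwa [show ℓ - (ℓ - p) = p by omega, show ℓ - (ℓ - 1 - q) = q + 1 by omega,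
      show ℓ - (ℓ - 1 - q + 1) = q by omega, show -h p - -h (q + 1) = h (q + 1) - h p by ring]
      at this

theorem FunnelsKnown.arcSearch (E : ExactGains M ℓ v h) (H : FunnelsKnown ℓ v h D)
    (T : Finset (Fin n)) : FunnelsKnown ℓ v h (arcSearch M T D) := by
  have H' := H.concatenateOpposite E T
  refine ⟨fun p q hpq hq F => (H'.1 p q hpq hq F).mono (le_concatenate_first _ _ _),
    fun p q hpq hq F => ?_⟩
  have h1 := (H'.2 p q hpq hq F).trans (le_concatenate_first (M := M.rev)
    (D₀ := (_root_.concatenateOpposite M T Finset.univ Finset.univ D).rev) T Finset.univ Finset.univ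
    (v (q + 1)) (v q) (v p))
  rwa [← PathData.rev_concatenate] at h1

theorem FunnelsKnown.arcSearch_iterate (E : ExactGains M ℓ v h) (H : FunnelsKnown ℓ v h D)
    (T : Finset (Fin n)) (k : ℕ) : FunnelsKnown ℓ v h ((_root_.arcSearch M T)^[k] D) := by
  induction k with
  | zero => exact H
  | succ k ih => rw [Function.iterate_succ_apply']; exact ih.arcSearch E T

/-- One iteration gets over a unimodal part of an arc-bounded path. -/
theorem FirstKnown.arcSearch_step (E : ExactGains M ℓ v h) (H : FunnelsKnown ℓ v h D)
    (hinj : ∀ i ≤ ℓ, ∀ j ≤ ℓ, v i = v j → i = j) {T : Finset (Fin n)} {p b s x : ℕ}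
    (hu : v p ∈ T) (hp : arcGain h p < 0) (hpb : p < b) (hbs : b ≤ s) (hsx : s < x) (hx : x ≤ ℓ)
    (hband : ∀ j, p ≤ j → j ≤ x → h (p + 1) ≤ h j ∧ h j ≤ h p)
    (Rb : Rising h b (s + 1)) (Fs : Falling h s x) (K : FirstKnown v h D p b) :
    FirstKnown v h (arcSearch M T D) p x := by
  -- The rising half ends with an ascent, which bounds it: a concatenation of opposite directions.
  have opp : ∀ s', b ≤ s' → s' < x → Rising h b (s' + 1) → 0 ≤ arcGain h s' →
      FirstKnown v h (concatenateOpposite M T Finset.univ Finset.univ D) p (s' + 1) := by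
    intro s' h1 h2 R' hs'
    have b1 := hband s' (by omega) (by omega)
    have b2 := hband (s' + 1) (by omega) (by omega)
    have b3 := hband b (by omega) (by omega)
    have := concatenateOpposite_step (D₀ := D) hu (Finset.mem_univ (v b))
      (Finset.mem_univ (v (s' + 1))) (fun e => by
        have := hinj b (by omega) (s' + 1) (by omega) e
        omega) (E p (by omega)) hp (E s' (by omega)) hs'
        (e := h b - h p) (e' := h (s' + 1) - h b)
        (by unfold arcGain; linarith) (by unfold arcGain; linarith) (by linarith) (by linarith)
        K (H.2 b s' h1 (by omega) R')
    unfold FirstKnown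
    refine le_trans ?_ this
    exact_mod_cast (by linarith)
  have H' := H.concatenateOpposite E T
  -- The falling half starts with a descent, which bounds it: a concatenation of the same direction.
  have cat : ∀ w, p < w → w < x → arcGain h w ≤ 0 → Falling h w x →
      FirstKnown v h (concatenateOpposite M T Finset.univ Finset.univ D) p w →
      FirstKnown v h (arcSearch M T D) p x := fun w h1 h2 h3 h4 h5 =>
    FirstKnown.concatenate_step E (by omega) (by omega) hu (Finset.mem_univ _) (Finset.mem_univ _)
      hp h3 (hband (w + 1) (by omega) (by omega)).1 h5 (H'.1 w x h2 hx h4)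
  -- A descending peak arc belongs to the falling half, an ascending one to the rising half. One of
  -- the halves may be empty.
  rcases le_or_gt (arcGain h s) 0 with hs | hs
  · refine cat s (by omega) hsx hs Fs ?_
    rcases hbs.eq_or_lt with rfl | hbs
    · exact le_concatenateOpposite_first _ _ _ _ _ _ (FirstKnown.bounded E (by omega)
        fun _ => (hband b (by omega) (by omega)).2) K
    · obtain ⟨r, rfl⟩ : ∃ r, s = r + 1 := ⟨s - 1, by omega⟩
      have := (Rb r (by omega) (by omega)).1
      exact opp r (by omega) (by omega) (Rb.mono le_rfl (by omega)) (by nlinarith)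
  · have K' := opp s hbs hsx Rb hs.le
    by_cases hx' : s + 1 = x
    · exact (hx' ▸ K' : FirstKnown v h _ p x).mono (le_concatenate_first _ _ _)
    · have := (Fs s le_rfl (by omega)).1
      exact cat (s + 1) (by omega) (by omega) (by nlinarith) (Fs.mono (by omega) le_rfl) K'

/-- Induction on the number of breaks: up to the last break before `x` the part is known, and from
there to `x` it is unimodal, so one more iteration suffices. Without breaks, the part is a funnel.
-/
theorem firstKnown_arcSearch (E : ExactGains M ℓ v h) (H : FunnelsKnown ℓ v h D)
    (hinj : ∀ i ≤ ℓ, ∀ j ≤ ℓ, v i = v j → i = j) {Bk : Finset ℕ} (hB : Breaks ℓ h Bk)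
    {T : Finset (Fin n)} {p q : ℕ} (hq : q ≤ ℓ) (hu : v p ∈ T)
    (hp : arcGain h p < 0) (hpB : p ∉ Bk) (hf : |arcGain h (p + 1)| ≤ |arcGain h p|)
    (hband : ∀ j, p ≤ j → j ≤ q → h (p + 1) ≤ h j ∧ h j ≤ h p) (t : ℕ) :
    ∀ x, p < x → x ≤ q → (Bk ∩ Finset.Ico p x).card ≤ t →
      FirstKnown v h ((arcSearch M T)^[t] D) p x := by
  induction t with
  | zero =>
    intro x h1 h2 h3
    refine H.1 p x h1 (by omega) (hB.falling (by omega) (fun i hi hix hib => ?_) fun _ => hf)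
    have := Finset.card_eq_zero.1 (Nat.le_zero.1 h3)
    exact Finset.notMem_empty i (this ▸ by simp [hib, hix]; omega)
  | succ t ih =>
    intro x h1 h2 h3
    rw [Function.iterate_succ_apply']
    have keep : ∀ b, p < b → b ≤ q → FirstKnown v h ((arcSearch M T)^[t] D) p b →
        FirstKnown v h (arcSearch M T ((arcSearch M T)^[t] D)) p b := fun b hb1 hb2 K =>
      le_arcSearch_first _ _ _ _ (FirstKnown.bounded E (by omega)
        fun _ => (hband b (by omega) (by omega)).2) K
    rcases (Bk ∩ Finset.Ico p x).eq_empty_or_nonempty with h0 | h0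
    · exact keep x h1 h2 (ih x h1 h2 (by simp [h0]))
    obtain ⟨b, hb, hmax⟩ := (Bk ∩ Finset.Ico p x).exists_max_image id h0
    rw [Finset.mem_inter, Finset.mem_Ico] at hb
    have hpb : p < b := lt_of_le_of_ne hb.2.1 fun e => hpB (e ▸ hb.1)
    obtain ⟨s, s1, s2, s3, s4⟩ := hB.unimodal hb.2.2 (by omega : x ≤ ℓ) (fun i hi hix hib => by
      have := hmax i (by rw [Finset.mem_inter, Finset.mem_Ico]; exact ⟨hib, by omega, hix⟩)
      simp only [id] at this
      omega)
    refine FirstKnown.arcSearch_step E (H.arcSearch_iterate E T t) hinj hu hp hpb s1 s2 (by omega)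
      (fun j hj1 hj2 => hband j hj1 (by omega)) s3 s4 (ih b hpb (by omega) ?_)
    have : insert b (Bk ∩ Finset.Ico p b) ⊆ Bk ∩ Finset.Ico p x := by
      intro i hi
      simp only [Finset.mem_insert, Finset.mem_inter, Finset.mem_Ico] at hi ⊢
      rcases hi with rfl | ⟨hi1, hi2, hi3⟩
      · exact hb
      · exact ⟨hi1, hi2, by omega⟩
    have := Finset.card_le_card this
    rw [Finset.card_insert_of_notMem (by simp)] at this
    omega

/-- The breaks of the path backwards. -/
def revBreaks (ℓ : ℕ) (Bk : Finset ℕ) : Finset ℕ := (Finset.range ℓ).filter (ℓ - 1 - · ∈ Bk)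

theorem Reducible.of_rev {t : ℕ} (ht : t + 3 ≤ ℓ) (R : Reducible (revHeight ℓ h) t) :
    Reducible h (ℓ - 3 - t) := by
  unfold Reducible at *
  rw [arcGain_revHeight (by omega), arcGain_revHeight (by omega), arcGain_revHeight (by omega),
    show ℓ - 1 - t = ℓ - 3 - t + 2 by omega, show ℓ - 1 - (t + 1) = ℓ - 3 - t + 1 by omega,
    show ℓ - 1 - (t + 2) = ℓ - 3 - t by omega] at R
  rcases R with R | R | R
  · exact Or.inr (Or.inl (by rwa [mul_comm]))
  · exact Or.inl (by rwa [mul_comm])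
  · exact Or.inr (Or.inr ⟨R.2, R.1⟩)

theorem Breaks.rev {Bk : Finset ℕ} (hB : Breaks ℓ h Bk) :
    Breaks ℓ (revHeight ℓ h) (revBreaks ℓ Bk) := by
  intro i hi hb
  obtain ⟨h1, h2, h3⟩ := hB (ℓ - 1 - i) (by omega) (fun hc => hb (by simp [revBreaks, hi, hc]))
  refine ⟨by omega, by omega, fun R => h3 ?_⟩
  have := R.of_rev (by omega)
  rwa [show ℓ - 3 - (i - 1) = ℓ - 1 - i - 1 by omega] at this

theorem card_revBreaks_inter_le (Bk : Finset ℕ) (x p : ℕ) (hp : p < ℓ) :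
    (revBreaks ℓ Bk ∩ Finset.Ico (ℓ - 1 - p) (ℓ - x)).card ≤ (Bk ∩ Finset.Ico x (p + 1)).card := by
  refine Finset.card_le_card_of_injOn (ℓ - 1 - ·) (fun i hi => ?_) (fun i hi j hj hij => ?_)
  · simp only [revBreaks, Finset.coe_inter, Finset.coe_filter, Finset.mem_range, Finset.coe_Ico,
      Set.mem_inter_iff, Set.mem_ofPred_eq, Set.mem_Ico, Finset.mem_coe] at hi ⊢
    exact ⟨hi.1.2, by omega, by omega⟩
  · simp only [revBreaks, Finset.coe_inter, Finset.coe_filter, Finset.mem_range, Finset.coe_Ico,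
      Set.mem_inter_iff, Set.mem_ofPred_eq, Set.mem_Ico] at hi hj hij
    omega

theorem lastKnown_arcSearch (E : ExactGains M ℓ v h) (H : FunnelsKnown ℓ v h D)
    (hinj : ∀ i ≤ ℓ, ∀ j ≤ ℓ, v i = v j → i = j) {Bk : Finset ℕ} (hB : Breaks ℓ h Bk)
    {T : Finset (Fin n)} {x p : ℕ} (hpℓ : p < ℓ) (hu : v (p + 1) ∈ T)
    (hp : arcGain h p < 0) (hpB : p ∉ Bk) (hf : |arcGain h (p - 1)| ≤ |arcGain h p|)
    (hxp : x ≤ p) (hband : ∀ j, x ≤ j → j ≤ p + 1 → h (p + 1) ≤ h j ∧ h j ≤ h p) (t : ℕ)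
    (ht : (Bk ∩ Finset.Ico x (p + 1)).card ≤ t) :
    LastKnown v h ((arcSearch M T)^[t] D) x p := by
  have h1 := hB.alternating hpℓ hpB
  rw [← firstKnown_rev hxp hpℓ, rev_arcSearch_iterate]
  refine firstKnown_arcSearch E.rev H.rev (fun i hi j hj hij => ?_) hB.rev (by omega) ?_ ?_ ?_ ?_
    (fun j hj1 hj2 => ?_) t (ℓ - x) (by omega) (by omega : ℓ - x ≤ ℓ - x)
    ((card_revBreaks_inter_le Bk x p hpℓ).trans ht)
  · have := hinj (ℓ - i) (by omega) (ℓ - j) (by omega) hij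
    omega
  · unfold revPath; rwa [show ℓ - (ℓ - 1 - p) = p + 1 by omega]
  · rwa [arcGain_revHeight (by omega), show ℓ - 1 - (ℓ - 1 - p) = p by omega]
  · simp only [revBreaks, Finset.mem_filter, not_and]
    intro _
    rwa [show ℓ - 1 - (ℓ - 1 - p) = p by omega]
  · rwa [arcGain_revHeight (by omega), arcGain_revHeight (by omega),
      show ℓ - 1 - (ℓ - 1 - p) = p by omega, show ℓ - 1 - (ℓ - 1 - p + 1) = p - 1 by omega]
  · unfold revHeight
    rw [show ℓ - (ℓ - 1 - p) = p + 1 by omega, show ℓ - (ℓ - 1 - p + 1) = p by omega]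
    have := hband (ℓ - j) (by omega) (by omega)
    constructor <;> linarith

end ArcSearch

/-! ### Long shortcuts along arc-bounded paths -/

section LongJumps

variable {n : ℕ} {M : Table n} {up : Prop} {B d w : ℝ} {x y : Fin n} {ℓ : ℕ} {v : ℕ → Fin n}
  {h : ℕ → ℝ} {D : PathData n} {T : Finset (Fin n)}

/-- The first vertex after the arc `p` where the path leaves the band of this arc. -/
noncomputable def fwdEnd (ℓ : ℕ) (h : ℕ → ℝ) (p : ℕ) : ℕ :=
  sInf {q | p + 1 < q ∧ (ℓ ≤ q ∨ ¬ (h (p + 1) ≤ h q ∧ h q ≤ h p))}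

/-- The last vertex before the arc `p` where the path is outside of the band of this arc. -/
noncomputable def bwdStart (ℓ : ℕ) (h : ℕ → ℝ) (p : ℕ) : ℕ :=
  ℓ - fwdEnd ℓ (revHeight ℓ h) (ℓ - 1 - p)

theorem fwdEnd_spec {p : ℕ} (hp : p + 2 ≤ ℓ) (hm : arcGain h p ≤ 0) :
    p + 1 < fwdEnd ℓ h p ∧ fwdEnd ℓ h p ≤ ℓ ∧
      (fwdEnd ℓ h p = ℓ ∨ ¬ (h (p + 1) ≤ h (fwdEnd ℓ h p) ∧ h (fwdEnd ℓ h p) ≤ h p)) ∧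
      ∀ j, p ≤ j → j < fwdEnd ℓ h p → h (p + 1) ≤ h j ∧ h j ≤ h p := by
  have hℓ : ℓ ∈ {q | p + 1 < q ∧ (ℓ ≤ q ∨ ¬ (h (p + 1) ≤ h q ∧ h q ≤ h p))} :=
    ⟨by omega, Or.inl le_rfl⟩
  have h1 : fwdEnd ℓ h p ∈ {q | p + 1 < q ∧ (ℓ ≤ q ∨ ¬ (h (p + 1) ≤ h q ∧ h q ≤ h p))} :=
    Nat.sInf_mem ⟨ℓ, hℓ⟩
  have h2 : fwdEnd ℓ h p ≤ ℓ := Nat.sInf_le hℓ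
  refine ⟨h1.1, h2, h1.2.imp_left h2.antisymm, fun j hj1 hj2 => ?_⟩
  unfold arcGain at hm
  by_contra hc
  rcases lt_or_ge (p + 1) j with h3 | h3
  · have : fwdEnd ℓ h p ≤ j := Nat.sInf_le ⟨h3, Or.inr hc⟩
    omega
  · obtain rfl | rfl : j = p ∨ j = p + 1 := by omega
    · exact hc ⟨by linarith, le_rfl⟩
    · exact hc ⟨le_rfl, by linarith⟩

theorem bwdStart_spec {p : ℕ} (h1p : 1 ≤ p) (hp : p + 1 ≤ ℓ) (hm : arcGain h p ≤ 0) :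
    bwdStart ℓ h p < p ∧
      (bwdStart ℓ h p = 0 ∨ ¬ (h (p + 1) ≤ h (bwdStart ℓ h p) ∧ h (bwdStart ℓ h p) ≤ h p)) ∧
      ∀ j, bwdStart ℓ h p < j → j ≤ p + 1 → h (p + 1) ≤ h j ∧ h j ≤ h p := by
  obtain ⟨s1, s2, s3, s4⟩ := fwdEnd_spec (h := revHeight ℓ h) (p := ℓ - 1 - p) (ℓ := ℓ) (by omega)
    (by rwa [arcGain_revHeight (by omega), show ℓ - 1 - (ℓ - 1 - p) = p by omega])
  unfold bwdStart
  generalize fwdEnd ℓ (revHeight ℓ h) (ℓ - 1 - p) = q at *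
  unfold revHeight at s3 s4
  rw [show ℓ - (ℓ - 1 - p) = p + 1 by omega, show ℓ - (ℓ - 1 - p + 1) = p by omega] at s3 s4
  simp only [neg_le_neg_iff] at s3 s4
  refine ⟨by omega, s3.imp (fun e => by omega) fun hc hc' => hc ⟨hc'.2, hc'.1⟩, fun j h1 h2 => ?_⟩
  have := s4 (ℓ - j) (by omega) (by omega)
  rw [show ℓ - (ℓ - j) = j by omega] at this
  exact ⟨this.2, this.1⟩

/-- The arc `p` is at least as long as the next one. -/
def IsFwd (h : ℕ → ℝ) (p : ℕ) : Prop := |arcGain h (p + 1)| ≤ |arcGain h p|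

open Classical in
/-- The start of the arc-bounded part of the path at the arc `p`, in the direction in which the
gains fall, with the arc that leaves the band. -/
noncomputable def partStart (ℓ : ℕ) (h : ℕ → ℝ) (p : ℕ) : ℕ :=
  if IsFwd h p then p else bwdStart ℓ h p

open Classical in
/-- The end of the arc-bounded part of the path at the arc `p`. -/
noncomputable def partEnd (ℓ : ℕ) (h : ℕ → ℝ) (p : ℕ) : ℕ :=
  if IsFwd h p then fwdEnd ℓ h p else p + 1

open Classical in
/-- The vertex at which the arc-bounded part of the path at the arc `p` starts or ends. -/
noncomputable def marker (v : ℕ → Fin n) (h : ℕ → ℝ) (p : ℕ) : Fin n :=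
  if IsFwd h p then v p else v (p + 1)

open Classical in
/-- The arc-bounded part of the path at the arc `p` is known. -/
def PartKnown (ℓ : ℕ) (v : ℕ → Fin n) (h : ℕ → ℝ) (D : PathData n) (p : ℕ) : Prop :=
  if IsFwd h p then FirstKnown v h D p (fwdEnd ℓ h p - 1) else LastKnown v h D (bwdStart ℓ h p + 1) p

theorem part_spec {p : ℕ} (h1 : 1 ≤ p) (h2 : p + 2 ≤ ℓ) (hm : arcGain h p ≤ 0) :
    partStart ℓ h p ≤ p ∧ p < partEnd ℓ h p ∧ partEnd ℓ h p ≤ ℓ ∧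
      partStart ℓ h p + 2 ≤ partEnd ℓ h p := by
  obtain ⟨s1, s2, -⟩ := fwdEnd_spec h2 hm
  obtain ⟨t1, -⟩ := bwdStart_spec (ℓ := ℓ) h1 (by omega) hm
  unfold partStart partEnd
  split_ifs <;> omega

/-- Suitable heights at the ends of a route that need not climb. -/
theorem Route.exists_end_heights (R : Route M up d w x y ℓ v h) (hup : ¬ up) (hw : w ≤ -d)
    (hℓ : 0 < ℓ) : ∃ k, Route M up d w x y ℓ v k ∧ (∀ i, 0 < i → i < ℓ → k i = h i) ∧
      h 0 ≤ k 0 ∧ k ℓ ≤ h ℓ ∧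
      (∀ p < ℓ, (∀ j, p ≤ j → j ≤ ℓ → h (p + 1) ≤ h j ∧ h j ≤ h p) → k ℓ ≤ h (p + 1)) ∧
      (∀ p < ℓ, (∀ j ≤ p + 1, h (p + 1) ≤ h j ∧ h j ≤ h p) → h p ≤ k 0) := by
  obtain ⟨a, ha, hamax⟩ := (Finset.range (ℓ + 1)).exists_max_image h ⟨0, by simp⟩
  obtain ⟨c, hc, hcmin⟩ := (Finset.range (ℓ + 1)).exists_min_image h ⟨0, by simp⟩
  obtain ⟨⟨i₀, j₀⟩, hij, hmax⟩ := (((Finset.range (ℓ + 1)) ×ˢ (Finset.range (ℓ + 1))).filter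
    (fun q => q.1 ≤ q.2)).exists_max_image (fun q => h q.1 - h q.2) ⟨(0, 0), by simp⟩
  simp only [Finset.mem_filter, Finset.mem_product, Finset.mem_range] at ha hc hij hmax hamax hcmin
  have hd' := R.drop i₀ j₀ hij.2 (by omega)
  set d' := h i₀ - h j₀
  have hD : ∀ i j, i ≤ j → j ≤ ℓ → h i - h j ≤ d' := fun i j h1 h2 =>
    hmax (i, j) ⟨⟨by omega, by omega⟩, h1⟩
  have hA : ∀ i ≤ ℓ, h i ≤ h a := fun i hi => hamax i (by omega)
  have hC : ∀ i ≤ ℓ, h c ≤ h i := fun i hi => hcmin i (by omega)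
  have hd0 : 0 ≤ d' := by simpa using hD 0 0 le_rfl (by omega)
  have hac : d' ≤ h a - h c := by
    have := hA i₀ (by omega)
    have := hC j₀ (by omega)
    simp only [d']; linarith
  have h0 : h 0 ≤ h c + d' := by linarith [hD 0 c (by omega) (by omega)]
  have hl : h a - d' ≤ h ℓ := by linarith [hD a ℓ (by omega) le_rfl]
  -- With the largest actual drop `d'`, the start is lifted to the lowest height plus `d'`, and the
  -- end is lowered to the highest height minus `d'`. These are the extreme changes that keep the
  -- drop between an end and an inner vertex within `d'`, and they serve all arcs `p` at once.
  let k : ℕ → ℝ := fun i => if i = 0 then h c + d' else if i = ℓ then h a - d' else h i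
  have k0 : k 0 = h c + d' := by simp [k]
  have kℓ : k ℓ = h a - d' := by simp [k, hℓ.ne']
  have ki : ∀ i, 0 < i → i < ℓ → k i = h i := fun i h1 h2 => by
    simp [k, h1.ne', h2.ne]
  refine ⟨k, R.modify hup hw (fun i hi => ?_) (fun i j hij hj => ?_), ki, ?_, ?_, ?_, ?_⟩
  · have e1 : k (i + 1) ≤ h (i + 1) := by
      by_cases e : i + 1 = ℓ
      · rw [e, kℓ]; exact hl
      · rw [ki _ (by omega) (by omega)]
    have e2 : h i ≤ k i := by
      rcases Nat.eq_zero_or_pos i with rfl | e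
      · rw [k0]; exact h0
      · rw [ki _ e hi]
    linarith
  · rcases hij.eq_or_lt with rfl | hij
    · linarith
    have e1 : k i = h c + d' ∧ i = 0 ∨ k i = h i := by
      rcases Nat.eq_zero_or_pos i with rfl | e
      · exact Or.inl ⟨k0, rfl⟩
      · exact Or.inr (ki _ e (by omega))
    have e2 : k j = h a - d' ∨ k j = h j := by
      rcases hj.eq_or_lt with rfl | e
      · exact Or.inl kℓ
      · exact Or.inr (ki _ (by omega) e)
    have := hA i (by omega)
    have := hC j hj
    have := hD i j hij.le hj
    rcases e1 with ⟨e1, -⟩ | e1 <;> rcases e2 with e2 | e2 <;> rw [e1, e2] <;> linarith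
  · rw [k0]; exact h0
  · rw [kℓ]; exact hl
  · intro p hp hband
    rw [kℓ]
    -- If the highest vertex comes before the foot of the arc, the drop from it to the foot is at
    -- most `d'`. If it comes later, it lies in the band, so the head start `h p` of the arc is a
    -- highest point, too.
    rcases le_total a (p + 1) with h1 | h1
    · linarith [hD a (p + 1) h1 (by omega)]
    · linarith [(hband a (by omega) (by omega)).2, hD p (p + 1) (by omega) (by omega)]
  · intro p hp hband
    rw [k0]
    rcases le_total p c with h1 | h1
    · linarith [hD p c h1 (by omega)]
    · linarith [(hband c (by omega)).1, hD p (p + 1) (by omega) (by omega)]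

/-- The known part reaches the last vertex in the band, and one further arc leaves the band or ends
the path. Leaving above gives a shortcut from the foot of the arc `p`, leaving below one from its
start. A path that ends inside the band only yields the gain of the arc `p`; a climbing route cannot
do this, as its end would be lower than its vertex `p`. -/
theorem Route.jump_fwd (R : Route M up d w x y ℓ v h) (E : ExactGains M ℓ v h) (hd : d ≤ B)
    {p : ℕ} (h2 : p + 2 ≤ ℓ) (hm : arcGain h p < 0) (hT : v p ∈ T)
    (K : FirstKnown v h D p (fwdEnd ℓ h p - 1)) :
    (∃ a, p ≤ a ∧ a ≤ p + 1 ∧ ((h (fwdEnd ℓ h p) - h a : ℝ) : EReal) ≤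
      (arcBoundedToMonotone B M T D).mono (v a) (v (fwdEnd ℓ h p))) ∨
    (¬ up ∧ fwdEnd ℓ h p = ℓ ∧ (∀ j, p ≤ j → j ≤ ℓ → h (p + 1) ≤ h j ∧ h j ≤ h p) ∧
      ((h (p + 1) - h p : ℝ) : EReal) ≤
        (arcBoundedToMonotone B M T D).mono (v p) (v (fwdEnd ℓ h p))) := by
  obtain ⟨s1, s2, s3, s4⟩ := fwdEnd_spec h2 hm.le
  generalize fwdEnd ℓ h p = q at *
  obtain ⟨r, rfl⟩ : ∃ r, q = r + 1 := ⟨q - 1, by omega⟩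
  rw [Nat.add_sub_cancel] at K
  have hsum : h r - h p + arcGain h r = h (r + 1) - h p := by unfold arcGain; ring
  have below := exit_first_below (B := B) hT (E p (by omega)) hm.le (E r (by omega)) K
    (by rw [hsum]; linarith [R.drop p (r + 1) (by omega) s2])
  have above : h p ≤ h (r + 1) → _ := fun hh => exit_first_above (B := B) hT (E p (by omega)) hm.le
    (E r (by omega)) K (by rw [hsum]; linarith)
  rw [hsum] at below above
  rcases le_or_gt (h p) (h (r + 1)) with c1 | c1
  · refine Or.inl ⟨p + 1, by omega, le_rfl, le_trans ?_ (above c1)⟩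
    unfold arcGain
    exact_mod_cast (by linarith)
  rcases lt_or_ge (h (r + 1)) (h (p + 1)) with c2 | c2
  · refine Or.inl ⟨p, le_rfl, by omega, le_trans ?_ below⟩
    rw [min_eq_right (by unfold arcGain; linarith)]
  obtain s3 | s3 := s3
  · refine Or.inr ⟨fun hu => ?_, s3, fun j hj1 hj2 => ?_, le_trans ?_ below⟩
    · have := (R.climb hu p (by omega)).2
      rw [← s3] at this
      linarith
    · rcases hj2.eq_or_lt with e | e
      · rw [e, ← s3]; exact ⟨c2, c1.le⟩
      · exact s4 j hj1 (by omega)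
    · rw [min_eq_left (by unfold arcGain; linarith)]
      rfl
  · exact absurd ⟨c2, c1.le⟩ s3

theorem Route.jump_bwd (R : Route M up d w x y ℓ v h) (E : ExactGains M ℓ v h) (hd : d ≤ B)
    {p : ℕ} (h1 : 1 ≤ p) (h2 : p + 1 ≤ ℓ) (hm : arcGain h p < 0) (hT : v (p + 1) ∈ T)
    (K : LastKnown v h D (bwdStart ℓ h p + 1) p) :
    (∃ b, p ≤ b ∧ b ≤ p + 1 ∧ ((h b - h (bwdStart ℓ h p) : ℝ) : EReal) ≤
      (arcBoundedToMonotone B M T D).mono (v (bwdStart ℓ h p)) (v b)) ∨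
    (¬ up ∧ bwdStart ℓ h p = 0 ∧ (∀ j ≤ p + 1, h (p + 1) ≤ h j ∧ h j ≤ h p) ∧
      ((h (p + 1) - h p : ℝ) : EReal) ≤
        (arcBoundedToMonotone B M T D).mono (v (bwdStart ℓ h p)) (v (p + 1))) := by
  obtain ⟨s1, s3, s4⟩ := bwdStart_spec h1 h2 hm.le
  generalize bwdStart ℓ h p = q at *
  have hsum : h (p + 1) - h (q + 1) + arcGain h q = h (p + 1) - h q := by unfold arcGain; ring
  have below := exit_last_below (B := B) hT (E p (by omega)) hm.le (E q (by omega)) K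
    (by rw [hsum]; linarith [R.drop q (p + 1) (by omega) (by omega)])
  have above : h q ≤ h (p + 1) → _ := fun hh => exit_last_above (B := B) hT (E p (by omega)) hm.le
    (E q (by omega)) K (by rw [hsum]; linarith)
  rw [hsum] at below above
  rcases le_or_gt (h q) (h (p + 1)) with c1 | c1
  · refine Or.inl ⟨p, le_rfl, by omega, le_trans ?_ (above c1)⟩
    unfold arcGain
    exact_mod_cast (by linarith)
  rcases lt_or_ge (h p) (h q) with c2 | c2
  · refine Or.inl ⟨p + 1, by omega, le_rfl, le_trans ?_ below⟩
    rw [min_eq_right (by unfold arcGain; linarith)]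
  obtain s3 | s3 := s3
  · refine Or.inr ⟨fun hu => ?_, s3, fun j hj2 => ?_, le_trans ?_ below⟩
    · have := (R.climb hu (p + 1) (by omega)).1
      rw [← s3] at this
      linarith
    · rcases Nat.eq_zero_or_pos j with e | e
      · rw [e, ← s3]; exact ⟨c1.le, c2⟩
      · exact s4 j (by omega) hj2
    · rw [min_eq_left (by unfold arcGain; linarith)]
      rfl
  · exact absurd ⟨c1.le, c2⟩ s3

/-- The known arc-bounded parts of the path give shortcuts. -/
theorem Route.exists_jumps (R : Route M up d w x y ℓ v h) (E : ExactGains M ℓ v h) (hd : d ≤ B)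
    (hw : ¬ up → w ≤ -d) :
    ∃ k, Route M up d w x y ℓ v k ∧ ∀ p, 1 ≤ p → p + 2 ≤ ℓ → arcGain h p < 0 →
      marker v h p ∈ T → PartKnown ℓ v h D p →
      ∃ a b, partStart ℓ h p ≤ a ∧ a < b ∧ b ≤ partEnd ℓ h p ∧
        partEnd ℓ h p - partStart ℓ h p ≤ b - a + 1 ∧
        ((k b - k a : ℝ) : EReal) ≤ (arcBoundedToMonotone B M T D).mono (v a) (v b) := by
  rcases Nat.eq_zero_or_pos ℓ with rfl | hℓ
  · exact ⟨h, R, fun p _ h2 => by omega⟩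
  have hk : ∃ k, Route M up d w x y ℓ v k ∧ (∀ i, 0 < i → i < ℓ → k i = h i) ∧
      h 0 ≤ k 0 ∧ k ℓ ≤ h ℓ ∧ (¬ up →
      (∀ p < ℓ, (∀ j, p ≤ j → j ≤ ℓ → h (p + 1) ≤ h j ∧ h j ≤ h p) → k ℓ ≤ h (p + 1)) ∧
      (∀ p < ℓ, (∀ j ≤ p + 1, h (p + 1) ≤ h j ∧ h j ≤ h p) → h p ≤ k 0)) := by
    by_cases hup : up
    · exact ⟨h, R, fun _ _ _ => rfl, le_rfl, le_rfl, fun hc => absurd hup hc⟩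
    · obtain ⟨k, k1, k2, k3, k4, k5⟩ := R.exists_end_heights hup (hw hup) hℓ
      exact ⟨k, k1, k2, k3, k4, fun _ => k5⟩
  obtain ⟨k, k1, k2, k3, k4, k5⟩ := hk
  -- The new heights are higher only at the start and lower only at the end, so shortcuts that
  -- realize the old increments realize the new ones.
  have hlow : ∀ i < ℓ, h i ≤ k i := fun i hi => by
    rcases Nat.eq_zero_or_pos i with rfl | e
    · exact k3
    · rw [k2 i e hi]
  have hupp : ∀ i, 0 < i → i ≤ ℓ → k i ≤ h i := fun i hi hi' => by
    rcases hi'.eq_or_lt with rfl | e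
    · exact k4
    · rw [k2 i hi e]
  refine ⟨k, k1, fun p h1 h2 hm hT K => ?_⟩
  unfold marker at hT
  unfold PartKnown at K
  unfold partStart partEnd
  by_cases hf : IsFwd h p
  · rw [if_pos hf] at hT K ⊢
    rw [if_pos hf]
    obtain ⟨s1, s2, -⟩ := fwdEnd_spec h2 hm.le
    rcases R.jump_fwd E hd h2 hm hT K with ⟨a, a1, a2, a3⟩ | ⟨hup, e1, e2, e3⟩
    · refine ⟨a, _, a1, by omega, le_rfl, by omega, le_trans ?_ a3⟩
      have := hlow a (by omega)
      have := hupp (fwdEnd ℓ h p) (by omega) s2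
      exact_mod_cast (by linarith)
    · refine ⟨p, _, le_rfl, by omega, le_rfl, by omega, le_trans ?_ e3⟩
      have := (k5 hup).1 p (by omega) e2
      rw [e1, k2 p (by omega) (by omega)]
      exact_mod_cast (by linarith)
  · rw [if_neg hf] at hT K ⊢
    rw [if_neg hf]
    obtain ⟨s1, -⟩ := bwdStart_spec (ℓ := ℓ) h1 (by omega) hm.le
    rcases R.jump_bwd E hd h1 (by omega) hm hT K with ⟨b, b1, b2, b3⟩ | ⟨hup, e1, e2, e3⟩
    · refine ⟨_, b, le_rfl, by omega, b2, by omega, le_trans ?_ b3⟩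
      have := hlow (bwdStart ℓ h p) (by omega)
      have := hupp b (by omega) (by omega)
      exact_mod_cast (by linarith)
    · refine ⟨_, p + 1, le_rfl, by omega, le_rfl, by omega, le_trans ?_ e3⟩
      have := (k5 hup).2 p (by omega) e2
      rw [e1, k2 (p + 1) (by omega) (by omega)]
      exact_mod_cast (by linarith)

/-- The known parts of the path, if they are long, shorten the route by a part of the length of
their union. -/
theorem Route.long_many (R : Route M up d w x y ℓ v h) (E : ExactGains M ℓ v h) (hd : d ≤ B)
    (hw : ¬ up → w ≤ -d) (hMD : M ≤ D.mono) (J : Finset ℕ)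
    (hJ : ∀ p ∈ J, 1 ≤ p ∧ p + 2 ≤ ℓ ∧ arcGain h p < 0 ∧ marker v h p ∈ T ∧ PartKnown ℓ v h D p ∧
      partStart ℓ h p + 4 ≤ partEnd ℓ h p) {k : ℕ}
    (hk : 6 * k ≤ (J.biUnion fun p => Finset.Ico (partStart ℓ h p) (partEnd ℓ h p)).card) :
    HasRoute (arcBoundedToMonotone B M T D).mono up d w x y (ℓ - k) := by
  obtain ⟨h', R', hjump⟩ := R.exists_jumps (T := T) (D := D) (B := B) E hd hw
  obtain ⟨J', hJ', hdis, hcard⟩ := exists_disjoint_intervals J (partStart ℓ h) (partEnd ℓ h)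
  have hex : ∀ p : ℕ, ∃ ab : ℕ × ℕ, p ∈ J → partStart ℓ h p ≤ ab.1 ∧ ab.1 < ab.2 ∧
      ab.2 ≤ partEnd ℓ h p ∧ partEnd ℓ h p - partStart ℓ h p ≤ ab.2 - ab.1 + 1 ∧
      ((h' ab.2 - h' ab.1 : ℝ) : EReal) ≤
        (arcBoundedToMonotone B M T D).mono (v ab.1) (v ab.2) := by
    intro p
    by_cases hp : p ∈ J
    · obtain ⟨j1, j2, j3, j4, j5, -⟩ := hJ p hp
      obtain ⟨a, b, hab⟩ := hjump p j1 j2 j3 j4 j5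
      exact ⟨(a, b), fun _ => hab⟩
    · exact ⟨(0, 0), fun hc => absurd hc hp⟩
  choose ab hab using hex
  refine (Route.skip_all J' (fun p => (ab p).1) (fun p => (ab p).2) (fun i hi j hj hij => ?_)
    (fun j hj => (hab j (hJ' hj)).2.1) (R'.mono (hMD.trans (le_arcBoundedToMonotone T)))
    (fun j hj => ?_) (fun j hj => (hab j (hJ' hj)).2.2.2.2)).mono le_rfl ?_
  · have h1 := hab i (hJ' hi)
    have h2 := hab j (hJ' hj)
    have := hdis i hi j hj hij
    omega
  · have h1 := hJ j (hJ' hj)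
    have h2 := part_spec h1.1 h1.2.1 h1.2.2.1.le
    have := hab j (hJ' hj)
    omega
  -- A jump may miss one arc of its part and is an arc itself. A part of length at least 4 thus
  -- still saves half of its length; together with the factor 3 for disjointness this gives 6.
  · have : ∑ p ∈ J', (partEnd ℓ h p - partStart ℓ h p) ≤
        ∑ p ∈ J', 2 * ((ab p).2 - (ab p).1 - 1) := by
      refine Finset.sum_le_sum fun p hp => ?_
      have h1 := hJ p (hJ' hp)
      have := hab p (hJ' hp)
      omega
    rw [← Finset.mul_sum] at this
    have h3 := hcard
    omega

end LongJumps

/-! ### Classes of arcs, and the sets that the samples have to hit -/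

section Classes

variable {n : ℕ} {ℓ : ℕ} {v : ℕ → Fin n} {h : ℕ → ℝ} {Bk : Finset ℕ}

open Classical in
/-- The arcs of negative gain that are not breaks. -/
noncomputable def descents (ℓ : ℕ) (h : ℕ → ℝ) (Bk : Finset ℕ) : Finset ℕ :=
  (Finset.range ℓ).filter fun p => p ∉ Bk ∧ arcGain h p < 0

/-- The number of breaks in the arc-bounded part of the path at the arc `p`. -/
noncomputable def breakCount (ℓ : ℕ) (h : ℕ → ℝ) (Bk : Finset ℕ) (p : ℕ) : ℕ :=
  (Bk ∩ Finset.Ico (partStart ℓ h p) (partEnd ℓ h p)).card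

theorem mem_descents {p : ℕ} :
    p ∈ descents ℓ h Bk ↔ p < ℓ ∧ p ∉ Bk ∧ arcGain h p < 0 := by
  simp [descents]

theorem Breaks.descent (hB : Breaks ℓ h Bk) {p : ℕ} (hp : p ∈ descents ℓ h Bk) :
    1 ≤ p ∧ p + 2 ≤ ℓ ∧ arcGain h p < 0 := by
  obtain ⟨h1, h2, h3⟩ := mem_descents.1 hp
  obtain ⟨h4, h5, -⟩ := hB p h1 h2
  exact ⟨h4, h5, h3⟩

/-- Arcs that are not breaks alternate with their neighbours, so each of the pairs `2k`, `2k + 1`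
contains a break or a descent. -/
theorem Breaks.card_descents (hB : Breaks ℓ h Bk) :
    ℓ / 2 ≤ (descents ℓ h Bk).card + Bk.card := by
  classical
  refine le_trans ?_ (Finset.card_union_le _ _)
  have hex : ∀ k : ℕ, ∃ i, (i = 2 * k ∨ i = 2 * k + 1) ∧
      (k < ℓ / 2 → i ∈ descents ℓ h Bk ∪ Bk) := by
    intro k
    by_cases hk : k < ℓ / 2
    · by_cases h1 : 2 * k ∈ Bk
      · exact ⟨2 * k, Or.inl rfl, fun _ => Finset.mem_union_right _ h1⟩
      by_cases h2 : 2 * k + 1 ∈ Bk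
      · exact ⟨2 * k + 1, Or.inr rfl, fun _ => Finset.mem_union_right _ h2⟩
      have := (hB.alternating (i := 2 * k) (by omega) h1).2.2.2.1
      rcases lt_or_ge (arcGain h (2 * k)) 0 with h3 | h3
      · exact ⟨2 * k, Or.inl rfl, fun _ => Finset.mem_union_left _
          (mem_descents.2 ⟨by omega, h1, h3⟩)⟩
      · exact ⟨2 * k + 1, Or.inr rfl, fun _ => Finset.mem_union_left _
          (mem_descents.2 ⟨by omega, h2, by nlinarith⟩)⟩
    · exact ⟨2 * k, Or.inl rfl, fun hc => absurd hc hk⟩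
  choose f hf1 hf2 using hex
  have := Finset.card_le_card_of_injOn (s := Finset.range (ℓ / 2)) f
    (fun k hk => hf2 k (by simpa using hk))
    (fun i _ j _ hij => by
      have := hf1 i
      have := hf1 j
      omega)
  simpa using this

/-- Two descents that are not breaks are never adjacent. So the head of one is not the tail of
another, and a vertex marks only one descent. -/
theorem marker_injOn (hinj : ∀ i ≤ ℓ, ∀ j ≤ ℓ, v i = v j → i = j) (hB : Breaks ℓ h Bk) :
    Set.InjOn (marker v h) (descents ℓ h Bk : Set ℕ) := by
  have key : ∀ i ∈ descents ℓ h Bk, i + 1 ∉ descents ℓ h Bk := by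
    intro i hi hc
    have h1 := mem_descents.1 hi
    have h2 := mem_descents.1 hc
    have := (hB.alternating h1.1 h1.2.1).2.2.2.1
    nlinarith [h1.2.2, h2.2.2]
  intro i hi j hj hij
  have h1 := mem_descents.1 hi
  have h2 := mem_descents.1 hj
  unfold marker at hij
  split_ifs at hij
  · exact hinj i (by omega) j (by omega) hij
  · have := hinj i (by omega) (j + 1) (by omega) hij
    exact absurd (this ▸ hi) (key j hj)
  · have := hinj (i + 1) (by omega) j (by omega) hij
    exact absurd (this ▸ hj) (key i hi)
  · have := hinj (i + 1) (by omega) (j + 1) (by omega) hij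
    omega

/-- Without a break the gains would fall up to the end of the part, and the path would stay in the
band. It cannot run to the end of the path in this way either, since the first and the last arc are
breaks. -/
theorem Breaks.one_le_breakCount (hB : Breaks ℓ h Bk) {p : ℕ} (hp : p ∈ descents ℓ h Bk) :
    1 ≤ breakCount ℓ h Bk p := by
  obtain ⟨h1, h2, h3⟩ := hB.descent hp
  have hpB := (mem_descents.1 hp).2.1
  by_contra hc
  have h0 : Bk ∩ Finset.Ico (partStart ℓ h p) (partEnd ℓ h p) = ∅ :=
    Finset.card_eq_zero.1 (by unfold breakCount at hc; omega)
  have hno : ∀ i, partStart ℓ h p ≤ i → i < partEnd ℓ h p → i ∉ Bk := fun i hi1 hi2 hi3 =>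
    Finset.notMem_empty i (h0 ▸ by simp [hi1, hi2, hi3])
  unfold partStart partEnd at hno
  by_cases hf : IsFwd h p
  · rw [if_pos hf, if_pos hf] at hno
    obtain ⟨s1, s2, s3, s4⟩ := fwdEnd_spec h2 h3.le
    generalize fwdEnd ℓ h p = q at *
    have F : Falling h p q := hB.falling s2 (fun i hi1 hi2 => hno i hi1.le hi2) fun _ => hf
    rcases s3 with s3 | s3
    · have := hB (q - 1) (by omega) (hno (q - 1) (by omega) (by omega))
      omega
    · exact s3 (F.band (by omega) h3.le q (by omega) le_rfl)
  · rw [if_neg hf, if_neg hf] at hno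
    obtain ⟨s1, s2, s3, s4⟩ := fwdEnd_spec (h := revHeight ℓ h) (p := ℓ - 1 - p) (ℓ := ℓ)
      (by omega) (by
        rw [arcGain_revHeight (by omega), show ℓ - 1 - (ℓ - 1 - p) = p by omega]; exact h3.le)
    unfold bwdStart at hno
    generalize fwdEnd ℓ (revHeight ℓ h) (ℓ - 1 - p) = q at *
    have F : Falling (revHeight ℓ h) (ℓ - 1 - p) q := by
      refine hB.rev.falling s2 (fun i hi1 hi2 => ?_) fun _ => ?_
      · simp only [revBreaks, Finset.mem_filter, not_and]
        exact fun _ => hno _ (by omega) (by omega)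
      · rw [arcGain_revHeight (by omega), arcGain_revHeight (by omega),
          show ℓ - 1 - (ℓ - 1 - p) = p by omega, show ℓ - 1 - (ℓ - 1 - p + 1) = p - 1 by omega]
        have := (hB.alternating (by omega) hpB).2.2.2.2
        unfold IsFwd at hf
        by_contra hcon
        exact hf (this (not_le.1 hcon).le).le
    rcases s3 with s3 | s3
    · have := hB 0 (by omega) (hno 0 (by omega) (by omega))
      omega
    · exact s3 (F.band (by omega) (by
        rw [arcGain_revHeight (by omega), show ℓ - 1 - (ℓ - 1 - p) = p by omega]; exact h3.le)
        q (by omega) le_rfl)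

/-- Few arcs have an arc-bounded part with many breaks. -/
theorem Breaks.card_bad (hB : Breaks ℓ h Bk) (Q : ℕ) :
    ((descents ℓ h Bk).filter fun p =>
      partEnd ℓ h p - partStart ℓ h p < Q * breakCount ℓ h Bk p).card ≤ 3 * (Q * Bk.card) := by
  classical
  set J := (descents ℓ h Bk).filter fun p =>
      partEnd ℓ h p - partStart ℓ h p < Q * breakCount ℓ h Bk p
  -- Every bad arc lies in its own part, and a disjoint subfamily covers a third of the union.
  -- Disjoint parts have at most `Bk.card` breaks in total, and bad parts are shorter than `Q` times
  -- their numbers of breaks.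
  obtain ⟨J', hJ', hdis, hcard⟩ := exists_disjoint_intervals J (partStart ℓ h) (partEnd ℓ h)
  have h1 : J ⊆ J.biUnion fun p => Finset.Ico (partStart ℓ h p) (partEnd ℓ h p) := by
    intro p hp
    obtain ⟨k1, k2, k3⟩ := hB.descent (Finset.mem_filter.1 hp).1
    have := part_spec k1 k2 k3.le
    exact Finset.mem_biUnion.2 ⟨p, hp, Finset.mem_Ico.2 ⟨by omega, by omega⟩⟩
  have h2 : ∑ p ∈ J', (partEnd ℓ h p - partStart ℓ h p) ≤ ∑ p ∈ J', Q * breakCount ℓ h Bk p :=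
    Finset.sum_le_sum fun p hp => (Finset.mem_filter.1 (hJ' hp)).2.le
  have h3 : ∑ p ∈ J', breakCount ℓ h Bk p ≤ Bk.card := by
    unfold breakCount
    rw [← Finset.card_biUnion]
    · exact Finset.card_le_card (Finset.biUnion_subset.2 fun p _ => Finset.inter_subset_left)
    · intro i hi j hj hij
      refine Finset.disjoint_of_subset_left Finset.inter_subset_right
        (Finset.disjoint_of_subset_right Finset.inter_subset_right ?_)
      rw [Finset.disjoint_left]
      intro e he1 he2
      rw [Finset.mem_Ico] at he1 he2
      have := hdis i hi j hj hij
      omega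
  rw [← Finset.mul_sum] at h2
  have h4 := Finset.card_le_card h1
  have h5 := Nat.mul_le_mul_left Q h3
  omega

/-- There is a large class of arcs with arc-bounded parts of the same direction, with similar
numbers of breaks and of large length. -/
theorem Breaks.exists_class (hB : Breaks ℓ h Bk) {Q I : ℕ} (hI0 : 0 < I) (hI : ℓ < Q * 2 ^ I) :
    ∃ i < I, ∃ G ⊆ descents ℓ h Bk, ((∀ p ∈ G, IsFwd h p) ∨ ∀ p ∈ G, ¬ IsFwd h p) ∧
      (∀ p ∈ G, breakCount ℓ h Bk p ≤ 2 ^ (i + 1) ∧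
        Q * 2 ^ i ≤ partEnd ℓ h p - partStart ℓ h p) ∧
      ℓ / 2 ≤ 2 * I * G.card + (3 * Q + 1) * Bk.card := by
  classical
  set N := (descents ℓ h Bk).filter fun p =>
      ¬ partEnd ℓ h p - partStart ℓ h p < Q * breakCount ℓ h Bk p with hN
  have h1 := hB.card_descents
  have h2 := hB.card_bad Q
  have h3 := Finset.card_filter_add_card_filter_not (s := descents ℓ h Bk)
      (fun p => partEnd ℓ h p - partStart ℓ h p < Q * breakCount ℓ h Bk p)
  rw [← hN] at h3
  have h4 : ℓ / 2 ≤ N.card + (3 * Q + 1) * Bk.card := by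
    have : (3 * Q + 1) * Bk.card = 3 * (Q * Bk.card) + Bk.card := by ring
    omega
  have hlen : ∀ p ∈ N, Q * breakCount ℓ h Bk p ≤ partEnd ℓ h p - partStart ℓ h p ∧
      1 ≤ breakCount ℓ h Bk p ∧ partEnd ℓ h p ≤ ℓ := fun p hp => by
    rw [hN, Finset.mem_filter] at hp
    obtain ⟨k1, k2, k3⟩ := hB.descent hp.1
    exact ⟨not_lt.1 hp.2, hB.one_le_breakCount hp.1, (part_spec k1 k2 k3.le).2.2.1⟩
  -- Pigeonhole over the binary logarithm of the number of breaks and the direction. There are only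
  -- `I` values of the logarithm, because `Q` times the number of breaks is at most `ℓ < Q * 2 ^ I`.
  obtain ⟨⟨i, b⟩, hi, hcard⟩ := Finset.exists_le_card_fiber_of_nsmul_le_card_of_maps_to
    (s := N) (t := Finset.range I ×ˢ (Finset.univ : Finset Bool))
    (f := fun p => (Nat.log 2 (breakCount ℓ h Bk p), decide (IsFwd h p)))
    (b := (N.card : ℝ) / (2 * I)) (fun p hp => by
      simp only [Finset.mem_product, Finset.mem_range, Finset.mem_univ, and_true]
      obtain ⟨k1, k2, k3⟩ := hlen p hp
      refine Nat.log_lt_of_lt_pow (by omega) (lt_of_mul_lt_mul_left (a := Q) ?_ (Nat.zero_le _))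
      omega) ⟨(0, true), by simp [hI0]⟩ (by
      simp only [Finset.card_product, Finset.card_range, Finset.card_univ, Fintype.card_bool,
        nsmul_eq_mul, Nat.cast_mul, Nat.cast_ofNat]
      have : (0 : ℝ) < I := by exact_mod_cast hI0
      rw [mul_comm (I : ℝ), mul_div_cancel₀]
      positivity)
  simp only [Finset.mem_product, Finset.mem_range, Finset.mem_univ, and_true] at hi
  refine ⟨i, hi, N.filter fun p =>
      (Nat.log 2 (breakCount ℓ h Bk p), decide (IsFwd h p)) = (i, b),
    (Finset.filter_subset _ N).trans (Finset.filter_subset _ _), ?_, ?_,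
    h4.trans (Nat.add_le_add_right ?_ _)⟩
  · cases b
    · exact Or.inr fun p hp => by simpa using (congrArg Prod.snd (Finset.mem_filter.1 hp).2)
    · exact Or.inl fun p hp => by simpa using (congrArg Prod.snd (Finset.mem_filter.1 hp).2)
  · intro p hp
    rw [Finset.mem_filter, Prod.mk.injEq] at hp
    obtain ⟨hp, e, -⟩ := hp
    obtain ⟨k1, k2, k3⟩ := hlen p hp
    rw [← e]
    exact ⟨(Nat.lt_pow_succ_log_self (by norm_num) _).le,
      (Nat.mul_le_mul_left Q (Nat.pow_log_le_self 2 (by omega))).trans k1⟩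
  · have : (0 : ℝ) < I := by exact_mod_cast hI0
    rw [div_le_iff₀ (by positivity)] at hcard
    have h5 : (N.card : ℝ) ≤ ((2 * I * (N.filter fun p =>
      (Nat.log 2 (breakCount ℓ h Bk p), decide (IsFwd h p)) = (i, b)).card : ℕ) : ℝ) := by
      push_cast; linarith
    exact_mod_cast h5

theorem exists_least_subset {ι : Type*} [DecidableEq ι] (s : Finset ι) (f : ι → ℤ) (k : ℕ)
    (hk : k ≤ s.card) : ∃ A ⊆ s, A.card = k ∧ ∀ a ∈ A, ∀ b ∈ s \ A, f a ≤ f b := by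
  induction s using Finset.strongInduction with
  | H s ih =>
    rcases hk.eq_or_lt with rfl | hk
    · exact ⟨s, subset_rfl, rfl, by simp⟩
    obtain ⟨m, hm, hmax⟩ := s.exists_max_image f (Finset.card_pos.1 (by omega))
    obtain ⟨A, hA, hc, hl⟩ := ih (s.erase m) (Finset.erase_ssubset hm)
      (by rw [Finset.card_erase_of_mem hm]; omega)
    refine ⟨A, hA.trans (Finset.erase_subset _ _), hc, fun a ha b hb => ?_⟩
    rw [Finset.mem_sdiff] at hb
    by_cases hbm : b = m
    · exact hbm ▸ hmax a (Finset.mem_of_mem_erase (hA ha))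
    · exact hl a ha b (by simp [hb, hbm])

/-- Few test sets of size `k` are sufficient: a set that hits all of them is followed, in every
block of length `m`, by all but fewer than `k` elements. -/
theorem exists_tests (G : Finset ℕ) {m k : ℕ} (hk : 1 ≤ k) (hG : ∀ p ∈ G, p < ℓ) (f : ℕ → ℤ) :
    ∃ 𝒜 : Finset (Finset ℕ), 𝒜.card ≤ ℓ / m + 1 ∧ (∀ A ∈ 𝒜, A ⊆ G ∧ A.card = k) ∧
      ∀ H : Finset ℕ, (∀ A ∈ 𝒜, ∃ a ∈ A, a ∈ H) → ∀ C : Finset ℕ,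
        (∀ a ∈ H, a ∈ G → ∀ p ∈ G, a / m = p / m → f a ≤ f p → p ∈ C) →
        G.card ≤ C.card + (k - 1) * (ℓ / m + 1) := by
  classical
  have block : ∀ b : ℕ, ∃ 𝒜 : Finset (Finset ℕ), 𝒜.card ≤ 1 ∧ (∀ A ∈ 𝒜, A ⊆ G ∧ A.card = k) ∧
      ∀ H : Finset ℕ, (∀ A ∈ 𝒜, ∃ a ∈ A, a ∈ H) → ∀ C : Finset ℕ,
        (∀ a ∈ H, a ∈ G → ∀ p ∈ G, a / m = p / m → f a ≤ f p → p ∈ C) →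
        (G.filter (fun p => p / m = b)).card ≤ (C.filter (fun p => p / m = b)).card + (k - 1) := by
    intro b
    by_cases hc : (G.filter (fun p => p / m = b)).card < k
    · exact ⟨∅, by simp, by simp, fun H _ C _ => by omega⟩
    -- The test set consists of the `k` least elements of the block. If it is hit, everything else
    -- in the block is covered and so is its own largest element, which leaves at most `k - 1`
    -- elements.
    obtain ⟨A, hA, hcard, hle⟩ := exists_least_subset (G.filter (fun p => p / m = b)) f k (by omega)
    refine ⟨{A}, by simp, by simpa using ⟨hA.trans (Finset.filter_subset _ _), hcard⟩,
      fun H hH C hC => ?_⟩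
    obtain ⟨a, ha, haH⟩ := hH A (by simp)
    obtain ⟨e, he, hemax⟩ := A.exists_max_image f ⟨a, ha⟩
    have haG := Finset.mem_filter.1 (hA ha)
    have hsub : G.filter (fun p => p / m = b) ⊆ C.filter (fun p => p / m = b) ∪ A.erase e := by
      intro p hp
      by_cases hpA : p ∈ A.erase e
      · exact Finset.mem_union_right _ hpA
      refine Finset.mem_union_left _ ?_
      have hpG := Finset.mem_filter.1 hp
      refine Finset.mem_filter.2 ⟨hC a haH haG.1 p hpG.1 (haG.2.trans hpG.2.symm) ?_, hpG.2⟩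
      by_cases hpA' : p ∈ A
      · have : p = e := by
          by_contra hne
          exact hpA (Finset.mem_erase.2 ⟨hne, hpA'⟩)
        exact this ▸ hemax a ha
      · exact hle a ha p (Finset.mem_sdiff.2 ⟨hp, hpA'⟩)
    have := (Finset.card_le_card hsub).trans (Finset.card_union_le _ _)
    rw [Finset.card_erase_of_mem he, hcard] at this
    exact this
  choose 𝒜 h1 h2 h3 using block
  refine ⟨(Finset.range (ℓ / m + 1)).biUnion 𝒜, ?_, ?_, fun H hH C hC => ?_⟩
  · refine Finset.card_biUnion_le.trans ((Finset.sum_le_sum fun b _ => h1 b).trans (by simp))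
  · intro A hA
    obtain ⟨b, -, hb⟩ := Finset.mem_biUnion.1 hA
    exact h2 b A hb
  · have e1 : G.card = ∑ b ∈ Finset.range (ℓ / m + 1), (G.filter (fun p => p / m = b)).card :=
      Finset.card_eq_sum_card_fiberwise fun p hp => by
        have := hG p hp
        simp only [Finset.coe_range, Set.mem_Iio]
        exact Nat.lt_succ_of_le (Nat.div_le_div_right this.le)
    have e2 : ∑ b ∈ Finset.range (ℓ / m + 1), (C.filter (fun p => p / m = b)).card ≤ C.card := by
      rw [← Finset.card_biUnion]
      · exact Finset.card_le_card (Finset.biUnion_subset.2 fun b _ => Finset.filter_subset _ _)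
      · intro i _ j _ hij
        refine Finset.disjoint_left.2 fun p hp1 hp2 => ?_
        exact hij ((Finset.mem_filter.1 hp1).2.symm.trans (Finset.mem_filter.1 hp2).2)
    have e3 := Finset.sum_le_sum (s := Finset.range (ℓ / m + 1)) fun b hb => h3 b H
      (fun A hA => hH A (Finset.mem_biUnion.2 ⟨b, hb, hA⟩)) C hC
    rw [Finset.sum_add_distrib, Finset.sum_const, Finset.card_range, smul_eq_mul] at e3
    rw [e1]
    have : (ℓ / m + 1) * (k - 1) = (k - 1) * (ℓ / m + 1) := mul_comm _ _
    omega

/-- The test sets of vertices for a class of arcs. -/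
theorem exists_vertex_tests (hinj : ∀ i ≤ ℓ, ∀ j ≤ ℓ, v i = v j → i = j) (hB : Breaks ℓ h Bk)
    {G : Finset ℕ} (hG : G ⊆ descents ℓ h Bk)
    (hdir : (∀ p ∈ G, IsFwd h p) ∨ ∀ p ∈ G, ¬ IsFwd h p) {m k : ℕ} (hm : 0 < m) (hk : 1 ≤ k)
    (hlen : ∀ p ∈ G, m ≤ partEnd ℓ h p - partStart ℓ h p) :
    ∃ 𝒲 : Finset (Finset (Fin n)), 𝒲.card ≤ ℓ / m + 1 ∧ (∀ W ∈ 𝒲, W.card = k) ∧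
      ∀ T : Finset (Fin n), (∀ W ∈ 𝒲, ∃ a ∈ W, a ∈ T) → G.card ≤
        ((G.filter (marker v h · ∈ T)).biUnion
          fun p => Finset.Ico (partStart ℓ h p) (partEnd ℓ h p)).card +
        (k - 1) * (ℓ / m + 1) := by
  classical
  have hGℓ : ∀ p ∈ G, p < ℓ := fun p hp => (mem_descents.1 (hG hp)).1
  -- Arcs of one block have distance less than `m`, the least length of a part. Ordered in the
  -- direction of the class, all arcs of the block that come after a sampled one lie in its part.
  have key : ∃ f : ℕ → ℤ, ∀ a ∈ G, ∀ p ∈ G, a / m = p / m → f a ≤ f p →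
      p ∈ Finset.Ico (partStart ℓ h a) (partEnd ℓ h a) := by
    have hdiv : ∀ a p : ℕ, a / m = p / m → p < a + m ∧ a < p + m := fun a p e => by
      have e1 := Nat.div_add_mod a m
      have e2 := Nat.div_add_mod p m
      have e3 := Nat.mod_lt a hm
      have e4 := Nat.mod_lt p hm
      rw [e] at e1
      omega
    rcases hdir with hd | hd
    · refine ⟨fun i => i, fun a ha p hp e hle => ?_⟩
      have h1 := hlen a ha
      have h2 := hdiv a p e
      have h3 : partStart ℓ h a = a := if_pos (hd a ha)
      simp only [Nat.cast_le] at hle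
      rw [Finset.mem_Ico]
      omega
    · refine ⟨fun i => -i, fun a ha p hp e hle => ?_⟩
      have h1 := hlen a ha
      have h2 := hdiv a p e
      have h3 : partEnd ℓ h a = a + 1 := if_neg (hd a ha)
      simp only [neg_le_neg_iff, Nat.cast_le] at hle
      rw [Finset.mem_Ico]
      omega
  obtain ⟨f, hf⟩ := key
  obtain ⟨𝒜, h1, h2, h3⟩ := exists_tests G (m := m) hk hGℓ f
  refine ⟨𝒜.image fun A => A.image (marker v h), Finset.card_image_le.trans h1, ?_, ?_⟩
  · intro W hW
    obtain ⟨A, hA, rfl⟩ := Finset.mem_image.1 hW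
    rw [Finset.card_image_of_injOn, (h2 A hA).2]
    exact (marker_injOn hinj hB).mono fun p hp => hG ((h2 A hA).1 hp)
  · intro T hT
    refine h3 (G.filter (marker v h · ∈ T)) (fun A hA => ?_) _ fun a ha haG p hp e hle => ?_
    · obtain ⟨b, hb, hbT⟩ := hT _ (Finset.mem_image_of_mem _ hA)
      obtain ⟨a, ha, rfl⟩ := Finset.mem_image.1 hb
      exact ⟨a, ha, Finset.mem_filter.2 ⟨(h2 A hA).1 ha, hbT⟩⟩
    · exact Finset.mem_biUnion.2 ⟨a, ha, hf a haG p hp e hle⟩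

end Classes

/-! ### Failure probabilities -/

namespace PMF

variable {α β : Type*}

/-- The probability that `P` does not hold. -/
noncomputable def fail (μ : PMF α) (P : α → Prop) : ℝ≥0∞ := μ.toOuterMeasure {x | ¬ P x}

/-- The expectation of a nonnegative function. -/
noncomputable def expect (μ : PMF α) (φ : α → ℝ≥0∞) : ℝ≥0∞ := ∑' x, μ x * φ x

theorem fail_le_one (μ : PMF α) (P : α → Prop) : μ.fail P ≤ 1 := by
  unfold fail
  rw [toOuterMeasure_apply, ← μ.tsum_coe]
  exact ENNReal.tsum_le_tsum fun x => Set.indicator_le_self _ _ _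

theorem fail_eq_zero {μ : PMF α} {P : α → Prop} : μ.fail P = 0 ↔ ∀ x ∈ μ.support, P x := by
  unfold fail
  rw [toOuterMeasure_apply_eq_zero_iff, Set.disjoint_left]
  exact ⟨fun h x hx => by simpa using h hx, fun h x hx hc => hc (h x hx)⟩

theorem fail_mono {μ : PMF α} {P Q : α → Prop} (h : ∀ x ∈ μ.support, P x → Q x) :
    μ.fail Q ≤ μ.fail P :=
  toOuterMeasure_mono _ fun x hx => fun hP => hx.1 (h x hx.2 hP)

theorem fail_map (μ : PMF α) (f : α → β) (P : β → Prop) :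
    (μ.map f).fail P = μ.fail fun x => P (f x) := by
  unfold fail
  rw [toOuterMeasure_map_apply]
  rfl

theorem fail_bind (μ : PMF α) (f : α → PMF β) (P : β → Prop) :
    (μ.bind f).fail P = μ.expect fun x => (f x).fail P := toOuterMeasure_bind_apply _ _ _

theorem expect_bind (μ : PMF α) (f : α → PMF β) (φ : β → ℝ≥0∞) :
    (μ.bind f).expect φ = μ.expect fun x => (f x).expect φ := by
  unfold expect
  simp only [bind_apply, ← ENNReal.tsum_mul_right, ← ENNReal.tsum_mul_left]
  rw [ENNReal.tsum_comm]
  simp only [mul_assoc]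

theorem expect_pure (x : α) (φ : α → ℝ≥0∞) : (pure x).expect φ = φ x := by
  unfold expect
  rw [tsum_eq_single x]
  · simp
  · intro y hy
    simp [pure_apply, hy]

theorem expect_mono {μ : PMF α} {φ ψ : α → ℝ≥0∞} (h : ∀ x ∈ μ.support, φ x ≤ ψ x) :
    μ.expect φ ≤ μ.expect ψ := by
  refine ENNReal.tsum_le_tsum fun x => ?_
  by_cases hx : x ∈ μ.support
  · exact mul_le_mul_right (h x hx) _
  · rw [mem_support_iff, not_not] at hx
    simp [hx]

theorem expect_const_mul (μ : PMF α) (c : ℝ≥0∞) (φ : α → ℝ≥0∞) :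
    μ.expect (fun x => c * φ x) = c * μ.expect φ := by
  unfold expect
  rw [← ENNReal.tsum_mul_left]
  exact tsum_congr fun x => by ring

theorem expect_const (μ : PMF α) (c : ℝ≥0∞) : μ.expect (fun _ => c) = c := by
  unfold expect
  rw [ENNReal.tsum_mul_right, μ.tsum_coe, one_mul]

theorem expect_add (μ : PMF α) (φ ψ : α → ℝ≥0∞) :
    μ.expect (fun x => φ x + ψ x) = μ.expect φ + μ.expect ψ := by
  unfold expect
  rw [← ENNReal.tsum_add]
  exact tsum_congr fun x => mul_add _ _ _

open Classical in
theorem fail_eq_expect (μ : PMF α) (P : α → Prop) :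
    μ.fail P = μ.expect fun x => if P x then 0 else 1 := by
  unfold fail expect
  rw [toOuterMeasure_apply]
  refine tsum_congr fun x => ?_
  by_cases hx : P x <;> simp [Set.indicator, hx]

theorem fail_bind_le {μ : PMF α} {f : α → PMF β} {P : α → Prop} {Q : β → Prop} {a b : ℝ≥0∞}
    (h₁ : μ.fail P ≤ a) (h₂ : ∀ x ∈ μ.support, P x → (f x).fail Q ≤ b) :
    (μ.bind f).fail Q ≤ a + b := by
  classical
  rw [fail_bind]
  calc μ.expect (fun x => (f x).fail Q) ≤ μ.expect fun x => (if P x then 0 else 1) + b := by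
        refine expect_mono fun x hx => ?_
        split_ifs with hP
        · rw [zero_add]; exact h₂ x hx hP
        · exact (fail_le_one _ _).trans le_self_add
    _ = μ.fail P + b := by rw [expect_add, expect_const, ← fail_eq_expect]
    _ ≤ a + b := by gcongr

theorem fail_bind_mul_le {μ : PMF α} {f : α → PMF α} {P : α → Prop} {c : ℝ≥0∞}
    (h₁ : ∀ x ∈ μ.support, P x → (f x).fail P = 0)
    (h₂ : ∀ x ∈ μ.support, (f x).fail P ≤ c) : (μ.bind f).fail P ≤ c * μ.fail P := by
  classical
  rw [fail_bind, fail_eq_expect μ, ← expect_const_mul]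
  refine expect_mono fun x hx => ?_
  split_ifs with hP
  · rw [h₁ x hx hP]; exact zero_le
  · rw [mul_one]; exact h₂ x hx

theorem fail_forall_le {ι : Type*} (μ : PMF α) (s : Finset ι) (P : ι → α → Prop) {a : ℝ≥0∞}
    (h : ∀ i ∈ s, μ.fail (P i) ≤ a) : μ.fail (fun x => ∀ i ∈ s, P i x) ≤ s.card * a := by
  classical
  rw [fail_eq_expect]
  calc _ ≤ μ.expect (fun x => ∑ i ∈ s, if P i x then 0 else 1) := by
        refine expect_mono fun x _ => ?_
        split_ifs with hx
        · exact zero_le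
        · push Not at hx
          obtain ⟨i, hi, hPi⟩ := hx
          refine le_trans ?_ (Finset.single_le_sum (f := fun i => if P i x then (0 : ℝ≥0∞) else 1)
            (fun _ _ => zero_le) hi)
          simp [hPi]
    _ = ∑ i ∈ s, μ.fail (P i) := by
        simp only [fail_eq_expect]
        unfold expect
        simp only [Finset.mul_sum]
        exact Summable.tsum_finsetSum fun _ _ => ENNReal.summable
    _ ≤ s.card * a := by
        rw [← nsmul_eq_mul]; exact Finset.sum_le_card_nsmul _ _ _ h

theorem fail_and_le (μ : PMF α) (P Q : α → Prop) :
    μ.fail (fun x => P x ∧ Q x) ≤ μ.fail P + μ.fail Q := by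
  classical
  rw [fail_eq_expect, fail_eq_expect, fail_eq_expect, ← expect_add]
  refine expect_mono fun x _ => ?_
  by_cases hP : P x <;> by_cases hQ : Q x <;> simp [hP, hQ]

/-- A function that is small unless `P` fails has a small expectation. -/
theorem expect_le {μ : PMF α} {φ : α → ℝ≥0∞} {P : α → Prop} {a b : ℝ≥0∞}
    (h₁ : ∀ x ∈ μ.support, P x → φ x ≤ a) (h₂ : ∀ x ∈ μ.support, φ x ≤ a + b) :
    μ.expect φ ≤ a + b * μ.fail P := by
  classical
  rw [fail_eq_expect, ← expect_const_mul]
  conv_rhs => rw [← expect_const μ a, ← expect_add]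
  refine expect_mono fun x hx => ?_
  by_cases hP : P x
  · simpa [hP] using h₁ x hx hP
  · simpa [hP] using h₂ x hx

/-- Markov's inequality for functions with values that are zero or at least one. -/
theorem fail_le_expect {μ : PMF α} {φ : α → ℝ≥0∞} {P : α → Prop}
    (h : ∀ x ∈ μ.support, ¬ P x → 1 ≤ φ x) : μ.fail P ≤ μ.expect φ := by
  classical
  rw [fail_eq_expect]
  refine expect_mono fun x hx => ?_
  split_ifs with hP
  · exact zero_le
  · exact h x hx hP

end PMF

/-! ### Repeated steps and samples -/

section Random

variable {σ : Type} {f : ℕ → σ → PMF σ}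

theorem repeatRandom_support {I : ℕ → σ → Prop} {st : σ} (h₀ : I 0 st)
    (h : ∀ i x, I i x → ∀ y ∈ (f i x).support, I (i + 1) y) (m : ℕ) :
    ∀ x ∈ (repeatRandom f m st).support, I m x := by
  induction m with
  | zero =>
    intro x hx
    rw [repeatRandom, PMF.support_pure, Set.mem_singleton_iff] at hx
    exact hx ▸ h₀
  | succ m ih =>
    intro x hx
    rw [repeatRandom, PMF.mem_support_bind_iff] at hx
    obtain ⟨y, hy, hx⟩ := hx
    exact h m y (ih y hy) x hx

/-- If `P` holds before and `Q` holds after the step `i`, up to a failure of the step, then `Q`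
holds at the end. -/
theorem repeatRandom_fail_le {P Q : σ → Prop} {st : σ} {i m : ℕ} (him : i < m) {a : ℝ≥0∞}
    (h₀ : P st) (hP : ∀ j x, P x → ∀ y ∈ (f j x).support, P y)
    (hQ : ∀ j x, Q x → ∀ y ∈ (f j x).support, Q y) (hi : ∀ x, P x → (f i x).fail Q ≤ a) :
    (repeatRandom f m st).fail Q ≤ a := by
  obtain ⟨k, rfl⟩ : ∃ k, m = i + 1 + k := ⟨m - (i + 1), by omega⟩
  induction k with
  | zero =>
    rw [add_zero, repeatRandom]
    have := PMF.fail_bind_le (μ := repeatRandom f i st) (f := f i) (P := P) (Q := Q) (a := 0)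
      (b := a) (PMF.fail_eq_zero.2 (repeatRandom_support (I := fun _ => P) h₀ hP i)).le
      fun x _ hx => hi x hx
    rwa [zero_add] at this
  | succ k ih =>
    rw [← add_assoc, repeatRandom]
    have := PMF.fail_bind_le (f := f (i + 1 + k)) (Q := Q) (b := 0) (ih (by omega)) fun x _ hx =>
      (PMF.fail_eq_zero.2 (hQ _ x hx)).le
    rwa [add_zero] at this

variable {n : ℕ}

theorem one_sub_clamp_le (p : ℝ) : 1 - clamp p ≤ ENNReal.ofReal (Real.exp (-p)) := by
  unfold clamp
  rcases le_or_gt 1 p with hp | hp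
  · rw [min_eq_right (by rw [← ENNReal.ofReal_one]; exact ENNReal.ofReal_le_ofReal hp), tsub_self]
    exact zero_le
  rcases le_or_gt 0 p with h0 | h0
  · rw [min_eq_left (by rw [← ENNReal.ofReal_one]; exact ENNReal.ofReal_le_ofReal hp.le),
      ← ENNReal.ofReal_one, ← ENNReal.ofReal_sub _ h0]
    refine ENNReal.ofReal_le_ofReal ?_
    linarith [Real.add_one_le_exp (-p)]
  · refine tsub_le_self.trans ?_
    rw [← ENNReal.ofReal_one]
    refine ENNReal.ofReal_le_ofReal ?_
    linarith [Real.add_one_le_exp (-p)]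

/-- The samples that miss `W` are the subsets of its complement. After the factor `(1 - clamp p) ^
W.card` is taken out, their weights form a binomial sum with value 1. -/
theorem sampleSet_fail (p : ℝ) (W : Finset (Fin n)) :
    (sampleSet n p).fail (fun S => ∃ a ∈ W, a ∈ S) = (1 - clamp p) ^ W.card := by
  classical
  unfold PMF.fail
  rw [PMF.toOuterMeasure_apply_fintype]
  have e1 : ∀ S : Finset (Fin n), {S : Finset (Fin n) | ¬ ∃ a ∈ W, a ∈ S}.indicator
      (sampleSet n p) S = if S ∈ (Wᶜ).powerset then
        (1 - clamp p) ^ W.card * (clamp p ^ S.card * (1 - clamp p) ^ ((Wᶜ).card - S.card)) else 0 := by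
    intro S
    have hiff : S ∈ {S : Finset (Fin n) | ¬ ∃ a ∈ W, a ∈ S} ↔ S ∈ (Wᶜ).powerset := by
      rw [Finset.mem_powerset]
      constructor
      · intro h a ha
        rw [Finset.mem_compl]
        exact fun haW => h ⟨a, haW, ha⟩
      · rintro h ⟨a, haW, ha⟩
        exact Finset.mem_compl.1 (h ha) haW
    by_cases hS : S ∈ (Wᶜ).powerset
    · rw [Set.indicator_of_mem (hiff.2 hS), if_pos hS]
      have h1 := Finset.card_le_card (Finset.mem_powerset.1 hS)
      have h2 := Finset.card_compl_add_card W
      rw [Fintype.card_fin] at h2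
      change clamp p ^ S.card * (1 - clamp p) ^ (n - S.card) = _
      rw [show n - S.card = W.card + ((Wᶜ).card - S.card) by omega, pow_add]
      ring
    · rw [Set.indicator_of_notMem (fun h => hS (hiff.1 h)), if_neg hS]
  rw [Finset.sum_congr rfl fun S _ => e1 S, Finset.sum_ite_mem, Finset.univ_inter,
    ← Finset.mul_sum, Finset.sum_pow_mul_eq_add_pow,
    add_tsub_cancel_of_le (show clamp p ≤ 1 from min_le_right _ _), one_pow, mul_one]

/-- A sample hits all sets of a small family of large sets. -/
theorem sampleSet_fail_forall_le (p : ℝ) (𝒲 : Finset (Finset (Fin n))) {k : ℕ}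
    (h : ∀ W ∈ 𝒲, k ≤ W.card) :
    (sampleSet n p).fail (fun S => ∀ W ∈ 𝒲, ∃ a ∈ W, a ∈ S) ≤
      𝒲.card * ENNReal.ofReal (Real.exp (-(p * k))) := by
  refine PMF.fail_forall_le _ _ _ fun W hW => ?_
  rw [sampleSet_fail]
  calc (1 - clamp p) ^ W.card ≤ (1 - clamp p) ^ k := pow_le_pow_right_of_le_one' tsub_le_self (h W hW)
    _ ≤ ENNReal.ofReal (Real.exp (-p)) ^ k := by gcongr; exact one_sub_clamp_le p
    _ = ENNReal.ofReal (Real.exp (-(p * k))) := by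
      rw [← ENNReal.ofReal_pow (Real.exp_nonneg _), ← Real.exp_nat_mul]
      congr 2; ring

theorem expect_repeatRandom_le {I : σ → Prop} {st : σ} {φ : σ → ℝ≥0∞} {c : ℝ≥0∞} (h₀ : I st)
    (hI : ∀ i x, I x → ∀ y ∈ (f i x).support, I y)
    (h : ∀ i x, I x → (f i x).expect φ ≤ c * φ x) (m : ℕ) :
    (repeatRandom f m st).expect φ ≤ c ^ m * φ st := by
  induction m with
  | zero => rw [repeatRandom, PMF.expect_pure, pow_zero, one_mul]
  | succ m ih =>
    rw [repeatRandom, PMF.expect_bind]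
    calc _ ≤ (repeatRandom f m st).expect (fun x => c * φ x) :=
          PMF.expect_mono fun x hx => h m x (repeatRandom_support (I := fun _ => I) h₀ hI m x hx)
      _ ≤ c ^ (m + 1) * φ st := by
          rw [PMF.expect_const_mul, pow_succ', mul_assoc]; gcongr

end Random

/-! ### The random parts of the long shortcuts -/

section Logarithm

variable {n : ℕ}

theorem one_le_lg (hn : 2 ≤ n) : 1 ≤ lg n := by
  unfold lg
  rw [Real.le_logb_iff_rpow_le (by norm_num) (by positivity), Real.rpow_one]
  exact_mod_cast hn

theorem log_le_lg : Real.log n ≤ lg n := by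
  unfold lg Real.logb
  rw [le_div_iff₀ (Real.log_pos (by norm_num))]
  have h1 : Real.log 2 ≤ 1 := by
    have := Real.log_le_sub_one_of_pos (show (0 : ℝ) < 2 by norm_num)
    linarith
  have h2 : 0 ≤ Real.log n := Real.log_natCast_nonneg n
  nlinarith

theorem le_two_pow_ceil_lg (hn : 1 ≤ n) : n ≤ 2 ^ ⌈lg n⌉₊ := by
  have h1 : (n : ℝ) = 2 ^ lg n := by
    unfold lg
    rw [Real.rpow_logb (by norm_num) (by norm_num) (by positivity)]
  have : (n : ℝ) ≤ 2 ^ (⌈lg n⌉₊ : ℝ) := by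
    conv_lhs => rw [h1]
    exact Real.rpow_le_rpow_of_exponent_le (by norm_num) (Nat.le_ceil _)
  rw [Real.rpow_natCast] at this
  exact_mod_cast this

theorem exp_neg_mul_lg_le (hn : 1 ≤ n) {a b : ℝ} (ha : 0 ≤ a) (hb : a * lg n ≤ b) :
    Real.exp (-b) ≤ (n : ℝ) ^ (-a) := by
  have hn' : (0 : ℝ) < n := by positivity
  rw [Real.rpow_def_of_pos hn', Real.exp_le_exp]
  have := mul_le_mul_of_nonneg_left (log_le_lg (n := n)) ha
  nlinarith

/-- The form in which union bounds over at most n test sets are used: n · n^(-5) ≤ 2^(-4). -/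
theorem mul_exp_neg_le (hn : 2 ≤ n) {b : ℝ} (hb : 5 * lg n ≤ b) :
    (n : ℝ≥0∞) * ENNReal.ofReal (Real.exp (-b)) ≤ ENNReal.ofReal (1 / 16) := by
  have h1 := exp_neg_mul_lg_le (n := n) (by omega) (by norm_num : (0 : ℝ) ≤ 5) hb
  rw [show (n : ℝ≥0∞) = ENNReal.ofReal n by rw [ENNReal.ofReal_natCast],
    ← ENNReal.ofReal_mul (by positivity)]
  refine ENNReal.ofReal_le_ofReal ?_
  have hn' : (2 : ℝ) ≤ n := by exact_mod_cast hn
  calc (n : ℝ) * Real.exp (-b) ≤ n * (n : ℝ) ^ (-5 : ℝ) := by gcongr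
    _ = ((n : ℝ) ^ 4)⁻¹ := by
      rw [Real.rpow_neg (by positivity), show (5 : ℝ) = (5 : ℕ) by norm_num, Real.rpow_natCast]
      field_simp
    _ ≤ ((2 : ℝ) ^ 4)⁻¹ := by gcongr
    _ = 1 / 16 := by norm_num

end Logarithm

/-! ### Samples that hit the funnels, and what they make known -/

section LongRandom

variable {n : ℕ} {M : Table n} {up : Prop} {B d w : ℝ} {x y : Fin n} {ℓ : ℕ} {v : ℕ → Fin n}
  {h : ℕ → ℝ} {D : PathData n} {Bk : Finset ℕ} {κ : HiddenConstants}

/-- The signs alternate, so among any `k + 1` falling arcs at least `(k + 1) / 2` descend. Their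
tails form one test set for each starting point. -/
theorem exists_funnel_tests (hinj : ∀ i ≤ ℓ, ∀ j ≤ ℓ, v i = v j → i = j) (k : ℕ) :
    ∃ 𝒲 : Finset (Finset (Fin n)), 𝒲.card ≤ ℓ ∧ (∀ W ∈ 𝒲, (k + 1) / 2 ≤ W.card) ∧
      ∀ S : Finset (Fin n), (∀ W ∈ 𝒲, ∃ a ∈ W, a ∈ S) → HitsFunnels ℓ v h S k := by
  classical
  let N : ℕ → Finset ℕ := fun p => (Finset.Ico p (p + k + 1)).filter fun i => arcGain h i < 0
  refine ⟨((Finset.range ℓ).filter fun p => p + k + 1 ≤ ℓ ∧ Falling h p (p + k + 1)).image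
    fun p => (N p).image v, ?_, ?_, ?_⟩
  · exact Finset.card_image_le.trans ((Finset.card_filter_le _ _).trans (by simp))
  · intro W hW
    obtain ⟨p, hp, rfl⟩ := Finset.mem_image.1 hW
    obtain ⟨-, h1, F⟩ := Finset.mem_filter.1 hp
    rw [Finset.card_image_of_injOn (fun i hi j hj hij => by
      have hi' := Finset.mem_Ico.1 (Finset.mem_filter.1 hi).1
      have hj' := Finset.mem_Ico.1 (Finset.mem_filter.1 hj).1
      exact hinj i (by omega) j (by omega) hij)]
    have hex : ∀ j : ℕ, ∃ i, (i = p + 2 * j ∨ i = p + 2 * j + 1) ∧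
        (j < (k + 1) / 2 → i ∈ N p) := by
      intro j
      by_cases hj : j < (k + 1) / 2
      · have := (F (p + 2 * j) (by omega) (by omega)).1
        rcases lt_or_ge (arcGain h (p + 2 * j)) 0 with h3 | h3
        · exact ⟨p + 2 * j, Or.inl rfl, fun _ => Finset.mem_filter.2
            ⟨Finset.mem_Ico.2 ⟨by omega, by omega⟩, h3⟩⟩
        · exact ⟨p + 2 * j + 1, Or.inr rfl, fun _ => Finset.mem_filter.2
            ⟨Finset.mem_Ico.2 ⟨by omega, by omega⟩, by nlinarith⟩⟩
      · exact ⟨p + 2 * j, Or.inl rfl, fun hc => absurd hc hj⟩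
    choose f hf1 hf2 using hex
    have := Finset.card_le_card_of_injOn (s := Finset.range ((k + 1) / 2)) f
      (fun j hj => hf2 j (by simpa using hj))
      (fun i _ j _ hij => by
        have := hf1 i
        have := hf1 j
        omega)
    simpa using this
  · intro S hS p hp F
    obtain ⟨a, ha, haS⟩ := hS _ (Finset.mem_image_of_mem (fun p => (N p).image v)
      (Finset.mem_filter.2 ⟨Finset.mem_range.2 (by omega), hp, F⟩))
    obtain ⟨i, hi, rfl⟩ := Finset.mem_image.1 ha
    obtain ⟨h1, h2⟩ := Finset.mem_filter.1 hi
    rw [Finset.mem_Ico] at h1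
    exact ⟨i, h1.1, by omega, haS, h2⟩

theorem funnelData_mono (k T : ℕ) (S : Finset (Fin n)) : (funnelData M k T S).mono = M := by
  have h1 : ∀ D : PathData n, ((breadthSearch M)^[k] D).mono = D.mono := fun D => by
    induction k with
    | zero => rfl
    | succ k ih => rw [Function.iterate_succ_apply', breadthSearch_mono, ih]
  have h2 : ∀ D : PathData n, ((concatenate M S S S)^[T] D).mono = D.mono := fun D => by
    induction T with
    | zero => rfl
    | succ k ih => rw [Function.iterate_succ_apply', concatenate_mono, ih]
  unfold funnelData
  rw [h1, concatenate_mono, h2, h1]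
  rfl

theorem computeFunnels_fail_le (hn : 2 ≤ n) (hκ : 0 < κ.funnel) (hκ' : 10 ≤ κ.sample) (hℓ : ℓ < n)
    (hinj : ∀ i ≤ ℓ, ∀ j ≤ ℓ, v i = v j → i = j) (E : ExactGains M ℓ v h) :
    (computeFunnels κ M).fail (fun D => FunnelsKnown ℓ v h D ∧ D.mono = M) ≤
      ENNReal.ofReal (1 / 16) + ENNReal.ofReal (1 / 16) := by
  unfold computeFunnels
  dsimp only
  rw [PMF.fail_map]
  have hn' : (0 : ℝ) < n := by positivity
  have hs : 0 < κ.funnel * (n : ℝ) ^ (2 / 3 : ℝ) := by positivity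
  generalize κ.funnel * (n : ℝ) ^ (2 / 3 : ℝ) = s at hs
  have hk : (n : ℝ) / s ≤ ⌈(n : ℝ) / s⌉₊ := Nat.le_ceil _
  generalize ⌈(n : ℝ) / s⌉₊ = k at hk
  have hL := one_le_lg hn
  have hhalf : (k : ℝ) / 2 ≤ (((k + 1) / 2 : ℕ) : ℝ) := by
    rw [div_le_iff₀ (by norm_num)]
    have : k ≤ (k + 1) / 2 * 2 := by omega
    exact_mod_cast this
  -- The size of the test sets is at least `n / (2 s)`, so `s` cancels: a test set is expected to
  -- contain `κ.sample * lg n / 2` samples, before truncation of the probability. The tests are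
  -- needed for the path and for its reversal, which gives two failure terms.
  have hp : 5 * lg n ≤ κ.sample * lg n * s / n * (((k + 1) / 2 : ℕ) : ℝ) := by
    calc 5 * lg n ≤ κ.sample * lg n / 2 := by nlinarith
      _ = κ.sample * lg n * s / n * (n / s / 2) := by field_simp
      _ ≤ _ := by
        gcongr
        exact (div_le_div_of_nonneg_right hk (by norm_num)).trans hhalf
  have hinj' : ∀ i ≤ ℓ, ∀ j ≤ ℓ, revPath ℓ v i = revPath ℓ v j → i = j := fun i hi j hj hij => by
    have := hinj (ℓ - i) (by omega) (ℓ - j) (by omega) hij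
    omega
  obtain ⟨𝒲, a1, a2, a3⟩ := exists_funnel_tests (h := h) hinj k
  obtain ⟨𝒲', b1, b2, b3⟩ := exists_funnel_tests (h := revHeight ℓ h) hinj' k
  have hT : ℓ ≤ 2 ^ ⌈lg n⌉₊ := hℓ.le.trans (le_two_pow_ceil_lg (by omega))
  have hfin : ∀ 𝒱 : Finset (Finset (Fin n)), 𝒱.card ≤ ℓ → (∀ W ∈ 𝒱, (k + 1) / 2 ≤ W.card) →
      (sampleSet n (κ.sample * lg n * s / n)).fail (fun S => ∀ W ∈ 𝒱, ∃ a ∈ W, a ∈ S) ≤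
        ENNReal.ofReal (1 / 16) := fun 𝒱 h1 h2 =>
    (sampleSet_fail_forall_le _ 𝒱 h2).trans (le_trans (by gcongr; omega) (mul_exp_neg_le hn hp))
  refine (PMF.fail_mono (P := fun S => (∀ W ∈ 𝒲, ∃ a ∈ W, a ∈ S) ∧ ∀ W ∈ 𝒲', ∃ a ∈ W, a ∈ S)
    fun S _ hS => ?_).trans ((PMF.fail_and_le _ _ _).trans
      (add_le_add (hfin 𝒲 a1 a2) (hfin 𝒲' b1 b2)))
  refine ⟨⟨fun p q hpq hq F => ?_, fun p q hpq hq F => ?_⟩, ?_⟩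
  · exact firstKnown_funnelData E (a3 S hS.1) hT hpq hq F
  · exact lastKnown_funnelData E (b3 S hS.2) hT hpq hq F
  · exact funnelData_mono _ _ _

theorem PartKnown.arcSearch (E : ExactGains M ℓ v h) (hB : Breaks ℓ h Bk) {p : ℕ}
    (hp : p ∈ descents ℓ h Bk) (K : PartKnown ℓ v h D p) (T : Finset (Fin n)) :
    PartKnown ℓ v h (arcSearch M T D) p := by
  obtain ⟨h1, h2, h3⟩ := hB.descent hp
  unfold PartKnown at K ⊢
  split_ifs at K ⊢ with hf
  · obtain ⟨s1, s2, s3, s4⟩ := fwdEnd_spec h2 h3.le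
    exact le_arcSearch_first _ _ _ _ (FirstKnown.bounded E (by omega)
      fun _ => (s4 _ (by omega) (by omega)).2) K
  · obtain ⟨s1, s3, s4⟩ := bwdStart_spec (ℓ := ℓ) h1 (by omega) h3.le
    refine le_arcSearch_last _ _ _ _ (Or.inl ?_) K
    have := (s4 (bwdStart ℓ h p + 1) (by omega) (by omega)).1
    exact_mod_cast (by linarith)

theorem PartKnown.arcSearch_iterate (E : ExactGains M ℓ v h) (hB : Breaks ℓ h Bk) {p : ℕ}
    (hp : p ∈ descents ℓ h Bk) (K : PartKnown ℓ v h D p) (T : Finset (Fin n)) (k : ℕ) :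
    PartKnown ℓ v h ((_root_.arcSearch M T)^[k] D) p := by
  induction k with
  | zero => exact K
  | succ k ih => rw [Function.iterate_succ_apply']; exact ih.arcSearch E hB hp T

theorem partKnown_arcSearch (E : ExactGains M ℓ v h) (H : FunnelsKnown ℓ v h D)
    (hinj : ∀ i ≤ ℓ, ∀ j ≤ ℓ, v i = v j → i = j) (hB : Breaks ℓ h Bk) {T : Finset (Fin n)} {p : ℕ}
    (hp : p ∈ descents ℓ h Bk) (hT : marker v h p ∈ T) {t : ℕ} (ht : breakCount ℓ h Bk p ≤ t) :
    PartKnown ℓ v h ((arcSearch M T)^[t] D) p := by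
  obtain ⟨h1, h2, h3⟩ := hB.descent hp
  obtain ⟨-, hpB, -⟩ := mem_descents.1 hp
  unfold breakCount partStart partEnd at ht
  unfold marker at hT
  unfold PartKnown
  by_cases hf : IsFwd h p
  · rw [if_pos hf] at hT ⊢
    rw [if_pos hf, if_pos hf] at ht
    obtain ⟨s1, s2, s3, s4⟩ := fwdEnd_spec h2 h3.le
    refine firstKnown_arcSearch E H hinj hB (q := fwdEnd ℓ h p - 1) (by omega) hT h3 hpB hf
      (fun j hj1 hj2 => s4 j hj1 (by omega)) t _ (by omega) le_rfl
      (le_trans (Finset.card_le_card ?_) ht)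
    exact Finset.inter_subset_inter_left (Finset.Ico_subset_Ico_right (by omega))
  · rw [if_neg hf] at hT ⊢
    rw [if_neg hf, if_neg hf] at ht
    obtain ⟨s1, s3, s4⟩ := bwdStart_spec (ℓ := ℓ) h1 (by omega) h3.le
    refine lastKnown_arcSearch E H hinj hB (by omega) hT h3 hpB ?_ (by omega)
      (fun j hj1 hj2 => s4 j (by omega) hj2) t (le_trans (Finset.card_le_card ?_) ht)
    · have := (hB.alternating (by omega) hpB).2.2.2.2
      unfold IsFwd at hf
      by_contra hcon
      exact hf (this (not_le.1 hcon).le).le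
    · exact Finset.inter_subset_inter_left (Finset.Ico_subset_Ico_left (by omega))

theorem arcSearch_iterate_mono (T : Finset (Fin n)) (k : ℕ) :
    ((arcSearch M T)^[k] D).mono = D.mono := by
  induction k with
  | zero => rfl
  | succ k ih =>
    rw [Function.iterate_succ_apply', ← ih]
    unfold arcSearch
    rw [concatenate_mono, concatenateOpposite_mono]

end LongRandom

/-! ### The success probability of the long shortcuts -/

section LongRandom

variable {n : ℕ} {M : Table n} {up : Prop} {B d w : ℝ} {x y : Fin n} {ℓ : ℕ} {v : ℕ → Fin n}
  {h : ℕ → ℝ} {Bk : Finset ℕ} {κ : HiddenConstants}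

/-- The number of iterations of the main loop of the long shortcuts. -/
noncomputable def stages (n : ℕ) : ℕ := ⌈lg ((n : ℝ) ^ (1 / 2 : ℝ) * lg n ^ 2)⌉₊

/-- The lower bound on `2 ^ stages n` makes the stages cover all numbers of breaks of sufficiently
long parts; the upper bound limits the number of classes. -/
theorem stages_spec (hn : 2 ≤ n) :
    0 < stages n ∧ (stages n : ℝ) ≤ 4 * lg n ∧ (n : ℝ) ^ (1 / 2 : ℝ) ≤ 2 ^ stages n := by
  have hL := one_le_lg hn
  have hn' : (2 : ℝ) ≤ n := by exact_mod_cast hn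
  have hsq : 1 < (n : ℝ) ^ (1 / 2 : ℝ) := Real.one_lt_rpow (by linarith) (by norm_num)
  have hL2 : 1 ≤ lg n ^ 2 := one_le_pow₀ hL
  have h1 : 1 < (n : ℝ) ^ (1 / 2 : ℝ) * lg n ^ 2 := by nlinarith
  have hpos : 0 < lg ((n : ℝ) ^ (1 / 2 : ℝ) * lg n ^ 2) := Real.logb_pos (by norm_num) h1
  refine ⟨Nat.ceil_pos.2 hpos, ?_, ?_⟩
  · have h2 : lg ((n : ℝ) ^ (1 / 2 : ℝ) * lg n ^ 2) = 1 / 2 * lg n + 2 * lg (lg n) := by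
      unfold lg at *
      rw [Real.logb_mul (by positivity) (by positivity), Real.logb_rpow_eq_mul_logb_of_pos
        (by positivity), Real.logb_pow]
      norm_num
    have h3 : lg (lg n) ≤ lg n := by
      unfold lg at *
      rw [Real.logb_le_iff_le_rpow (by norm_num) (by linarith), Real.rpow_logb (by norm_num)
        (by norm_num) (by linarith)]
      rw [Real.logb_le_iff_le_rpow (by norm_num) (by linarith), Real.rpow_natCast]
      exact_mod_cast n.lt_two_pow_self.le
    have h4 := Nat.ceil_lt_add_one hpos.le
    unfold stages
    linarith
  · have h5 : (n : ℝ) ^ (1 / 2 : ℝ) * lg n ^ 2 ≤ 2 ^ (stages n : ℝ) := by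
      conv_lhs => rw [← Real.rpow_logb (b := 2) (by norm_num) (by norm_num) (by linarith :
        0 < (n : ℝ) ^ (1 / 2 : ℝ) * lg n ^ 2)]
      exact Real.rpow_le_rpow_of_exponent_le (by norm_num) (Nat.le_ceil _)
    rw [Real.rpow_natCast] at h5
    nlinarith

theorem longStep_support {i : ℕ} {st st' : PathData n × Finset (Fin n)}
    (hs : st' ∈ (longStep κ M i st).support) :
    ∃ T, st' = ((arcSearch M T)^[2 ^ i] st.1, st.2 ∪ T) := by
  unfold longStep at hs
  rw [PMF.mem_support_map_iff] at hs
  obtain ⟨T, -, rfl⟩ := hs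
  exact ⟨T, rfl⟩

/-- On a long route with few breaks, the long shortcuts are likely to save a large part. -/
theorem Route.long_fail (hn : 2 ≤ n) (hκ : 0 < κ.funnel) (hκ' : 10 ≤ κ.sample)
    (hκ'' : 320 ≤ κ.long) (R : Route M up d w x y ℓ v h) (E : ExactGains M ℓ v h) (hd : d ≤ B)
    (hw : ¬ up → w ≤ -d) (hB : Breaks ℓ h Bk)
    (hfew : 8 * ((12 * ⌈(n : ℝ) ^ (1 / 2 : ℝ)⌉₊ + 1) * Bk.card) ≤ ℓ)
    (hlong : 768 * lg n ≤ ℓ) :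
    ∃ k : ℕ, (ℓ : ℝ) ≤ 768 * lg n * k ∧ k ≤ ℓ ∧
      (longShortcuts κ B M).fail (fun L => HasRoute L up d w x y (ℓ - k)) ≤ 1 / 2 := by
  classical
  have hL := one_le_lg hn
  have hℓn := R.length_lt
  obtain ⟨I0, I1, I2⟩ := stages_spec hn
  have hnr : (0 : ℝ) < n := by positivity
  have hsq : 0 < (n : ℝ) ^ (1 / 2 : ℝ) := by positivity
  set q : ℝ := (n : ℝ) ^ (1 / 2 : ℝ) with hq
  -- With this `Q` we have `n < Q * 2 ^ stages n`, all parts in a class have length at least 4, and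
  -- the loss `(3 * Q + 1) * Bk.card` due to breaks is at most `ℓ / 8` by assumption.
  set Q : ℕ := 4 * ⌈q⌉₊ with hQ
  have hQr : 4 * q ≤ Q := by
    have := Nat.le_ceil q
    rw [hQ]; push_cast; linarith
  have hQpos : 0 < Q := by
    have : (0 : ℝ) < Q := by linarith
    exact_mod_cast this
  have hI : ℓ < Q * 2 ^ stages n := by
    have : (ℓ : ℝ) < Q * 2 ^ stages n := by
      have : (ℓ : ℝ) < n := by exact_mod_cast hℓn
      have hsq2 : (n : ℝ) = q * q := by
        rw [hq, ← Real.rpow_add hnr]; norm_num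
      nlinarith [mul_le_mul hQr I2 hsq.le (by positivity)]
    exact_mod_cast this
  obtain ⟨i, hi, G, hG, hdir, hcls, hcard⟩ := hB.exists_class I0 hI
  have hℓ0 : (768 : ℝ) ≤ ℓ := by nlinarith
  have hℓ1 : 768 ≤ ℓ := by exact_mod_cast hℓ0
  have hGr : (ℓ : ℝ) ≤ 32 * lg n * G.card := by
    have h1 : ℓ ≤ 8 * stages n * G.card := by
      have : 8 * ((3 * Q + 1) * Bk.card) ≤ ℓ := by
        rwa [hQ, show 3 * (4 * ⌈q⌉₊) = 12 * ⌈q⌉₊ by ring]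
      have e : 8 * stages n * G.card = 4 * (2 * stages n * G.card) := by ring
      omega
    calc (ℓ : ℝ) ≤ 8 * stages n * G.card := by exact_mod_cast h1
      _ ≤ 8 * (4 * lg n) * G.card := by gcongr
      _ = _ := by ring
  have hG24 : (24 : ℝ) ≤ G.card := by
    by_contra hc
    have : 32 * lg n * G.card < 32 * lg n * 24 := by gcongr; linarith
    linarith
  have hGpos : 0 < G.card := by
    have : (0 : ℝ) < G.card := by linarith
    exact_mod_cast this
  set m := Q * 2 ^ i with hm
  have hmpos : 0 < m := by positivity
  have hmℓ : m ≤ ℓ := by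
    obtain ⟨p, hp⟩ := Finset.card_pos.1 hGpos
    obtain ⟨h1, h2, h3⟩ := hB.descent (hG hp)
    have := (part_spec h1 h2 h3.le).2.2.1
    have := (hcls p hp).2
    omega
  have hmr : (0 : ℝ) < m := by exact_mod_cast hmpos
  have hℓr : (0 : ℝ) < ℓ := by linarith
  -- The size of the test sets: there are at most `2 * ℓ / m` blocks, and each loses at most `θ`
  -- elements, so at most half of the class is lost.
  set θ : ℝ := G.card * m / (4 * ℓ) with hθ
  have hθpos : 0 < θ := by positivity
  obtain ⟨𝒲, w1, w2, w3⟩ := exists_vertex_tests R.inj hB hG hdir hmpos (k := ⌈θ⌉₊)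
    (Nat.one_le_iff_ne_zero.2 (Nat.ceil_pos.2 hθpos).ne') fun p hp => (hcls p hp).2
  have hloss : 2 * ((⌈θ⌉₊ - 1) * (ℓ / m + 1)) ≤ G.card := by
    have e1 : ((⌈θ⌉₊ - 1 : ℕ) : ℝ) ≤ θ := by
      have h1 := Nat.ceil_lt_add_one hθpos.le
      have h2 := Nat.ceil_pos.2 hθpos
      rw [Nat.cast_sub (by omega)]
      push_cast
      linarith
    have e2 : ((ℓ / m + 1 : ℕ) : ℝ) ≤ 2 * ℓ / m := by
      rw [le_div_iff₀ hmr]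
      have h1 := Nat.div_mul_le_self ℓ m
      have : (ℓ / m + 1) * m ≤ 2 * ℓ := by linarith
      exact_mod_cast this
    have e3 : (2 : ℝ) * (((⌈θ⌉₊ - 1 : ℕ) : ℝ) * ((ℓ / m + 1 : ℕ) : ℝ)) ≤ G.card := by
      calc _ ≤ 2 * (θ * (2 * ℓ / m)) := by gcongr
        _ = G.card := by rw [hθ]; field_simp; norm_num
    exact_mod_cast e3
  -- Half of the class is covered, and a sixth of the union is saved.
  refine ⟨G.card / 12, ?_, ?_, ?_⟩
  · have h1 : (G.card : ℝ) ≤ 24 * (G.card / 12 : ℕ) := by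
      have h24 : 24 ≤ G.card := by exact_mod_cast hG24
      have : G.card ≤ 24 * (G.card / 12) := by omega
      exact_mod_cast this
    calc (ℓ : ℝ) ≤ 32 * lg n * G.card := hGr
      _ ≤ 32 * lg n * (24 * (G.card / 12 : ℕ)) := by gcongr
      _ = _ := by ring
  · have : G.card ≤ ℓ := by
      refine (Finset.card_le_card (t := Finset.range ℓ) fun p hp => ?_).trans (by simp)
      exact Finset.mem_range.2 (mem_descents.1 (hG hp)).1
    omega
  let P : PathData n × Finset (Fin n) → Prop := fun st => FunnelsKnown ℓ v h st.1 ∧ st.1.mono = M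
  -- The sample `T` of the successful stage is kept in the event, because later stages enlarge the
  -- set of all samples by vertices whose parts need not be known.
  let S : PathData n × Finset (Fin n) → Prop := fun st => st.1.mono = M ∧
    ∃ T : Finset (Fin n), (∀ W ∈ 𝒲, ∃ a ∈ W, a ∈ T) ∧ T ⊆ st.2 ∧
      ∀ p ∈ G, marker v h p ∈ T → PartKnown ℓ v h st.1 p
  have hPstep : ∀ j st, P st → ∀ st' ∈ (longStep κ M (j + 1) st).support, P st' := by
    intro j st hst st' hs
    obtain ⟨T, rfl⟩ := longStep_support hs
    exact ⟨hst.1.arcSearch_iterate E T _, (arcSearch_iterate_mono T _).trans hst.2⟩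
  have hSstep : ∀ j st, S st → ∀ st' ∈ (longStep κ M (j + 1) st).support, S st' := by
    rintro j st ⟨h1, T', h2, h3, h4⟩ st' hs
    obtain ⟨T, rfl⟩ := longStep_support hs
    exact ⟨(arcSearch_iterate_mono T _).trans h1, T', h2, h3.trans Finset.subset_union_left,
      fun p hp hpT => (h4 p hp hpT).arcSearch_iterate E hB (hG hp) T _⟩
  -- The loop index `i` runs stage `i + 1`, whose `2 ^ (i + 1)` iterations are at least the number
  -- of breaks in any part of the class.
  have hhit : ∀ st, P st → (longStep κ M (i + 1) st).fail S ≤ ENNReal.ofReal (1 / 16) := by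
    intro st hst
    unfold longStep
    rw [PMF.fail_map]
    refine (PMF.fail_mono (P := fun T => ∀ W ∈ 𝒲, ∃ a ∈ W, a ∈ T) fun T _ hT => ?_).trans
      ((sampleSet_fail_forall_le _ 𝒲 fun W hW => (w2 W hW).ge).trans
        (le_trans ?_ (mul_exp_neg_le hn
        (b := κ.long * lg n ^ 2 / (2 ^ (i + 1) * q) * (⌈θ⌉₊ : ℕ)) ?_)))
    · exact ⟨(arcSearch_iterate_mono T _).trans hst.2, T, hT, Finset.subset_union_right,
        fun p hp hpT => partKnown_arcSearch E hst.1 R.inj hB (hG hp) hpT (hcls p hp).1⟩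
    · have : 𝒲.card ≤ n := by
        have := Nat.div_le_self ℓ m
        omega
      gcongr
    -- The factor 64 is 2 from the stage index times 32 from the size of the class. One logarithm of
    -- the density pays for the number of classes, the other one for the failure probability.
    · calc 5 * lg n ≤ 320 * lg n / 64 := by linarith
        _ ≤ κ.long * lg n / 64 := by gcongr
        _ = κ.long * lg n ^ 2 / (2 ^ (i + 1) * q) * ((ℓ / (32 * lg n)) * (4 * q * 2 ^ i) / (4 * ℓ)) := by
          rw [pow_succ 2 i]; field_simp; ring
        _ ≤ κ.long * lg n ^ 2 / (2 ^ (i + 1) * q) * (G.card * m / (4 * ℓ)) := by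
          have : (4 * q * 2 ^ i : ℝ) ≤ m := by
            rw [hm]; push_cast; gcongr
          have h2 : ℓ / (32 * lg n) ≤ G.card := by
            rw [div_le_iff₀ (by positivity)]; linarith
          gcongr
        _ ≤ _ := by gcongr; exact Nat.le_ceil _
  unfold longShortcuts
  have hbind := PMF.fail_bind_le (μ := computeFunnels κ M)
    (f := fun D => (repeatRandom (fun i => longStep κ M (i + 1)) (stages n) (D, ∅)).map
      fun st => (arcBoundedToMonotone B M st.2 st.1).mono)
    (Q := fun L => HasRoute L up d w x y (ℓ - G.card / 12))
    (b := ENNReal.ofReal (1 / 16))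
    (computeFunnels_fail_le hn hκ hκ' hℓn R.inj E) fun D _ hD => by
      rw [PMF.fail_map]
      refine (PMF.fail_mono (P := S) fun st _ hst => ?_).trans
        (repeatRandom_fail_le (P := P) hi hD hPstep hSstep hhit)
      obtain ⟨h1, T, h2, h3, h4⟩ := hst
      refine R.long_many E hd hw h1.ge (G.filter (marker v h · ∈ T)) (fun p hp => ?_) ?_
      · rw [Finset.mem_filter] at hp
        obtain ⟨k1, k2, k3⟩ := hB.descent (hG hp.1)
        refine ⟨k1, k2, k3, h3 hp.2, h4 p hp.1 hp.2, ?_⟩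
        have e1 := (hcls p hp.1).2
        have e2 : 4 ≤ m := by
          rw [hm, hQ]
          have : 0 < ⌈q⌉₊ := Nat.ceil_pos.2 hsq
          have : 0 < 2 ^ i := by positivity
          nlinarith
        omega
      · have := w3 T h2
        omega
  refine hbind.trans ?_
  rw [← ENNReal.ofReal_add (by norm_num) (by norm_num), ← ENNReal.ofReal_add (by norm_num)
    (by norm_num), show (1 : ℝ≥0∞) / 2 = ENNReal.ofReal (1 / 2) by
      rw [ENNReal.ofReal_div_of_pos (by norm_num)]; simp]
  exact ENNReal.ofReal_le_ofReal (by norm_num)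

end LongRandom

/-! ### One outer iteration -/

section Update

variable {n : ℕ} {M : Table n} {up : Prop} {B d w : ℝ} {x y : Fin n} {κ : HiddenConstants}

/-- The least length of a route. -/
noncomputable def routeLength (M : Table n) (up : Prop) (d w : ℝ) (x y : Fin n) : ℕ :=
  sInf {L | HasRoute M up d w x y L}

theorem HasRoute.length_spec {L : ℕ} (R : HasRoute M up d w x y L) :
    HasRoute M up d w x y (routeLength M up d w x y) :=
  Nat.sInf_mem (s := {L | HasRoute M up d w x y L}) ⟨L, R⟩

theorem HasRoute.length_le {L : ℕ} (R : HasRoute M up d w x y L) :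
    routeLength M up d w x y ≤ L := Nat.sInf_le R

theorem HasRoute.exists_exact {L : ℕ} (R : HasRoute M up d w x y L) (hM : ∀ a b, M a b ≠ ⊤) :
    ∃ ℓ ≤ L, ∃ v h, Route M up d w x y ℓ v h ∧ ExactGains M ℓ v h := by
  obtain ⟨ℓ, hℓ, v, h, R⟩ := R
  obtain ⟨h', R', E⟩ := R.exact hM
  exact ⟨ℓ, hℓ, v, h', R', E⟩

theorem HasRoute.short {L : ℕ} (R : HasRoute M up d w x y L) (hM : ∀ a b, M a b ≠ ⊤) (hd : d ≤ B)
    (hw : ¬ up → w ≤ -d) : HasRoute (shortShortcuts B M) up d w x y (max (L - 1) 1) := by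
  obtain ⟨ℓ, hℓ, v, h, R, E⟩ := R.exists_exact hM
  rcases le_or_gt 2 ℓ with h2 | h2
  · exact (R.short_one E hd hw h2).mono le_rfl (by omega)
  · exact ⟨ℓ, by omega, v, h, R.mono le_shortShortcuts⟩

theorem HasRoute.short_iterate {L : ℕ} (R : HasRoute M up d w x y L) (hd : d ≤ B)
    (hw : ¬ up → w ≤ -d) (hM : ∀ j a b, (shortShortcuts B)^[j] M a b ≠ ⊤) (j : ℕ) :
    HasRoute ((shortShortcuts B)^[j] M) up d w x y (max (L - j) 1) := by
  induction j with
  | zero => exact R.mono le_rfl (by omega)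
  | succ j ih =>
    rw [Function.iterate_succ_apply']
    exact (ih.short (hM j) hd hw).mono le_rfl (by omega)

open Classical in
/-- The ends and the middle arcs of the reducible triples. -/
noncomputable def reducibleBreaks (ℓ : ℕ) (h : ℕ → ℝ) : Finset ℕ :=
  {0, ℓ - 1} ∪ (((Finset.range ℓ).filter fun t => t + 3 ≤ ℓ ∧ Reducible h t).image (· + 1))

theorem breaks_reducibleBreaks (ℓ : ℕ) (h : ℕ → ℝ) : Breaks ℓ h (reducibleBreaks ℓ h) := by
  classical
  intro i hi hb
  simp only [reducibleBreaks, Finset.mem_union, Finset.mem_insert, Finset.mem_singleton,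
    Finset.mem_image, Finset.mem_filter, Finset.mem_range, not_or, not_exists] at hb
  refine ⟨by omega, by omega, fun R => hb.2 (i - 1) ⟨⟨by omega, by omega, R⟩, by omega⟩⟩

/-- A route that the short shortcuts can hardly shorten has few breaks. -/
theorem Route.card_breaks_le {ℓ k : ℕ} {v : ℕ → Fin n} {h : ℕ → ℝ}
    (R : Route M up d w x y ℓ v h) (E : ExactGains M ℓ v h) (hd : d ≤ B)
    (hk : ∀ L, HasRoute (shortShortcuts B M) up d w x y L → ℓ ≤ L + k) :
    (reducibleBreaks ℓ h).card ≤ 3 * k + 4 := by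
  classical
  set T := (Finset.range ℓ).filter fun t => t + 3 ≤ ℓ ∧ Reducible h t with hT
  have h1 := R.short_many E hd T (fun t ht => (Finset.mem_filter.1 ht).2) (T.card / 3) (by omega)
  have h2 := hk _ h1
  have h3 : T.card ≤ ℓ := (Finset.card_filter_le _ _).trans (by simp)
  have h4 : (reducibleBreaks ℓ h).card ≤ 2 + T.card :=
    (Finset.card_union_le _ _).trans (add_le_add Finset.card_le_two Finset.card_image_le)
  omega

/-- Thus a route whose length is comparable to the number of rounds is long enough for the long
shortcuts. -/
theorem lg_le_two_mul_sqrt (hn : 1 ≤ n) : lg n ≤ 2 * (n : ℝ) ^ (1 / 2 : ℝ) := by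
  have hn' : (0 : ℝ) < n := by positivity
  have hpos : 0 < (n : ℝ) ^ (1 / 2 : ℝ) := by positivity
  have h1 : lg n = 2 * lg ((n : ℝ) ^ (1 / 2 : ℝ)) := by
    unfold lg
    rw [Real.logb_rpow_eq_mul_logb_of_pos hn']
    ring
  rw [h1]
  generalize (n : ℝ) ^ (1 / 2 : ℝ) = q at hpos
  have : lg q ≤ q := by
    unfold lg Real.logb
    rw [div_le_iff₀ (Real.log_pos (by norm_num))]
    have h2 : Real.log (q / 2) ≤ q / 2 - 1 := Real.log_le_sub_one_of_pos (by positivity)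
    rw [Real.log_div hpos.ne' (by norm_num)] at h2
    have := Real.log_two_gt_d9
    have := Real.log_two_lt_d9
    nlinarith
  linarith

theorem updateStep_fail_le {r : ℕ} {st : Table n × Table n} {P : Table n → Prop}
    (hP : ∀ T T', P T → T ≤ T' → P T')
    (h : (longShortcuts κ B st.1).fail P ≤ 1 / 2) :
    (updateStep κ B r st).fail (fun st => P st.2) ≤
      clamp (lg n / r) * (1 / 2) + (1 - clamp (lg n / r)) := by
  unfold updateStep
  rw [PMF.fail_bind]
  unfold PMF.expect
  rw [tsum_fintype, Fintype.sum_bool]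
  simp only [PMF.fail_map, Bool.false_eq_true, if_true, if_false]
  refine add_le_add (mul_le_mul' le_rfl ?_) (mul_le_of_le_one_right zero_le (PMF.fail_le_one _ _))
  exact (PMF.fail_mono fun L _ hL => hP _ _ hL fun a b => le_max_right _ _).trans h

theorem updateStep_support {r : ℕ} {st st' : Table n × Table n}
    (hs : st' ∈ (updateStep κ B r st).support) :
    st'.1 = shortShortcuts B st.1 ∧ (st'.2 = st.2 ∨
      ∃ L ∈ (longShortcuts κ B st.1).support, st'.2 = fun x y => max (st.2 x y) (L x y)) := by
  unfold updateStep at hs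
  rw [PMF.mem_support_bind_iff] at hs
  obtain ⟨b, -, hs⟩ := hs
  rw [PMF.mem_support_map_iff] at hs
  obtain ⟨M', hM', rfl⟩ := hs
  refine ⟨rfl, ?_⟩
  cases b
  · left
    simpa using hM'
  · right
    simp only [if_true] at hM'
    rw [PMF.mem_support_map_iff] at hM'
    obtain ⟨L, hL, rfl⟩ := hM'
    exact ⟨L, hL, rfl⟩

theorem le_of_mem_support_updateStep {r : ℕ} {st st' : Table n × Table n}
    (hs : st' ∈ (updateStep κ B r st).support) : st.2 ≤ st'.2 := by
  obtain ⟨-, h | ⟨L, -, h⟩⟩ := updateStep_support hs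
  · exact h.ge
  · exact fun a b => h ▸ le_max_left _ _

theorem updateLoop_fst {r m : ℕ} {st : Table n × Table n}
    (hs : st ∈ (repeatRandom (fun _ => updateStep κ B r) m (M, M)).support) :
    st.1 = (shortShortcuts B)^[m] M ∧ M ≤ st.2 :=
  repeatRandom_support (I := fun m st => st.1 = (shortShortcuts B)^[m] M ∧ M ≤ st.2)
    ⟨rfl, le_rfl⟩ (fun i st hst st' hs => ⟨by
      rw [(updateStep_support hs).1, hst.1, Function.iterate_succ_apply'],
      hst.2.trans (le_of_mem_support_updateStep hs)⟩) m st hs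

theorem le_of_mem_support_updateShortcuts {M' : Table n}
    (hs : M' ∈ (updateShortcuts κ B M).support) : M ≤ M' := by
  unfold updateShortcuts at hs
  rw [PMF.mem_support_map_iff] at hs
  obtain ⟨st, hst, rfl⟩ := hs
  exact fun a b => le_max_of_le_right ((updateLoop_fst hst).2 a b)

/-- The first component evolves deterministically by short shortcuts, so the set `J` of promising
rounds is fixed in advance. A success is never undone, and every round of `J` multiplies the failure
probability by the same factor. -/
theorem updateLoop_fail_le {r : ℕ} {P : Table n → Prop} (hP : ∀ T T', P T → T ≤ T' → P T')
    (J : Finset ℕ) (hJ : ∀ j ∈ J, (longShortcuts κ B ((shortShortcuts B)^[j] M)).fail P ≤ 1 / 2)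
    (m : ℕ) : (repeatRandom (fun _ => updateStep κ B r) m (M, M)).fail (fun st => P st.2) ≤
      (clamp (lg n / r) * (1 / 2) + (1 - clamp (lg n / r))) ^ (J ∩ Finset.range m).card := by
  classical
  induction m with
  | zero => simpa using PMF.fail_le_one _ _
  | succ m ih =>
    rw [repeatRandom]
    have hpers : ∀ st ∈ (repeatRandom (fun _ => updateStep κ B r) m (M, M)).support, P st.2 →
        (updateStep κ B r st).fail (fun st => P st.2) = 0 := fun st _ hst =>
      PMF.fail_eq_zero.2 fun st' hs => hP _ _ hst (le_of_mem_support_updateStep hs)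
    by_cases hm : m ∈ J
    · rw [Finset.range_add_one, Finset.inter_insert_of_mem hm,
        Finset.card_insert_of_notMem (by simp), pow_succ']
      refine (PMF.fail_bind_mul_le hpers fun st hst => updateStep_fail_le hP ?_).trans
        (mul_le_mul' le_rfl ih)
      rw [(updateLoop_fst hst).1]
      exact hJ m hm
    · rw [Finset.range_add_one, Finset.inter_insert_of_notMem hm]
      refine (PMF.fail_bind_mul_le (c := 1) hpers fun st _ => PMF.fail_le_one _ _).trans ?_
      rwa [one_mul]

theorem clamp_half_le {p q : ℝ} (hq0 : 0 ≤ q) (hq1 : q ≤ 1) (hp : q ≤ p) :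
    clamp p * (1 / 2) + (1 - clamp p) ≤ ENNReal.ofReal (Real.exp (-(q / 2))) := by
  have h1 : clamp p = ENNReal.ofReal (min p 1) := by
    unfold clamp
    rw [← ENNReal.ofReal_one]
    exact (ENNReal.ofReal_mono.map_min).symm
  have h2 : q ≤ min p 1 := le_min hp hq1
  have h3 : min p 1 ≤ 1 := min_le_right _ _
  rw [h1]
  generalize min p 1 = c at h2 h3
  rw [← ENNReal.ofReal_one, ← ENNReal.ofReal_ofNat, ← ENNReal.ofReal_div_of_pos (by norm_num),
    ← ENNReal.ofReal_mul (by linarith), ← ENNReal.ofReal_sub _ (by linarith),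
    ← ENNReal.ofReal_add (by linarith) (by linarith)]
  refine ENNReal.ofReal_le_ofReal ?_
  linarith [Real.add_one_le_exp (-(q / 2))]

end Update

/-! ### The progress of one outer iteration -/

section Update

variable {n : ℕ} {M : Table n} {up : Prop} {B d w : ℝ} {x y : Fin n} {κ : HiddenConstants}

/-- Most steps of a slowly decreasing sequence are short. -/
theorem card_short_steps {ℓ : ℕ → ℕ} {r : ℕ} (hanti : ∀ j < r, ℓ (j + 1) ≤ ℓ j)
    (hr : ℓ 0 < 2 * ℓ r) :
    r ≤ 2 * ((Finset.range r).filter fun j => r * (ℓ j - ℓ (j + 1)) ≤ 4 * ℓ j).card := by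
  set J := (Finset.range r).filter fun j => r * (ℓ j - ℓ (j + 1)) ≤ 4 * ℓ j
  set K := (Finset.range r).filter fun j => ¬ r * (ℓ j - ℓ (j + 1)) ≤ 4 * ℓ j with hK
  have h1 : J.card + K.card = r := by
    have := Finset.card_filter_add_card_filter_not (s := Finset.range r)
      (fun j => r * (ℓ j - ℓ (j + 1)) ≤ 4 * ℓ j)
    rwa [Finset.card_range] at this
  have hmono : ∀ i j, i ≤ j → j ≤ r → ℓ j ≤ ℓ i := by
    intro i j hij
    induction j, hij using Nat.le_induction with
    | base => intro _; exact le_rfl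
    | succ j hij ih => intro hj; exact (hanti j (by omega)).trans (ih (by omega))
  have htel : ∀ m ≤ r, ∑ j ∈ Finset.range m, (ℓ j - ℓ (j + 1)) = ℓ 0 - ℓ m := by
    intro m hm
    induction m with
    | zero => simp
    | succ m ih =>
      rw [Finset.sum_range_succ, ih (by omega)]
      have := hanti m (by omega)
      have := hmono 0 m (by omega) (by omega)
      omega
  have h2 : ∑ j ∈ K, (ℓ j - ℓ (j + 1)) ≤ ℓ 0 - ℓ r := by
    rw [← htel r le_rfl]
    exact Finset.sum_le_sum_of_subset (Finset.filter_subset _ _)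
  -- A step in `K` removes more than `4 * ℓ j / r`, which is more than `2 * ℓ 0 / r`, while all
  -- steps together remove less than half of `ℓ 0`.
  have h3 : K.card * (2 * ℓ 0) ≤ ∑ j ∈ K, r * (ℓ j - ℓ (j + 1)) := by
    rw [← smul_eq_mul]
    refine Finset.card_nsmul_le_sum _ _ _ fun j hj => ?_
    rw [hK, Finset.mem_filter, Finset.mem_range, not_le] at hj
    have := hmono j r hj.1.le le_rfl
    omega
  rw [← Finset.mul_sum] at h3
  have h4 := h3.trans (Nat.mul_le_mul_left r h2)
  have h5 : 2 * (ℓ 0 - ℓ r) ≤ ℓ 0 := by omega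
  by_contra hc
  have h6 : r < 2 * K.card := by omega
  have h7 : 2 * (K.card * (2 * ℓ 0)) ≤ r * ℓ 0 := by
    calc 2 * (K.card * (2 * ℓ 0)) ≤ 2 * (r * (ℓ 0 - ℓ r)) := by omega
      _ = r * (2 * (ℓ 0 - ℓ r)) := by ring
      _ ≤ r * ℓ 0 := Nat.mul_le_mul_left r h5
  have h8 : 0 < ℓ 0 := by
    by_contra h0
    have := hmono 0 r (Nat.zero_le _) le_rfl
    omega
  nlinarith

/-- One outer iteration is likely to save a large part of a shortest route. -/
theorem updateShortcuts_fail (hn : 2 ≤ n) (hκ : 0 < κ.funnel) (hκ' : 10 ≤ κ.sample)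
    (hκ'' : 320 ≤ κ.long) (hκr : 4000 ≤ κ.rounds) (hd : d ≤ B) (hw : ¬ up → w ≤ -d)
    (hM : ∀ j a b, (shortShortcuts B)^[j] M a b ≠ ⊤) {L : ℕ} (R : HasRoute M up d w x y L) :
    ∃ L' ≤ routeLength M up d w x y - 1,
      ((routeLength M up d w x y - 1 : ℕ) : ℝ) ≤
        1536 * lg n * ((routeLength M up d w x y - 1 : ℕ) - L') ∧
      (updateShortcuts κ B M).fail (fun T => HasRoute T up d w x y (L' + 1)) ≤
        ENNReal.ofReal (4 / 5) := by
  classical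
  have hL := one_le_lg hn
  have hnr : (0 : ℝ) < n := by positivity
  have hlgq := lg_le_two_mul_sqrt (n := n) (by omega)
  have hq1 : 1 ≤ (n : ℝ) ^ (1 / 2 : ℝ) :=
    Real.one_le_rpow (by exact_mod_cast (by omega : 1 ≤ n)) (by norm_num)
  unfold updateShortcuts
  dsimp only
  set q : ℝ := (n : ℝ) ^ (1 / 2 : ℝ) with hq
  have hrq : 4000 * q ≤ ⌈κ.rounds * q⌉₊ := by
    refine le_trans ?_ (Nat.le_ceil _)
    gcongr
  generalize ⌈κ.rounds * q⌉₊ = r at hrq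
  have hr0 : (4000 : ℝ) ≤ r := by linarith
  have hr1 : 4000 ≤ r := by exact_mod_cast hr0
  let A : ℕ → Table n := fun j => (shortShortcuts B)^[j] M
  have hAmono : ∀ j, A j ≤ A (j + 1) := fun j => by
    simp only [A]
    rw [Function.iterate_succ_apply']
    exact le_shortShortcuts
  have hAM : ∀ j, M ≤ A j := fun j => by
    induction j with
    | zero => exact le_rfl
    | succ j ih => exact ih.trans (hAmono j)
  let ℓ : ℕ → ℕ := fun j => routeLength (A j) up d w x y
  have hspec : ∀ j, HasRoute (A j) up d w x y (ℓ j) := fun j => (R.mono (hAM j) le_rfl).length_spec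
  have hanti : ∀ j, ℓ (j + 1) ≤ ℓ j := fun j => ((hspec j).mono (hAmono j) le_rfl).length_le
  have hanti' : ∀ i j, i ≤ j → ℓ j ≤ ℓ i := fun i j hij => antitone_nat_of_succ_le hanti hij
  have hℓ0 : routeLength M up d w x y = ℓ 0 := rfl
  have hfst : ∀ L' : ℕ, HasRoute (A r) up d w x y (L' + 1) →
      ((repeatRandom (fun _ => updateStep κ B r) r (M, M)).map
        fun st x y => max (st.1 x y) (st.2 x y)).fail (fun T => HasRoute T up d w x y (L' + 1)) ≤
        ENNReal.ofReal (4 / 5) := fun L' hL' => by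
    rw [PMF.fail_map]
    refine (PMF.fail_eq_zero.2 fun st hst => ?_).le.trans zero_le
    refine hL'.mono (fun a b => ?_) le_rfl
    exact le_max_of_le_left ((updateLoop_fst hst).1 ▸ le_rfl)
  rw [hℓ0]
  have hc : (1 : ℝ) ≤ 1536 * lg n := by linarith
  -- A short route is finished by the short shortcuts alone, since each round saves an arc. If the
  -- rounds halve the length, they also suffice. Otherwise most rounds hardly shorten the route, and
  -- the long shortcuts have to help.
  rcases le_or_gt (ℓ 0) (r + 1) with hcase | hcase
  · refine ⟨0, Nat.zero_le _, ?_, hfst 0 ?_⟩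
    · have : (0 : ℝ) ≤ ((ℓ 0 - 1 : ℕ) : ℝ) := Nat.cast_nonneg _
      push_cast
      nlinarith
    · exact ((hspec 0).short_iterate hd hw hM r).mono le_rfl (by omega)
  rcases le_or_gt (2 * ℓ r) (ℓ 0) with hcase2 | hcase2
  · refine ⟨ℓ r - 1, by omega, ?_, hfst _ ((hspec r).mono le_rfl (by omega))⟩
    have h1 : ((ℓ 0 - 1 : ℕ) : ℝ) ≤ 2 * (((ℓ 0 - 1 : ℕ) : ℝ) - ((ℓ r - 1 : ℕ) : ℝ)) := by
      have : (ℓ 0 - 1) + 2 * (ℓ r - 1) ≤ 2 * (ℓ 0 - 1) := by omega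
      have : (((ℓ 0 - 1) + 2 * (ℓ r - 1) : ℕ) : ℝ) ≤ ((2 * (ℓ 0 - 1) : ℕ) : ℝ) := by
        exact_mod_cast this
      push_cast at this
      linarith
    have h2 : (0 : ℝ) ≤ ((ℓ 0 - 1 : ℕ) : ℝ) := Nat.cast_nonneg _
    nlinarith
  set J := (Finset.range r).filter fun j => r * (ℓ j - ℓ (j + 1)) ≤ 4 * ℓ j with hJ
  have hJcard := card_short_steps (r := r) (fun j _ => hanti j) hcase2
  -- The long shortcuts save the fraction `1 / (768 * lg n)` of the current length, which is more
  -- than half of `ℓ 0`.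
  set K := ⌈(ℓ 0 : ℝ) / (1536 * lg n)⌉₊ with hK
  have hKle : (ℓ 0 : ℝ) ≤ 1536 * lg n * K := by
    have := Nat.le_ceil ((ℓ 0 : ℝ) / (1536 * lg n))
    rw [div_le_iff₀ (by positivity)] at this
    linarith
  have hK0 : K ≤ ℓ 0 := Nat.ceil_le.2 (div_le_self (Nat.cast_nonneg _) hc)
  have hKpos : 0 < K := Nat.ceil_pos.2 (by
      have : (0 : ℝ) < ℓ 0 := by exact_mod_cast (by omega : 0 < ℓ 0)
      positivity)
  refine ⟨ℓ 0 - K - 1, by omega, ?_, ?_⟩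
  · have h2 : (0 : ℝ) ≤ ((ℓ 0 - 1 : ℕ) : ℝ) := Nat.cast_nonneg _
    rcases hK0.eq_or_lt with e | e
    · rw [show ℓ 0 - K - 1 = 0 by omega]
      push_cast
      nlinarith
    · rw [show ℓ 0 - K - 1 = ℓ 0 - 1 - K by omega, Nat.cast_sub (by omega : K ≤ ℓ 0 - 1)]
      have : ((ℓ 0 - 1 : ℕ) : ℝ) ≤ ℓ 0 := by exact_mod_cast Nat.sub_le _ _
      linarith
  rw [PMF.fail_map]
  refine (PMF.fail_mono (P := fun st : Table n × Table n => HasRoute st.2 up d w x y (ℓ 0 - K - 1 + 1))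
    fun st _ hst => hst.mono (fun a b => le_max_right _ _) le_rfl).trans
    ((updateLoop_fail_le (P := fun T => HasRoute T up d w x y (ℓ 0 - K - 1 + 1))
      (fun T T' hT hTT' => hT.mono hTT' le_rfl) J (fun j hj => ?_) r).trans ?_)
  · rw [hJ, Finset.mem_filter, Finset.mem_range] at hj
    obtain ⟨ℓ', hℓ', v, h, Rj, E⟩ := (hspec j).exists_exact (hM j)
    have hℓ'' : ℓ' = ℓ j := le_antisymm hℓ' (HasRoute.length_le ⟨ℓ', le_rfl, v, h, Rj⟩)
    subst hℓ''
    have hshort : ∀ L, HasRoute (shortShortcuts B (A j)) up d w x y L →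
        ℓ j ≤ L + (ℓ j - ℓ (j + 1)) := fun L hL => by
      have e : shortShortcuts B (A j) = A (j + 1) := (Function.iterate_succ_apply' _ _ _).symm
      rw [e] at hL
      have : ℓ (j + 1) ≤ L := hL.length_le
      omega
    have hBk := Rj.card_breaks_le E hd hshort
    have hj2 := hanti' j r hj.1.le
    have hj0 := hanti' 0 j (Nat.zero_le _)
    have hrℓ : r ≤ 2 * ℓ j := by omega
    -- 12 from the reducible triples of a round in `J`, and 8 from the constant 4 with `r ≤ 2 * ℓ
    -- j`.
    have hrBk : r * (reducibleBreaks (ℓ j) h).card ≤ 20 * ℓ j := by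
      calc _ ≤ r * (3 * (ℓ j - ℓ (j + 1)) + 4) := Nat.mul_le_mul_left r hBk
        _ = 3 * (r * (ℓ j - ℓ (j + 1))) + 4 * r := by ring
        _ ≤ 20 * ℓ j := by omega
    have hrℓ' : (r : ℝ) ≤ 2 * ℓ j := by exact_mod_cast hrℓ
    obtain ⟨k, k1, k2, k3⟩ := Rj.long_fail hn hκ hκ' hκ'' E hd hw
      (breaks_reducibleBreaks (ℓ j) h) (by
        have h1 : (⌈q⌉₊ : ℝ) ≤ 2 * q := by
          have := Nat.ceil_lt_add_one (by linarith : 0 ≤ q)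
          linarith
        have h2 : (r : ℝ) * (reducibleBreaks (ℓ j) h).card ≤ 20 * ℓ j := by exact_mod_cast hrBk
        have h3 : (8 : ℝ) * ((12 * ⌈q⌉₊ + 1) * (reducibleBreaks (ℓ j) h).card) ≤ ℓ j := by
          have h4 : (0 : ℝ) ≤ (reducibleBreaks (ℓ j) h).card := Nat.cast_nonneg _
          have h5 : (12 * (⌈q⌉₊ : ℝ) + 1) * 160 ≤ r := by linarith
          have h6 := mul_le_mul_of_nonneg_right h5 h4
          linarith
        exact_mod_cast h3) (by linarith)
    refine (PMF.fail_mono fun T _ hT => hT.mono le_rfl ?_).trans k3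
    have hKk : K ≤ k := by
      refine Nat.ceil_le.2 ?_
      rw [div_le_iff₀ (by positivity)]
      have : (ℓ 0 : ℝ) ≤ 2 * ℓ j := by exact_mod_cast (by omega : ℓ 0 ≤ 2 * ℓ j)
      linarith
    omega
  · rw [Finset.inter_eq_left.2 (Finset.filter_subset _ _)]
    have hr' : (0 : ℝ) < r := by linarith
    -- A call probability of `1 / r` is enough for constant success: with at least `r / 2` promising
    -- rounds, the failure probability is at most exp(-1/4) ≤ 4/5.
    have h1 := clamp_half_le (p := lg n / r) (q := 1 / r) (by positivity)
      (by rw [div_le_one hr']; linarith) (by gcongr)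
    refine (pow_le_pow_left' h1 _).trans ?_
    rw [← ENNReal.ofReal_pow (Real.exp_nonneg _), ← Real.exp_nat_mul]
    refine ENNReal.ofReal_le_ofReal ?_
    have h2 : (r : ℝ) ≤ 2 * J.card := by exact_mod_cast hJcard
    have h3 : (J.card : ℝ) * -(1 / r / 2) ≤ -(1 / 4) := by
      rw [div_div, mul_neg, neg_le_neg_iff, mul_one_div, div_le_div_iff₀ (by norm_num)
        (by positivity)]
      linarith
    calc Real.exp (J.card * -(1 / r / 2)) ≤ Real.exp (-(1 / 4)) := Real.exp_le_exp.2 h3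
      _ = (Real.exp (1 / 4))⁻¹ := Real.exp_neg _
      _ ≤ (5 / 4)⁻¹ := by
        gcongr
        linarith [Real.add_one_le_exp (1 / 4 : ℝ)]
      _ = 4 / 5 := by norm_num

end Update

/-! ### The output of the algorithm -/

section Output

variable {n : ℕ} {G : RoadNetwork (Fin n)} {M : Table n} {up : Prop} {B d w : ℝ} {x y : Fin n}
  {κ : HiddenConstants}

theorem SoundTable.short_iterate (hM : SoundTable G B M) (j : ℕ) :
    SoundTable G B ((_root_.shortShortcuts B)^[j] M) := by
  induction j with
  | zero => exact hM
  | succ j ih => rw [Function.iterate_succ_apply']; exact ih.shortShortcuts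

theorem SoundData.breadthSearch_iterate {D : PathData n} (hM : SoundTable G B M)
    (hD : SoundData G B M D) (k : ℕ) : SoundData G B M ((_root_.breadthSearch M)^[k] D) := by
  induction k with
  | zero => exact hD
  | succ k ih => rw [Function.iterate_succ_apply']; exact ih.breadthSearch hM

theorem SoundData.concatenate_iterate {D : PathData n} (hM : SoundTable G B M)
    (hD : SoundData G B M D) (U W X : Finset (Fin n)) (k : ℕ) :
    SoundData G B M ((_root_.concatenate M U W X)^[k] D) := by
  induction k with
  | zero => exact hD
  | succ k ih => rw [Function.iterate_succ_apply']; exact ih.concatenate hM U W X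

theorem SoundData.arcSearch_iterate {D : PathData n} (hM : SoundTable G B M)
    (hD : SoundData G B M D) (T : Finset (Fin n)) (k : ℕ) :
    SoundData G B M ((arcSearch M T)^[k] D) := by
  induction k with
  | zero => exact hD
  | succ k ih =>
    rw [Function.iterate_succ_apply']
    exact (ih.concatenateOpposite hM _ _ _).concatenate hM _ _ _

theorem SoundTable.computeFunnels (hM : SoundTable G B M) :
    ∀ D ∈ (_root_.computeFunnels κ M).support, SoundData G B M D := by
  intro D hD
  unfold _root_.computeFunnels at hD
  rw [PMF.mem_support_map_iff] at hD
  obtain ⟨S, -, rfl⟩ := hD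
  exact (((hM.init.breadthSearch_iterate hM _).concatenate_iterate hM S S S _).concatenate hM
    S S Finset.univ).breadthSearch_iterate hM _

theorem SoundTable.longShortcuts (hM : SoundTable G B M) :
    ∀ L ∈ (_root_.longShortcuts κ B M).support, SoundTable G B L := by
  intro L hL
  unfold _root_.longShortcuts at hL
  rw [PMF.mem_support_bind_iff] at hL
  obtain ⟨D, hD, hL⟩ := hL
  rw [PMF.mem_support_map_iff] at hL
  obtain ⟨st, hst, rfl⟩ := hL
  have := repeatRandom_support (I := fun _ st => SoundData G B M st.1)
    (hM.computeFunnels D hD) (fun i st hst' st' hs => by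
      obtain ⟨T, rfl⟩ := longStep_support hs
      exact hst'.arcSearch_iterate hM T _) _ st hst
  exact (this.arcBoundedToMonotone hM _).mono

theorem SoundTable.updateShortcuts (hM : SoundTable G B M) :
    ∀ M' ∈ (_root_.updateShortcuts κ B M).support, SoundTable G B M' := by
  intro M' hM'
  unfold _root_.updateShortcuts at hM'
  rw [PMF.mem_support_map_iff] at hM'
  obtain ⟨st, hst, rfl⟩ := hM'
  obtain ⟨h1, h2⟩ := repeatRandom_support
    (I := fun _ st => SoundTable G B st.1 ∧ SoundTable G B st.2) ⟨hM, hM⟩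
    (fun i st hst' st' hs => by
      obtain ⟨e1, e2⟩ := updateStep_support hs
      refine ⟨e1 ▸ hst'.1.shortShortcuts, ?_⟩
      rcases e2 with e2 | ⟨L, hL, e2⟩
      · exact e2 ▸ hst'.2
      · exact e2 ▸ hst'.2.max (hst'.1.longShortcuts L hL)) _ st hst
  exact h1.max h2

theorem SoundTable.ofNetwork (hB : 0 ≤ B)
    (hG : ∀ u v, G.Adj u v → G.gain u v ∈ Set.Icc (-B) B) : SoundTable G B (Table.ofNetwork G) := by
  classical
  intro x y
  unfold Table.ofNetwork
  refine Holds.max ?_ ?_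
  · split_ifs with h
    · subst h
      exact Holds.coe (r := 0) (soundEntry_self hB)
    · exact .bot
  · split_ifs with h
    · exact .coe (soundEntry_of_arc h (hG x y h))
    · exact .bot

theorem SoundTable.ne_top (hM : SoundTable G B M) (a b : Fin n) : M a b ≠ ⊤ := (hM a b).ne_top

theorem computeShortcuts_support (hB : 0 ≤ B)
    (hG : ∀ u v, G.Adj u v → G.gain u v ∈ Set.Icc (-B) B) :
    ∀ M ∈ (computeShortcuts κ B G).support, SoundTable G B M ∧ Table.ofNetwork G ≤ M :=
  repeatRandom_support (I := fun _ M => SoundTable G B M ∧ Table.ofNetwork G ≤ M)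
    ⟨SoundTable.ofNetwork hB hG, le_rfl⟩ (fun _ _ hM M' hM' =>
      ⟨hM.1.updateShortcuts M' hM', hM.2.trans (le_of_mem_support_updateShortcuts hM')⟩) _

/-- The excess length never grows, and with probability at least 1/5 it loses the fraction `1 /
(1536 * lg n)`; hence 7680 = 5 · 1536. -/
theorem updateShortcuts_expect_le (hn : 2 ≤ n) (hκ : 0 < κ.funnel) (hκ' : 10 ≤ κ.sample)
    (hκ'' : 320 ≤ κ.long) (hκr : 4000 ≤ κ.rounds) (hd : d ≤ B) (hw : ¬ up → w ≤ -d)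
    (hM : SoundTable G B M) {L : ℕ} (R : HasRoute M up d w x y L) :
    (updateShortcuts κ B M).expect (fun T => ((routeLength T up d w x y - 1 : ℕ) : ℝ≥0∞)) ≤
      ENNReal.ofReal (1 - 1 / (7680 * lg n)) * ((routeLength M up d w x y - 1 : ℕ) : ℝ≥0∞) := by
  have hL := one_le_lg hn
  obtain ⟨L', h1, h2, h3⟩ := updateShortcuts_fail hn hκ hκ' hκ'' hκr hd hw
    (fun j => (hM.short_iterate j).ne_top) R
  have hlen := R.length_spec
  generalize routeLength M up d w x y = ℓ at *
  refine (PMF.expect_le (a := (L' : ℝ≥0∞)) (b := ((ℓ - 1 - L' : ℕ) : ℝ≥0∞))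
    (P := fun T => HasRoute T up d w x y (L' + 1)) (fun T _ hT => ?_) (fun T hT => ?_)).trans ?_
  · have := hT.length_le
    exact_mod_cast (by omega)
  · have := (hlen.mono (le_of_mem_support_updateShortcuts hT) le_rfl).length_le
    exact_mod_cast (by omega)
  · calc _ ≤ (L' : ℝ≥0∞) + ((ℓ - 1 - L' : ℕ) : ℝ≥0∞) * ENNReal.ofReal (4 / 5) := by gcongr
      _ = ENNReal.ofReal (L' + (ℓ - 1 - L' : ℕ) * (4 / 5)) := by
        rw [ENNReal.ofReal_add (by positivity) (by positivity),
          ENNReal.ofReal_mul (by positivity), ENNReal.ofReal_natCast, ENNReal.ofReal_natCast]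
      _ ≤ ENNReal.ofReal ((1 - 1 / (7680 * lg n)) * (ℓ - 1 : ℕ)) := by
        refine ENNReal.ofReal_le_ofReal ?_
        rw [Nat.cast_sub h1]
        have h4 : 1 / (7680 * lg n) * ((ℓ - 1 : ℕ) : ℝ) ≤ ((ℓ - 1 : ℕ) - (L' : ℝ)) / 5 := by
          rw [one_div_mul_eq_div, div_le_div_iff₀ (by positivity) (by norm_num)]
          linarith
        linarith
      _ = _ := by
        rw [ENNReal.ofReal_mul, ENNReal.ofReal_natCast]
        rw [sub_nonneg, div_le_one (by positivity)]
        linarith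

/-- Markov's inequality: the excess length is less than n at the start, it is an integer of at least
1 upon failure, and the outer iterations multiply its expectation by at most n^(-(c + 4)). -/
theorem computeShortcuts_fail_route (hn : 2 ≤ n) (hκ : 0 < κ.funnel) (hκ' : 10 ≤ κ.sample)
    (hκ'' : 320 ≤ κ.long) (hκr : 4000 ≤ κ.rounds) {c : ℝ} (hc : 0 ≤ c)
    (hκo : 7680 * (c + 4) ≤ κ.outer) (hB : 0 ≤ B)
    (hG : ∀ u v, G.Adj u v → G.gain u v ∈ Set.Icc (-B) B) (hd : d ≤ B) (hw : ¬ up → w ≤ -d) {L : ℕ}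
    (R : HasRoute (Table.ofNetwork G) up d w x y L) :
    (computeShortcuts κ B G).fail (fun M => HasRoute M up d w x y 1) ≤
      ENNReal.ofReal ((n : ℝ) ^ (-(c + 4))) * n := by
  have hL := one_le_lg hn
  let I : Table n → Prop := fun M => SoundTable G B M ∧ HasRoute M up d w x y L
  have h0 : I (Table.ofNetwork G) := ⟨SoundTable.ofNetwork hB hG, R⟩
  have hI : ∀ (i : ℕ) M, I M → ∀ M' ∈ (updateShortcuts κ B M).support, I M' := fun _ M hM M' hM' =>
    ⟨hM.1.updateShortcuts M' hM', hM.2.mono (le_of_mem_support_updateShortcuts hM') le_rfl⟩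
  have hE := expect_repeatRandom_le (f := fun _ => updateShortcuts κ B) h0 hI (fun _ M hM =>
    updateShortcuts_expect_le hn hκ hκ' hκ'' hκr hd hw hM.1 hM.2) ⌈κ.outer * lg n ^ 2⌉₊
  refine (PMF.fail_le_expect (φ := fun T => ((routeLength T up d w x y - 1 : ℕ) : ℝ≥0∞))
    fun M hM hno => ?_).trans (hE.trans (mul_le_mul' ?_ ?_))
  · have hR := (repeatRandom_support (I := fun _ => I) h0 hI _ M hM).2.length_spec
    have : 1 ≤ routeLength M up d w x y - 1 := by
      by_contra hlt
      exact hno (hR.mono le_rfl (by omega))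
    exact_mod_cast this
  · calc _ ≤ ENNReal.ofReal (Real.exp (-(1 / (7680 * lg n)))) ^ ⌈κ.outer * lg n ^ 2⌉₊ := by
          refine pow_le_pow_left' (ENNReal.ofReal_le_ofReal ?_) _
          linarith [Real.add_one_le_exp (-(1 / (7680 * lg n)))]
      _ = ENNReal.ofReal (Real.exp (-(⌈κ.outer * lg n ^ 2⌉₊ * (1 / (7680 * lg n))))) := by
          rw [← ENNReal.ofReal_pow (Real.exp_nonneg _), ← Real.exp_nat_mul, mul_neg]
      _ ≤ _ := by
          refine ENNReal.ofReal_le_ofReal (exp_neg_mul_lg_le (by omega) (by linarith) ?_)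
          calc (c + 4) * lg n = 7680 * (c + 4) * lg n ^ 2 * (1 / (7680 * lg n)) := by field_simp
            _ ≤ κ.outer * lg n ^ 2 * (1 / (7680 * lg n)) := by gcongr
            _ ≤ _ := by gcongr; exact Nat.le_ceil _
  · obtain ⟨ℓ, hℓ, v, h, Rℓ⟩ := R
    have h1 := Rℓ.length_lt
    have h2 := HasRoute.length_le ⟨ℓ, le_rfl, v, h, Rℓ⟩
    exact_mod_cast (by omega)

/-- All the shortcuts that are due to simple paths of the network are in the table. -/
def CompleteTable (G : RoadNetwork (Fin n)) (B : ℝ) (M : Table n) : Prop :=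
  (∀ w x y ℓ v h, Route (Table.ofNetwork G) True B w x y ℓ v h → (w : EReal) ≤ M x y) ∧
    ∀ d ≤ B, ∀ x y ℓ v h, Route (Table.ofNetwork G) False d (-d) x y ℓ v h →
      ((-d : ℝ) : EReal) ≤ M x y

/-- A route of length 1 is an entry; one of length 0 has no positive gain, which the nonnegative
diagonal covers. -/
theorem HasRoute.le_entry (R : HasRoute M up d w x y 1) (h0 : ∀ x, 0 ≤ M x x) :
    (w : EReal) ≤ M x y := by
  obtain ⟨ℓ, hℓ, v, h, R⟩ := R
  have ht := R.total
  obtain rfl | rfl : ℓ = 0 ∨ ℓ = 1 := by omega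
  · rw [← R.start, ← R.finish]
    refine le_trans ?_ (h0 _)
    rw [sub_self] at ht
    exact_mod_cast ht
  · have := R.gain 0 (by omega)
    rw [R.start, R.finish] at this
    exact le_trans (by exact_mod_cast ht) this

/-- The gains of the parts of the paths of length at most `n`. -/
noncomputable def pathGains (M : Table n) : Finset ℝ :=
  open Classical in
  (Finset.univ : Finset ((Fin (n + 1) → Fin n) × Fin (n + 1) × Fin (n + 1))).image fun q =>
    ∑ k ∈ Finset.Ico (q.2.1 : ℕ) q.2.2, (M (q.1 (Fin.ofNat (n + 1) k))
      (q.1 (Fin.ofNat (n + 1) (k + 1)))).toReal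

theorem Route.sub_mem_pathGains {ℓ : ℕ} {v : ℕ → Fin n} {h : ℕ → ℝ}
    (R : Route M up d w x y ℓ v h) (E : ExactGains M ℓ v h) {i j : ℕ} (hij : i ≤ j) (hj : j ≤ ℓ) :
    h j - h i ∈ pathGains M := by
  classical
  have hℓ := R.length_lt
  refine Finset.mem_image.2 ⟨(fun k => v k, ⟨i, by omega⟩, ⟨j, by omega⟩), Finset.mem_univ _, ?_⟩
  rw [← Finset.sum_Ico_sub (f := h) hij]
  refine Finset.sum_congr rfl fun k hk => ?_
  rw [Finset.mem_Ico] at hk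
  have e1 : ((Fin.ofNat (n + 1) k : Fin (n + 1)) : ℕ) = k := Nat.mod_eq_of_lt (by omega)
  have e2 : ((Fin.ofNat (n + 1) (k + 1) : Fin (n + 1)) : ℕ) = k + 1 := Nat.mod_eq_of_lt (by omega)
  simp only [e1, e2]
  rw [E k (by omega)]
  rfl

/-- Routes with exact gains realize only finitely many total gains, so one best route per pair
dominates all others. This makes the union bound finite, although the heights are real; the same
applies to `exists_best_drop`. -/
theorem exists_best_climb (hM : ∀ a b, M a b ≠ ⊤) (x y : Fin n) :
    ∃ w, ∀ w' ℓ v h, Route M True B w' x y ℓ v h → w' ≤ w ∧ HasRoute M True B w x y n := by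
  classical
  let W := (pathGains M).filter fun w => HasRoute M True B w x y n
  have key : ∀ w' ℓ v h, Route M True B w' x y ℓ v h → ∃ w ∈ W, w' ≤ w := by
    intro w' ℓ v h R
    obtain ⟨h', R', E⟩ := R.exact hM
    exact ⟨h' ℓ - h' 0, Finset.mem_filter.2 ⟨R'.sub_mem_pathGains E (Nat.zero_le _) le_rfl,
      ℓ, R'.length_lt.le, v, h', { R' with total := le_rfl }⟩, R'.total⟩
  rcases W.eq_empty_or_nonempty with h0 | h0
  · refine ⟨0, fun w' ℓ v h R => ?_⟩
    obtain ⟨w, hw, -⟩ := key w' ℓ v h R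
    exact absurd hw (h0 ▸ Finset.notMem_empty w)
  · obtain ⟨w, hw, hmax⟩ := W.exists_max_image id h0
    refine ⟨w, fun w' ℓ v h R => ?_⟩
    obtain ⟨w'', hw'', hle⟩ := key w' ℓ v h R
    exact ⟨hle.trans (hmax w'' hw''), (Finset.mem_filter.1 hw).2⟩

theorem exists_best_drop (hM : ∀ a b, M a b ≠ ⊤) (x y : Fin n) :
    ∃ d, ∀ d' ℓ v h, d' ≤ B → Route M False d' (-d') x y ℓ v h →
      d ≤ d' ∧ d ≤ B ∧ HasRoute M False d (-d) x y n := by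
  classical
  let W := (pathGains M).filter fun w => HasRoute M False (-w) w x y n
  have key : ∀ d' ℓ v h, Route M False d' (-d') x y ℓ v h → ∃ w ∈ W, -d' ≤ w := by
    intro d' ℓ v h R
    obtain ⟨h', R', E⟩ := R.exact hM
    obtain ⟨⟨i, j⟩, hij, hmax⟩ := (((Finset.range (ℓ + 1)) ×ˢ (Finset.range (ℓ + 1))).filter
      (fun q => q.1 ≤ q.2)).exists_max_image (fun q => h' q.1 - h' q.2) ⟨(0, 0), by simp⟩
    simp only [Finset.mem_filter, Finset.mem_product, Finset.mem_range] at hij hmax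
    have hdrop : ∀ a b, a ≤ b → b ≤ ℓ → h' a - h' b ≤ -(h' j - h' i) := fun a b h1 h2 => by
      have := hmax (a, b) ⟨⟨by omega, by omega⟩, h1⟩
      simp only at this
      linarith
    refine ⟨h' j - h' i, Finset.mem_filter.2 ⟨R'.sub_mem_pathGains E hij.2 (by omega),
      ℓ, R'.length_lt.le, v, h', { R' with drop := hdrop, total := ?_ }⟩, ?_⟩
    · linarith [hdrop 0 ℓ (Nat.zero_le _) le_rfl]
    · linarith [R'.drop i j hij.2 (by omega)]
  rcases W.eq_empty_or_nonempty with h0 | h0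
  · refine ⟨0, fun w' ℓ v h _ R => ?_⟩
    obtain ⟨w, hw, -⟩ := key w' ℓ v h R
    exact absurd hw (h0 ▸ Finset.notMem_empty w)
  · obtain ⟨w, hw, hmax⟩ := W.exists_max_image id h0
    refine ⟨-w, fun d' ℓ v h hd R => ?_⟩
    obtain ⟨w'', hw'', hle⟩ := key d' ℓ v h R
    have := hmax w'' hw''
    simp only [id] at this
    exact ⟨by linarith, by linarith, by rw [neg_neg]; exact (Finset.mem_filter.1 hw).2⟩

theorem zero_le_ofNetwork (x : Fin n) : 0 ≤ Table.ofNetwork G x x := by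
  unfold Table.ofNetwork
  rw [if_pos rfl]
  exact le_max_left _ _

/-- Union bound over the best climb and the best drop of every pair: 2n² · n^(-(c + 4)) · n = 2n^(-c
- 1) ≤ n^(-c). -/
theorem computeShortcuts_fail_complete (hn : 2 ≤ n) (hκ : 0 < κ.funnel) (hκ' : 10 ≤ κ.sample)
    (hκ'' : 320 ≤ κ.long) (hκr : 4000 ≤ κ.rounds) {c : ℝ} (hc : 0 ≤ c)
    (hκo : 7680 * (c + 4) ≤ κ.outer) (hB : 0 ≤ B)
    (hG : ∀ u v, G.Adj u v → G.gain u v ∈ Set.Icc (-B) B) :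
    (computeShortcuts κ B G).fail (CompleteTable G B) ≤ ENNReal.ofReal ((n : ℝ) ^ (-c)) := by
  classical
  have hM := (SoundTable.ofNetwork hB hG).ne_top
  choose wU hU using exists_best_climb (B := B) hM
  choose dD hD using exists_best_drop (B := B) hM
  have hfail := PMF.fail_forall_le (computeShortcuts κ B G)
    (Finset.univ : Finset (Bool × Fin n × Fin n)) (fun q M => match q with
      | (true, x, y) => HasRoute (Table.ofNetwork G) True B (wU x y) x y n →
          HasRoute M True B (wU x y) x y 1
      | (false, x, y) => dD x y ≤ B → HasRoute (Table.ofNetwork G) False (dD x y) (-dD x y) x y n →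
          HasRoute M False (dD x y) (-dD x y) x y 1)
    (a := ENNReal.ofReal ((n : ℝ) ^ (-(c + 4))) * n) (fun q _ => by
      obtain ⟨b, x, y⟩ := q
      cases b
      · by_cases h1 : dD x y ≤ B ∧ HasRoute (Table.ofNetwork G) False (dD x y) (-dD x y) x y n
        · exact (PMF.fail_mono fun M _ hR _ _ => hR).trans (computeShortcuts_fail_route hn hκ hκ'
            hκ'' hκr hc hκo hB hG h1.1 (fun _ => le_rfl) h1.2)
        · exact (PMF.fail_eq_zero.2 fun M _ h2 h3 => absurd ⟨h2, h3⟩ h1).le.trans zero_le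
      · by_cases h1 : HasRoute (Table.ofNetwork G) True B (wU x y) x y n
        · exact (PMF.fail_mono fun M _ hR _ => hR).trans (computeShortcuts_fail_route hn hκ hκ'
            hκ'' hκr hc hκo hB hG le_rfl (fun h => absurd trivial h) h1)
        · exact (PMF.fail_eq_zero.2 fun M _ h2 => absurd h2 h1).le.trans zero_le)
  refine (PMF.fail_mono fun M hMs hall => ?_).trans (hfail.trans ?_)
  · have h0 : ∀ x, 0 ≤ M x x := fun x => (zero_le_ofNetwork x).trans
      ((computeShortcuts_support hB hG M hMs).2 x x)
    refine ⟨fun w x y ℓ v h R => ?_, fun d hd x y ℓ v h R => ?_⟩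
    · obtain ⟨h1, h2⟩ := hU x y w ℓ v h R
      have := hall (true, x, y) (Finset.mem_univ _) h2
      exact le_trans (by exact_mod_cast h1) (this.le_entry h0)
    · obtain ⟨h1, h2, h3⟩ := hD x y d ℓ v h hd R
      have := hall (false, x, y) (Finset.mem_univ _) h2 h3
      exact le_trans (by exact_mod_cast (by linarith)) (this.le_entry h0)
  · have hn' : (2 : ℝ) ≤ n := by exact_mod_cast hn
    rw [Finset.card_univ, Fintype.card_prod, Fintype.card_prod, Fintype.card_bool, Fintype.card_fin]
    rw [← ENNReal.ofReal_natCast (2 * (n * n)), ← ENNReal.ofReal_natCast n,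
      ← ENNReal.ofReal_mul (by positivity), ← ENNReal.ofReal_mul (by positivity)]
    refine ENNReal.ofReal_le_ofReal ?_
    rw [show -(c + 4) = -c - 4 by ring, Real.rpow_sub (by positivity),
      show (4 : ℝ) = (4 : ℕ) by norm_num, Real.rpow_natCast]
    have hpos : 0 < (n : ℝ) ^ (-c) := by positivity
    rw [show ((2 * (n * n) : ℕ) : ℝ) * ((n : ℝ) ^ (-c) / (n : ℝ) ^ 4 * n) =
      (n : ℝ) ^ (-c) * (2 / n) by push_cast; field_simp]
    exact mul_le_of_le_one_right hpos.le ((div_le_one (by positivity)).2 hn')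

end Output

/-! ### The auxiliary graph -/

section AuxGraph

variable {n : ℕ} {G : RoadNetwork (Fin n)} {M : Table n} {B : ℝ} {s t x y z : Fin n}

theorem SoundTable.exists_real (hM : SoundTable G B M) {x y : Fin n} (h : M x y ≠ ⊥) :
    ∃ m : ℝ, M x y = m ∧ SoundEntry G B x y m := by
  rcases hM x y with h' | h'
  · exact absurd h' h
  · exact h'

theorem SoundTable.exists_real_pair (hM : SoundTable G B M) {x y z w : Fin n}
    (h : 0 ≤ M x y + M z w) : ∃ m m' : ℝ, M x y = m ∧ M z w = m' ∧ SoundEntry G B x y m ∧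
      SoundEntry G B z w m' ∧ 0 ≤ m + m' := by
  obtain ⟨m, e, S⟩ := hM.exists_real (x := x) (y := y) fun hb => by
    rw [hb, EReal.bot_add] at h; simp at h
  obtain ⟨m', e', S'⟩ := hM.exists_real (x := z) (y := w) fun hb => by
    rw [hb, EReal.add_bot] at h; simp at h
  refine ⟨m, m', e, e', S, S', ?_⟩
  rw [e, e'] at h
  exact_mod_cast h

/-- The charge at a copy of a vertex. -/
def levelCharge (B : ℝ) : Level → ℝ
  | .zero => 0
  | .full => B

/-- By driving back and forth between two vertices, with a positive total gain, the battery can be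
charged. -/
theorem reaches_full_of_cycle (hB : 0 ≤ B) {m m' : ℝ} (S : SoundEntry G B x y m)
    (S' : SoundEntry G B y x m') (hm : 0 < m) (hmm : 0 < m + m') : G.Reaches B x 0 y B := by
  -- Each round trip gains `m + m'`, unless the battery overflows. If this happens on the way back,
  -- the car is full at `x` and, as `m > 0`, also at `y`.
  have key : ∀ k : ℕ, G.Reaches B x 0 y B ∨
      (k * (m + m') ≤ B ∧ G.Reaches B x 0 x (k * (m + m'))) := by
    intro k
    induction k with
    | zero => exact Or.inr ⟨by simpa using hB, .refl (by simp)⟩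
    | succ k ih =>
      rcases ih with ih | ⟨h1, h2⟩
      · exact Or.inl ih
      have h0 : 0 ≤ (k : ℝ) * (m + m') := by positivity
      rcases le_or_gt B (k * (m + m') + m) with h3 | h3
      · exact Or.inl (h2.trans (S.reaches h0 h1 (by linarith) h3 le_rfl))
      have h4 := h2.trans (S.reaches h0 h1 (by linarith) le_rfl h3.le)
      push_cast
      rcases le_or_gt ((k + 1) * (m + m')) B with h5 | h5
      · exact Or.inr ⟨h5, h4.trans (S'.reaches (by linarith) h3.le (by linarith) (by linarith) h5)⟩
      · have h6 := h4.trans (S'.reaches (t := B) (by linarith) h3.le (by linarith) (by linarith)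
          le_rfl)
        exact Or.inl (h6.trans (S.reaches hB le_rfl (by linarith) (by linarith) le_rfl))
  obtain ⟨k, hk⟩ := exists_nat_gt (B / (m + m'))
  rw [div_lt_iff₀ hmm] at hk
  exact (key k).resolve_right fun h => by linarith [h.1]

theorem reaches_of_auxGraph (hB : 0 ≤ B) (hM : SoundTable G B M) {p q : Fin n × Level}
    (h : (auxGraph B M).Adj p q) :
    G.Reaches B p.1 (levelCharge B p.2) q.1 (levelCharge B q.2) := by
  obtain ⟨x, _ | _⟩ := p <;> obtain ⟨z, _ | _⟩ := q
  · change G.Reaches B x 0 z 0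
    obtain ⟨y, h1, h2⟩ := h
    obtain ⟨m, m', e, e', S, S', hs⟩ := hM.exists_real_pair h1
    rw [e] at h2
    have hm : 0 ≤ m := by exact_mod_cast h2
    have r1 := S.reaches (t := min m B) le_rfl hB (by linarith) (by simp) (min_le_right _ _)
    refine r1.trans (S'.reaches (le_min hm hB) (min_le_right _ _) ?_ ?_ hB) <;>
    · have := S'.1
      rcases min_choice m B with e | e <;> rw [e] <;> linarith
  · change G.Reaches B x 0 z B
    rcases h with h | ⟨h1, h2⟩
    · obtain ⟨m, e, S⟩ := hM.exists_real (x := x) (y := z) fun hb => by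
        rw [hb] at h; simp at h
      rw [e] at h
      have hm : B ≤ m := by exact_mod_cast h
      exact S.reaches le_rfl hB (by linarith) (by linarith) le_rfl
    · obtain ⟨m, m', e, e', S, S', hs⟩ := hM.exists_real_pair h1.le
      rw [e] at h2
      rw [e, e'] at h1
      exact reaches_full_of_cycle hB S S' (by exact_mod_cast h2) (by exact_mod_cast h1)
  · change G.Reaches B x B z 0
    obtain ⟨m, e, S⟩ := hM.exists_real h
    have := S.1
    exact S.reaches (c := B) hB le_rfl (by linarith) (by linarith) hB
  · change G.Reaches B x B z B
    obtain ⟨y, h1, h2⟩ := h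
    obtain ⟨m, m', e, e', S, S', hs⟩ := hM.exists_real_pair h1
    rw [e'] at h2
    have hm : 0 ≤ m' := by exact_mod_cast h2
    have h3 := S.1
    have h4 := S'.1
    have r1 := S.reaches (c := B) (t := min (B + m) B) hB le_rfl (by linarith) (min_le_left _ _)
      (min_le_right _ _)
    refine r1.trans (S'.reaches (le_min (by linarith) hB) (min_le_right _ _) ?_ ?_ le_rfl) <;>
    · rcases min_choice (B + m) B with e | e <;> rw [e] <;> linarith

/-- The auxiliary graph is sound. -/
theorem alpha_eq_of_transGen (hB : 0 ≤ B) (hM : SoundTable G B M)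
    (h : Relation.TransGen (auxGraph B M).Adj (s, Level.full) (t, Level.full)) :
    G.alpha B B s t = B := by
  have key : ∀ q, Relation.TransGen (auxGraph B M).Adj (s, Level.full) q →
      G.Reaches B s B q.1 (levelCharge B q.2) := by
    intro q hq
    induction hq with
    | single h => exact reaches_of_auxGraph hB hM h
    | tail _ h ih => exact ih.trans (reaches_of_auxGraph hB hM h)
  exact le_antisymm (RoadNetwork.alpha_le s t le_rfl) (key _ h).le_alpha

/-! ### Simple paths in the auxiliary graph -/

variable {v : ℕ → Fin n} {h : ℕ → ℝ} {a b : ℕ} {d : ℝ}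

theorem CompleteTable.climb (hC : CompleteTable G B M) (hab : a ≤ b)
    (hinj : ∀ i j, a ≤ i → i ≤ b → a ≤ j → j ≤ b → v i = v j → i = j)
    (hgain : ∀ i, a ≤ i → i < b →
      ((h (i + 1) - h i : ℝ) : EReal) ≤ Table.ofNetwork G (v i) (v (i + 1)))
    (hdrop : ∀ i j, a ≤ i → i ≤ j → j ≤ b → h i - h j ≤ B)
    (hclimb : ∀ i, a ≤ i → i ≤ b → h a ≤ h i ∧ h i ≤ h b) :
    ((h b - h a : ℝ) : EReal) ≤ M (v a) (v b) := by
  obtain ⟨k, rfl⟩ : ∃ k, b = a + k := ⟨b - a, by omega⟩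
  refine hC.1 _ _ _ k (fun i => v (a + i)) (fun i => h (a + i)) ⟨rfl, rfl, fun i hi j hj hij => ?_,
    fun i hi => hgain (a + i) (by omega) (by omega), fun i j hij hj =>
      hdrop _ _ (by omega) (by omega) (by omega), le_rfl, fun _ i hi =>
      hclimb (a + i) (by omega) (by omega)⟩
  have := hinj _ _ (by omega) (by omega) (by omega) (by omega) hij
  omega

theorem CompleteTable.drop (hC : CompleteTable G B M) (hd : d ≤ B) (hab : a ≤ b)
    (hinj : ∀ i j, a ≤ i → i ≤ b → a ≤ j → j ≤ b → v i = v j → i = j)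
    (hgain : ∀ i, a ≤ i → i < b →
      ((h (i + 1) - h i : ℝ) : EReal) ≤ Table.ofNetwork G (v i) (v (i + 1)))
    (hdrop : ∀ i j, a ≤ i → i ≤ j → j ≤ b → h i - h j ≤ d) :
    ((-d : ℝ) : EReal) ≤ M (v a) (v b) := by
  obtain ⟨k, rfl⟩ : ∃ k, b = a + k := ⟨b - a, by omega⟩
  refine hC.2 d hd _ _ k (fun i => v (a + i)) (fun i => h (a + i)) ⟨rfl, rfl,
    fun i hi j hj hij => ?_, fun i hi => hgain (a + i) (by omega) (by omega), fun i j hij hj =>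
      hdrop _ _ (by omega) (by omega) (by omega), ?_, fun hc => hc.elim⟩
  · have := hinj _ _ (by omega) (by omega) (by omega) (by omega) hij
    omega
  · have := hdrop a (a + k) le_rfl (by omega) le_rfl
    simp only [add_zero]
    linarith

/-- A cycle of positive gain, unrolled, gives an arc of the auxiliary graph. -/
theorem exists_full_of_cycle (hC : CompleteTable G B M) {L : ℕ} (hL : 2 ≤ L) {Δ : ℝ} (hΔ : 0 < Δ)
    {V : ℕ → Fin n} {H : ℕ → ℝ} (hV : ∀ i, V (i + L) = V i) (hH : ∀ i, H (i + L) = H i + Δ)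
    (hinj : ∀ i j, i < j + L → j < i + L → V i = V j → i = j)
    (hgain : ∀ i, ((H (i + 1) - H i : ℝ) : EReal) ≤ Table.ofNetwork G (V i) (V (i + 1)))
    (hbd : ∀ i < L, 0 ≤ H i ∧ H i ≤ B) :
    ∃ a b, (auxGraph B M).Adj (V a, Level.zero) (V b, Level.full) := by
  have hper : ∀ k i, H (i + k * L) = H i + k * Δ := by
    intro k i
    induction k with
    | zero => simp
    | succ k ih =>
      rw [show i + (k + 1) * L = i + k * L + L by ring, hH, ih]
      push_cast; ring
  -- The largest drop within less than one turn.
  obtain ⟨⟨a, r⟩, har, hmax⟩ := ((Finset.range L) ×ˢ (Finset.range L)).exists_max_image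
    (fun q => H q.1 - H (q.1 + q.2)) ⟨(0, 0), by simp; omega⟩
  simp only [Finset.mem_product, Finset.mem_range] at har hmax
  set D := H a - H (a + r) with hD
  -- Full turns only gain height, so they can be removed from the way from `i` to `j`.
  have hdrop : ∀ i j, i ≤ j → H i - H j ≤ D := by
    intro i j hij
    have e1 := Nat.div_add_mod' i L
    have e2 := Nat.div_add_mod' (j - i) L
    have h1 := hper (i / L) (i % L)
    have h2 := hper (i / L + (j - i) / L) (i % L + (j - i) % L)
    rw [show i % L + i / L * L = i by omega] at h1
    rw [show i % L + (j - i) % L + (i / L + (j - i) / L) * L = j by rw [add_mul]; omega] at h2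
    have h3 := hmax (i % L, (j - i) % L) ⟨Nat.mod_lt _ (by omega), Nat.mod_lt _ (by omega)⟩
    simp only at h3
    have h4 : (0 : ℝ) ≤ ((j - i) / L : ℕ) * Δ := by positivity
    push_cast at h2
    rw [h1, h2]
    linarith
  have hpos : ∀ i, 0 ≤ H i := fun i => by
    have h1 := hper (i / L) (i % L)
    rw [show i % L + i / L * L = i by have := Nat.div_add_mod' i L; omega] at h1
    have h2 := (hbd (i % L) (Nat.mod_lt _ (by omega))).1
    have h4 : (0 : ℝ) ≤ (i / L : ℕ) * Δ := by positivity
    linarith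
  have hDB : D ≤ B := by
    have := (hbd a har.1).2
    have := hpos (a + r)
    linarith
  have hD0 : 0 ≤ D := by simpa using hdrop 0 0 le_rfl
  -- Without any drop, the heights never decrease: an arc that strictly ascends and the rest of the
  -- turn are both climbing, and their gains add up to `Δ`.
  rcases hD0.eq_or_lt with hD' | hD'
  · have hex : ∃ i < L, H i < H (i + 1) := by
      by_contra hcon
      push Not at hcon
      have : ∀ i ≤ L, H i ≤ H 0 := by
        intro i
        induction i with
        | zero => intro _; exact le_rfl
        | succ i ih => intro hi; exact (hcon i (by omega)).trans (ih (by omega))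
      have h1 := this L le_rfl
      have h2 := hH 0
      rw [zero_add] at h2
      linarith
    obtain ⟨i, hi, hlt⟩ := hex
    have h1 := hC.climb (v := V) (h := H) (a := i) (b := i + 1) (by omega)
      (fun a b _ _ _ _ => hinj a b (by omega) (by omega)) (fun _ _ _ => hgain _)
      (fun a b _ hab _ => (hdrop a b hab).trans hDB) (fun j hj1 hj2 =>
        ⟨by linarith [hdrop i j hj1], by linarith [hdrop j (i + 1) hj2]⟩)
    have h2 := hC.climb (v := V) (h := H) (a := i + 1) (b := i + L) (by omega)
      (fun a b _ _ _ _ => hinj a b (by omega) (by omega)) (fun _ _ _ => hgain _)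
      (fun a b _ hab _ => (hdrop a b hab).trans hDB) (fun j hj1 hj2 =>
        ⟨by linarith [hdrop (i + 1) j hj1], by linarith [hdrop j (i + L) hj2]⟩)
    rw [hV, hH] at h2
    refine ⟨i, i + 1, Or.inr ⟨?_, ?_⟩⟩
    · refine lt_of_lt_of_le ?_ (add_le_add h1 h2)
      exact_mod_cast (by linarith : (0 : ℝ) < (H (i + 1) - H i) + (H i + Δ - H (i + 1)))
    · exact lt_of_lt_of_le (by exact_mod_cast sub_pos.2 hlt) h1
  -- Otherwise the turn is cut at the ends of the largest drop. Its foot `a + r` is the lowest and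
  -- the next copy of its top the highest point of the rest of the turn, because a lower or a higher
  -- point would give a larger drop. The climb gains `D + Δ` and the drop costs `D`.
  · have hr : 0 < r := by
      rcases Nat.eq_zero_or_pos r with rfl | hr
      · rw [add_zero, sub_self] at hD; linarith
      · exact hr
    have h1 := hC.drop (v := V) (h := H) (a := a) (b := a + r) hDB (by omega)
      (fun i j _ _ _ _ => hinj i j (by omega) (by omega)) (fun _ _ _ => hgain _)
      (fun i j _ hij _ => hdrop i j hij)
    have h2 := hC.climb (v := V) (h := H) (a := a + r) (b := a + L) (by omega)
      (fun i j _ _ _ _ => hinj i j (by omega) (by omega)) (fun _ _ _ => hgain _)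
      (fun i j _ hij _ => (hdrop i j hij).trans hDB) (fun j hj1 hj2 =>
        ⟨by linarith [hdrop a j (by omega)], by
          have e1 := hdrop j (a + r + L) (by omega)
          rw [hH] at e1
          rw [hH]; linarith⟩)
    rw [hV, hH] at h2
    refine ⟨a + r, a, Or.inr ⟨?_, ?_⟩⟩
    · refine lt_of_lt_of_le ?_ (add_le_add h2 h1)
      exact_mod_cast (by linarith : (0 : ℝ) < (H a + Δ - H (a + r)) + -D)
    · exact lt_of_lt_of_le (by exact_mod_cast (by linarith : (0 : ℝ) < H a + Δ - H (a + r))) h2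

end AuxGraph

/-! ### Full charges -/

section FullCharge

variable {n : ℕ} {G : RoadNetwork (Fin n)} {M : Table n} {B c g : ℝ} {u x z t : Fin n} {ℓ : ℕ}
  {v : ℕ → Fin n} {h : ℕ → ℝ} {F : Fin n → Prop}

/-- A simple path from `u` to `x`, with lower bounds for the charges on it when it is started
with a full battery. -/
structure ChargeRun (G : RoadNetwork (Fin n)) (B : ℝ) (u x : Fin n) (ℓ : ℕ) (v : ℕ → Fin n)
    (h : ℕ → ℝ) : Prop where
  start : v 0 = u
  finish : v ℓ = x
  inj : ∀ i ≤ ℓ, ∀ j ≤ ℓ, v i = v j → i = j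
  gain : ∀ i < ℓ, ((h (i + 1) - h i : ℝ) : EReal) ≤ Table.ofNetwork G (v i) (v (i + 1))
  full : h 0 = B
  mem : ∀ i ≤ ℓ, 0 ≤ h i ∧ h i ≤ B

/-- A simple path that starts fully charged at a vertex of `F` has a charge of at least `c`
at `x`. -/
def ChargeFrom (G : RoadNetwork (Fin n)) (B : ℝ) (F : Fin n → Prop) (x : Fin n) (c : ℝ) : Prop :=
  ∃ u, F u ∧ ∃ ℓ v h, ChargeRun G B u x ℓ v h ∧ c ≤ h ℓ

theorem ChargeFrom.mono {c' : ℝ} (hx : ChargeFrom G B F x c) (hc : c' ≤ c) :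
    ChargeFrom G B F x c' := by
  obtain ⟨u, hu, ℓ, v, h, R, hl⟩ := hx
  exact ⟨u, hu, ℓ, v, h, R, hc.trans hl⟩

theorem ChargeFrom.of_mem (hB : 0 ≤ B) (hx : F x) (hc : c ≤ B) : ChargeFrom G B F x c :=
  ⟨x, hx, 0, fun _ => x, fun _ => B, ⟨rfl, rfl, fun i hi j hj _ => by omega,
    fun i hi => absurd hi (Nat.not_lt_zero _), rfl, fun _ _ => ⟨hB, le_rfl⟩⟩, hc⟩

namespace ChargeRun

theorem length_lt (R : ChargeRun G B u x ℓ v h) : ℓ < n := by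
  have := Fintype.card_le_of_injective (fun i : Fin (ℓ + 1) => v i) fun i j hij =>
    Fin.ext (R.inj i (by omega) j (by omega) hij)
  simpa using this

theorem drop_le (R : ChargeRun G B u x ℓ v h) {i j : ℕ} (hi : i ≤ ℓ) (hj : j ≤ ℓ) :
    h i - h j ≤ B := by
  linarith [(R.mem i hi).2, (R.mem j hj).1]

theorem take (R : ChargeRun G B u x ℓ v h) {p : ℕ} (hp : p ≤ ℓ) :
    ChargeRun G B u (v p) p v h :=
  ⟨R.start, rfl, fun i hi j hj => R.inj i (hi.trans hp) j (hj.trans hp),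
    fun i hi => R.gain i (by omega), R.full, fun i hi => R.mem i (hi.trans hp)⟩

/-- The part of the path that begins at one of its vertices, started with a full battery. -/
theorem recharge (R : ChargeRun G B u x ℓ v h) {q : ℕ} (hq : q ≤ ℓ) :
    ChargeRun G B (v q) x (ℓ - q) (fun i => v (q + i))
      (fun i => if i = 0 then B else h (q + i)) := by
  refine ⟨rfl, ?_, fun i hi j hj hij => ?_, fun i hi => ?_, by simp, fun i hi => ?_⟩
  · rw [show q + (ℓ - q) = ℓ by omega]
    exact R.finish
  · have := R.inj _ (by omega) _ (by omega) hij
    omega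
  · refine le_trans ?_ (R.gain (q + i) (by omega))
    simp only [if_neg (Nat.succ_ne_zero i)]
    have := (R.mem q hq).2
    split_ifs with h0
    · subst h0
      exact_mod_cast sub_le_sub_left this _
    · exact le_rfl
  · split_ifs
    · have := R.mem 0 (Nat.zero_le _)
      exact ⟨this.1.trans this.2, le_rfl⟩
    · exact R.mem _ (by omega)

theorem snoc (R : ChargeRun G B u x ℓ v h) (hz : ∀ i ≤ ℓ, v i ≠ z)
    (hg : (g : EReal) ≤ Table.ofNetwork G x z) (hc : 0 ≤ c) (hcB : c ≤ B) (hcg : c ≤ h ℓ + g) :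
    ChargeRun G B u z (ℓ + 1) (fun i => if i ≤ ℓ then v i else z)
      (fun i => if i ≤ ℓ then h i else c) := by
  refine ⟨by simp [R.start], by simp, fun i hi j hj hij => ?_, fun i hi => ?_, by simp [R.full],
    fun i hi => ?_⟩
  · split_ifs at hij with h1 h2 h2
    · exact R.inj i h1 j h2 hij
    · exact absurd hij (hz i h1)
    · exact absurd hij.symm (hz j h2)
    · omega
  · simp only [if_pos (Nat.lt_succ_iff.1 hi)]
    rcases (Nat.lt_succ_iff.1 hi).lt_or_eq with h1 | rfl
    · simp only [if_pos (Nat.succ_le_of_lt h1)]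
      exact R.gain i h1
    · simp only [if_neg (Nat.not_succ_le_self i)]
      rw [R.finish]
      exact le_trans (by exact_mod_cast (by linarith)) hg
  · split_ifs with h1
    · exact R.mem i h1
    · exact ⟨hc, hcB⟩

theorem entry_ne_bot (hC : CompleteTable G B M) (R : ChargeRun G B u x ℓ v h) {i : ℕ}
    (hi : i ≤ ℓ) : M u (v i) ≠ ⊥ := by
  intro hb
  have := hC.drop (v := v) (h := h) (a := 0) (b := i) le_rfl (Nat.zero_le _)
    (fun a b _ ha _ hb => R.inj a (ha.trans hi) b (hb.trans hi)) (fun a _ ha => R.gain a (by omega))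
    (fun a b _ hab hb => R.drop_le (by omega) (by omega))
  rw [R.start, hb, le_bot_iff] at this
  exact EReal.coe_ne_bot _ this

/-- The path is split at a vertex of least charge `h i`. The part before it never loses more than `B
- h i`, and the part behind it climbs from its lowest to its highest point and gains `B - h i`. -/
theorem exists_adj_of_full (hC : CompleteTable G B M) (R : ChargeRun G B u x ℓ v h)
    (hf : B ≤ h ℓ) : (auxGraph B M).Adj (u, Level.full) (x, Level.full) := by
  obtain ⟨i, hi, hmin⟩ := (Finset.range (ℓ + 1)).exists_min_image h ⟨0, by simp⟩
  simp only [Finset.mem_range, Nat.lt_succ_iff] at hi hmin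
  have hB : h ℓ = B := le_antisymm (R.mem ℓ le_rfl).2 hf
  have h1 := hC.drop (v := v) (h := h) (a := 0) (b := i) (d := B - h i)
    (by linarith [(R.mem i hi).1]) (Nat.zero_le _)
    (fun a b _ ha _ hb => R.inj a (ha.trans hi) b (hb.trans hi)) (fun a _ ha => R.gain a (by omega))
    (fun a b _ hab hb => by linarith [(R.mem a (by omega)).2, hmin b (by omega)])
  have h2 := hC.climb (v := v) (h := h) (a := i) (b := ℓ) hi
    (fun a b _ ha _ hb => R.inj a ha b hb) (fun a _ ha => R.gain a ha)
    (fun a b _ hab hb => R.drop_le (by omega) hb)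
    (fun a _ ha => ⟨hmin a ha, hB ▸ (R.mem a ha).2⟩)
  rw [R.start] at h1
  rw [R.finish, hB] at h2
  refine ⟨v i, le_trans ?_ (add_le_add h1 h2), le_trans ?_ h2⟩
  · exact_mod_cast (by linarith : (0 : ℝ) ≤ -(B - h i) + (B - h i))
  · exact_mod_cast (by linarith [(R.mem i hi).2] : (0 : ℝ) ≤ B - h i)

/-- If the path can be closed to a cycle of positive gain, then the battery can be filled at one
of the vertices of the cycle. -/
theorem exists_full_of_close (hC : CompleteTable G B M)
    (hF : ∀ u x y, F u → M u x ≠ ⊥ → (auxGraph B M).Adj (x, Level.zero) (y, Level.full) → F y)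
    (R : ChargeRun G B u x ℓ v h) (hu : F u) {p : ℕ} (hp : p < ℓ)
    (hg : (g : EReal) ≤ Table.ofNetwork G x (v p)) (hpc : h p < c) (hcg : c ≤ h ℓ + g) :
    ∃ q, p ≤ q ∧ q ≤ ℓ ∧ F (v q) := by
  set L := ℓ - p + 1 with hL
  have hL0 : 0 < L := by omega
  have hmod : ∀ i, p + i % L ≤ ℓ := fun i => by
    have := Nat.mod_lt i hL0
    omega
  -- The cycle is unrolled to a periodic path, whose heights increase by `c - h p` with every turn.
  obtain ⟨a, b, hab⟩ := exists_full_of_cycle hC (L := L) (by omega) (sub_pos.2 hpc)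
    (V := fun i => v (p + i % L)) (H := fun i => h (p + i % L) + (i / L : ℕ) * (c - h p))
    (fun i => by simp) (fun i => by
      rw [Nat.add_mod_right, Nat.add_div_right _ hL0]
      push_cast; ring)
    (fun i j hi hj hij => by
      have h1 := R.inj _ (hmod i) _ (hmod j) hij
      refine Nat.ModEq.eq_of_abs_lt (m := L) (by unfold Nat.ModEq; omega) ?_
      rw [abs_lt]; constructor <;> omega)
    (fun i => by
      have h1 := Nat.div_add_mod i L
      have h2 := Nat.mod_lt i hL0
      rcases Nat.lt_or_ge (i % L + 1) L with h3 | h3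
      · have e : i + 1 = (i % L + 1) + L * (i / L) := by omega
        have e1 : (i + 1) % L = i % L + 1 := by
          rw [e, Nat.add_mul_mod_self_left, Nat.mod_eq_of_lt h3]
        have e2 : (i + 1) / L = i / L := by
          rw [e, Nat.add_mul_div_left _ _ hL0, Nat.div_eq_of_lt h3, zero_add]
        rw [e1, e2, add_sub_add_right_eq_sub, ← add_assoc]
        exact R.gain _ (by omega)
      · have e : i + 1 = L * (i / L + 1) := by rw [mul_add]; omega
        have e1 : (i + 1) % L = 0 := by rw [e, Nat.mul_mod_right]
        have e2 : (i + 1) / L = i / L + 1 := by rw [e, Nat.mul_div_cancel_left _ hL0]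
        have e3 : p + i % L = ℓ := by omega
        rw [e1, e2, e3, add_zero, R.finish]
        refine le_trans ?_ hg
        exact EReal.coe_le_coe_iff.2 (by push_cast; linarith))
    (fun i hi => by
      rw [Nat.mod_eq_of_lt hi, Nat.div_eq_of_lt hi]
      simpa using R.mem (p + i) (by omega))
  exact ⟨p + b % L, by omega, hmod b, hF u _ _ hu (R.entry_ne_bot hC (hmod a)) hab⟩

end ChargeRun

/-- Paths are kept simple. A return to a visited vertex with no more charge is cut off; a return
with more charge closes a cycle of positive gain, on which the battery can be filled. -/
theorem ChargeFrom.extend (hB : 0 ≤ B) (hM : Table.ofNetwork G ≤ M) (hC : CompleteTable G B M)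
    (hF : ∀ u x y, F u → M u x ≠ ⊥ → (auxGraph B M).Adj (x, Level.zero) (y, Level.full) → F y)
    (hx : ChargeFrom G B F x c) (hg : (g : EReal) ≤ Table.ofNetwork G x z) (h0 : 0 ≤ c + g) :
    ChargeFrom G B F z (min (c + g) B) := by
  obtain ⟨u, hu, ℓ, v, h, R, hl⟩ := hx
  have hc0 : 0 ≤ min (c + g) B := le_min h0 hB
  have hcg : min (c + g) B ≤ h ℓ + g := (min_le_left _ _).trans (by linarith)
  have hcB : min (c + g) B ≤ B := min_le_right _ _
  by_cases hz : ∀ i ≤ ℓ, v i ≠ z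
  · exact ⟨u, hu, _, _, _, R.snoc hz hg hc0 hcB hcg, by simp⟩
  push Not at hz
  obtain ⟨p, hp, rfl⟩ := hz
  rcases le_or_gt (min (c + g) B) (h p) with h1 | h1
  · exact ⟨u, hu, p, v, h, R.take hp, h1⟩
  rcases hp.lt_or_eq with hp' | rfl
  · obtain ⟨q, hpq, hq, hFq⟩ := R.exists_full_of_close hC hF hu hp' hg h1 hcg
    rcases hpq.eq_or_lt with rfl | hpq
    · exact .of_mem hB hFq hcB
    -- The part from `q > p` on does not contain `v p`, so the arc back to this vertex extends it to
    -- a simple path.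
    refine ⟨v q, hFq, _, _, _, (R.recharge hq).snoc (fun i hi hij => ?_) hg hc0 hcB ?_, by simp⟩
    · have := R.inj _ (by omega) _ hp hij
      omega
    · split_ifs
      · linarith [(R.mem ℓ le_rfl).2]
      · rwa [show q + (ℓ - q) = ℓ by omega]
  -- The new arc is a loop at the current vertex with positive gain, which is by itself a cycle for
  -- the arc from level 0 to level B.
  · rw [R.finish] at hg ⊢
    have hpos : 0 < M x x := by
      refine lt_of_lt_of_le ?_ (hg.trans (hM x x))
      exact_mod_cast (by linarith : (0 : ℝ) < g)
    refine .of_mem hB (hF u x x hu ?_ (Or.inr ⟨hpos.trans_le (le_add_of_nonneg_right hpos.le), hpos⟩)) hcB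
    have := R.entry_ne_bot hC le_rfl
    rwa [R.finish] at this

theorem le_ofNetwork_of_adj (h : G.Adj x z) : (G.gain x z : EReal) ≤ Table.ofNetwork G x z := by
  unfold Table.ofNetwork
  rw [if_pos h]
  exact le_max_right _ _

/-- Induction on the last arc, so that the simple path always accounts for a whole prefix of the
given path. -/
theorem ChargeFrom.of_path (hB : 0 ≤ B) (hM : Table.ofNetwork G ≤ M) (hC : CompleteTable G B M)
    (hF : ∀ u x y, F u → M u x ≠ ⊥ → (auxGraph B M).Adj (x, Level.zero) (y, Level.full) → F y)
    (hu : F u) (P : List (Fin n)) : ∀ x, G.IsPath u x P → G.pathCharge B B P ≠ ⊥ →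
      ∃ c : ℝ, G.pathCharge B B P = c ∧ 0 ≤ c ∧ ChargeFrom G B F x c := by
  induction P using List.reverseRecOn with
  | nil => intro x hP; simpa using hP.2.1
  | append_singleton Q y ih =>
    rintro x ⟨h1, h2, h3⟩ h4
    obtain rfl : y = x := by simpa using h3
    rcases hQ : Q.getLast? with _ | w
    · rw [List.getLast?_eq_none_iff] at hQ
      subst hQ
      obtain rfl : y = u := by simpa using h2
      exact ⟨B, rfl, hB, .of_mem hB hu le_rfl⟩
    · rw [List.isChain_append] at h1
      have hadj : G.Adj w y := h1.2.2 w (by simp [hQ]) y (by simp)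
      have hhead : Q.head? = some u := by
        cases Q with
        | nil => simp at hQ
        | cons a Q => simpa using h2
      rw [RoadNetwork.pathCharge_append Q [y] w hQ] at h4 ⊢
      change RoadNetwork.arcCharge B _ _ ≠ ⊥ at h4
      change ∃ c : ℝ, RoadNetwork.arcCharge B _ _ = _ ∧ _
      obtain ⟨c, e, hc, hch⟩ := ih w ⟨h1.1, hhead, hQ⟩ fun hb => h4 (by
        rw [hb, RoadNetwork.arcCharge_bot])
      rw [e] at h4 ⊢
      have h5 : 0 ≤ c + G.gain w y := by
        by_contra hlt
        exact h4 (RoadNetwork.arcCharge_coe_of_neg (not_le.1 hlt))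
      exact ⟨_, RoadNetwork.arcCharge_coe h5, le_min h5 hB,
        hch.extend hB hM hC hF (le_ofNetwork_of_adj hadj) h5⟩

/-- The charges on a path that is started with a full battery, if none of them is negative. -/
noncomputable def topCharge (M : Table n) (B : ℝ) (v : ℕ → Fin n) : ℕ → ℝ
  | 0 => B
  | i + 1 => min (topCharge M B v i + (M (v i) (v (i + 1))).toReal) B

theorem topCharge_congr {v' : ℕ → Fin n} {i : ℕ} (hv : ∀ j ≤ i, v j = v' j) :
    topCharge M B v i = topCharge M B v' i := by
  induction i with
  | zero => rfl
  | succ i ih =>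
    rw [topCharge, topCharge, ih fun j hj => hv j (by omega), hv i (by omega), hv (i + 1) le_rfl]

theorem ChargeRun.le_topCharge (hM : ∀ a b, Table.ofNetwork G a b ≠ ⊤)
    (R : ChargeRun G B u x ℓ v h) {i : ℕ} (hi : i ≤ ℓ) :
    h i ≤ topCharge (Table.ofNetwork G) B v i := by
  induction i with
  | zero => exact R.full.le
  | succ i ih =>
    refine le_min ?_ (R.mem _ hi).2
    have h1 := EReal.toReal_le_toReal (R.gain i (by omega)) (EReal.coe_ne_bot _) (hM _ _)
    rw [EReal.toReal_coe] at h1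
    linarith [ih (by omega)]

theorem ChargeRun.top (hM : ∀ a b, Table.ofNetwork G a b ≠ ⊤) (R : ChargeRun G B u x ℓ v h) :
    ChargeRun G B u x ℓ v (topCharge (Table.ofNetwork G) B v) := by
  refine ⟨R.start, R.finish, R.inj, fun i hi => ?_, rfl, fun i hi =>
    ⟨(R.mem i hi).1.trans (R.le_topCharge hM hi), ?_⟩⟩
  · have h1 : Table.ofNetwork G (v i) (v (i + 1)) ≠ ⊥ := fun hb => by
      have := R.gain i hi
      rw [hb, le_bot_iff] at this
      exact EReal.coe_ne_bot _ this
    rw [← EReal.coe_toReal (hM _ _) h1]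
    refine EReal.coe_le_coe_iff.2 ?_
    rw [topCharge]
    linarith [min_le_left (topCharge (Table.ofNetwork G) B v i +
      (Table.ofNetwork G (v i) (v (i + 1))).toReal) B]
  · cases i with
    | zero => exact le_rfl
    | succ i => exact min_le_right _ _

/-- The supremum of the charges is attained. -/
theorem ChargeFrom.of_forall_lt (hM : ∀ a b, Table.ofNetwork G a b ≠ ⊤)
    (hx : ∀ c < B, ChargeFrom G B F x c) : ChargeFrom G B F x B := by
  classical
  -- The best charge on a simple path is determined by its vertices, and a simple path has at most n
  -- of them, so only finitely many values matter.
  let W : Finset ℝ := ((Finset.univ : Finset ((Fin (n + 1) → Fin n) × Fin (n + 1))).image fun q =>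
    topCharge (Table.ofNetwork G) B (fun i => q.1 (Fin.ofNat (n + 1) i)) q.2).filter
      (ChargeFrom G B F x)
  have key : ∀ c < B, ∃ w ∈ W, c ≤ w := by
    intro c hc
    obtain ⟨u, hu, ℓ, v, h, R, hl⟩ := hx c hc
    have hℓ := R.length_lt
    refine ⟨topCharge (Table.ofNetwork G) B v ℓ, Finset.mem_filter.2 ⟨Finset.mem_image.2
      ⟨(fun k => v k, ⟨ℓ, by omega⟩), Finset.mem_univ _, topCharge_congr fun j hj => ?_⟩,
      u, hu, ℓ, v, _, R.top hM, le_rfl⟩, hl.trans (R.le_topCharge hM le_rfl)⟩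
    have : ((Fin.ofNat (n + 1) j : Fin (n + 1)) : ℕ) = j :=
      Nat.mod_eq_of_lt (by simp only at hj; omega)
    simp only [this]
  obtain ⟨w₀, hw₀, -⟩ := key (B - 1) (by linarith)
  obtain ⟨w, hw, hmax⟩ := W.exists_max_image id ⟨w₀, hw₀⟩
  refine (Finset.mem_filter.1 hw).2.mono ?_
  by_contra hlt
  rw [not_le] at hlt
  obtain ⟨w', hw', hle⟩ := key ((w + B) / 2) (by linarith)
  have := hmax w' hw'
  simp only [id] at this
  linarith

/-- The auxiliary graph is complete. -/
theorem transGen_of_alpha_eq {s : Fin n} (hB : 0 ≤ B) (hG : ∀ a b, Table.ofNetwork G a b ≠ ⊤)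
    (hM : Table.ofNetwork G ≤ M) (hC : CompleteTable G B M) (hα : G.alpha B B s t = B) :
    Relation.TransGen (auxGraph B M).Adj (s, Level.full) (t, Level.full) := by
  let F : Fin n → Prop := fun u =>
    Relation.TransGen (auxGraph B M).Adj (s, Level.full) (u, Level.full)
  have hs : F s := by
    have := (zero_le_ofNetwork (G := G) s).trans (hM s s)
    exact .single ⟨s, add_nonneg this this, this⟩
  have hF : ∀ u x y, F u → M u x ≠ ⊥ →
      (auxGraph B M).Adj (x, Level.zero) (y, Level.full) → F y := fun u x y hu hux hxy =>
    (Relation.TransGen.tail (c := (x, Level.zero)) hu hux).tail hxy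
  have ht : ChargeFrom G B F t B := by
    refine ChargeFrom.of_forall_lt hG fun c hc => ?_
    have h1 : (c : EReal) < G.alpha B B s t := hα ▸ EReal.coe_lt_coe_iff.2 hc
    obtain ⟨⟨P, hP⟩, h2⟩ := lt_iSup_iff.1 h1
    obtain ⟨c', e, -, h3⟩ := ChargeFrom.of_path hB hM hC hF hs P t hP (ne_bot_of_gt h2)
    refine h3.mono ?_
    simp only [e] at h2
    exact (EReal.coe_lt_coe_iff.1 h2).le
  obtain ⟨u, hu, ℓ, v, h, R, hl⟩ := ht
  exact Relation.TransGen.tail hu (R.exists_adj_of_full hC hl)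

end FullCharge

theorem PMF.ofReal_one_sub_le_toOuterMeasure {α : Type*} (μ : PMF α) {P : α → Prop} {a : ℝ}
    (ha : 0 ≤ a) (h : μ.fail P ≤ ENNReal.ofReal a) :
    ENNReal.ofReal (1 - a) ≤ μ.toOuterMeasure {x | P x} := by
  rw [ENNReal.ofReal_sub _ ha, ENNReal.ofReal_one, tsub_le_iff_right]
  calc (1 : ℝ≥0∞) = μ.toOuterMeasure Set.univ :=
        ((μ.toOuterMeasure_apply_eq_one_iff _).2 (Set.subset_univ _)).symm
    _ = μ.toOuterMeasure ({x | P x} ∪ {x | ¬ P x}) := by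
        rw [← Set.compl_ofPred, Set.union_compl_self]
    _ ≤ μ.toOuterMeasure {x | P x} + μ.toOuterMeasure {x | ¬ P x} :=
        MeasureTheory.measure_union_le _ _
    _ ≤ _ := by gcongr; exact h

theorem mainTheorem5 (c : ℝ) (hc : 0 < c) :
    ∃ K : ℝ, 0 < K ∧ ∀ κ : HiddenConstants, κ.AtLeast K →
      ∀ n : ℕ, 0 < n → ∀ B : ℝ, 0 < B → ∀ G : RoadNetwork (Fin n),
        (∀ u v, G.Adj u v → G.gain u v ∈ Set.Icc (-B) B) →
        ENNReal.ofReal (1 - (n : ℝ) ^ (-c)) ≤ (computeShortcuts κ B G).toOuterMeasure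
          {M | ∀ s t, G.alpha B B s t = (B : EReal) ↔
            (transitiveClosure (auxGraph B M)).Adj (s, Level.full) (t, Level.full)} := by
  -- 4000 is the bound for the number of rounds and exceeds the bounds for the sampling constants;
  -- the other term is for the outer iterations.
  refine ⟨max 4000 (7680 * (c + 4)), by positivity, fun κ hκ n hn B hB G hG => ?_⟩
  obtain ⟨h1, h2, h3, h4, h5⟩ := hκ
  have hK := le_max_left 4000 (7680 * (c + 4))
  obtain rfl | hn : n = 1 ∨ 2 ≤ n := by omega
  -- For `n = 1` the required probability is 0.
  · simp
  refine PMF.ofReal_one_sub_le_toOuterMeasure _ (by positivity) (le_trans (PMF.fail_mono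
    fun M hM hC s t => ?_) (computeShortcuts_fail_complete hn (by linarith) (by linarith)
      (by linarith) (by linarith) hc.le ((le_max_right _ _).trans h1) hB.le hG))
  obtain ⟨hS, hle⟩ := computeShortcuts_support hB.le hG M hM
  exact ⟨transGen_of_alpha_eq hB.le (SoundTable.ofNetwork hB.le hG).ne_top hle hC,
    alpha_eq_of_transGen hB.le hS⟩
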